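/- **Dynamic metric facility location.** Let $(V,d)$ be a (possibly infinite) metric space in which every ball of radius $r$ can be covered by at most $2^\kappa$ balls of radius $r/2$ (doubling dimension at most $\kappa$), with $d(x,y)\le W<\infty$ for all $x,y\in V$. Let $J\subseteq V$ be a finite set of facilities with opening costs $f_j\ge 0$, not all zero; put $f_{\max}=\max_j f_j$ and $f_{\min}=\min\{f_j: f_j>0\}$. For a finite set $C\subseteq V$ of clients, a solution is a set $S\subseteq J$ of open facilities, nonempty if $C\neq\emptyset$. Its cost is $\sum_{j\in S}f_j+\sum_{i\in C}\min_{j\in S}d(i,j)$, and $\mathrm{OPT}(C)$ is the minimum cost of a solution. Put $$\Delta(C)=2+\log_2\frac{\max(W,f_{\max})\cdot\max(|J|,|C|)}{f_{\min}} .$$ There are one deterministic algorithm and one absolute constant $c>0$ such that the following holds for every such $V$, $\kappa$, $W$, $J$, $f$. The algorithm runs on a unit-cost random access machine whose memory cells hold natural numbers (operations: addition, subtraction, halving, comparison), real numbers (the four arithmetic operations and comparison, no rounding) or points of $V$ (copying, and measuring the distance of two points). It receives $J$, $f$ and $W$, but not $\kappa$, and performs a preprocessing that halts. After it, starting with $C=\emptyset$,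 it processes an arbitrary finite sequence of requests: insert a point $p\notin C$ into $C$ (the algorithm returns a number, the handle of $p$), delete a point $p\in C$ from $C$ (given together with its handle), cost query, and solution query. At every moment, with $C$ the current set of clients (before the request): 1. every insertion and every deletion is processed in worst-case time at most $c\cdot 2^{c\kappa^2}\cdot\Delta(C)^3\cdot(\kappa^2+\log\Delta(C))$; 2. a cost query is answered in time at most $c$ by a real number $v$ with $\mathrm{OPT}(C)\le v\le c\cdot\mathrm{OPT}(C)$; 3. a solution query is answered in time at most $c\cdot(|S|+1)$ by a list, without repetition, of the facilities of a solution $S$ for $C$ whose cost is at most $c\cdot\mathrm{OPT}(C)$. -/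

import Mathlib

namespace RAM

/-! A deterministic random access machine over a metric space `V`, programmed in a small
imperative language.  The machine has a fixed finite number of unbounded arrays (those that its
program mentions) of natural numbers, of real numbers and of points of `V`.  Natural numbers can
be added, subtracted, halved and compared; real numbers can be added, subtracted, multiplied,
divided and compared (no rounding is available); points can only be copied and have their
distance measured.  Every operation has unit cost. -/

/-- Expressions for natural numbers; `cell a i` is entry `i` of array `a`. -/
inductive NExp where
  | lit (n : ℕ)
  | cell (a : ℕ) (i : NExp)
  | add (e e' : NExp)
  | sub (e e' : NExp)
  | half (e : NExp)

/-- Expressions for real numbers; `dist a i b j` is the distance between the point in entry `i` of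
array `a` and the point in entry `j` of array `b`. -/
inductive RExp where
  | lit (n : ℕ)
  | ofNat (e : NExp)
  | cell (a : ℕ) (i : NExp)
  | add (e e' : RExp)
  | sub (e e' : RExp)
  | mul (e e' : RExp)
  | div (e e' : RExp)
  | dist (a : ℕ) (i : NExp) (b : ℕ) (j : NExp)

/-- Tests. -/
inductive BExp where
  | nlt (e e' : NExp)
  | rlt (e e' : RExp)
  | not (b : BExp)
  | and (b b' : BExp)

/-- Programs.  They do not depend on the metric space. -/
inductive Cmd where
  | skip
  | nset (a : ℕ) (i e : NExp)
  | rset (a : ℕ) (i : NExp) (e : RExp)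
  | pset (a : ℕ) (i : NExp) (b : ℕ) (j : NExp)
  | emit (e : NExp)
  | seq (c c' : Cmd)
  | ite (b : BExp) (c c' : Cmd)
  | while (b : BExp) (c : Cmd)

/-- A memory content: arrays of naturals, of reals and of points (a cell may hold no point),
and the list of numbers written to the output so far. -/
structure State (V : Type*) where
  nat : ℕ → ℕ → ℕ
  real : ℕ → ℕ → ℝ
  pt : ℕ → ℕ → Option V
  out : List ℕ

/-- The number of unit-cost operations needed to evaluate an expression. -/
def NExp.cost : NExp → ℕ
  | .lit _ => 1
  | .cell _ i => i.cost + 1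
  | .add e e' => e.cost + e'.cost + 1
  | .sub e e' => e.cost + e'.cost + 1
  | .half e => e.cost + 1

def RExp.cost : RExp → ℕ
  | .lit _ => 1
  | .ofNat e => e.cost + 1
  | .cell _ i => i.cost + 1
  | .add e e' => e.cost + e'.cost + 1
  | .sub e e' => e.cost + e'.cost + 1
  | .mul e e' => e.cost + e'.cost + 1
  | .div e e' => e.cost + e'.cost + 1
  | .dist _ i _ j => i.cost + j.cost + 1

def BExp.cost : BExp → ℕ
  | .nlt e e' => e.cost + e'.cost + 1
  | .rlt e e' => e.cost + e'.cost + 1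
  | .not b => b.cost + 1
  | .and b b' => b.cost + b'.cost + 1

/-- The value of an expression in a given state. -/
def NExp.eval {V : Type*} (σ : State V) : NExp → ℕ
  | .lit n => n
  | .cell a i => σ.nat a (i.eval σ)
  | .add e e' => e.eval σ + e'.eval σ
  | .sub e e' => e.eval σ - e'.eval σ
  | .half e => e.eval σ / 2

/-- The distance between two point cells (`0` if one of them holds no point). -/
noncomputable def ptDist {V : Type*} [MetricSpace V] : Option V → Option V → ℝ
  | some x, some y => Dist.dist x y
  | _, _ => 0

noncomputable def RExp.eval {V : Type*} [MetricSpace V] (σ : State V) : RExp → ℝ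
  | .lit n => (n : ℝ)
  | .ofNat e => (e.eval σ : ℝ)
  | .cell a i => σ.real a (i.eval σ)
  | .add e e' => e.eval σ + e'.eval σ
  | .sub e e' => e.eval σ - e'.eval σ
  | .mul e e' => e.eval σ * e'.eval σ
  | .div e e' => e.eval σ / e'.eval σ
  | .dist a i b j => ptDist (σ.pt a (i.eval σ)) (σ.pt b (j.eval σ))

def BExp.Holds {V : Type*} [MetricSpace V] (σ : State V) : BExp → Prop
  | .nlt e e' => e.eval σ < e'.eval σ
  | .rlt e e' => e.eval σ < e'.eval σ
  | .not b => ¬ b.Holds σ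
  | .and b b' => b.Holds σ ∧ b'.Holds σ

/-- Overwriting entry `i` of array `a`. -/
def write {α : Type*} (A : ℕ → ℕ → α) (a i : ℕ) (x : α) : ℕ → ℕ → α :=
  Function.update A a (Function.update (A a) i x)

/-- `Exec c σ t σ'`: the program `c`, started in `σ`, halts in `σ'` after exactly `t` unit-cost
operations. -/
inductive Exec {V : Type*} [MetricSpace V] : Cmd → State V → ℕ → State V → Prop where
  | skip (σ : State V) : Exec .skip σ 1 σ
  | nset (σ : State V) (a : ℕ) (i e : NExp) :
      Exec (.nset a i e) σ (i.cost + e.cost + 1)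
        { σ with nat := write σ.nat a (i.eval σ) (e.eval σ) }
  | rset (σ : State V) (a : ℕ) (i : NExp) (e : RExp) :
      Exec (.rset a i e) σ (i.cost + e.cost + 1)
        { σ with real := write σ.real a (i.eval σ) (e.eval σ) }
  | pset (σ : State V) (a : ℕ) (i : NExp) (b : ℕ) (j : NExp) :
      Exec (.pset a i b j) σ (i.cost + j.cost + 1)
        { σ with pt := write σ.pt a (i.eval σ) (σ.pt b (j.eval σ)) }
  | emit (σ : State V) (e : NExp) :
      Exec (.emit e) σ (e.cost + 1) { σ with out := σ.out ++ [e.eval σ] }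
  | seq {c c' : Cmd} {σ σ₁ σ₂ : State V} {t t' : ℕ} :
      Exec c σ t σ₁ → Exec c' σ₁ t' σ₂ → Exec (.seq c c') σ (t + t') σ₂
  | iteTrue {b : BExp} {c c' : Cmd} {σ σ₁ : State V} {t : ℕ} :
      b.Holds σ → Exec c σ t σ₁ → Exec (.ite b c c') σ (b.cost + t) σ₁
  | iteFalse {b : BExp} {c c' : Cmd} {σ σ₁ : State V} {t : ℕ} :
      ¬ b.Holds σ → Exec c' σ t σ₁ → Exec (.ite b c c') σ (b.cost + t) σ₁
  | whileFalse {b : BExp} {c : Cmd} {σ : State V} :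
      ¬ b.Holds σ → Exec (.while b c) σ b.cost σ
  | whileTrue {b : BExp} {c : Cmd} {σ σ₁ σ₂ : State V} {t t' : ℕ} :
      b.Holds σ → Exec c σ t σ₁ → Exec (.while b c) σ₁ t' σ₂ →
      Exec (.while b c) σ (b.cost + t + t') σ₂

/-- Programs are deterministic: the running time and the final state are determined by the
initial state. -/
theorem Exec.det {V : Type*} [MetricSpace V] {c : Cmd} {σ σ₁ σ₂ : State V} {t₁ t₂ : ℕ}
    (h₁ : Exec c σ t₁ σ₁) (h₂ : Exec c σ t₂ σ₂) : t₁ = t₂ ∧ σ₁ = σ₂ := by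
  induction h₁ generalizing t₂ σ₂ with
  | skip | nset | rset | pset | emit => cases h₂; exact ⟨rfl, rfl⟩
  | seq _ _ ih ih' =>
    cases h₂ with
    | seq k k' =>
      obtain ⟨rfl, rfl⟩ := ih k
      obtain ⟨rfl, rfl⟩ := ih' k'
      exact ⟨rfl, rfl⟩
  | iteTrue hb _ ih =>
    cases h₂ with
    | iteTrue _ k => obtain ⟨rfl, rfl⟩ := ih k; exact ⟨rfl, rfl⟩
    | iteFalse hb' _ => exact absurd hb hb'
  | iteFalse hb _ ih =>
    cases h₂ with
    | iteTrue hb' _ => exact absurd hb' hb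
    | iteFalse _ k => obtain ⟨rfl, rfl⟩ := ih k; exact ⟨rfl, rfl⟩
  | whileFalse hb =>
    cases h₂ with
    | whileFalse _ => exact ⟨rfl, rfl⟩
    | whileTrue hb' _ _ => exact absurd hb' hb
  | whileTrue hb _ _ ih ih' =>
    cases h₂ with
    | whileFalse hb' => exact absurd hb hb'
    | whileTrue _ k k' =>
      obtain ⟨rfl, rfl⟩ := ih k
      obtain ⟨rfl, rfl⟩ := ih' k'
      exact ⟨rfl, rfl⟩

end RAM

namespace FacilityLocation

/-- The static part of an instance of metric facility location in a metric space `V`: finitely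
many distinct facilities with nonnegative opening costs, not all of them zero, and a number `W`
that is at least the diameter of `V`. -/
structure Input (V : Type*) [MetricSpace V] where
  m : ℕ
  fac : Fin m → V
  fac_injective : Function.Injective fac
  f : Fin m → ℝ
  f_nonneg : ∀ j, 0 ≤ f j
  exists_f_pos : ∃ j, 0 < f j
  W : ℝ
  dist_le_W : ∀ x y : V, dist x y ≤ W

/-- Every ball of radius `r` is covered by at most `2 ^ κ` balls of radius `r / 2`. -/
def HasDoublingDimension (V : Type*) [MetricSpace V] (κ : ℝ) : Prop :=
  ∀ (x : V) (r : ℝ), ∃ s : Finset V, (s.card : ℝ) ≤ 2 ^ κ ∧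
    Metric.closedBall x r ⊆ ⋃ y ∈ s, Metric.closedBall y (r / 2)

variable {V : Type*} [MetricSpace V]

/-- A set of open facilities can serve the client set `C`. -/
def Input.Feasible (I : Input V) (C : Finset V) (S : Finset (Fin I.m)) : Prop :=
  C.Nonempty → S.Nonempty

/-- Opening costs plus the distances of the clients to their closest open facilities. -/
noncomputable def Input.cost (I : Input V) (C : Finset V) (S : Finset (Fin I.m)) : ℝ :=
  ∑ j ∈ S, I.f j + ∑ i ∈ C, Metric.infDist i (I.fac '' (S : Set (Fin I.m)))

/-- The minimum cost of a feasible set of open facilities. -/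
noncomputable def Input.opt (I : Input V) (C : Finset V) : ℝ :=
  sInf {x | ∃ S : Finset (Fin I.m), I.Feasible C S ∧ I.cost C S = x}

/-- The maximum opening cost. -/
noncomputable def Input.fmax (I : Input V) : ℝ := ⨆ j, I.f j

/-- The minimum nonzero opening cost. -/
noncomputable def Input.fmin (I : Input V) : ℝ := sInf {x | 0 < x ∧ ∃ j, I.f j = x}

/-- Up to a constant factor, the number of powers of `5` between `fmin / max |J| |C|` and
`max W fmax`. -/
noncomputable def Input.Δ (I : Input V) (C : Finset V) : ℝ :=
  2 + Real.logb 2 (max I.W I.fmax * max (I.m : ℝ) (C.card : ℝ) / I.fmin)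

/-- The memory before preprocessing.  The number of facilities is in cell `0` of number array `0`;
the cost and the location of facility `k` are in cell `k` of real array `0` and of point array
`0`; the number `W` is in cell `0` of real array `1`. -/
noncomputable def Input.initState (I : Input V) : RAM.State V where
  nat := RAM.write (fun _ _ => 0) 0 0 I.m
  real := RAM.write (fun a k => if h : a = 0 ∧ k < I.m then I.f ⟨k, h.2⟩ else 0) 1 0 I.W
  pt := fun a k => if h : a = 0 ∧ k < I.m then some (I.fac ⟨k, h.2⟩) else none
  out := []

/-- A dynamic algorithm: one program for the preprocessing and one for each kind of request.
They share the memory, which persists between the requests. -/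
structure Algorithm where
  preprocess : RAM.Cmd
  insert : RAM.Cmd
  delete : RAM.Cmd
  costQuery : RAM.Cmd
  solutionQuery : RAM.Cmd

/-- Issuing an insertion of `p`: the point `p` is put into cell `0` of point array `1`. -/
def insertRequest (σ : RAM.State V) (p : V) : RAM.State V :=
  { σ with pt := RAM.write σ.pt 1 0 (some p), out := [] }

/-- Issuing a deletion of `p`: the point `p` is put into cell `0` of point array `1`, and the
handle of `p`, that is the number which the algorithm returned when `p` was last inserted, into
cell `0` of number array `1`. -/
def deleteRequest (σ : RAM.State V) (p : V) (handle : ℕ) : RAM.State V :=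
  { σ with pt := RAM.write σ.pt 1 0 (some p), nat := RAM.write σ.nat 1 0 handle, out := [] }

/-- Issuing a query. -/
def queryRequest (σ : RAM.State V) : RAM.State V := { σ with out := [] }

open scoped Classical in
/-- `Reachable A I C h σ`: starting without clients, after preprocessing and some finite sequence
of requests (insertions of points that are not clients, deletions of clients, queries) the set of
clients is `C`, the handles that the algorithm `A` returned for them are given by `h`, and the
memory is `σ`.  An insertion returns its handle in cell `0` of number array `1`. -/
inductive Reachable (A : Algorithm) (I : Input V) : Finset V → (V → ℕ) → RAM.State V → Prop where
  | init {t : ℕ} {σ : RAM.State V} :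
      RAM.Exec A.preprocess I.initState t σ → Reachable A I ∅ (fun _ => 0) σ
  | insert {C : Finset V} {h : V → ℕ} {σ σ' : RAM.State V} {t : ℕ} {p : V} :
      Reachable A I C h σ → p ∉ C → RAM.Exec A.insert (insertRequest σ p) t σ' →
      Reachable A I (insert p C) (Function.update h p (σ'.nat 1 0)) σ'
  | delete {C : Finset V} {h : V → ℕ} {σ σ' : RAM.State V} {t : ℕ} {p : V} :
      Reachable A I C h σ → p ∈ C → RAM.Exec A.delete (deleteRequest σ p (h p)) t σ' →
      Reachable A I (C.erase p) h σ'
  | costQuery {C : Finset V} {h : V → ℕ} {σ σ' : RAM.State V} {t : ℕ} :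
      Reachable A I C h σ → RAM.Exec A.costQuery (queryRequest σ) t σ' →
      Reachable A I C h σ'
  | solutionQuery {C : Finset V} {h : V → ℕ} {σ σ' : RAM.State V} {t : ℕ} :
      Reachable A I C h σ → RAM.Exec A.solutionQuery (queryRequest σ) t σ' →
      Reachable A I C h σ'

/-- `c * 2 ^ (c κ²) * Δ³ * (κ² + log Δ)`. -/
noncomputable def updateBound (c κ Δ : ℝ) : ℝ :=
  c * 2 ^ (c * κ ^ 2) * Δ ^ 3 * (κ ^ 2 + Real.log Δ)

end FacilityLocation

/-! Let r_t = R / 2 ^ t with R = max(W, f_max). The preprocessing computes for every scale t a net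
of the facilities, for every facility x a net point (its parent) within r_t, a cheapest facility
g_t(x) within 4 r_t, and the list of the net points within 12 r_t. By the doubling property such a
list has at most 2 ^ (5κ) entries. An arriving client is snapped to a facility at most three times
as far away as its closest one. From then on it is treated as located there, and the sum of the
snapping distances is kept separately.

The client in slot k is counted only at the scales up to L_k = base + 2 size(k), where r_base ≤
f_min and size(k) is the number of binary digits of k. Since 4 ^ size(k) ≥ (k + 1)², the radii
r_{L_k} add up to at most 2 f_min (`sum_scale_le`). Hence ignoring the finer scales costs a constant
factor only, no bound on the number of clients is needed in advance, and one client is counted at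
O(Δ) scales.

A net point x is heavy at scale t if the clients counted within 3 r_t of it could pay for g_t(x)
with r_t each. It is eligible if it is heavy, g_t(x) is not free, and no net point of scale t + 1
within 4 r_t is heavy. A maximal 6 r_t-separated set K_t of eligible net points is maintained at
every scale. Open are the free facilities and all g_t(x) with x in K_t. The `payment` of a client is
the sum of the radii of its scales at which its parent is not heavy, plus the smaller one of r_L and
its distance to the closest free facility. Three facts give the approximation: the opening costs are
at most twice the total payment (`sum_open_le`); every client has an open facility within 22 times
its payment (`exists_open_le_payment`); the total payment is at most four times the cost of any
solution for the snapped clients (`sum_payment_le`). So the snapping distances plus 24 times the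
total payment lie between OPT and 400 OPT, and they bound the cost of the maintained solution
(`Represents.cost_opened_le`, `Represents.estimate_le_cost`).

Adding or removing a client at facility j changes counts only within 3 r_t of j, and therefore
eligibility only within 6 r_t (`eligible_congr`). So K_t is repaired by removing its members within
6 r_t of j and going greedily through the net points within 12 r_t (`memberBody_spec`). This takes
O(2 ^ (10κ)) steps per scale (`change_spec`). A deletion also moves the client of the last slot into
the vacated one, which makes three such changes at most.

Snapping descends a search tree on sets of facilities. In a doubling metric every set of at least
two points has a ball that contains a fraction of 1 / (2 · 2 ^ (3κ)) of it and whose double misses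
such a fraction (`HasDoublingDimension.exists_ring`). Each step discards that fraction, and the
centre of the ball is an adequate answer for all discarded points (`snap_spec`). The tree is
tabulated for all subsets of the facilities, encoded in binary, since the preprocessing only has to
halt. Altogether an update takes O(2 ^ (10κ) Δ) steps, which is within the bound
(`time_le_updateBound`).

The programs are verified in a calculus of total correctness with time (`WP`), where a syntactic
frame property (`Exec.agree`) takes care of everything that a program does not write. The invariant
that connects memory and client set is `Represents`. -/

namespace RAM

/-! ### Frame property of programs. -/

set_option linter.unusedSectionVars false

/-- The number arrays that a program may write. -/
def Cmd.nw : Cmd → List ℕ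
  | .nset a _ _ => [a]
  | .seq c c' => c.nw ++ c'.nw
  | .ite _ c c' => c.nw ++ c'.nw
  | .while _ c => c.nw
  | _ => []

/-- The real arrays that a program may write. -/
def Cmd.rw : Cmd → List ℕ
  | .rset a _ _ => [a]
  | .seq c c' => c.rw ++ c'.rw
  | .ite _ c c' => c.rw ++ c'.rw
  | .while _ c => c.rw
  | _ => []

/-- The point arrays that a program may write. -/
def Cmd.pw : Cmd → List ℕ
  | .pset a _ _ _ => [a]
  | .seq c c' => c.pw ++ c'.pw
  | .ite _ c c' => c.pw ++ c'.pw
  | .while _ c => c.pw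
  | _ => []

variable {V : Type*} [MetricSpace V]

theorem write_same {α : Type*} (A : ℕ → ℕ → α) (a i : ℕ) (x : α) :
    write A a i x a = Function.update (A a) i x := by simp [write]

theorem write_other {α : Type*} (A : ℕ → ℕ → α) {a b : ℕ} (h : b ≠ a) (i : ℕ) (x : α) :
    write A a i x b = A b := by simp [write, h]

/-- `σ'` differs from `σ` only in arrays that `c` may write. -/
structure Agree (c : Cmd) (σ σ' : State V) : Prop where
  nat : ∀ a, a ∉ c.nw → σ'.nat a = σ.nat a
  real : ∀ a, a ∉ c.rw → σ'.real a = σ.real a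
  pt : ∀ a, a ∉ c.pw → σ'.pt a = σ.pt a

theorem Agree.refl (c : Cmd) (σ : State V) : Agree c σ σ :=
  ⟨fun _ _ => rfl, fun _ _ => rfl, fun _ _ => rfl⟩

theorem Agree.trans {c : Cmd} {σ σ₁ σ₂ : State V} (h : Agree c σ σ₁) (h' : Agree c σ₁ σ₂) :
    Agree c σ σ₂ :=
  ⟨fun a ha => (h'.nat a ha).trans (h.nat a ha), fun a ha => (h'.real a ha).trans (h.real a ha),
    fun a ha => (h'.pt a ha).trans (h.pt a ha)⟩

theorem Agree.mono {c c' : Cmd} {σ σ' : State V} (h : Agree c σ σ') (hn : c.nw ⊆ c'.nw)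
    (hr : c.rw ⊆ c'.rw) (hp : c.pw ⊆ c'.pw) : Agree c' σ σ' :=
  ⟨fun a ha => h.nat a fun k => ha (hn k), fun a ha => h.real a fun k => ha (hr k),
    fun a ha => h.pt a fun k => ha (hp k)⟩

/-- The sets of written arrays are computable from the program text, so for a concrete program every
claim that an array is preserved reduces to `decide`. -/
theorem Exec.agree {c : Cmd} {σ σ' : State V} {t : ℕ} (h : Exec c σ t σ') : Agree c σ σ' := by
  induction h with
  | skip | emit => exact ⟨fun _ _ => rfl, fun _ _ => rfl, fun _ _ => rfl⟩
  | nset σ a i e =>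
    refine ⟨fun b hb => write_other _ ?_ _ _, fun _ _ => rfl, fun _ _ => rfl⟩
    simpa [Cmd.nw] using hb
  | rset σ a i e =>
    refine ⟨fun _ _ => rfl, fun b hb => write_other _ ?_ _ _, fun _ _ => rfl⟩
    simpa [Cmd.rw] using hb
  | pset σ a i e =>
    refine ⟨fun _ _ => rfl, fun _ _ => rfl, fun b hb => write_other _ ?_ _ _⟩
    simpa [Cmd.pw] using hb
  | seq _ _ ih ih' =>
    exact (ih.mono (by simp [Cmd.nw]) (by simp [Cmd.rw]) (by simp [Cmd.pw])).trans
      (ih'.mono (by simp [Cmd.nw]) (by simp [Cmd.rw]) (by simp [Cmd.pw]))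
  | iteTrue _ _ ih => exact ih.mono (by simp [Cmd.nw]) (by simp [Cmd.rw]) (by simp [Cmd.pw])
  | iteFalse _ _ ih => exact ih.mono (by simp [Cmd.nw]) (by simp [Cmd.rw]) (by simp [Cmd.pw])
  | whileFalse => exact Agree.refl _ _
  | whileTrue _ _ _ ih ih' =>
    exact (ih.mono (by simp [Cmd.nw]) (by simp [Cmd.rw]) (by simp [Cmd.pw])).trans ih'

/-! ### Calculus of total correctness with running time. -/

/-- `c` halts when started in `σ`, and its running time and final state satisfy `Q`. -/
def WP (c : Cmd) (σ : State V) (Q : ℕ → State V → Prop) : Prop :=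
  ∃ t σ', Exec c σ t σ' ∧ Q t σ'

/-- Besides weakening the postcondition, this hands `Agree` to the continuation. Specifications
therefore mention only what a program changes. -/
theorem WP.mono {c : Cmd} {σ : State V} {Q Q' : ℕ → State V → Prop} (h : WP c σ Q)
    (hQ : ∀ t σ', Agree c σ σ' → Q t σ' → Q' t σ') : WP c σ Q' := by
  obtain ⟨t, σ', he, hq⟩ := h
  exact ⟨t, σ', he, hQ t σ' he.agree hq⟩

theorem wp_skip {σ : State V} {Q : ℕ → State V → Prop} : WP .skip σ Q ↔ Q 1 σ := by
  constructor
  · rintro ⟨_, _, ⟨⟩, h⟩; exact h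
  · exact fun h => ⟨_, _, .skip σ, h⟩

theorem wp_nset {σ : State V} {Q : ℕ → State V → Prop} {a : ℕ} {i e : NExp} :
    WP (.nset a i e) σ Q ↔
      Q (i.cost + e.cost + 1) { σ with nat := write σ.nat a (i.eval σ) (e.eval σ) } := by
  constructor
  · rintro ⟨_, _, ⟨⟩, h⟩; exact h
  · exact fun h => ⟨_, _, .nset σ a i e, h⟩

theorem wp_rset {σ : State V} {Q : ℕ → State V → Prop} {a : ℕ} {i : NExp} {e : RExp} :
    WP (.rset a i e) σ Q ↔
      Q (i.cost + e.cost + 1) { σ with real := write σ.real a (i.eval σ) (e.eval σ) } := by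
  constructor
  · rintro ⟨_, _, ⟨⟩, h⟩; exact h
  · exact fun h => ⟨_, _, .rset σ a i e, h⟩

theorem wp_emit {σ : State V} {Q : ℕ → State V → Prop} {e : NExp} :
    WP (.emit e) σ Q ↔ Q (e.cost + 1) { σ with out := σ.out ++ [e.eval σ] } := by
  constructor
  · rintro ⟨_, _, ⟨⟩, h⟩; exact h
  · exact fun h => ⟨_, _, .emit σ e, h⟩

theorem wp_seq {σ : State V} {Q : ℕ → State V → Prop} {c c' : Cmd} :
    WP (.seq c c') σ Q ↔ WP c σ fun t σ₁ => WP c' σ₁ fun t' σ₂ => Q (t + t') σ₂ := by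
  constructor
  · rintro ⟨_, _, h, hQ⟩
    cases h with
    | seq k k' => exact ⟨_, _, k, _, _, k', hQ⟩
  · rintro ⟨_, _, k, _, _, k', hQ⟩
    exact ⟨_, _, .seq k k', hQ⟩

open Classical in
theorem wp_ite {σ : State V} {Q : ℕ → State V → Prop} {b : BExp} {c c' : Cmd} :
    WP (.ite b c c') σ Q ↔
      if b.Holds σ then WP c σ (fun t => Q (b.cost + t)) else WP c' σ (fun t => Q (b.cost + t)) := by
  constructor
  · rintro ⟨_, _, h, hQ⟩
    cases h with
    | iteTrue hb k => rw [if_pos hb]; exact ⟨_, _, k, hQ⟩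
    | iteFalse hb k => rw [if_neg hb]; exact ⟨_, _, k, hQ⟩
  · intro h
    split_ifs at h with hb
    · obtain ⟨_, _, k, hQ⟩ := h; exact ⟨_, _, .iteTrue hb k, hQ⟩
    · obtain ⟨_, _, k, hQ⟩ := h; exact ⟨_, _, .iteFalse hb k, hQ⟩

theorem WP.ite {σ : State V} {Q : ℕ → State V → Prop} {b : BExp} {c c' : Cmd}
    (h : b.Holds σ → WP c σ (fun t => Q (b.cost + t)))
    (h' : ¬ b.Holds σ → WP c' σ (fun t => Q (b.cost + t))) : WP (.ite b c c') σ Q := by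
  rw [wp_ite]; split_ifs with hb
  exacts [h hb, h' hb]

/-- Total correctness of a loop: `Inv` depends on the time elapsed, `μ` decreases. -/
theorem WP.while {b : BExp} {c : Cmd} {Q : ℕ → State V → Prop} (σ : State V)
    (μ : State V → ℕ) (Inv : ℕ → State V → Prop) (h0 : Inv 0 σ)
    (step : ∀ τ σ', Agree c σ σ' → Inv τ σ' → b.Holds σ' →
      WP c σ' fun t σ'' => Inv (τ + b.cost + t) σ'' ∧ μ σ'' < μ σ')
    (post : ∀ τ σ', Agree c σ σ' → Inv τ σ' → ¬ b.Holds σ' → Q (τ + b.cost) σ') :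
    WP (.while b c) σ Q := by
  suffices H : ∀ N τ σ', Agree c σ σ' → Inv τ σ' → μ σ' < N →
      WP (.while b c) σ' fun t => Q (τ + t) by
    simpa using H _ 0 σ (Agree.refl _ _) h0 (Nat.lt_succ_self _)
  intro N
  induction N with
  | zero => intro τ σ' _ _ h; omega
  | succ N ih =>
    intro τ σ' ha hi hN
    by_cases hb : b.Holds σ'
    · obtain ⟨t, σ'', he, hi', hμ⟩ := step τ σ' ha hi hb
      obtain ⟨t', σ₃, he', hQ⟩ := ih _ σ'' (ha.trans he.agree) hi' (by omega)
      refine ⟨_, _, .whileTrue hb he he', ?_⟩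
      convert hQ using 1
      omega
    · exact ⟨_, _, .whileFalse hb, post τ σ' ha hi hb⟩

/-! ### Scalars and counting loops. -/

/-- The scalar kept in cell `0` of number array `a`. -/
abbrev nv (a : ℕ) : NExp := .cell a (.lit 0)

/-- The scalar kept in cell `0` of real array `a`. -/
abbrev rv (a : ℕ) : RExp := .cell a (.lit 0)

abbrev nlet (a : ℕ) (e : NExp) : Cmd := .nset a (.lit 0) e

abbrev rlet (a : ℕ) (e : RExp) : Cmd := .rset a (.lit 0) e

/-- The loop in which the scalar `v` runs from `lo` to `hi - 1`. -/
def forLoop (v : ℕ) (lo hi : NExp) (body : Cmd) : Cmd :=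
  .seq (nlet v lo) (.while (.nlt (nv v) hi) (.seq body (nlet v (.add (nv v) (.lit 1)))))

/-- The state after an assignment to a number scalar. -/
def State.nlet (σ : State V) (a x : ℕ) : State V := { σ with nat := write σ.nat a 0 x }

theorem Agree.nlet {c : Cmd} {σ σ' : State V} (h : Agree c σ σ') (a x : ℕ) (ha : a ∈ c.nw) :
    Agree c σ (σ'.nlet a x) :=
  ⟨fun b hb => (write_other _ (by rintro rfl; exact hb ha) _ _).trans (h.nat b hb), h.real, h.pt⟩

theorem forLoop_nw (v : ℕ) (lo hi : NExp) (body : Cmd) :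
    (forLoop v lo hi body).nw = v :: (body.nw ++ [v]) := rfl

theorem forLoop_rw (v : ℕ) (lo hi : NExp) (body : Cmd) :
    (forLoop v lo hi body).rw = body.rw := by simp [forLoop, Cmd.rw]

theorem forLoop_pw (v : ℕ) (lo hi : NExp) (body : Cmd) :
    (forLoop v lo hi body).pw = body.pw := by simp [forLoop, Cmd.pw]

/-- Total correctness of a counting loop, with elapsed time. -/
theorem WP.forLoop_time {v : ℕ} {lo hi : NExp} {body : Cmd} {Q : ℕ → State V → Prop} {σ : State V}
    (a b : ℕ) (hab : a ≤ b) (hv : v ∉ body.nw) (ha : lo.eval σ = a)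
    (hhi : ∀ σ', Agree (forLoop v lo hi body) σ σ' → hi.eval σ' = b)
    (Inv : ℕ → ℕ → State V → Prop) (h0 : Inv a (lo.cost + 2) (σ.nlet v a))
    (step : ∀ k τ σ', a ≤ k → k < b → σ'.nat v 0 = k → Agree (forLoop v lo hi body) σ σ' →
      Inv k τ σ' → WP body σ' fun t σ'' => Inv (k + 1) (τ + t + (hi.cost + 9)) (σ''.nlet v (k + 1)))
    (post : ∀ τ σ', Agree (forLoop v lo hi body) σ σ' → σ'.nat v 0 = b → Inv b τ σ' →
      Q (τ + (hi.cost + 3)) σ') :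
    WP (forLoop v lo hi body) σ Q := by
  have hvm : v ∈ (forLoop v lo hi body).nw := by simp [forLoop_nw]
  have hw : (Cmd.seq body (RAM.nlet v (.add (nv v) (.lit 1)))).nw ⊆ (forLoop v lo hi body).nw := by
    intro x hx; simp [forLoop_nw, Cmd.nw] at hx ⊢; tauto
  have hr : (Cmd.seq body (RAM.nlet v (.add (nv v) (.lit 1)))).rw ⊆ (forLoop v lo hi body).rw := by
    intro x hx; simpa [forLoop_rw, Cmd.rw] using hx
  have hp : (Cmd.seq body (RAM.nlet v (.add (nv v) (.lit 1)))).pw ⊆ (forLoop v lo hi body).pw := by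
    intro x hx; simpa [forLoop_pw, Cmd.pw] using hx
  have hA0 : Agree (forLoop v lo hi body) σ (σ.nlet v a) := (Agree.refl _ _).nlet _ _ hvm
  unfold forLoop
  rw [wp_seq, wp_nset, ha]
  refine WP.while (σ.nlet v a) (fun σ' => b - σ'.nat v 0)
    (fun τ σ' => ∃ k, a ≤ k ∧ k ≤ b ∧ σ'.nat v 0 = k ∧ Inv k (lo.cost + 2 + τ) σ') ?_ ?_ ?_
  · exact ⟨a, le_rfl, hab, by simp [State.nlet, write_same], h0⟩
  · rintro τ σ' hag ⟨k, hak, -, hk, hI⟩ hb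
    have hag' := hA0.trans (hag.mono hw hr hp)
    have hlt : k < b := by simpa [BExp.Holds, NExp.eval, hk, hhi σ' hag'] using hb
    rw [wp_seq]
    refine (step k _ σ' hak hlt hk hag' hI).mono fun t σ'' hag2 hI2 => ?_
    rw [wp_nset]
    have hk2 : σ''.nat v 0 = k := by rw [hag2.nat v hv, hk]
    refine ⟨⟨k + 1, by omega, hlt, by simp [NExp.eval, hk2, write_same], ?_⟩, ?_⟩
    · convert hI2 using 1
      · simp only [BExp.cost, NExp.cost]; omega
      · simp [State.nlet, NExp.eval, hk2]
    · simp [NExp.eval, hk2, write_same, hk]; omega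
  · rintro τ σ' hag ⟨k, hak, hkb, hk, hI⟩ hb
    have hag' := hA0.trans (hag.mono hw hr hp)
    have hge : b ≤ k := by simpa [BExp.Holds, NExp.eval, hk, hhi σ' hag'] using hb
    obtain rfl : k = b := by omega
    have := post _ σ' hag' hk hI
    convert this using 1
    simp only [BExp.cost, NExp.cost]; omega

/-- Total correctness of a counting loop each of whose iterations takes time at most `B`. -/
theorem WP.forLoop_bounded {v : ℕ} {lo hi : NExp} {body : Cmd} {Q : ℕ → State V → Prop} {σ : State V}
    (a b B : ℕ) (hab : a ≤ b) (hv : v ∉ body.nw) (ha : lo.eval σ = a)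
    (hhi : ∀ σ', Agree (forLoop v lo hi body) σ σ' → hi.eval σ' = b)
    (Inv : ℕ → State V → Prop) (h0 : Inv a (σ.nlet v a))
    (step : ∀ k σ', a ≤ k → k < b → σ'.nat v 0 = k → Agree (forLoop v lo hi body) σ σ' →
      Inv k σ' → WP body σ' fun t σ'' => t ≤ B ∧ Inv (k + 1) (σ''.nlet v (k + 1)))
    (post : ∀ t σ', t ≤ (b - a) * (B + (hi.cost + 9)) + (lo.cost + hi.cost + 5) →
      Agree (forLoop v lo hi body) σ σ' → σ'.nat v 0 = b → Inv b σ' → Q t σ') :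
    WP (forLoop v lo hi body) σ Q := by
  refine WP.forLoop_time a b hab hv ha hhi
    (fun k τ σ' => τ ≤ (k - a) * (B + (hi.cost + 9)) + (lo.cost + 2) ∧ Inv k σ') ⟨by omega, h0⟩ ?_ ?_
  · rintro k τ σ' hak hkb hk hag ⟨ht, hI⟩
    refine (step k σ' hak hkb hk hag hI).mono ?_
    rintro t σ'' - ⟨h1, h2⟩
    refine ⟨?_, h2⟩
    rw [show k + 1 - a = k - a + 1 by omega, add_mul]
    omega
  · rintro τ σ' hag hk ⟨ht, hI⟩
    exact post _ _ (by omega) hag hk hI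

/-- Total correctness of a counting loop, regardless of time. -/
theorem WP.forLoop_halts {v : ℕ} {lo hi : NExp} {body : Cmd} {Q : ℕ → State V → Prop}
    {σ : State V} (a b : ℕ) (hab : a ≤ b) (hv : v ∉ body.nw) (ha : lo.eval σ = a)
    (hhi : ∀ σ', Agree (forLoop v lo hi body) σ σ' → hi.eval σ' = b)
    (Inv : ℕ → State V → Prop) (h0 : Inv a (σ.nlet v a))
    (step : ∀ k σ', a ≤ k → k < b → σ'.nat v 0 = k → Agree (forLoop v lo hi body) σ σ' →
      Inv k σ' → WP body σ' fun _ σ'' => Inv (k + 1) (σ''.nlet v (k + 1)))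
    (post : ∀ t σ', Agree (forLoop v lo hi body) σ σ' → σ'.nat v 0 = b → Inv b σ' → Q t σ') :
    WP (forLoop v lo hi body) σ Q :=
  WP.forLoop_time a b hab hv ha hhi (fun k _ σ' => Inv k σ') h0
    (fun k _ σ' hak hkb hk hag hI => step k σ' hak hkb hk hag hI)
    (fun _ σ' hag hk hI => post _ σ' hag hk hI)

theorem BExp.holds_nlt {σ : State V} {e e' : NExp} :
    (BExp.nlt e e').Holds σ ↔ e.eval σ < e'.eval σ := Iff.rfl

theorem BExp.holds_rlt {σ : State V} {e e' : RExp} :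
    (BExp.rlt e e').Holds σ ↔ e.eval σ < e'.eval σ := Iff.rfl

theorem BExp.holds_not {σ : State V} {b : BExp} : (BExp.not b).Holds σ ↔ ¬ b.Holds σ := Iff.rfl

theorem BExp.holds_and {σ : State V} {b b' : BExp} :
    (BExp.and b b').Holds σ ↔ b.Holds σ ∧ b'.Holds σ := Iff.rfl

end RAM

namespace FacilityLocation

/-! ### Approximation by heavy net points, independent of the machine. -/

section Approximation

variable {V : Type*} [MetricSpace V]

/-- For every scale `R₀ / 2 ^ t` a covering net in the facilities `F x`, `x < m`: `par t x` is a net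
point close to `x`, and `g t x` is a cheapest facility in a ball around `x`. -/
structure NetSystem (m : ℕ) (F : ℕ → V) (f : ℕ → ℝ) (R₀ : ℝ) (net : ℕ → ℕ → Prop)
    (par g : ℕ → ℕ → ℕ) : Prop where
  par_lt : ∀ t x, x < m → par t x < m
  par_net : ∀ t x, x < m → net t (par t x)
  par_dist : ∀ t x, x < m → dist (F x) (F (par t x)) ≤ R₀ / 2 ^ t
  g_lt : ∀ t x, x < m → g t x < m
  g_dist : ∀ t x, x < m → dist (F x) (F (g t x)) ≤ 4 * (R₀ / 2 ^ t)
  g_min : ∀ t x y, x < m → y < m → dist (F x) (F y) ≤ 4 * (R₀ / 2 ^ t) → f (g t x) ≤ f y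

/-- A net point is eligible when it is heavy, does not have a free facility nearby, and has no heavy
net point of the next finer scale nearby. -/
def Elig (m : ℕ) (F : ℕ → V) (f : ℕ → ℝ) (R₀ : ℝ) (net : ℕ → ℕ → Prop) (g : ℕ → ℕ → ℕ)
    (heavy : ℕ → ℕ → Prop) (t x : ℕ) : Prop :=
  heavy t x ∧ 0 < f (g t x) ∧
    ∀ y < m, net (t + 1) y → dist (F x) (F y) ≤ 4 * (R₀ / 2 ^ t) → ¬ heavy (t + 1) y

/-- `K` is at scale `t` a maximal well separated set of eligible net points. -/
structure IsMaxSep (m : ℕ) (F : ℕ → V) (f : ℕ → ℝ) (R₀ : ℝ) (net : ℕ → ℕ → Prop) (g : ℕ → ℕ → ℕ)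
    (heavy : ℕ → ℕ → Prop) (K : ℕ → Prop) (t : ℕ) : Prop where
  lt : ∀ x, K x → x < m
  isNet : ∀ x, K x → net t x
  elig : ∀ x, K x → Elig m F f R₀ net g heavy t x
  sep : ∀ x y, K x → K y → x ≠ y → 6 * (R₀ / 2 ^ t) < dist (F x) (F y)
  max : ∀ x < m, net t x → Elig m F f R₀ net g heavy t x →
    ∃ y, K y ∧ dist (F x) (F y) ≤ 6 * (R₀ / 2 ^ t)

open Classical in
/-- The number of clients counted at scale `t` in the ball around `x`; client `k` is located at
facility `j k` and counted at the scales up to `L k`. -/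
noncomputable def ballCount (F : ℕ → V) (R₀ : ℝ) (n : ℕ) (j L : ℕ → ℕ) (t x : ℕ) : ℕ :=
  ((Finset.range n).filter fun k => t ≤ L k ∧ dist (F x) (F (j k)) ≤ 3 * (R₀ / 2 ^ t)).card

/-- The threshold at which the clients counted around `x`, contributing one radius each, can pay for
the cheapest facility nearby. -/
def Heavy (f : ℕ → ℝ) (R₀ : ℝ) (g bal : ℕ → ℕ → ℕ) (t x : ℕ) : Prop :=
  f (g t x) ≤ R₀ / 2 ^ t * bal t x

open Classical in
/-- The estimate of the cost of a client at `j`, counted at the scales up to `L`. -/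
noncomputable def payment (R₀ : ℝ) (Z : ℕ → ℝ) (par : ℕ → ℕ → ℕ) (heavy : ℕ → ℕ → Prop)
    (j L : ℕ) : ℝ :=
  min (Z j) (R₀ / 2 ^ L) +
    ∑ t ∈ Finset.range (L + 1), if heavy t (par t j) then 0 else R₀ / 2 ^ t

variable {m n : ℕ} {F : ℕ → V} {f : ℕ → ℝ} {R₀ fm : ℝ} {net : ℕ → ℕ → Prop} {par g : ℕ → ℕ → ℕ}
  {j L : ℕ → ℕ} {Z : ℕ → ℝ} {K : Finset (ℕ × ℕ)}

/-- `Z x` is the distance of `x` to the closest free facility, cut off at `R₀`. -/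
structure FreeDist (m : ℕ) (F : ℕ → V) (f : ℕ → ℝ) (R₀ : ℝ) (Z : ℕ → ℝ) : Prop where
  nonneg : ∀ x < m, 0 ≤ Z x
  le : ∀ x < m, ∀ y < m, f y = 0 → Z x ≤ dist (F x) (F y)
  attained : ∀ x < m, Z x = R₀ ∨ ∃ y < m, f y = 0 ∧ dist (F x) (F y) = Z x

open Classical in
theorem term_le_payment (hR : 0 ≤ R₀) {heavy : ℕ → ℕ → Prop} {i l t : ℕ} (hZ : 0 ≤ Z i)
    (ht : t ≤ l) (hh : ¬ heavy t (par t i)) : R₀ / 2 ^ t ≤ payment R₀ Z par heavy i l := by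
  unfold payment
  have h1 : (if heavy t (par t i) then 0 else R₀ / 2 ^ t) ≤
      ∑ t ∈ Finset.range (l + 1), if heavy t (par t i) then 0 else R₀ / 2 ^ t :=
    Finset.single_le_sum (f := fun t => if heavy t (par t i) then (0 : ℝ) else R₀ / 2 ^ t)
      (fun t _ => by split_ifs <;> positivity) (by simp; omega)
  rw [if_neg hh] at h1
  have : 0 ≤ min (Z i) (R₀ / 2 ^ l) := le_min hZ (by positivity)
  linarith

/-- The opening costs are bounded by the payments. -/
theorem sum_open_le (hR : 0 < R₀) (hN : NetSystem m F f R₀ net par g) (hZ : FreeDist m F f R₀ Z)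
    (hj : ∀ k < n, j k < m)
    (hK : ∀ t, IsMaxSep m F f R₀ net g (Heavy f R₀ g (ballCount F R₀ n j L)) (fun x => (t, x) ∈ K) t) :
    ∑ p ∈ K, f (g p.1 p.2) ≤
      2 * ∑ k ∈ Finset.range n,
        payment R₀ Z par (Heavy f R₀ g (ballCount F R₀ n j L)) (j k) (L k) := by
  classical
  set heavy := Heavy f R₀ g (ballCount F R₀ n j L) with hheavy
  have hr : ∀ t : ℕ, 0 < R₀ / 2 ^ t := fun t => by positivity
  -- Members are heavy, so every client counted within three radii of a member contributes one
  -- radius towards its facility. After exchanging the sums it remains to bound the contributions of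
  -- a single client.
  have h1 : ∑ p ∈ K, f (g p.1 p.2) ≤ ∑ p ∈ K, ∑ k ∈ Finset.range n,
      if p.1 ≤ L k ∧ dist (F p.2) (F (j k)) ≤ 3 * (R₀ / 2 ^ p.1) then R₀ / 2 ^ p.1 else 0 := by
    refine Finset.sum_le_sum ?_
    rintro ⟨t, x⟩ hp
    have he : f (g t x) ≤ R₀ / 2 ^ t * (ballCount F R₀ n j L t x : ℕ) := ((hK t).elig x hp).1
    rw [← Finset.sum_filter, Finset.sum_const, nsmul_eq_mul]
    simpa [ballCount, mul_comm] using he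
  rw [Finset.sum_comm] at h1
  refine h1.trans ?_
  rw [Finset.mul_sum]
  refine Finset.sum_le_sum fun k hk => ?_
  have hk : k < n := by simpa using hk
  rw [← Finset.sum_filter]
  set A := K.filter fun p => p.1 ≤ L k ∧ dist (F p.2) (F (j k)) ≤ 3 * (R₀ / 2 ^ p.1) with hA
  -- A client contributes to at most one member per scale: two members within three radii of it
  -- would violate the separation by six radii.
  have hinj : Set.InjOn Prod.fst (A : Set (ℕ × ℕ)) := by
    rintro ⟨t, x⟩ hx ⟨t', y⟩ hy (rfl : t = t')
    simp only [hA, Finset.coe_filter, Set.mem_ofPred_eq] at hx hy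
    by_contra hne
    have hxy : x ≠ y := fun h => hne (by rw [h])
    have := (hK t).sep x y hx.1 hy.1 hxy
    have := dist_triangle_right (F x) (F y) (F (j k))
    linarith [hx.2.2, hy.2.2]
  -- A contribution at a scale coarser than the finest one is charged to the next finer term of the
  -- payment, which is half as large. The contribution at the finest scale is charged to the base
  -- term.
  set w : ℕ → ℝ := fun t => if t < L k then
      2 * (if heavy (t + 1) (par (t + 1) (j k)) then 0 else R₀ / 2 ^ (t + 1))
    else min (Z (j k)) (R₀ / 2 ^ L k) with hw
  have hw0 : ∀ t, 0 ≤ w t := by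
    intro t
    simp only [hw]
    split_ifs
    · simp
    · positivity
    · exact le_min (hZ.nonneg _ (hj k hk)) (hr _).le
  have hAw : ∀ p ∈ A, R₀ / 2 ^ p.1 ≤ w p.1 := by
    rintro ⟨t, x⟩ hp
    simp only [hA, Finset.mem_filter] at hp
    obtain ⟨hpK, htL, hd⟩ := hp
    have hel := (hK t).elig x hpK
    have hxm := (hK t).lt x hpK
    simp only [hw]
    split_ifs with h2 h3
    -- The parent at scale `t + 1` lies within 3 + 1/2 ≤ 4 radii of the member, so eligibility
    -- forbids it to be heavy.
    · exfalso
      refine hel.2.2 _ (hN.par_lt _ _ (hj k hk)) (hN.par_net _ _ (hj k hk)) ?_ h3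
      have e1 := hN.par_dist (t + 1) _ (hj k hk)
      have e2 : R₀ / 2 ^ (t + 1) = R₀ / 2 ^ t / 2 := by rw [pow_succ]; field_simp
      have e3 := dist_triangle (F x) (F (j k)) (F (par (t + 1) (j k)))
      linarith [hr t]
    · have e2 : R₀ / 2 ^ (t + 1) = R₀ / 2 ^ t / 2 := by rw [pow_succ]; field_simp
      rw [e2]; linarith
    -- If a free facility were closer to the client than the finest radius, it would be within four
    -- radii of the member. Then the cheapest facility of the member would be free, contrary to
    -- eligibility.
    · have htL' : t = L k := by omega
      subst htL'
      refine le_min ?_ le_rfl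
      rcases hZ.attained (j k) (hj k hk) with h4 | ⟨y, hy, hfy, h4⟩
      · rw [h4]
        exact div_le_self hR.le (one_le_pow₀ (by norm_num))
      · rw [← h4]
        by_contra hlt
        push Not at hlt
        have e1 := hN.g_min (L k) x y hxm hy
          (by have := dist_triangle (F x) (F (j k)) (F y); linarith)
        have := hel.2.1
        linarith
  calc ∑ p ∈ A, R₀ / 2 ^ p.1 ≤ ∑ p ∈ A, w p.1 := Finset.sum_le_sum hAw
    _ = ∑ t ∈ A.image Prod.fst, w t := (Finset.sum_image (f := w) hinj).symm
    _ ≤ ∑ t ∈ Finset.range (L k + 1), w t := by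
      refine Finset.sum_le_sum_of_subset_of_nonneg ?_ fun t _ _ => hw0 t
      intro t ht
      obtain ⟨p, hp, rfl⟩ := Finset.mem_image.1 ht
      simp only [hA, Finset.mem_filter] at hp
      simp; omega
    _ = 2 * (∑ t ∈ Finset.range (L k), if heavy (t + 1) (par (t + 1) (j k)) then 0
          else R₀ / 2 ^ (t + 1)) + min (Z (j k)) (R₀ / 2 ^ L k) := by
      rw [Finset.sum_range_succ, Finset.mul_sum]
      congr 1
      · refine Finset.sum_congr rfl fun t ht => ?_
        simp only [hw]; rw [if_pos (by simpa using ht)]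
      · simp [hw]
    _ ≤ 2 * payment R₀ Z par heavy (j k) (L k) := by
      unfold payment
      rw [Finset.sum_range_succ']
      have h5 : (0 : ℝ) ≤ if heavy 0 (par 0 (j k)) then 0 else R₀ / 2 ^ 0 := by
        split_ifs <;> positivity
      have h6 : 0 ≤ min (Z (j k)) (R₀ / 2 ^ L k) := le_min (hZ.nonneg _ (hj k hk)) (hr _).le
      linarith

/-- Close to a heavy net point there is an open facility. -/
theorem exists_open_near (hR : 0 < R₀) (hN : NetSystem m F f R₀ net par g) (hf : ∀ x, 0 ≤ f x)
    (hK : ∀ t, IsMaxSep m F f R₀ net g (Heavy f R₀ g (ballCount F R₀ n j L)) (fun x => (t, x) ∈ K) t)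
    {t x : ℕ} (hx : x < m) (hnet : net t x) (hh : Heavy f R₀ g (ballCount F R₀ n j L) t x) :
    ∃ s < m, (f s = 0 ∨ ∃ p ∈ K, s = g p.1 p.2) ∧ dist (F x) (F s) ≤ 10 * (R₀ / 2 ^ t) := by
  classical
  obtain ⟨B, hB⟩ : ∃ B, ∀ k < n, L k < B := by
    refine ⟨(Finset.range n).sup L + 1, fun k hk => ?_⟩
    exact Nat.lt_succ_of_le (Finset.le_sup (f := L) (by simpa using hk))
  have hr : ∀ t : ℕ, 0 < R₀ / 2 ^ t := fun t => by positivity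
  have free : ∀ t x, x < m → ¬ 0 < f (g t x) → ∃ s < m,
      (f s = 0 ∨ ∃ p ∈ K, s = g p.1 p.2) ∧ dist (F x) (F s) ≤ 10 * (R₀ / 2 ^ t) := by
    intro t x hx h
    exact ⟨g t x, hN.g_lt _ _ hx, .inl (le_antisymm (not_lt.1 h) (hf _)),
      (hN.g_dist t x hx).trans (by linarith [hr t])⟩
  -- Induction from the finest scale. Beyond all `L k` the ball counts nobody, so a heavy point has
  -- a free facility nearby. The constant 10 satisfies 6 + 4 ≤ 10, for an eligible point covered by
  -- a member, and 4 + 10/2 ≤ 10, for a heavy point of the next scale.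
  induction hd : B - t generalizing t x with
  | zero =>
    refine free t x hx ?_
    have : ballCount F R₀ n j L t x = 0 := by
      rw [ballCount, Finset.card_eq_zero, Finset.filter_eq_empty_iff]
      intro k hk h
      have := hB k (by simpa using hk)
      omega
    simp only [Heavy, this] at hh
    simpa using hh
  | succ d ih =>
    by_cases hpos : 0 < f (g t x)
    swap
    · exact free t x hx hpos
    by_cases hel : ∀ y < m, net (t + 1) y → dist (F x) (F y) ≤ 4 * (R₀ / 2 ^ t) →
        ¬ Heavy f R₀ g (ballCount F R₀ n j L) (t + 1) y
    · obtain ⟨y, hy, hxy⟩ := (hK t).max x hx hnet ⟨hh, hpos, hel⟩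
      have hym := (hK t).lt y hy
      refine ⟨g t y, hN.g_lt _ _ hym, .inr ⟨_, hy, rfl⟩, ?_⟩
      have := hN.g_dist t y hym
      have := dist_triangle (F x) (F y) (F (g t y))
      linarith
    · push Not at hel
      obtain ⟨y, hy, hny, hxy, hhy⟩ := hel
      obtain ⟨s, hs, hopen, hys⟩ := ih hy hny hhy (by omega)
      refine ⟨s, hs, hopen, ?_⟩
      have e2 : R₀ / 2 ^ (t + 1) = R₀ / 2 ^ t / 2 := by rw [pow_succ]; field_simp
      rw [e2] at hys
      have := dist_triangle (F x) (F y) (F s)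
      linarith [hr t]

/-- Every client has an open facility at a distance bounded by its payment. -/
theorem exists_open_le_payment (hR : 0 < R₀) (hN : NetSystem m F f R₀ net par g)
    (hf : ∀ x, 0 ≤ f x) (hfR : ∀ x, f x ≤ R₀) (hFR : ∀ x y, dist (F x) (F y) ≤ R₀)
    (hZ : FreeDist m F f R₀ Z) (hj : ∀ k < n, j k < m)
    (hK : ∀ t, IsMaxSep m F f R₀ net g (Heavy f R₀ g (ballCount F R₀ n j L)) (fun x => (t, x) ∈ K) t)
    {k : ℕ} (hk : k < n) :
    ∃ s < m, (f s = 0 ∨ ∃ p ∈ K, s = g p.1 p.2) ∧ dist (F (j k)) (F s) ≤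
      22 * payment R₀ Z par (Heavy f R₀ g (ballCount F R₀ n j L)) (j k) (L k) := by
  classical
  have hr : ∀ t : ℕ, 0 < R₀ / 2 ^ t := fun t => by positivity
  set heavy := Heavy f R₀ g (ballCount F R₀ n j L) with hheavy
  -- At scale 0 the ball contains all facilities, so one client suffices for heaviness because
  -- opening costs are at most `R₀`.
  have h0 : heavy 0 (par 0 (j k)) := by
    have h1 : 1 ≤ ballCount F R₀ n j L 0 (par 0 (j k)) := by
      rw [ballCount, Nat.one_le_iff_ne_zero, Finset.card_ne_zero]
      exact ⟨k, by simp [hk]; linarith [hFR (par 0 (j k)) (j k)]⟩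
    have h2 : (1 : ℝ) ≤ ballCount F R₀ n j L 0 (par 0 (j k)) := by exact_mod_cast h1
    have h3 := hfR (g 0 (par 0 (j k)))
    simp only [hheavy, Heavy, pow_zero, div_one]
    nlinarith
  -- The finest scale with a heavy parent yields an open facility within 1 + 10 radii. If it is not
  -- the last scale of the client, the next term of the payment is half of its radius, whence 22 = 2
  -- · 11. Otherwise the base term pays, or a free facility is close enough.
  obtain ⟨t, ⟨htL, hth⟩, hmax⟩ : ∃ t, (t ≤ L k ∧ heavy t (par t (j k))) ∧
      ∀ t', t < t' → t' ≤ L k → ¬ heavy t' (par t' (j k)) := by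
    refine ⟨Nat.findGreatest (fun t => heavy t (par t (j k))) (L k), ⟨Nat.findGreatest_le _, ?_⟩, ?_⟩
    · exact Nat.findGreatest_spec (P := fun t => heavy t (par t (j k))) (Nat.zero_le _) h0
    · intro t' h1 h2
      exact Nat.findGreatest_is_greatest (P := fun t => heavy t (par t (j k))) h1 h2
  obtain ⟨s, hs, hopen, hd⟩ := exists_open_near hR hN hf hK (hN.par_lt t _ (hj k hk))
    (hN.par_net t _ (hj k hk)) hth
  have hd' : dist (F (j k)) (F s) ≤ 11 * (R₀ / 2 ^ t) := by
    have := hN.par_dist t _ (hj k hk)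
    have := dist_triangle (F (j k)) (F (par t (j k))) (F s)
    linarith
  have hZk := hZ.nonneg _ (hj k hk)
  rcases htL.lt_or_eq with hlt | rfl
  · have h4 := term_le_payment (Z := Z) hR.le hZk hlt (hmax (t + 1) (by omega) hlt)
    have e2 : R₀ / 2 ^ (t + 1) = R₀ / 2 ^ t / 2 := by rw [pow_succ]; field_simp
    rw [e2] at h4
    exact ⟨s, hs, hopen, by linarith⟩
  · have h5 : min (Z (j k)) (R₀ / 2 ^ L k) ≤ payment R₀ Z par heavy (j k) (L k) := by
      unfold payment
      have : (0 : ℝ) ≤ ∑ t ∈ Finset.range (L k + 1),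
          if heavy t (par t (j k)) then 0 else R₀ / 2 ^ t :=
        Finset.sum_nonneg fun t _ => by split_ifs <;> positivity
      linarith
    by_cases hc : R₀ / 2 ^ L k ≤ Z (j k)
    · rw [min_eq_right hc] at h5
      exact ⟨s, hs, hopen, by linarith [hr (L k)]⟩
    · push Not at hc
      rw [min_eq_left hc.le] at h5
      rcases hZ.attained _ (hj k hk) with h6 | ⟨y, hy, hfy, h6⟩
      · have : R₀ / 2 ^ L k ≤ R₀ := div_le_self hR.le (one_le_pow₀ (by norm_num))
        linarith
      · exact ⟨y, hy, .inl hfy, by linarith⟩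

theorem sum_range_div_two_pow_le (hR : 0 ≤ R₀) (a b : ℕ) :
    ∑ t ∈ Finset.Ico a b, R₀ / 2 ^ t ≤ 2 * (R₀ / 2 ^ a) := by
  rcases le_total b a with h | h
  · rw [Finset.Ico_eq_empty_of_le h]; simp; positivity
  · suffices H : ∑ t ∈ Finset.Ico a b, R₀ / 2 ^ t = 2 * (R₀ / 2 ^ a) - 2 * (R₀ / 2 ^ b) by
      rw [H]; have : 0 ≤ R₀ / 2 ^ b := by positivity
      linarith
    induction b, h using Nat.le_induction with
    | base => simp
    | succ b hb ih => rw [Finset.sum_Ico_succ_top hb, ih, pow_succ]; field_simp; ring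

/-- The payments are bounded by the cost of any assignment of the clients to facilities. -/
theorem sum_payment_le (hR : 0 < R₀) (hN : NetSystem m F f R₀ net par g)
    (hf : ∀ x, 0 ≤ f x) (hZ : FreeDist m F f R₀ Z) (hj : ∀ k < n, j k < m)
    (hfm : ∀ x < m, 0 < f x → fm ≤ f x)
    (hL : ∑ k ∈ Finset.range n, R₀ / 2 ^ L k ≤ 2 * fm)
    (S : Finset ℕ) (hS : ∀ s ∈ S, s < m) (φ : ℕ → ℕ) (hφ : ∀ k < n, φ k ∈ S) :
    ∑ k ∈ Finset.range n, payment R₀ Z par (Heavy f R₀ g (ballCount F R₀ n j L)) (j k) (L k) ≤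
      4 * (∑ s ∈ S, f s + ∑ k ∈ Finset.range n, dist (F (j k)) (F (φ k))) := by
  classical
  have hr : ∀ t : ℕ, 0 < R₀ / 2 ^ t := fun t => by positivity
  set heavy := Heavy f R₀ g (ballCount F R₀ n j L) with hheavy
  set con := ∑ k ∈ Finset.range n, dist (F (j k)) (F (φ k)) with hcon
  have hcon0 : 0 ≤ con := Finset.sum_nonneg fun _ _ => dist_nonneg
  have hop0 : 0 ≤ ∑ s ∈ S, f s := Finset.sum_nonneg fun _ _ => hf _
  -- Either the solution opens a facility of positive cost, which pays for all finest radii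
  -- together, or each client goes to a free facility and its base term is at most its connection
  -- cost.
  have base : ∑ k ∈ Finset.range n, min (Z (j k)) (R₀ / 2 ^ L k) ≤ 2 * (∑ s ∈ S, f s + con) := by
    by_cases hpos : ∃ s ∈ S, 0 < f s
    · obtain ⟨s, hs, hfs⟩ := hpos
      have h1 : ∑ k ∈ Finset.range n, min (Z (j k)) (R₀ / 2 ^ L k) ≤
          ∑ k ∈ Finset.range n, R₀ / 2 ^ L k := Finset.sum_le_sum fun k _ => min_le_right _ _
      have h2 := hfm s (hS s hs) hfs
      have h3 := Finset.single_le_sum (f := f) (fun s _ => hf s) hs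
      linarith
    · push Not at hpos
      have h1 : ∑ k ∈ Finset.range n, min (Z (j k)) (R₀ / 2 ^ L k) ≤ con := by
        refine Finset.sum_le_sum fun k hk => (min_le_left _ _).trans ?_
        have hk : k < n := by simpa using hk
        exact hZ.le _ (hj k hk) _ (hS _ (hφ k hk)) (le_antisymm (hpos _ (hφ k hk)) (hf _))
      linarith
  -- The number `β` is the radius of the coarsest scale with a light parent, or zero if there is
  -- none. The geometric series bounds all the light terms by `2 * β`.
  have hβ : ∀ k, ∃ β : ℝ, (∑ t ∈ Finset.range (L k + 1), if heavy t (par t (j k)) then 0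
      else R₀ / 2 ^ t) ≤ 2 * β ∧ (β = 0 ∨ ∃ t ≤ L k, β = R₀ / 2 ^ t ∧ ¬ heavy t (par t (j k))) := by
    intro k
    by_cases hex : ∃ t, t ≤ L k ∧ ¬ heavy t (par t (j k))
    · refine ⟨R₀ / 2 ^ Nat.find hex, ?_, .inr ⟨_, (Nat.find_spec hex).1, rfl,
        (Nat.find_spec hex).2⟩⟩
      refine le_trans ?_ (sum_range_div_two_pow_le hR.le (Nat.find hex) (L k + 1))
      rw [Finset.range_eq_Ico, ← Finset.sum_Ico_consecutive _ (Nat.zero_le (Nat.find hex))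
        (by have := (Nat.find_spec hex).1; omega)]
      rw [Finset.sum_eq_zero, zero_add]
      · refine Finset.sum_le_sum fun t _ => ?_
        split_ifs
        exacts [(hr t).le, le_rfl]
      · intro t ht
        have h1 : t < Nat.find hex := (Finset.mem_Ico.1 ht).2
        have h2 := Nat.find_min hex h1
        have h3 := (Nat.find_spec hex).1
        rw [if_pos]
        by_contra h4
        exact h2 ⟨by omega, h4⟩
    · push Not at hex
      refine ⟨0, ?_, .inl rfl⟩
      rw [Finset.sum_eq_zero]
      · simp
      · intro t ht
        rw [if_pos (hex t (by simpa [Nat.lt_succ_iff] using ht))]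
  choose β hβ1 hβ2 using hβ
  have hβ0 : ∀ k, 0 ≤ β k := by
    intro k
    rcases hβ2 k with h | ⟨t, -, h, -⟩ <;> rw [h]
    exact (hr t).le
  have main : ∑ k ∈ Finset.range n, β k ≤ ∑ s ∈ S, f s + con := by
    -- Clients connected at distance at least `β` pay for `β` by their connection. The others are
    -- grouped by the facility serving them, and each group is paid for by the opening cost of that
    -- facility.
    set A := (Finset.range n).filter fun k => dist (F (j k)) (F (φ k)) < β k with hA
    have h1 : ∑ k ∈ Finset.range n, β k ≤ ∑ k ∈ A, β k + con := by
      rw [← Finset.sum_filter_add_sum_filter_not (Finset.range n)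
        (fun k => dist (F (j k)) (F (φ k)) < β k)]
      refine add_le_add le_rfl ?_
      calc _ ≤ ∑ k ∈ (Finset.range n).filter (fun k => ¬ dist (F (j k)) (F (φ k)) < β k),
            dist (F (j k)) (F (φ k)) := Finset.sum_le_sum fun k hk => by
              simpa using (Finset.mem_filter.1 hk).2
        _ ≤ con := Finset.sum_le_sum_of_subset_of_nonneg (Finset.filter_subset _ _)
            fun _ _ _ => dist_nonneg
    have h2 : ∑ k ∈ A, β k ≤ ∑ s ∈ S, f s := by
      rw [← Finset.sum_fiberwise_of_maps_to (s := A) (t := S) (g := φ)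
        (fun k hk => hφ k (by simpa using (Finset.mem_filter.1 hk).1))]
      refine Finset.sum_le_sum fun s hs => ?_
      set B := A.filter fun k => φ k = s with hB
      rcases B.eq_empty_or_nonempty with he | hne
      · rw [he]; simpa using hf s
      -- The client with the largest `β` in the group decides: its light parent `c` is within two
      -- radii of `s`, so the cheapest facility near `c` costs at most `f s`. All clients of the
      -- group are counted in the ball of three radii around `c`. As `c` is light, the group pays
      -- less than that facility costs.
      obtain ⟨i, hi, hmax⟩ := B.exists_max_image β hne
      have hmem : ∀ k ∈ B, k < n ∧ dist (F (j k)) (F s) < β k := by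
        intro k hk
        simp only [hB, hA, Finset.mem_filter, Finset.mem_range] at hk
        exact ⟨hk.1.1, by rw [← hk.2]; exact hk.1.2⟩
      obtain ⟨hin, hid⟩ := hmem i hi
      rcases hβ2 i with h3 | ⟨t, htL, h3, hnh⟩
      · rw [h3] at hid; exact absurd hid (not_lt.2 dist_nonneg)
      set c := par t (j i) with hc
      have hcm : c < m := hN.par_lt _ _ (hj i hin)
      have hci : dist (F (j i)) (F c) ≤ R₀ / 2 ^ t := hN.par_dist _ _ (hj i hin)
      have hg : f (g t c) ≤ f s := by
        refine hN.g_min t c s hcm (hS s hs) ?_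
        have := dist_triangle_left (F c) (F s) (F (j i))
        linarith [hr t]
      have hcard : (B.card : ℝ) ≤ ballCount F R₀ n j L t c := by
        rw [ballCount]
        refine Nat.cast_le.2 (Finset.card_le_card fun k hk => ?_)
        obtain ⟨hkn, hkd⟩ := hmem k hk
        have hki := hmax k hk
        rw [Finset.mem_filter, Finset.mem_range]
        refine ⟨hkn, ?_, ?_⟩
        · rcases hβ2 k with h4 | ⟨t', htL', h4, -⟩
          · rw [h4] at hkd; exact absurd hkd (not_lt.2 dist_nonneg)
          -- Since `β k ≤ β i`, the scale of client `k` is at least as fine as `t`, so this client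
          -- is counted at scale `t`.
          · refine le_trans ?_ htL'
            by_contra hlt
            push Not at hlt
            rw [h3, h4] at hki
            have : R₀ / 2 ^ t < R₀ / 2 ^ t' :=
              div_lt_div_of_pos_left hR (by positivity) (pow_lt_pow_right₀ (by norm_num) hlt)
            linarith
        · have e1 := dist_triangle_left (F c) (F s) (F (j i))
          have e2 := dist_triangle_right (F c) (F (j k)) (F s)
          linarith
      have hlt : R₀ / 2 ^ t * ballCount F R₀ n j L t c < f (g t c) := by
        simpa [hheavy, Heavy] using hnh
      calc ∑ k ∈ B, β k ≤ ∑ _k ∈ B, R₀ / 2 ^ t := Finset.sum_le_sum fun k hk => h3 ▸ hmax k hk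
        _ = R₀ / 2 ^ t * B.card := by rw [Finset.sum_const, nsmul_eq_mul, mul_comm]
        _ ≤ R₀ / 2 ^ t * ballCount F R₀ n j L t c := by gcongr
        _ ≤ f s := by linarith
    linarith
  have hsum : ∑ k ∈ Finset.range n, payment R₀ Z par heavy (j k) (L k) ≤
      ∑ k ∈ Finset.range n, min (Z (j k)) (R₀ / 2 ^ L k) + 2 * ∑ k ∈ Finset.range n, β k := by
    rw [Finset.mul_sum, ← Finset.sum_add_distrib]
    exact Finset.sum_le_sum fun k _ => by unfold payment; linarith [hβ1 k]
  linarith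

end Approximation

end FacilityLocation

namespace FacilityLocation

set_option linter.unusedSectionVars false

open RAM

/-! Names of the arrays: first the tables computed by the preprocessing, then the dynamic data
structure, then scratch memory. -/

notation "aM" => (0 : ℕ)
notation "aReq" => (1 : ℕ)
notation "aT" => (2 : ℕ)
notation "aNet" => (3 : ℕ)
notation "aPar" => (4 : ℕ)
notation "aSt" => (5 : ℕ)
notation "aLst" => (6 : ℕ)
notation "aG" => (7 : ℕ)
notation "aBase" => (8 : ℕ)
notation "aCtr" => (9 : ℕ)
notation "aInn" => (10 : ℕ)
notation "aOut" => (11 : ℕ)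
notation "aScore" => (12 : ℕ)
notation "aFull" => (13 : ℕ)
notation "aBal" => (14 : ℕ)
notation "aCnt" => (15 : ℕ)
notation "aInd" => (16 : ℕ)
notation "aRef" => (17 : ℕ)
notation "aOpen" => (18 : ℕ)
notation "aPos" => (19 : ℕ)
notation "aLen" => (20 : ℕ)
notation "aN" => (21 : ℕ)
notation "aCli" => (22 : ℕ)
notation "aHid" => (23 : ℕ)
notation "aSlot" => (24 : ℕ)
notation "aFresh" => (25 : ℕ)
notation "vJ" => (30 : ℕ)
notation "vL" => (31 : ℕ)
notation "vInc" => (32 : ℕ)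
notation "vDec" => (33 : ℕ)
notation "vt" => (34 : ℕ)
notation "vRow" => (35 : ℕ)
notation "vSRow" => (36 : ℕ)
notation "vRowN" => (37 : ℕ)
notation "vSRowN" => (38 : ℕ)
notation "vk" => (39 : ℕ)
notation "vx" => (40 : ℕ)
notation "vg" => (41 : ℕ)
notation "vkN" => (42 : ℕ)
notation "vy" => (43 : ℕ)
notation "vok" => (44 : ℕ)
notation "vA" => (45 : ℕ)
notation "vs" => (46 : ℕ)
notation "vPtr" => (47 : ℕ)
notation "aMem" => (48 : ℕ)
notation "vq" => (49 : ℕ)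
notation "vNear" => (50 : ℕ)
notation "vFar" => (51 : ℕ)
notation "vPow" => (52 : ℕ)
notation "rF" => (0 : ℕ)
notation "rAns" => (1 : ℕ)
notation "rTop" => (2 : ℕ)
notation "rZ" => (3 : ℕ)
notation "rRad" => (4 : ℕ)
notation "rPay" => (5 : ℕ)
notation "rSnap" => (6 : ℕ)
notation "rr" => (10 : ℕ)
notation "rh" => (11 : ℕ)
notation "rMin" => (12 : ℕ)
notation "pFac" => (0 : ℕ)
notation "pReq" => (1 : ℕ)

-- Tables computed by the preprocessing.

infixr:60 " ;; " => Cmd.seq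

attribute [simp] wp_seq wp_nset wp_rset wp_skip wp_emit wp_ite write_same NExp.eval RExp.eval
  NExp.cost RExp.cost BExp.cost BExp.holds_nlt BExp.holds_rlt BExp.holds_not BExp.holds_and

attribute [simp] write_other

/-- The content of the memory that is fixed by the preprocessing. -/
structure Tables (V : Type*) where
  m : ℕ
  F : ℕ → V
  f : ℕ → ℝ
  top : ℝ
  T : ℕ
  base : ℕ
  net : ℕ → ℕ
  par : ℕ → ℕ
  st : ℕ → ℕ
  lst : ℕ → ℕ
  g : ℕ → ℕ
  Z : ℕ → ℝ
  ctr : ℕ → ℕ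
  inn : ℕ → ℕ
  out : ℕ → ℕ
  score : ℕ → ℕ
  rad : ℕ → ℝ
  full : ℕ

variable {V : Type*} [MetricSpace V]

/-- The tables are in the memory. -/
structure Tables.Loaded (S : Tables V) (σ : State V) : Prop where
  m : σ.nat aM 0 = S.m
  F : ∀ x < S.m, σ.pt pFac x = some (S.F x)
  f : σ.real rF = S.f
  top : σ.real rTop 0 = S.top
  T : σ.nat aT 0 = S.T
  base : σ.nat aBase 0 = S.base
  net : σ.nat aNet = S.net
  par : σ.nat aPar = S.par
  st : σ.nat aSt = S.st
  lst : σ.nat aLst = S.lst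
  g : σ.nat aG = S.g
  Z : σ.real rZ = S.Z
  ctr : σ.nat aCtr = S.ctr
  inn : σ.nat aInn = S.inn
  out : σ.nat aOut = S.out
  score : σ.nat aScore = S.score
  rad : σ.real rRad = S.rad
  full : σ.nat aFull 0 = S.full

/-- The number, real and point arrays that hold the tables. -/
def tableNat : List ℕ := [aM, aT, aNet, aPar, aSt, aLst, aG, aBase, aCtr, aInn, aOut, aScore, aFull]
def tableReal : List ℕ := [rF, rTop, rZ, rRad]

/-- `c` does not write the tables. -/
def KeepsTables (c : Cmd) : Prop :=
  (∀ a ∈ tableNat, a ∉ c.nw) ∧ (∀ a ∈ tableReal, a ∉ c.rw) ∧ pFac ∉ c.pw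

instance (c : Cmd) : Decidable (KeepsTables c) := by unfold KeepsTables; infer_instance

theorem Tables.Loaded.of_eq {S : Tables V} {σ σ' : State V} (h : S.Loaded σ)
    (hn : ∀ a ∈ tableNat, σ'.nat a = σ.nat a) (hr : ∀ a ∈ tableReal, σ'.real a = σ.real a)
    (hp : σ'.pt pFac = σ.pt pFac) : S.Loaded σ' := by
  simp only [tableNat, tableReal, List.forall_mem_cons, List.not_mem_nil] at hn hr
  obtain ⟨n0, n1, n2, n3, n4, n5, n6, n7, n8, n9, n10, n11, n12, -⟩ := hn
  obtain ⟨r0, r1, r2, r3, -⟩ := hr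
  exact ⟨by rw [n0, h.m], fun x hx => by rw [hp, h.F x hx], by rw [r0, h.f], by rw [r1, h.top],
    by rw [n1, h.T], by rw [n7, h.base], by rw [n2, h.net], by rw [n3, h.par], by rw [n4, h.st],
    by rw [n5, h.lst], by rw [n6, h.g], by rw [r2, h.Z], by rw [n8, h.ctr], by rw [n9, h.inn],
    by rw [n10, h.out], by rw [n11, h.score], by rw [r3, h.rad], by rw [n12, h.full]⟩

theorem Tables.Loaded.agree {S : Tables V} {σ σ' : State V} {c : Cmd} (h : S.Loaded σ)
    (ha : Agree c σ σ') (hc : KeepsTables c) : S.Loaded σ' :=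
  h.of_eq (fun a k => ha.nat a (hc.1 a k)) (fun a k => ha.real a (hc.2.1 a k)) (ha.pt _ hc.2.2)

/-! ### The list of open facilities -/

/-- Increase the reference count of the facility in `vg`. -/
def openFac : Cmd :=
  .nset aRef (nv vg) (.add (.cell aRef (nv vg)) (.lit 1)) ;;
  .ite (.nlt (.cell aRef (nv vg)) (.lit 2))
    (.nset aOpen (nv aLen) (nv vg) ;; .nset aPos (nv vg) (nv aLen) ;;
      nlet aLen (.add (nv aLen) (.lit 1))) .skip

/-- Decrease the reference count of the facility in `vg`. -/
def closeFac : Cmd :=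
  .nset aRef (nv vg) (.sub (.cell aRef (nv vg)) (.lit 1)) ;;
  .ite (.nlt (.cell aRef (nv vg)) (.lit 1))
    (nlet aLen (.sub (nv aLen) (.lit 1)) ;;
      .nset aOpen (.cell aPos (nv vg)) (.cell aOpen (nv aLen)) ;;
      .nset aPos (.cell aOpen (nv aLen)) (.cell aPos (nv vg))) .skip

/-- The open list enumerates the facilities with positive reference count. -/
structure OpenRep (ref : ℕ → ℕ) (σ : State V) : Prop where
  ref_eq : σ.nat aRef = ref
  of_lt : ∀ i < σ.nat aLen 0, 0 < ref (σ.nat aOpen i) ∧ σ.nat aPos (σ.nat aOpen i) = i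
  of_pos : ∀ x, 0 < ref x → σ.nat aPos x < σ.nat aLen 0 ∧ σ.nat aOpen (σ.nat aPos x) = x

theorem OpenRep.of_eq {ref : ℕ → ℕ} {σ σ' : State V} (h : OpenRep ref σ)
    (hn : ∀ a ∈ [aRef, aOpen, aPos, aLen], σ'.nat a = σ.nat a) : OpenRep ref σ' := by
  simp only [List.forall_mem_cons, List.not_mem_nil] at hn
  obtain ⟨h0, h1, h2, h3, -⟩ := hn
  exact ⟨h0.trans h.ref_eq, by rw [h1, h2, h3]; exact h.of_lt, by rw [h1, h2, h3]; exact h.of_pos⟩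

/-- The facility joins the end of the list exactly when its count becomes 1, which is tested as
being less than 2 after the increment. -/
theorem openFac_spec {ref : ℕ → ℕ} {σ : State V} (h : OpenRep ref σ) :
    WP openFac σ fun t σ' => t ≤ 30 ∧
      OpenRep (Function.update ref (σ.nat vg 0) (ref (σ.nat vg 0) + 1)) σ' := by
  obtain ⟨h1, h2, h3⟩ := h
  set x := σ.nat vg 0 with hx
  unfold openFac
  simp [h1, ← hx]
  split_ifs with h0
  · refine ⟨?_, ?_, ?_⟩
    · simp [h1, h0]
    · intro i hi
      simp at hi ⊢
      simp only [Function.update_apply]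
      have hxi : ∀ i < σ.nat aLen 0, σ.nat aOpen i ≠ x := by
        intro i hi he
        have := (h2 i hi).1
        rw [he, h0] at this; omega
      by_cases hi' : i = σ.nat aLen 0
      · subst hi'; simp
      · have hi2 : i < σ.nat aLen 0 := by omega
        have := hxi i hi2
        simp [hi', this]
        exact h2 i hi2
    · intro y hy
      simp only [Function.update_apply] at hy
      by_cases hyx : y = x
      · subst hyx; simp
      · rw [if_neg hyx] at hy
        have := h3 y hy
        simp [hyx, Function.update_apply]
        rw [if_neg (by omega)]
        exact ⟨by omega, this.2⟩
  · refine ⟨?_, ?_, ?_⟩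
    · simp [h1]
    · intro i hi
      simp at hi ⊢
      have := h2 i hi
      simp only [Function.update_apply]
      split_ifs with h5 <;> simp_all
    · intro y hy
      simp only [Function.update_apply] at hy
      simp
      apply h3
      split_ifs at hy with h5
      · subst h5; omega
      · exact hy

/-- When the count drops to zero, the last entry of the list moves to the vacated position. If the
facility itself is last, the two assignments write back the old values and the shortened length
alone removes it. -/
theorem closeFac_spec {ref : ℕ → ℕ} {σ : State V} (h : OpenRep ref σ)
    (hpos : 0 < ref (σ.nat vg 0)) :
    WP closeFac σ fun t σ' => t ≤ 40 ∧
      OpenRep (Function.update ref (σ.nat vg 0) (ref (σ.nat vg 0) - 1)) σ' := by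
  obtain ⟨h1, h2, h3⟩ := h
  set x := σ.nat vg 0 with hx
  unfold closeFac
  simp [h1, ← hx]
  obtain ⟨hp1, hp2⟩ := h3 x hpos
  split_ifs with h0
  · refine ⟨?_, ?_, ?_⟩
    · simp [h1]
    · intro i hi
      simp [Function.update_apply] at hi ⊢
      have hlast := h2 (σ.nat aLen 0 - 1) (by omega)
      have hi2 := h2 i (by omega)
      by_cases e1 : i = σ.nat aPos x
      · rw [if_pos e1]
        have e2 : σ.nat aOpen (σ.nat aLen 0 - 1) ≠ x := by
          intro he
          rw [he] at hlast
          omega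
        simp [e2, e1, hlast]
      · rw [if_neg e1]
        have e2 : σ.nat aOpen i ≠ x := by intro he; rw [he] at hi2; omega
        have e3 : σ.nat aOpen i ≠ σ.nat aOpen (σ.nat aLen 0 - 1) := by
          intro he; rw [he, hlast.2] at hi2; omega
        have e4 : σ.nat aLen 0 - 1 ≠ i := by omega
        split_ifs <;> simp_all
    · intro y hy
      simp only [Function.update_apply] at hy
      by_cases hyx : y = x
      · rw [if_pos hyx] at hy; omega
      rw [if_neg hyx] at hy
      obtain ⟨h5, h6⟩ := h3 y hy
      have h7 : σ.nat aPos y ≠ σ.nat aPos x := by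
        intro he; rw [he, hp2] at h6; exact hyx h6.symm
      simp [Function.update_apply]
      by_cases h8 : y = σ.nat aOpen (σ.nat aLen 0 - 1)
      · have h9 : σ.nat aPos x ≠ σ.nat aLen 0 - 1 := by
          intro he; rw [he] at hp2; exact hyx (h8.trans hp2)
        rw [if_pos h8, if_pos fun h => absurd h8 h]
        exact ⟨by omega, h8.symm⟩
      · have h9 : σ.nat aPos y ≠ σ.nat aLen 0 - 1 := by
          intro he; rw [he] at h6; exact h8 h6.symm
        rw [if_neg h8, if_neg fun h => h7 (h h8)]
        exact ⟨by omega, h6⟩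
  · refine ⟨?_, ?_, ?_⟩
    · simp [h1]
    · intro i hi
      simp at hi ⊢
      have := h2 i hi
      simp only [Function.update_apply]
      split_ifs with h5 <;> (simp_all; try omega)
    · intro y hy
      simp only [Function.update_apply] at hy
      simp
      apply h3
      split_ifs at hy with h5
      · subst h5; omega
      · exact hy

/-! ### Sweeping over the scales -/

namespace Tables

/-- The position of `x` at scale `t` in the tables; the scales beyond `T` share one row. -/
def idx (S : Tables V) (t x : ℕ) : ℕ := min t S.T * S.m + x

def IsNet (S : Tables V) (t x : ℕ) : Prop := S.net (S.idx t x) = 1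

def parent (S : Tables V) (t x : ℕ) : ℕ := S.par (S.idx t x)

def cheap (S : Tables V) (t x : ℕ) : ℕ := S.g (S.idx t x)

/-- The properties of the tables on which the updates rely. -/
structure Valid (S : Tables V) (ℓ : ℕ) : Prop where
  m_pos : 0 < S.m
  top_pos : 0 < S.top
  f_nonneg : ∀ x, 0 ≤ S.f x
  f_le : ∀ x, S.f x ≤ S.top
  dist_le : ∀ x y, dist (S.F x) (S.F y) ≤ S.top
  sys : NetSystem S.m S.F S.f S.top S.IsNet S.parent S.cheap
  free : FreeDist S.m S.F S.f S.top S.Z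
  st_le : ∀ t x, x < S.m → S.st (S.idx t x) ≤ S.st (S.idx t x + 1)
  st_le_add : ∀ t x, x < S.m → S.st (S.idx t x + 1) ≤ S.st (S.idx t x) + ℓ
  lst_lt : ∀ t x k, x < S.m → S.st (S.idx t x) ≤ k → k < S.st (S.idx t x + 1) → S.lst k < S.m
  lst_net : ∀ t x k, x < S.m → S.st (S.idx t x) ≤ k → k < S.st (S.idx t x + 1) →
    S.IsNet t (S.lst k)
  lst_inj : ∀ t x k k', x < S.m → S.st (S.idx t x) ≤ k → k < S.st (S.idx t x + 1) →
    S.st (S.idx t x) ≤ k' → k' < S.st (S.idx t x + 1) → S.lst k = S.lst k' → k = k'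
  lst_complete : ∀ t x y, x < S.m → y < S.m → S.IsNet t y →
    dist (S.F x) (S.F y) ≤ 12 * (S.top / 2 ^ t) →
    ∃ k, S.st (S.idx t x) ≤ k ∧ k < S.st (S.idx t x + 1) ∧ S.lst k = y

/-- The control variables of `levels` at scale `t`. -/
structure AtLevel (S : Tables V) (t : ℕ) (σ : State V) : Prop where
  t_eq : σ.nat vt 0 = t
  row : σ.nat vRow 0 = t * S.m
  srow : σ.nat vSRow 0 = min t S.T * S.m
  rowN : σ.nat vRowN 0 = (t + 1) * S.m
  srowN : σ.nat vSRowN 0 = min (t + 1) S.T * S.m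
  rad : σ.real rr 0 = S.top / 2 ^ t
  radN : σ.real rh 0 = S.top / 2 ^ (t + 1)

end Tables

/-- Run `body` for all scales `0, …, vL`. -/
def levels (body : Cmd) : Cmd :=
  nlet vSRow (.lit 0) ;; nlet vRow (.lit 0) ;; rlet rr (rv rTop) ;;
  forLoop vt (.lit 0) (.add (nv vL) (.lit 1))
    (.ite (.nlt (nv vt) (nv aT)) (nlet vSRowN (.add (nv vSRow) (nv aM)))
        (nlet vSRowN (nv vSRow)) ;;
      nlet vRowN (.add (nv vRow) (nv aM)) ;; rlet rh (.div (rv rr) (.lit 2)) ;;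
      body ;;
      nlet vSRow (nv vSRowN) ;; nlet vRow (nv vRowN) ;; rlet rr (rv rh))

/-- Number cells cannot be multiplied, so the row offsets `t * m` and `min t T * m` are maintained
by addition. `Inv` must be stable under the writes of `levels .skip`, that is, under the control
variables alone. -/
theorem levels_spec {S : Tables V} {σ : State V} {body : Cmd} {Q : ℕ → State V → Prop}
    (hS : S.Loaded σ) (l B : ℕ) (hl : σ.nat vL 0 = l) (hk : KeepsTables body)
    (hn : ∀ a ∈ [vL, vt, vRow, vSRow, vRowN, vSRowN], a ∉ body.nw)
    (hr : ∀ a ∈ [rr, rh], a ∉ body.rw)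
    (Inv : ℕ → State V → Prop)
    (hInv : ∀ t σ σ', Agree (levels .skip) σ σ' → Inv t σ → Inv t σ')
    (h0 : Inv 0 σ)
    (step : ∀ t σ', t ≤ l → Agree (levels body) σ σ' → S.Loaded σ' → S.AtLevel t σ' → Inv t σ' →
      WP body σ' fun τ σ'' => τ ≤ B ∧ Inv (t + 1) σ'')
    (post : ∀ τ σ', τ ≤ (l + 1) * (B + 60) + 60 → Agree (levels body) σ σ' → S.Loaded σ' →
      σ'.real rr 0 = S.top / 2 ^ (l + 1) → Inv (l + 1) σ' → Q τ σ') :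
    WP (levels body) σ Q := by
  have hkl : KeepsTables (levels body) := by
    obtain ⟨h1, h2, h3⟩ := hk
    refine ⟨?_, ?_, ?_⟩
    · intro a ha
      have := h1 a ha
      simp only [tableNat, List.mem_cons, List.not_mem_nil, or_false] at ha
      simp only [levels, forLoop, Cmd.nw, List.mem_append, List.mem_cons, List.not_mem_nil]
      rcases ha with rfl | rfl | rfl | rfl | rfl | rfl | rfl | rfl | rfl | rfl | rfl | rfl | rfl <;>
        simpa using this
    · intro a ha
      have := h2 a ha
      simp only [tableReal, List.mem_cons, List.not_mem_nil, or_false] at ha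
      simp only [levels, forLoop, Cmd.rw, List.mem_append, List.mem_cons, List.not_mem_nil]
      rcases ha with rfl | rfl | rfl | rfl <;> simpa using this
    · simpa [levels, forLoop, Cmd.pw] using h3
  simp only [List.forall_mem_cons, List.not_mem_nil] at hn hr
  obtain ⟨n1, n2, n3, n4, n5, n6, -⟩ := hn
  obtain ⟨r1, r2, -⟩ := hr
  have hvL : vL ∉ (levels body).nw := by
    simp [levels, forLoop, Cmd.nw, n1]
  unfold levels
  simp only [wp_seq, wp_nset, wp_rset]
  set σ₀ : State V := { σ with
    nat := write (write σ.nat vSRow 0 0) vRow 0 0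
    real := write σ.real rr 0 (σ.real rTop 0) } with hσ₀
  have hA0 : Agree (levels body) σ σ₀ := by
    refine ⟨fun a ha => ?_, fun a ha => ?_, fun a _ => rfl⟩
    · simp only [levels, Cmd.nw, List.mem_append, List.mem_singleton, not_or] at ha
      simp [hσ₀, write_other, ha]
    · simp only [levels, Cmd.rw, List.mem_append, List.mem_singleton, not_or] at ha
      simp [hσ₀, write_other, ha]
  have hA0s : Agree (levels .skip) σ σ₀ := by
    refine ⟨fun a ha => ?_, fun a ha => ?_, fun a _ => rfl⟩
    · simp only [levels, Cmd.nw, List.mem_append, List.mem_singleton, not_or] at ha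
      simp [hσ₀, write_other, ha]
    · simp only [levels, Cmd.rw, List.mem_append, List.mem_singleton, not_or] at ha
      simp [hσ₀, write_other, ha]
  have hsub : ∀ σ', Agree (forLoop vt (.lit 0) (.add (nv vL) (.lit 1))
    (.ite (.nlt (nv vt) (nv aT)) (nlet vSRowN (.add (nv vSRow) (nv aM)))
        (nlet vSRowN (nv vSRow)) ;;
      nlet vRowN (.add (nv vRow) (nv aM)) ;; rlet rh (.div (rv rr) (.lit 2)) ;;
      body ;;
      nlet vSRow (nv vSRowN) ;; nlet vRow (nv vRowN) ;; rlet rr (rv rh))) σ₀ σ' →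
      Agree (levels body) σ σ' := by
    intro σ' h
    refine hA0.trans (h.mono ?_ ?_ ?_)
    · simp only [levels, Cmd.nw]; intro a; simp only [List.mem_append]; tauto
    · simp only [levels, Cmd.rw]; intro a; simp only [List.mem_append]; tauto
    · simp only [levels, Cmd.pw]; intro a; simp only [List.mem_append]; tauto
  refine WP.forLoop_bounded (σ := σ₀) 0 (l + 1) (B + 40) (Nat.zero_le _) ?_ rfl ?_
    (fun t σ' => σ'.nat vRow 0 = t * S.m ∧ σ'.nat vSRow 0 = min t S.T * S.m ∧
      σ'.real rr 0 = S.top / 2 ^ t ∧ Inv t σ') ?_ ?_ ?_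
  · simp [Cmd.nw, n2]
  · intro σ' h
    simp [(hsub σ' h).nat vL hvL, hl]
  · refine ⟨by simp [State.nlet, hσ₀], by simp [State.nlet, hσ₀], by simp [State.nlet, hσ₀, hS.top],
      hInv _ _ _ (hA0s.nlet vt 0 ?_) h0⟩
    simp [levels, forLoop, Cmd.nw]
  · rintro t σ' - htl hvt hag ⟨hrow, hsrow, hrad, hI⟩
    have hag' := hsub σ' hag
    have hS' := hS.agree hag' hkl
    rw [wp_seq]
    -- The rest of the loop body after the case distinction, verified once for both branches.
    have key : ∀ v, v = min (t + 1) S.T * S.m → ∀ c ≤ 12,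
        WP (nlet vRowN (.add (nv vRow) (nv aM)) ;; rlet rh (.div (rv rr) (.lit 2)) ;;
          body ;; nlet vSRow (nv vSRowN) ;; nlet vRow (nv vRowN) ;; rlet rr (rv rh))
          { σ' with nat := write σ'.nat vSRowN 0 v } fun τ σ'' => c + τ ≤ B + 40 ∧
            ((σ''.nlet vt (t + 1)).nat vRow 0 = (t + 1) * S.m ∧
            (σ''.nlet vt (t + 1)).nat vSRow 0 = min (t + 1) S.T * S.m ∧
            (σ''.nlet vt (t + 1)).real rr 0 = S.top / 2 ^ (t + 1) ∧
            Inv (t + 1) (σ''.nlet vt (t + 1))) := by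
      intro v hv c hc
      simp only [wp_seq, wp_nset, wp_rset]
      simp only [NExp.eval, RExp.eval]
      set σ₁ : State V := { σ' with
        nat := write (write σ'.nat vSRowN 0 v) vRowN 0
          (write σ'.nat vSRowN 0 v vRow 0 + write σ'.nat vSRowN 0 v aM 0)
        real := write σ'.real rh 0 (σ'.real rr 0 / (2 : ℕ)) } with hσ₁
      have hA1 : Agree (levels body) σ' σ₁ := by
        refine ⟨fun a ha => ?_, fun a ha => ?_, fun a _ => rfl⟩
        · simp only [levels, forLoop, Cmd.nw, List.mem_append, List.mem_singleton, not_or] at ha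
          simp [hσ₁, write_other, ha]
        · simp only [levels, forLoop, Cmd.rw, List.mem_append, List.mem_singleton, not_or] at ha
          simp [hσ₁, write_other, ha]
      have hA1s : Agree (levels .skip) σ' σ₁ := by
        refine ⟨fun a ha => ?_, fun a ha => ?_, fun a _ => rfl⟩
        · simp only [levels, forLoop, Cmd.nw, List.mem_append, List.mem_singleton, not_or] at ha
          simp [hσ₁, write_other, ha]
        · simp only [levels, forLoop, Cmd.rw, List.mem_append, List.mem_singleton, not_or] at ha
          simp [hσ₁, write_other, ha]
      have hat : S.AtLevel t σ₁ := by
        refine ⟨by simp [hσ₁, hvt], by simp [hσ₁, hrow], by simp [hσ₁, hsrow], ?_, ?_,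
          by simp [hσ₁, hrad], ?_⟩
        · simp [hσ₁, hrow, hS'.m]; ring
        · simp [hσ₁, hv]
        · simp [hσ₁, hrad, pow_succ]; field_simp
      refine (step t σ₁ (by omega) (hag'.trans hA1) (hS'.agree hA1 hkl) hat
        (hInv _ _ _ hA1s hI)).mono ?_
      rintro τ σ₂ hag2 ⟨hτ, hI2⟩
      have e1 : σ₂.nat vRowN 0 = (t + 1) * S.m := by rw [hag2.nat _ n5, hat.rowN]
      have e2 : σ₂.nat vSRowN 0 = min (t + 1) S.T * S.m := by rw [hag2.nat _ n6, hat.srowN]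
      have e3 : σ₂.real rh 0 = S.top / 2 ^ (t + 1) := by rw [hag2.real _ r2, hat.radN]
      refine ⟨by simp only [NExp.cost, RExp.cost]; omega, by simp [State.nlet, e1],
        by simp [State.nlet, e2], by simp [State.nlet, e3], ?_⟩
      refine hInv _ σ₂ _ ?_ hI2
      refine ⟨fun a ha => ?_, fun a ha => ?_, fun a _ => rfl⟩
      · simp only [levels, forLoop, Cmd.nw, List.mem_append, List.mem_singleton, not_or] at ha
        simp [State.nlet, write_other, ha]
      · simp only [levels, forLoop, Cmd.rw, List.mem_append, List.mem_singleton, not_or] at ha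
        simp [State.nlet, write_other, ha]
    refine WP.ite (fun hb => ?_) (fun hb => ?_)
    · rw [wp_nset]
      refine (key _ ?_ _ ?_).mono fun _ _ _ h => h
      · have : t < S.T := by simpa [hvt, hS'.T] using hb
        simp only [NExp.eval, hsrow, hS'.m]
        rw [min_eq_left this.le, min_eq_left this]; ring
      · simp
    · rw [wp_nset]
      refine (key _ ?_ _ ?_).mono fun _ _ _ h => h
      · have : S.T ≤ t := by simpa [hvt, hS'.T] using hb
        simp only [NExp.eval, hsrow]
        rw [min_eq_right this, min_eq_right (by omega)]
      · simp
  · rintro τ σ' hτ hag - ⟨-, -, hrad, hI⟩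
    have hag' := hsub σ' hag
    refine post _ σ' ?_ hag' (hS.agree hag' hkl) hrad hI
    simp at hτ ⊢
    have : (l + 1) * (B + 40 + 13) ≤ (l + 1) * (B + 60) := Nat.mul_le_mul_left _ (by omega)
    omega

/-! ### Updating the counts -/

/-- The test that the net point in `v` is not heavy. -/
def light (row srow rad v : ℕ) : BExp :=
  .rlt (.mul (rv rad) (.ofNat (.cell aBal (.add (nv row) (nv v)))))
    (.cell rF (.cell aG (.add (nv srow) (nv v))))

/-- The first and one past the last position of the list of the net points near the facility in
`v`. -/
def listLo (srow v : ℕ) : NExp := .cell aSt (.add (nv srow) (nv v))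
def listHi (srow v : ℕ) : NExp := .cell aSt (.add (.add (nv srow) (nv v)) (.lit 1))

/-- Change the counts of the net points near the facility in `vJ` at one scale. -/
def countBody : Cmd :=
  forLoop vk (listLo vSRow vJ) (listHi vSRow vJ)
    (nlet vx (.cell aLst (nv vk)) ;;
      .ite (.rlt (.mul (.lit 3) (rv rr)) (.dist pFac (nv vx) pFac (nv vJ))) .skip
        (.ite (light vRow vSRow rr vx)
            (rlet rPay (.sub (rv rPay)
              (.mul (.ofNat (.cell aCnt (.add (nv vRow) (nv vx)))) (rv rr)))) .skip ;;
          .nset aBal (.add (nv vRow) (nv vx))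
            (.sub (.add (.cell aBal (.add (nv vRow) (nv vx))) (nv vInc)) (nv vDec)) ;;
          .ite (.and (.not (.nlt (nv vx) (.cell aPar (.add (nv vSRow) (nv vJ)))))
              (.not (.nlt (.cell aPar (.add (nv vSRow) (nv vJ))) (nv vx))))
            (.nset aCnt (.add (nv vRow) (nv vx))
              (.sub (.add (.cell aCnt (.add (nv vRow) (nv vx))) (nv vInc)) (nv vDec))) .skip ;;
          .ite (light vRow vSRow rr vx)
            (rlet rPay (.add (rv rPay)
              (.mul (.ofNat (.cell aCnt (.add (nv vRow) (nv vx)))) (rv rr)))) .skip))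

/-- Add `inc` and subtract `dec` in the cells satisfying `P`. -/
noncomputable def shift (inc dec : ℕ) (P : ℕ → Prop) (A : ℕ → ℕ) : ℕ → ℕ :=
  open Classical in fun i => if P i then A i + inc - dec else A i

theorem shift_of_not {inc dec : ℕ} {P : ℕ → Prop} {A : ℕ → ℕ} {i : ℕ} (h : ¬ P i) :
    shift inc dec P A i = A i := by simp [shift, h]

theorem shift_of {inc dec : ℕ} {P : ℕ → Prop} {A : ℕ → ℕ} {i : ℕ} (h : P i) :
    shift inc dec P A i = A i + inc - dec := by simp [shift, h]

theorem shift_shift {inc dec : ℕ} {P P' : ℕ → Prop} {A : ℕ → ℕ} (h : ∀ i, P i → ¬ P' i) :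
    shift inc dec P' (shift inc dec P A) = shift inc dec (fun i => P i ∨ P' i) A := by
  funext i
  have := h i
  simp only [shift]
  by_cases h1 : P i <;> by_cases h2 : P' i <;> simp_all

theorem update_shift {inc dec : ℕ} {P : ℕ → Prop} {A : ℕ → ℕ} {i : ℕ} (h : ¬ P i) :
    Function.update (shift inc dec P A) i (shift inc dec P A i + inc - dec) =
      shift inc dec (fun k => P k ∨ k = i) A := by
  funext k
  simp only [shift, Function.update_apply]
  by_cases h1 : k = i
  · subst h1; simp [h]
  · by_cases h2 : P k <;> simp [h1, h2]

theorem shift_congr {inc dec : ℕ} {P P' : ℕ → Prop} {A : ℕ → ℕ} (h : ∀ i, P i ↔ P' i) :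
    shift inc dec P A = shift inc dec P' A := by
  rw [show P = P' from funext fun i => propext (h i)]

/-- Whether a net point is heavy, in terms of the flat array of counts. -/
def Tables.HeavyAt (S : Tables V) (bal : ℕ → ℕ) (t x : ℕ) : Prop :=
  Heavy S.f S.top S.cheap (fun t x => bal (t * S.m + x)) t x

open Classical in
/-- The contribution of a cell to the estimate of the cost. -/
noncomputable def Tables.cellPay (S : Tables V) (bal cnt : ℕ → ℕ) (t x : ℕ) : ℝ :=
  if S.HeavyAt bal t x then 0 else cnt (t * S.m + x) * (S.top / 2 ^ t)

noncomputable def Tables.rowPay (S : Tables V) (bal cnt : ℕ → ℕ) (t : ℕ) : ℝ :=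
  ∑ x ∈ Finset.range S.m, S.cellPay bal cnt t x

theorem Tables.cellPay_congr (S : Tables V) {bal cnt bal' cnt' : ℕ → ℕ} {t x : ℕ}
    (h : bal' (t * S.m + x) = bal (t * S.m + x)) (h' : cnt' (t * S.m + x) = cnt (t * S.m + x)) :
    S.cellPay bal' cnt' t x = S.cellPay bal cnt t x := by
  unfold cellPay
  rw [h', show S.HeavyAt bal' t x = S.HeavyAt bal t x by simp [HeavyAt, Heavy, h]]

theorem Tables.rowPay_sub (S : Tables V) {bal cnt bal' cnt' : ℕ → ℕ} {t x : ℕ} (hx : x < S.m)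
    (h : ∀ i, i ≠ t * S.m + x → bal' i = bal i) (h' : ∀ i, i ≠ t * S.m + x → cnt' i = cnt i) :
    S.rowPay bal' cnt' t - S.rowPay bal cnt t = S.cellPay bal' cnt' t x - S.cellPay bal cnt t x := by
  rw [rowPay, rowPay, ← Finset.sum_sub_distrib]
  refine Finset.sum_eq_single x (fun y _ hy => ?_) (fun hx' => absurd (Finset.mem_range.2 hx) hx')
  rw [S.cellPay_congr (h _ (by omega)) (h' _ (by omega)), sub_self]

theorem holds_light {S : Tables V} {σ : State V} (hS : S.Loaded σ) {row srow rad v t x : ℕ}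
    (h1 : σ.nat row 0 = t * S.m) (h2 : σ.nat srow 0 = min t S.T * S.m)
    (h3 : σ.real rad 0 = S.top / 2 ^ t) (h4 : σ.nat v 0 = x) :
    (light row srow rad v).Holds σ ↔ ¬ S.HeavyAt (σ.nat aBal) t x := by
  simp [light, h1, h2, h3, h4, hS.f, hS.g, Tables.HeavyAt, Heavy, Tables.cheap, Tables.idx]

theorem ptDist_some (x y : V) : ptDist (some x) (some y) = dist x y := rfl

/-- The state after writing a number or a real. -/
abbrev setNat (σ : State V) (a i x : ℕ) : State V := { σ with nat := write σ.nat a i x }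

noncomputable abbrev setReal (σ : State V) (a i : ℕ) (x : ℝ) : State V :=
  { σ with real := write σ.real a i x }

theorem write_self {α : Type*} (A : ℕ → ℕ → α) (a i : ℕ) : write A a i (A a i) = A := by
  simp [write]

/-- Subtracting the contribution of a cell before its counts change, and adding the new one
afterwards, keeps the stored estimate right without summing over the row. For a heavy point nothing
is done, which agrees with subtracting a contribution of zero. -/
theorem wp_subPay {S : Tables V} {σ : State V} (hS : S.Loaded σ) {t x : ℕ}
    (h1 : σ.nat vRow 0 = t * S.m) (h2 : σ.nat vSRow 0 = min t S.T * S.m)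
    (h3 : σ.real rr 0 = S.top / 2 ^ t) (h4 : σ.nat vx 0 = x) :
    WP (.ite (light vRow vSRow rr vx) (rlet rPay (.sub (rv rPay)
      (.mul (.ofNat (.cell aCnt (.add (nv vRow) (nv vx)))) (rv rr)))) .skip) σ fun τ σ' => τ ≤ 40 ∧
      σ' = setReal σ rPay 0 (σ.real rPay 0 - S.cellPay (σ.nat aBal) (σ.nat aCnt) t x) := by
  have hl := holds_light hS h1 h2 h3 h4
  refine WP.ite (fun hb => ?_) (fun hb => ?_)
  · rw [hl] at hb
    simp [light, Tables.cellPay, hb, h1, h3, h4]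
  · rw [hl, not_not] at hb
    simp [light, Tables.cellPay, hb, write_self, setReal]

theorem wp_addPay {S : Tables V} {σ : State V} (hS : S.Loaded σ) {t x : ℕ}
    (h1 : σ.nat vRow 0 = t * S.m) (h2 : σ.nat vSRow 0 = min t S.T * S.m)
    (h3 : σ.real rr 0 = S.top / 2 ^ t) (h4 : σ.nat vx 0 = x) :
    WP (.ite (light vRow vSRow rr vx) (rlet rPay (.add (rv rPay)
      (.mul (.ofNat (.cell aCnt (.add (nv vRow) (nv vx)))) (rv rr)))) .skip) σ fun τ σ' => τ ≤ 40 ∧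
      σ' = setReal σ rPay 0 (σ.real rPay 0 + S.cellPay (σ.nat aBal) (σ.nat aCnt) t x) := by
  have hl := holds_light hS h1 h2 h3 h4
  refine WP.ite (fun hb => ?_) (fun hb => ?_)
  · rw [hl] at hb
    simp [light, Tables.cellPay, hb, h1, h3, h4]
  · rw [hl, not_not] at hb
    simp [light, Tables.cellPay, hb, write_self, setReal]

/-- Equality with the parent is tested by two negated comparisons. If it fails, the conclusion
describes a write of the old value, so both cases have the same form. -/
theorem wp_updateCnt {S : Tables V} {σ : State V} (hS : S.Loaded σ) {t x j inc dec : ℕ}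
    (h1 : σ.nat vRow 0 = t * S.m) (h2 : σ.nat vSRow 0 = min t S.T * S.m) (h4 : σ.nat vx 0 = x)
    (h5 : σ.nat vJ 0 = j) (h6 : σ.nat vInc 0 = inc) (h7 : σ.nat vDec 0 = dec) :
    WP (.ite (.and (.not (.nlt (nv vx) (.cell aPar (.add (nv vSRow) (nv vJ)))))
              (.not (.nlt (.cell aPar (.add (nv vSRow) (nv vJ))) (nv vx))))
            (.nset aCnt (.add (nv vRow) (nv vx))
              (.sub (.add (.cell aCnt (.add (nv vRow) (nv vx))) (nv vInc)) (nv vDec))) .skip)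
      σ fun τ σ' => τ ≤ 40 ∧
      σ' = setNat σ aCnt (t * S.m + x)
        (if x = S.parent t j then σ.nat aCnt (t * S.m + x) + inc - dec
          else σ.nat aCnt (t * S.m + x)) := by
  have he : (BExp.and (.not (.nlt (nv vx) (.cell aPar (.add (nv vSRow) (nv vJ)))))
      (.not (.nlt (.cell aPar (.add (nv vSRow) (nv vJ))) (nv vx)))).Holds σ ↔
      x = S.parent t j := by
    simp [h2, h4, h5, hS.par, Tables.parent, Tables.idx, le_antisymm_iff, and_comm]
  refine WP.ite (fun hb => ?_) (fun hb => ?_)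
  · rw [he] at hb
    simp [← hb, h1, h4, h6, h7]
  · rw [he] at hb
    simp [hb, write_self, setNat]

/-- The list of radius 12 contains all net points within three radii and also the parent, which is
within one. The difference between `rPay` and the sum over the row is invariant, because every
visited cell updates both by the same amount. -/
theorem countBody_spec {S : Tables V} {ℓ : ℕ} (hV : S.Valid ℓ) {σ : State V} (hS : S.Loaded σ)
    {t j inc dec : ℕ} (hat : S.AtLevel t σ) (hj : σ.nat vJ 0 = j) (hjm : j < S.m)
    (hinc : σ.nat vInc 0 = inc) (hdec : σ.nat vDec 0 = dec) :
    WP countBody σ fun τ σ' => τ ≤ ℓ * 200 + 50 ∧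
      σ'.nat aBal = shift inc dec (fun i => ∃ x < S.m, i = t * S.m + x ∧ S.IsNet t x ∧
        dist (S.F x) (S.F j) ≤ 3 * (S.top / 2 ^ t)) (σ.nat aBal) ∧
      σ'.nat aCnt = shift inc dec (fun i => i = t * S.m + S.parent t j) (σ.nat aCnt) ∧
      σ'.real rPay 0 - S.rowPay (σ'.nat aBal) (σ'.nat aCnt) t =
        σ.real rPay 0 - S.rowPay (σ.nat aBal) (σ.nat aCnt) t := by
  have hr : 0 < S.top / 2 ^ t := by have := hV.top_pos; positivity
  have hkt : KeepsTables countBody := by decide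
  set a := S.st (S.idx t j) with ha
  set b := S.st (S.idx t j + 1) with hb
  -- The cells changed before the list pointer reaches position `k`; `P'` is its restriction to the
  -- cell of the parent.
  set P : ℕ → ℕ → Prop := fun k i => ∃ k', a ≤ k' ∧ k' < k ∧ i = t * S.m + S.lst k' ∧
    dist (S.F (S.lst k')) (S.F j) ≤ 3 * (S.top / 2 ^ t) with hP
  set P' : ℕ → ℕ → Prop := fun k i => P k i ∧ i = t * S.m + S.parent t j with hP'
  unfold countBody
  refine WP.forLoop_bounded a b 180 (hV.st_le t j hjm) (by decide) ?_ ?_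
    (fun k σ' => σ'.nat aBal = shift inc dec (P k) (σ.nat aBal) ∧
      σ'.nat aCnt = shift inc dec (P' k) (σ.nat aCnt) ∧
      σ'.real rPay 0 - S.rowPay (σ'.nat aBal) (σ'.nat aCnt) t =
        σ.real rPay 0 - S.rowPay (σ.nat aBal) (σ.nat aCnt) t) ?_ ?_ ?_
  · simp [listLo, hS.st, hat.srow, hj, ha, Tables.idx]
  · intro σ' hag
    have h1 : σ'.nat aSt = σ.nat aSt := hag.nat _ (by decide)
    have h2 : σ'.nat vSRow = σ.nat vSRow := hag.nat _ (by decide)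
    have h3 : σ'.nat vJ = σ.nat vJ := hag.nat _ (by decide)
    simp [listHi, h1, h2, h3, hS.st, hat.srow, hj, hb, Tables.idx]
  · refine ⟨?_, ?_, ?_⟩
    · funext i; simp [State.nlet, shift, hP]; intro k _ h; omega
    · funext i; simp [State.nlet, shift, hP', hP]; intro k _ h; omega
    · simp [State.nlet]
  · rintro k σ' hak hkb hk hag ⟨hbal, hcnt, hpay⟩
    have hS' : S.Loaded σ' := hS.agree hag (by decide)
    set x := S.lst k with hx
    have hxm : x < S.m := hV.lst_lt t j k hjm hak hkb
    have hrow : σ'.nat vRow 0 = t * S.m := (hag.nat vRow (by decide)) ▸ hat.row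
    have hsrow : σ'.nat vSRow 0 = min t S.T * S.m := (hag.nat vSRow (by decide)) ▸ hat.srow
    have hrad : σ'.real rr 0 = S.top / 2 ^ t := (hag.real rr (by decide)) ▸ hat.rad
    have hj' : σ'.nat vJ 0 = j := (hag.nat vJ (by decide)) ▸ hj
    have hinc' : σ'.nat vInc 0 = inc := (hag.nat vInc (by decide)) ▸ hinc
    have hdec' : σ'.nat vDec 0 = dec := (hag.nat vDec (by decide)) ▸ hdec
    -- The list has no repetitions, so no cell is changed twice.
    have hnew : ¬ P k (t * S.m + x) := by
      rintro ⟨k', h1, h2, h3, -⟩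
      have := hV.lst_inj t j k' k hjm h1 (by omega) hak hkb (by omega)
      omega
    have hPs : ∀ i, P (k + 1) i ↔
        (P k i ∨ (i = t * S.m + x ∧ dist (S.F x) (S.F j) ≤ 3 * (S.top / 2 ^ t))) := by
      intro i
      constructor
      · rintro ⟨k', h1, h2, h3, h4⟩
        rcases Nat.lt_succ_iff_lt_or_eq.1 h2 with h5 | rfl
        · exact .inl ⟨k', h1, h5, h3, h4⟩
        · exact .inr ⟨h3, h4⟩
      · rintro (⟨k', h1, h2, h3, h4⟩ | ⟨h3, h4⟩)
        · exact ⟨k', h1, by omega, h3, h4⟩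
        · exact ⟨k, hak, by omega, h3, h4⟩
    simp only [wp_seq, wp_nset]
    refine WP.ite (fun hb => ?_) (fun hb => ?_)
    · rw [wp_skip]
      have hfar : ¬ dist (S.F x) (S.F j) ≤ 3 * (S.top / 2 ^ t) := by
        simpa [hS'.lst, hk, hj', hrad, ← hx, hS'.F x hxm, hS'.F j hjm, ptDist_some] using hb
      refine ⟨by simp, ?_, ?_, ?_⟩
      · simp only [State.nlet]
        rw [write_other _ (by decide), write_other _ (by decide), hbal]
        exact shift_congr fun i => by rw [hPs]; simp [hfar]
      · simp only [State.nlet]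
        rw [write_other _ (by decide), write_other _ (by decide), hcnt]
        exact shift_congr fun i => by simp only [hP', hPs]; simp [hfar]
      · simpa [State.nlet] using hpay
    · have hnear : dist (S.F x) (S.F j) ≤ 3 * (S.top / 2 ^ t) := by
        simpa [hS'.lst, hk, hj', hrad, ← hx, hS'.F x hxm, hS'.F j hjm, ptDist_some] using hb
      set σ₁ : State V := setNat σ' vx ((NExp.lit 0).eval σ')
        ((NExp.cell aLst (nv vk)).eval σ') with hσ₁
      have hS₁ : S.Loaded σ₁ := hS'.of_eq
        (fun a ha => write_other _ (by rintro rfl; revert ha; decide) _ _) (fun _ _ => rfl) rfl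
      have hx₁ : σ₁.nat vx 0 = x := by simp [hσ₁, hk, hS'.lst, hx]
      rw [wp_seq]
      refine (wp_subPay hS₁ (t := t) (x := x) (by simp [hσ₁, hrow]) (by simp [hσ₁, hsrow])
        (by simp [hσ₁, hrad]) hx₁).mono ?_
      rintro τ₁ σ₂ - ⟨hτ₁, hσ₂⟩
      simp only [wp_seq, wp_nset]
      set σ₃ : State V := setNat σ₂ aBal (((nv vRow).add (nv vx)).eval σ₂)
          ((((NExp.cell aBal ((nv vRow).add (nv vx))).add (nv vInc)).sub (nv vDec)).eval σ₂)
        with hσ₃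
      have hS₃ : S.Loaded σ₃ := hS₁.of_eq
        (fun a ha => by
          rw [hσ₃, hσ₂]; exact write_other _ (by rintro rfl; revert ha; decide) _ _)
        (fun a ha => by
          rw [hσ₃, hσ₂]; exact write_other _ (by rintro rfl; revert ha; decide) _ _)
        (by rw [hσ₃, hσ₂])
      have hbal₃ : σ₃.nat aBal = shift inc dec (P (k + 1)) (σ.nat aBal) := by
        rw [shift_congr hPs, hσ₃, hσ₂]
        simp only [hσ₁, write_same, write_other, NExp.eval, hk, hS'.lst, ← hx, hrow, hinc', hdec',
          ne_eq, not_false_eq_true, Nat.reduceEqDiff,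
          Function.update_self, hbal]
        rw [update_shift hnew]
        exact shift_congr fun i => by simp [hnear]
      refine (wp_updateCnt hS₃ (t := t) (x := x) (j := j) (inc := inc) (dec := dec)
        (by simp [hσ₃, hσ₂, hσ₁, hrow]) (by simp [hσ₃, hσ₂, hσ₁, hsrow])
        (by simp only [hσ₃, hσ₂]; simpa using hx₁) (by simp [hσ₃, hσ₂, hσ₁, hj'])
        (by simp [hσ₃, hσ₂, hσ₁, hinc']) (by simp [hσ₃, hσ₂, hσ₁, hdec'])).mono ?_
      rintro τ₄ σ₄ - ⟨hτ₄, hσ₄⟩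
      have hcnt₃ : σ₃.nat aCnt = shift inc dec (P' k) (σ.nat aCnt) := by
        rw [hσ₃, hσ₂]; simp [hσ₁, hcnt]
      have hcnt₄ : σ₄.nat aCnt = shift inc dec (P' (k + 1)) (σ.nat aCnt) := by
        have hn' : ¬ P' k (t * S.m + x) := fun h => hnew h.1
        rw [hσ₄]
        simp only [write_same, hcnt₃]
        split_ifs with hxp
        · rw [update_shift hn']
          refine shift_congr fun i => ?_
          simp only [hP', hPs]
          constructor
          · rintro (⟨h1, h2⟩ | h1)
            · exact ⟨.inl h1, h2⟩
            · exact ⟨.inr ⟨h1, hnear⟩, by rw [h1, hxp]⟩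
          · rintro ⟨h1 | h1, h2⟩
            · exact .inl ⟨h1, h2⟩
            · exact .inr h1.1
        · rw [Function.update_eq_self]
          refine shift_congr fun i => ?_
          simp only [hP', hPs]
          constructor
          · rintro ⟨h1, h2⟩; exact ⟨.inl h1, h2⟩
          · rintro ⟨h1 | h1, h2⟩
            · exact ⟨h1, h2⟩
            · exact absurd (by omega) hxp
      have hbal₄ : σ₄.nat aBal = shift inc dec (P (k + 1)) (σ.nat aBal) := by
        simp [hσ₄, hbal₃]
      have hS₄ : S.Loaded σ₄ := hS₃.of_eq
        (fun a ha => by rw [hσ₄]; exact write_other _ (by rintro rfl; revert ha; decide) _ _)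
        (fun a ha => by rw [hσ₄]) (by rw [hσ₄])
      refine (wp_addPay hS₄ (t := t) (x := x) (by simp [hσ₄, hσ₃, hσ₂, hσ₁, hrow])
        (by simp [hσ₄, hσ₃, hσ₂, hσ₁, hsrow]) (by simp [hσ₄, hσ₃, hσ₂, hσ₁, hrad])
        (by simp only [hσ₄, hσ₃, hσ₂]; simpa using hx₁)).mono ?_
      rintro τ₅ σ₅ - ⟨hτ₅, hσ₅⟩
      have hbal₅ : σ₅.nat aBal = σ₄.nat aBal := by rw [hσ₅]
      have hcnt₅ : σ₅.nat aCnt = σ₄.nat aCnt := by rw [hσ₅]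
      refine ⟨?_, ?_, ?_, ?_⟩
      · simp; omega
      · simp only [State.nlet]
        rw [write_other _ (by decide), hbal₅, hbal₄]
      · simp only [State.nlet]
        rw [write_other _ (by decide), hcnt₅, hcnt₄]
      · simp only [State.nlet]
        rw [write_other _ (by decide), write_other _ (by decide), hbal₅, hcnt₅]
        have hp₅ : σ₅.real rPay 0 = σ'.real rPay 0 - S.cellPay (σ'.nat aBal) (σ'.nat aCnt) t x +
            S.cellPay (σ₄.nat aBal) (σ₄.nat aCnt) t x := by
          rw [hσ₅]
          simp only [write_same, Function.update_self]
          congr 1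
          rw [hσ₄, hσ₃, hσ₂]
          simp [hσ₁]
        have hd := S.rowPay_sub (bal := σ'.nat aBal) (cnt := σ'.nat aCnt) (bal' := σ₄.nat aBal)
          (cnt' := σ₄.nat aCnt) (t := t) hxm
          (fun i hi => by
            rw [hbal₄, hbal]
            have e : P (k + 1) i ↔ P k i := by rw [hPs]; simp [hi]
            by_cases h : P k i <;> simp [shift, e, h])
          (fun i hi => by
            rw [hcnt₄, hcnt]
            have e : P' (k + 1) i ↔ P' k i := and_congr_left' (by rw [hPs]; simp [hi])
            by_cases h : P' k i <;> simp [shift, e, h])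
        rw [hp₅]
        linarith
  · rintro τ σ' hτ hag - ⟨hbal, hcnt, hpay⟩
    have hPb : ∀ i, P b i ↔ ∃ x < S.m, i = t * S.m + x ∧ S.IsNet t x ∧
        dist (S.F x) (S.F j) ≤ 3 * (S.top / 2 ^ t) := by
      intro i
      constructor
      · rintro ⟨k', h1, h2, h3, h4⟩
        exact ⟨_, hV.lst_lt t j k' hjm h1 h2, h3, hV.lst_net t j k' hjm h1 h2, h4⟩
      · rintro ⟨x, hx, rfl, hn, hd⟩
        obtain ⟨k', h1, h2, rfl⟩ := hV.lst_complete t j x hjm hx hn (by rw [dist_comm]; linarith)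
        exact ⟨k', h1, h2, rfl, hd⟩
    refine ⟨?_, ?_, ?_, hpay⟩
    · have h5 := hV.st_le_add t j hjm
      simp [listLo, listHi] at hτ
      have : b - a ≤ ℓ := by omega
      have := Nat.mul_le_mul_right 195 this
      omega
    · rw [hbal]; exact shift_congr hPb
    · rw [hcnt]
      refine shift_congr fun i => ⟨fun h => h.2, fun h => ⟨(hPb i).2 ⟨S.parent t j,
        hV.sys.par_lt t j hjm, h, hV.sys.par_net t j hjm, ?_⟩, h⟩⟩
      have := hV.sys.par_dist t j hjm
      rw [dist_comm]; linarith

/-! ### Correctness of the counts -/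

theorem row_inj {m t t' x x' : ℕ} (hx : x < m) (hx' : x' < m) (h : t * m + x = t' * m + x') :
    t = t' ∧ x = x' := by
  have h1 : (t * m + x) / m = t := by
    rw [mul_comm, Nat.mul_add_div (by omega), Nat.div_eq_of_lt hx, add_zero]
  have h2 : (t' * m + x') / m = t' := by
    rw [mul_comm, Nat.mul_add_div (by omega), Nat.div_eq_of_lt hx', add_zero]
  have : t = t' := by rw [← h1, h, h2]
  subst this
  exact ⟨rfl, by omega⟩

theorem Tables.rowPay_congr (S : Tables V) {bal cnt bal' cnt' : ℕ → ℕ} {t : ℕ}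
    (h : ∀ x < S.m, bal' (t * S.m + x) = bal (t * S.m + x))
    (h' : ∀ x < S.m, cnt' (t * S.m + x) = cnt (t * S.m + x)) :
    S.rowPay bal' cnt' t = S.rowPay bal cnt t :=
  Finset.sum_congr rfl fun x hx => S.cellPay_congr (h x (by simpa using hx)) (h' x (by simpa using hx))

/-- Account in the estimate for the finest scale at which the client is counted. -/
def basePay : Cmd :=
  .ite (.rlt (.cell rZ (nv vJ)) (.mul (.lit 2) (rv rr)))
    (rlet rPay (.add (rv rPay) (.mul (.sub (.ofNat (nv vInc)) (.ofNat (nv vDec)))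
      (.cell rZ (nv vJ)))))
    (rlet rPay (.add (rv rPay) (.mul (.sub (.ofNat (nv vInc)) (.ofNat (nv vDec)))
      (.mul (.lit 2) (rv rr)))))

def countAll : Cmd := levels countBody ;; basePay

open Classical in
/-- The counts and the estimate are right for the clients `M`, given by their facility and the
finest scale at which they are counted. -/
structure Counts (S : Tables V) (M : Multiset (ℕ × ℕ)) (σ : State V) : Prop where
  mem : ∀ p ∈ M, p.1 < S.m
  bal : ∀ t x, x < S.m → S.IsNet t x → σ.nat aBal (t * S.m + x) =
    M.countP fun p => t ≤ p.2 ∧ dist (S.F x) (S.F p.1) ≤ 3 * (S.top / 2 ^ t)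
  cnt : ∀ t x, x < S.m → σ.nat aCnt (t * S.m + x) =
    M.countP fun p => t ≤ p.2 ∧ S.parent t p.1 = x
  pay : ∃ B₀, ∀ B ≥ B₀, σ.real rPay 0 = (M.map fun p => min (S.Z p.1) (S.top / 2 ^ p.2)).sum +
    ∑ t ∈ Finset.range B, S.rowPay (σ.nat aBal) (σ.nat aCnt) t

theorem Counts.of_eq {S : Tables V} {M : Multiset (ℕ × ℕ)} {σ σ' : State V} (h : Counts S M σ)
    (h1 : σ'.nat aBal = σ.nat aBal) (h2 : σ'.nat aCnt = σ.nat aCnt)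
    (h3 : σ'.real rPay = σ.real rPay) : Counts S M σ' :=
  ⟨h.mem, by rw [h1]; exact h.bal, by rw [h2]; exact h.cnt, by rw [h1, h2, h3]; exact h.pay⟩

/-- `M'` arises from `M` by adding or removing a client, according to `inc` and `dec`. -/
def Change (inc dec : ℕ) (p : ℕ × ℕ) (M M' : Multiset (ℕ × ℕ)) : Prop :=
  (inc = 1 ∧ dec = 0 ∧ M' = p ::ₘ M) ∨ (inc = 0 ∧ dec = 1 ∧ M = p ::ₘ M')

/-- The truncated subtraction is exact: a removed client is among those counted, so the count is
positive. -/
theorem Change.countP_of {inc dec : ℕ} {p : ℕ × ℕ} {M M' : Multiset (ℕ × ℕ)}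
    (h : Change inc dec p M M') (P : ℕ × ℕ → Prop) [DecidablePred P] (hp : P p) :
    M'.countP P = M.countP P + inc - dec := by
  rcases h with ⟨rfl, rfl, rfl⟩ | ⟨rfl, rfl, rfl⟩ <;> rw [Multiset.countP_cons, if_pos hp] <;> omega

theorem Change.countP_of_not {inc dec : ℕ} {p : ℕ × ℕ} {M M' : Multiset (ℕ × ℕ)}
    (h : Change inc dec p M M') (P : ℕ × ℕ → Prop) [DecidablePred P] (hp : ¬ P p) :
    M'.countP P = M.countP P := by
  rcases h with ⟨rfl, rfl, rfl⟩ | ⟨rfl, rfl, rfl⟩ <;> rw [Multiset.countP_cons, if_neg hp, add_zero]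

theorem Change.sum {inc dec : ℕ} {p : ℕ × ℕ} {M M' : Multiset (ℕ × ℕ)}
    (h : Change inc dec p M M') (φ : ℕ × ℕ → ℝ) :
    (M'.map φ).sum = (M.map φ).sum + ((inc : ℝ) - dec) * φ p := by
  rcases h with ⟨rfl, rfl, rfl⟩ | ⟨rfl, rfl, rfl⟩ <;> (simp; try ring)

theorem countLevels_spec {S : Tables V} {ℓ : ℕ} (hV : S.Valid ℓ) {σ : State V} (hS : S.Loaded σ)
    {j l inc dec : ℕ} (hj : σ.nat vJ 0 = j) (hjm : j < S.m) (hl : σ.nat vL 0 = l)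
    (hinc : σ.nat vInc 0 = inc) (hdec : σ.nat vDec 0 = dec) :
    WP (levels countBody) σ fun τ σ' => τ ≤ (l + 1) * (ℓ * 200 + 110) + 60 ∧
      σ'.nat aBal = shift inc dec (fun i => ∃ t ≤ l, ∃ x < S.m, i = t * S.m + x ∧ S.IsNet t x ∧
        dist (S.F x) (S.F j) ≤ 3 * (S.top / 2 ^ t)) (σ.nat aBal) ∧
      σ'.nat aCnt = shift inc dec (fun i => ∃ t ≤ l, i = t * S.m + S.parent t j) (σ.nat aCnt) ∧
      (∀ B ≥ l + 1, σ'.real rPay 0 - ∑ t ∈ Finset.range B, S.rowPay (σ'.nat aBal) (σ'.nat aCnt) t =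
        σ.real rPay 0 - ∑ t ∈ Finset.range B, S.rowPay (σ.nat aBal) (σ.nat aCnt) t) ∧
      σ'.real rr 0 = S.top / 2 ^ (l + 1) := by
  refine levels_spec hS l (ℓ * 200 + 50) hl (by decide) (by decide) (by decide)
    (fun t σ' =>
      σ'.nat aBal = shift inc dec (fun i => ∃ t' < t, ∃ x < S.m, i = t' * S.m + x ∧ S.IsNet t' x ∧
        dist (S.F x) (S.F j) ≤ 3 * (S.top / 2 ^ t')) (σ.nat aBal) ∧
      σ'.nat aCnt = shift inc dec (fun i => ∃ t' < t, i = t' * S.m + S.parent t' j) (σ.nat aCnt) ∧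
      (∀ B ≥ l + 1, σ'.real rPay 0 - ∑ t ∈ Finset.range B, S.rowPay (σ'.nat aBal) (σ'.nat aCnt) t =
        σ.real rPay 0 - ∑ t ∈ Finset.range B, S.rowPay (σ.nat aBal) (σ.nat aCnt) t))
    ?_ ?_ ?_ ?_
  · rintro t σ₁ σ₂ hag ⟨h1, h2, h3⟩
    have e1 : σ₂.nat aBal = σ₁.nat aBal := hag.nat _ (by decide)
    have e2 : σ₂.nat aCnt = σ₁.nat aCnt := hag.nat _ (by decide)
    have e3 : σ₂.real rPay = σ₁.real rPay := hag.real _ (by decide)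
    rw [e1, e2, e3]
    exact ⟨h1, h2, h3⟩
  · refine ⟨?_, ?_, fun _ _ => rfl⟩
    · funext i; simp [shift]
    · funext i; simp [shift]
  · rintro t σ₁ htl hag hS₁ hat ⟨hbal, hcnt, hpay⟩
    refine (countBody_spec hV hS₁ hat ((hag.nat vJ (by decide)) ▸ hj) hjm
      ((hag.nat vInc (by decide)) ▸ hinc) ((hag.nat vDec (by decide)) ▸ hdec)).mono ?_
    rintro τ σ₂ - ⟨hτ, hbal₂, hcnt₂, hpay₂⟩
    have hpm := fun t => hV.sys.par_lt t j hjm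
    refine ⟨hτ, ?_, ?_, ?_⟩
    · rw [hbal₂, hbal, shift_shift]
      · refine shift_congr fun i => ?_
        constructor
        · rintro (⟨t', h1, h2⟩ | h)
          · exact ⟨t', by omega, h2⟩
          · exact ⟨t, by omega, h⟩
        · rintro ⟨t', h1, h2⟩
          rcases Nat.lt_succ_iff_lt_or_eq.1 h1 with h3 | rfl
          · exact .inl ⟨t', h3, h2⟩
          · exact .inr h2
      · rintro i ⟨t', h1, x, hx, h2, -⟩ ⟨x', hx', h3, -⟩
        have := (row_inj hx hx' (h2.symm.trans h3)).1
        omega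
    · rw [hcnt₂, hcnt, shift_shift]
      · refine shift_congr fun i => ?_
        constructor
        · rintro (⟨t', h1, h2⟩ | h)
          · exact ⟨t', by omega, h2⟩
          · exact ⟨t, by omega, h⟩
        · rintro ⟨t', h1, h2⟩
          rcases Nat.lt_succ_iff_lt_or_eq.1 h1 with h3 | rfl
          · exact .inl ⟨t', h3, h2⟩
          · exact .inr h2
      · rintro i ⟨t', h1, h2⟩ h3
        have := (row_inj (hpm _) (hpm _) (h2.symm.trans h3)).1
        omega
    · intro B hB
      rw [← hpay B hB]
      -- Only row `t` has changed, since rows occupy disjoint cells. The other summands cancel.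
      have : ∑ t ∈ Finset.range B, S.rowPay (σ₂.nat aBal) (σ₂.nat aCnt) t -
          ∑ t ∈ Finset.range B, S.rowPay (σ₁.nat aBal) (σ₁.nat aCnt) t =
          S.rowPay (σ₂.nat aBal) (σ₂.nat aCnt) t - S.rowPay (σ₁.nat aBal) (σ₁.nat aCnt) t := by
        rw [← Finset.sum_sub_distrib]
        refine Finset.sum_eq_single t (fun t' _ ht' => ?_) (fun h => ?_)
        · rw [sub_eq_zero]
          refine S.rowPay_congr (fun x hx => ?_) (fun x hx => ?_)
          · rw [hbal₂, shift_of_not]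
            rintro ⟨x', hx', h3, -⟩
            exact ht' (row_inj hx hx' h3).1
          · rw [hcnt₂, shift_of_not]
            intro h3
            exact ht' (row_inj hx (hpm _) h3).1
        · exact absurd (Finset.mem_range.2 (by omega)) h
      linarith
  · rintro τ σ₁ hτ hag hS₁ hrad ⟨hbal, hcnt, hpay⟩
    refine ⟨by linarith, ?_, ?_, hpay, hrad⟩
    · rw [hbal]; exact shift_congr fun i => by simp only [Nat.lt_succ_iff]
    · rw [hcnt]; exact shift_congr fun i => by simp only [Nat.lt_succ_iff]

theorem basePay_spec {S : Tables V} {σ : State V} (hS : S.Loaded σ) {j l inc dec : ℕ}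
    (hj : σ.nat vJ 0 = j) (hinc : σ.nat vInc 0 = inc) (hdec : σ.nat vDec 0 = dec)
    (hrad : σ.real rr 0 = S.top / 2 ^ (l + 1)) :
    WP basePay σ fun τ σ' => τ ≤ 60 ∧ σ'.real rPay 0 =
      σ.real rPay 0 + ((inc : ℝ) - dec) * min (S.Z j) (S.top / 2 ^ l) := by
  -- The sweep leaves the radius of scale `l + 1` behind, hence the factor 2 in the program.
  have h2 : 2 * (S.top / 2 ^ (l + 1)) = S.top / 2 ^ l := by rw [pow_succ]; field_simp
  refine WP.ite (fun hb => ?_) (fun hb => ?_)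
  · have : S.Z j < S.top / 2 ^ l := by simpa [hS.Z, hj, hrad, h2] using hb
    simp [min_eq_left this.le, hS.Z, hj, hinc, hdec]
  · have : S.top / 2 ^ l ≤ S.Z j := by simpa [hS.Z, hj, hrad, h2] using hb
    simp [min_eq_right this, hrad, hinc, hdec, h2]

/-- The last conclusion is the locality on which the repair of the member sets rests: counts of net
points beyond three radii, or at scales finer than `l`, are untouched. -/
theorem countAll_spec {S : Tables V} {ℓ : ℕ} (hV : S.Valid ℓ) {σ : State V} (hS : S.Loaded σ)
    {j l inc dec : ℕ} (hj : σ.nat vJ 0 = j) (hjm : j < S.m) (hl : σ.nat vL 0 = l)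
    (hinc : σ.nat vInc 0 = inc) (hdec : σ.nat vDec 0 = dec) {M M' : Multiset (ℕ × ℕ)}
    (hM : Change inc dec (j, l) M M') (hC : Counts S M σ) :
    WP countAll σ fun τ σ' => τ ≤ (l + 1) * (ℓ * 200 + 110) + 120 ∧ Counts S M' σ' ∧
      ∀ t x, x < S.m → S.IsNet t x →
        ¬ (t ≤ l ∧ dist (S.F x) (S.F j) ≤ 3 * (S.top / 2 ^ t)) →
        σ'.nat aBal (t * S.m + x) = σ.nat aBal (t * S.m + x) := by
  classical
  unfold countAll
  rw [wp_seq]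
  refine (countLevels_spec hV hS hj hjm hl hinc hdec).mono ?_
  rintro τ₁ σ₁ hag₁ ⟨hτ₁, hbal, hcnt, hpay, hrad⟩
  refine (basePay_spec (hS.agree hag₁ (by decide)) ((hag₁.nat vJ (by decide)) ▸ hj)
      ((hag₁.nat vInc (by decide)) ▸ hinc) ((hag₁.nat vDec (by decide)) ▸ hdec) hrad).mono ?_
  rintro τ₂ σ₂ hag₂ ⟨hτ₂, hpay₂⟩
  have e1 : σ₂.nat aBal = σ₁.nat aBal := hag₂.nat _ (by decide)
  have e2 : σ₂.nat aCnt = σ₁.nat aCnt := hag₂.nat _ (by decide)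
  have hP : ∀ t x, x < S.m → S.IsNet t x →
      ((∃ t' ≤ l, ∃ x' < S.m, t * S.m + x = t' * S.m + x' ∧ S.IsNet t' x' ∧
        dist (S.F x') (S.F j) ≤ 3 * (S.top / 2 ^ t')) ↔
      (t ≤ l ∧ dist (S.F x) (S.F j) ≤ 3 * (S.top / 2 ^ t))) := by
    intro t x hx hn
    constructor
    · rintro ⟨t', h1, x', hx', h2, -, h3⟩
      obtain ⟨rfl, rfl⟩ := row_inj hx hx' h2
      exact ⟨h1, h3⟩
    · rintro ⟨h1, h2⟩
      exact ⟨t, h1, x, hx, rfl, hn, h2⟩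
  refine ⟨by omega, ⟨?_, ?_, ?_, ?_⟩, ?_⟩
  · intro p hp
    rcases hM with ⟨-, -, rfl⟩ | ⟨-, -, rfl⟩
    · rcases Multiset.mem_cons.1 hp with rfl | hp
      exacts [hjm, hC.mem p hp]
    · exact hC.mem p (Multiset.mem_cons_of_mem hp)
  · intro t x hx hn
    rw [e1, hbal]
    by_cases h : t ≤ l ∧ dist (S.F x) (S.F j) ≤ 3 * (S.top / 2 ^ t)
    · rw [shift_of ((hP t x hx hn).2 h), hM.countP_of _ h, hC.bal t x hx hn]
    · rw [shift_of_not (fun h' => h ((hP t x hx hn).1 h')), hM.countP_of_not _ h,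
        hC.bal t x hx hn]
  · intro t x hx
    rw [e2, hcnt]
    have : (∃ t' ≤ l, t * S.m + x = t' * S.m + S.parent t' j) ↔ (t ≤ l ∧ S.parent t j = x) := by
      constructor
      · rintro ⟨t', h1, h2⟩
        obtain ⟨rfl, rfl⟩ := row_inj hx (hV.sys.par_lt t' j hjm) h2
        exact ⟨h1, rfl⟩
      · rintro ⟨h1, rfl⟩
        exact ⟨t, h1, rfl⟩
    by_cases h : t ≤ l ∧ S.parent t j = x
    · rw [shift_of (this.2 h), hM.countP_of _ h, hC.cnt t x hx]
    · rw [shift_of_not (fun h' => h (this.1 h')), hM.countP_of_not _ h, hC.cnt t x hx]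
  · obtain ⟨B₀, hB₀⟩ := hC.pay
    refine ⟨max B₀ (l + 1), fun B hB => ?_⟩
    have h1 := hB₀ B (le_trans (le_max_left _ _) hB)
    have h2 := hpay B (le_trans (le_max_right _ _) hB)
    rw [hM.sum, hpay₂, e1, e2]
    dsimp only
    linarith
  · intro t x hx hn hnot
    rw [e1, hbal, shift_of_not]
    rwa [hP t x hx hn]

/-! ### The set of open net points -/

/-- The memory in the body of `levels` at scale `t`, when an update at facility `j` is processed. -/
structure AtUpdate (S : Tables V) (t j : ℕ) (σ : State V) : Prop where
  loaded : S.Loaded σ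
  level : S.AtLevel t σ
  vJ_eq : σ.nat vJ 0 = j

/-- `c` does not write the tables and the control variables of an update. -/
def KeepsUpdate (c : Cmd) : Prop :=
  KeepsTables c ∧ (∀ a ∈ [vJ, vt, vRow, vSRow, vRowN, vSRowN], a ∉ c.nw) ∧
    ∀ a ∈ [rr, rh], a ∉ c.rw

instance (c : Cmd) : Decidable (KeepsUpdate c) := by unfold KeepsUpdate; infer_instance

theorem AtUpdate.agree {S : Tables V} {t j : ℕ} {σ σ' : State V} {c : Cmd} (h : AtUpdate S t j σ)
    (ha : Agree c σ σ') (hc : KeepsUpdate c) : AtUpdate S t j σ' := by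
  obtain ⟨h0, hn, hr⟩ := hc
  simp only [List.forall_mem_cons, List.not_mem_nil] at hn hr
  obtain ⟨n1, n2, n3, n4, n5, n6, -⟩ := hn
  obtain ⟨r1, r2, -⟩ := hr
  obtain ⟨h1, ⟨a1, a2, a3, a4, a5, a6, a7⟩, h3⟩ := h
  refine ⟨h1.agree ha h0, ⟨?_, ?_, ?_, ?_, ?_, ?_, ?_⟩, ?_⟩
  all_goals first | rw [ha.nat _ ‹_›]; assumption | rw [ha.real _ ‹_›]; assumption

theorem agree_nlet {a x : ℕ} (σ : State V) : Agree (nlet a (.lit x)) σ (setNat σ a 0 x) :=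
  ⟨fun b hb => write_other _ (by simpa [Cmd.nw] using hb) _ _, fun _ _ => rfl, fun _ _ => rfl⟩

/-- Clear the flag `vok` if some net point near the one in `vx` satisfies a test. -/
def scan (srow : ℕ) (test : BExp) : Cmd :=
  forLoop vkN (listLo srow vx) (listHi srow vx)
    (nlet vy (.cell aLst (nv vkN)) ;; .ite test (nlet vok (.lit 0)) .skip)

/-- The flag survives exactly if it was set before and no entry of the list has the property `T`.
The test is related to `T` only at listed points, all of which are net points of the scale. -/
theorem scan_spec {S : Tables V} {ℓ : ℕ} (hV : S.Valid ℓ) {σ : State V} (hS : S.Loaded σ)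
    {srow t x : ℕ} {test : BExp} (htest : test.cost ≤ 60) (hsr : srow ∉ [vkN, vy, vok])
    (hsrow : σ.nat srow 0 = min t S.T * S.m) (hx : σ.nat vx 0 = x) (hxm : x < S.m)
    (T : ℕ → Prop)
    (hT : ∀ σ' y, Agree (scan srow test) σ σ' → y < S.m → S.IsNet t y → σ'.nat vy 0 = y →
      (test.Holds σ' ↔ T y)) :
    WP (scan srow test) σ fun τ σ' => τ ≤ ℓ * 100 + 50 ∧
      (σ'.nat vok 0 ≠ 0 ↔ σ.nat vok 0 ≠ 0 ∧
        ∀ k, S.st (S.idx t x) ≤ k → k < S.st (S.idx t x + 1) → ¬ T (S.lst k)) := by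
  simp only [List.mem_cons, List.not_mem_nil, or_false, not_or] at hsr
  have hkeep : ∀ σ', Agree (scan srow test) σ σ' → S.Loaded σ' := fun σ' h =>
    hS.agree h (by
      refine ⟨?_, ?_, ?_⟩
      · simp [scan, forLoop, Cmd.nw, tableNat]
      · simp [scan, forLoop, Cmd.rw, tableReal]
      · simp [scan, forLoop, Cmd.pw])
  refine WP.forLoop_bounded (S.st (S.idx t x)) (S.st (S.idx t x + 1)) 80 (hV.st_le t x hxm)
    (by simp [Cmd.nw]) ?_ ?_
    (fun k σ' => (σ'.nat vok 0 ≠ 0 ↔ σ.nat vok 0 ≠ 0 ∧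
        ∀ k', S.st (S.idx t x) ≤ k' → k' < k → ¬ T (S.lst k'))) ?_ ?_ ?_
  · simp [listLo, hS.st, hsrow, hx, Tables.idx]
  · intro σ' hag
    have h1 : σ'.nat aSt = S.st := (hkeep σ' hag).st
    have h2 : σ'.nat srow = σ.nat srow := hag.nat _ (by
      simp [forLoop, Cmd.nw]; tauto)
    have h3 : σ'.nat vx = σ.nat vx := hag.nat _ (by simp [forLoop, Cmd.nw])
    simp [listHi, h1, h2, h3, hsrow, hx, Tables.idx]
  · simp [State.nlet]
    intro _ k h1 h2; omega
  · intro k σ' hak hkb hk hag hI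
    rw [wp_seq, wp_nset]
    have hS' := hkeep σ' hag
    have hag₁ : Agree (scan srow test) σ
        { σ' with nat := write σ'.nat vy ((NExp.lit 0).eval σ') ((NExp.cell aLst (nv vkN)).eval σ') } :=
      hag.trans ⟨fun b hb => write_other _ (by
          rintro rfl; exact hb (by simp [forLoop, Cmd.nw])) _ _, fun _ _ => rfl, fun _ _ => rfl⟩
    have hiff := hT _ (S.lst k) hag₁ (hV.lst_lt t x k hxm hak hkb) (hV.lst_net t x k hxm hak hkb)
      (by simp [hS'.lst, hk])
    have hsplit : (∀ k', S.st (S.idx t x) ≤ k' → k' < k + 1 → ¬ T (S.lst k')) ↔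
        (∀ k', S.st (S.idx t x) ≤ k' → k' < k → ¬ T (S.lst k')) ∧ ¬ T (S.lst k) := by
      constructor
      · intro h; exact ⟨fun k' h1 h2 => h k' h1 (by omega), h k hak (by omega)⟩
      · rintro ⟨h1, h2⟩ k' h3 h4
        rcases Nat.lt_succ_iff_lt_or_eq.1 h4 with h5 | rfl
        exacts [h1 k' h3 h5, h2]
    refine WP.ite (fun hb => ?_) (fun hb => ?_)
    · rw [hiff] at hb
      rw [wp_nset]
      refine ⟨by simp only [NExp.cost]; omega, ?_⟩
      rw [hsplit]
      simp [State.nlet, hb]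
    · rw [hiff] at hb
      rw [wp_skip]
      refine ⟨by simp only [NExp.cost]; omega, ?_⟩
      rw [hsplit, ← and_assoc, and_iff_left hb]
      refine Iff.trans ?_ hI
      simp [State.nlet]
  · intro τ σ' hτ hag _ hI
    refine ⟨?_, hI⟩
    have h5 := hV.st_le_add t x hxm
    simp [listLo, listHi] at hτ
    have : S.st (S.idx t x + 1) - S.st (S.idx t x) ≤ ℓ := by omega
    have := Nat.mul_le_mul_right 95 this
    omega

open Classical in
/-- The number of reasons for a facility to be open: being free and being the cheapest one near a
member of `K`. -/
noncomputable def Tables.refs (S : Tables V) (K : Finset (ℕ × ℕ)) (x : ℕ) : ℕ :=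
  (if x < S.m ∧ S.f x = 0 then 1 else 0) + (K.filter fun p => S.cheap p.1 p.2 = x).card

open Classical in
/-- The set `K` and the list of open facilities are represented in the memory. -/
structure IndRep (S : Tables V) (K : Finset (ℕ × ℕ)) (σ : State V) : Prop where
  lt : ∀ p ∈ K, p.2 < S.m
  ind : ∀ t x, x < S.m → σ.nat aInd (t * S.m + x) = if (t, x) ∈ K then 1 else 0
  rep : OpenRep (S.refs K) σ

theorem IndRep.of_eq {S : Tables V} {K : Finset (ℕ × ℕ)} {σ σ' : State V} (h : IndRep S K σ)
    (h' : ∀ a ∈ [aInd, aRef, aOpen, aPos, aLen], σ'.nat a = σ.nat a) : IndRep S K σ' :=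
  ⟨h.lt, by rw [h' aInd (by simp)]; exact h.ind, h.rep.of_eq fun a ha => h' a (by simp at ha ⊢; tauto)⟩

theorem refs_insert (S : Tables V) {K : Finset (ℕ × ℕ)} {p : ℕ × ℕ} (hp : p ∉ K) :
    S.refs (insert p K) = Function.update (S.refs K) (S.cheap p.1 p.2)
      (S.refs K (S.cheap p.1 p.2) + 1) := by
  classical
  funext x
  have hp' : ∀ x, p ∉ K.filter fun p => S.cheap p.1 p.2 = x := fun x h => hp (Finset.mem_filter.1 h).1
  simp only [Tables.refs, Function.update_apply, Finset.filter_insert]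
  by_cases h : S.cheap p.1 p.2 = x
  · rw [if_pos h, Finset.card_insert_of_notMem (hp' x), if_pos h.symm, h]
    omega
  · have h' : x ≠ S.cheap p.1 p.2 := fun h' => h h'.symm
    simp only [h, h', if_false]

/-- The member being removed is itself a reason for its facility to be open, so the count is
positive and may be decremented. -/
theorem refs_erase (S : Tables V) {K : Finset (ℕ × ℕ)} {p : ℕ × ℕ} (hp : p ∈ K) :
    0 < S.refs K (S.cheap p.1 p.2) ∧
    S.refs (K.erase p) = Function.update (S.refs K) (S.cheap p.1 p.2)
      (S.refs K (S.cheap p.1 p.2) - 1) := by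
  classical
  have h := refs_insert S (Finset.notMem_erase p K)
  rw [Finset.insert_erase hp] at h
  constructor
  · rw [h]; simp
  · funext x
    rw [h]
    simp only [Function.update_apply]
    split_ifs <;> simp_all

def dropMember : Cmd :=
  .nset aInd (.add (nv vRow) (nv vx)) (.lit 0) ;;
  nlet vg (.cell aG (.add (nv vSRow) (nv vx))) ;; closeFac

def addMember : Cmd :=
  .nset aInd (.add (nv vRow) (nv vx)) (.lit 1) ;;
  nlet vg (.cell aG (.add (nv vSRow) (nv vx))) ;; openFac

theorem dropMember_spec {S : Tables V} {σ : State V} {t j x : ℕ} (hU : AtUpdate S t j σ)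
    {K : Finset (ℕ × ℕ)} (hK : IndRep S K σ) (hx : σ.nat vx 0 = x) (hxK : (t, x) ∈ K) :
    WP dropMember σ fun τ σ' => τ ≤ 70 ∧ IndRep S (K.erase (t, x)) σ' := by
  classical
  obtain ⟨hS, hat, -⟩ := hU
  unfold dropMember
  simp only [wp_seq, wp_nset]
  obtain ⟨hpos, hrefs⟩ := refs_erase S hxK
  set σ₁ : State V := setNat (setNat σ aInd (t * S.m + x) 0) vg 0 (S.cheap t x) with hσ₁
  have hrep : OpenRep (S.refs K) σ₁ := hK.rep.of_eq (by simp [hσ₁, setNat])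
  have hrun : WP closeFac σ₁ fun τ σ' => τ ≤ 40 ∧ OpenRep (S.refs (K.erase (t, x))) σ' := by
    have := closeFac_spec hrep (by simpa [hσ₁] using hpos)
    rw [hrefs]
    simpa [hσ₁] using this
  have hfin : WP closeFac σ₁ fun τ σ' => τ ≤ 50 ∧ IndRep S (K.erase (t, x)) σ' := by
    refine hrun.mono ?_
    rintro τ σ₂ hag ⟨h1, h2⟩
    refine ⟨by omega, ⟨fun p hp => hK.lt p (Finset.mem_of_mem_erase hp), ?_, h2⟩⟩
    intro t' x' hx'
    rw [hag.nat aInd (by decide)]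
    have h3 : (t' * S.m + x' = t * S.m + x) ↔ (t', x') = (t, x) := by
      constructor
      · intro h; obtain ⟨rfl, rfl⟩ := row_inj hx' (hK.lt _ hxK) h; rfl
      · intro h; simp only [Prod.mk.injEq] at h; rw [h.1, h.2]
    simp only [hσ₁, setNat, ne_eq, Nat.reduceEqDiff, not_false_eq_true, write_other, write_same,
      Function.update_apply, h3, hK.ind t' x' hx', Finset.mem_erase]
    split_ifs <;> simp_all
  simp only [NExp.eval, NExp.cost, write_other, hat.row, hat.srow, hx, hS.g, ne_eq,
    Nat.reduceEqDiff, not_false_eq_true]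
  change WP closeFac σ₁ _
  exact hfin.mono fun τ σ' _ h => ⟨by omega, h.2⟩

theorem addMember_spec {S : Tables V} {σ : State V} {t j x : ℕ} (hU : AtUpdate S t j σ)
    {K : Finset (ℕ × ℕ)} (hK : IndRep S K σ) (hx : σ.nat vx 0 = x) (hxm : x < S.m)
    (hxK : (t, x) ∉ K) :
    WP addMember σ fun τ σ' => τ ≤ 70 ∧ IndRep S (insert (t, x) K) σ' := by
  classical
  obtain ⟨hS, hat, -⟩ := hU
  unfold addMember
  simp only [wp_seq, wp_nset]
  have hrefs := refs_insert S hxK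
  set σ₁ : State V := setNat (setNat σ aInd (t * S.m + x) 1) vg 0 (S.cheap t x) with hσ₁
  have hrep : OpenRep (S.refs K) σ₁ := hK.rep.of_eq (by simp [hσ₁, setNat])
  have hrun : WP openFac σ₁ fun τ σ' => τ ≤ 30 ∧ OpenRep (S.refs (insert (t, x) K)) σ' := by
    have := openFac_spec hrep
    rw [hrefs]
    simpa [hσ₁] using this
  have hfin : WP openFac σ₁ fun τ σ' => τ ≤ 50 ∧ IndRep S (insert (t, x) K) σ' := by
    refine hrun.mono ?_
    rintro τ σ₂ hag ⟨h1, h2⟩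
    refine ⟨by omega, ⟨fun p hp => ?_, ?_, h2⟩⟩
    · rcases Finset.mem_insert.1 hp with rfl | hp
      exacts [hxm, hK.lt p hp]
    intro t' x' hx'
    rw [hag.nat aInd (by decide)]
    have h3 : (t' * S.m + x' = t * S.m + x) ↔ (t', x') = (t, x) := by
      constructor
      · intro h; obtain ⟨rfl, rfl⟩ := row_inj hx' hxm h; rfl
      · intro h; simp only [Prod.mk.injEq] at h; rw [h.1, h.2]
    simp only [hσ₁, setNat, ne_eq, Nat.reduceEqDiff, not_false_eq_true, write_other, write_same,
      Function.update_apply, h3, hK.ind t' x' hx', Finset.mem_insert]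
    split_ifs <;> simp_all
  simp only [NExp.eval, NExp.cost, write_other, hat.row, hat.srow, hx, hS.g, ne_eq,
    Nat.reduceEqDiff, not_false_eq_true]
  change WP openFac σ₁ _
  exact hfin.mono fun τ σ' _ h => ⟨by omega, h.2⟩

/-! ### Changing the set of open net points -/

/-- Eligibility of a net point in terms of the flat array of counts. -/
def Tables.Eligible (S : Tables V) (bal : ℕ → ℕ) (t x : ℕ) : Prop :=
  Elig S.m S.F S.f S.top S.IsNet S.cheap (S.HeavyAt bal) t x

/-- The members of `K` at scale `t` are a maximal separated set of eligible net points. -/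
def Tables.MaxSep (S : Tables V) (bal : ℕ → ℕ) (K : Finset (ℕ × ℕ)) (t : ℕ) : Prop :=
  IsMaxSep S.m S.F S.f S.top S.IsNet S.cheap (S.HeavyAt bal) (fun x => (t, x) ∈ K) t

/-- The net point in `vy` is a heavy point of the next scale near the one in `vx`. -/
def heavyNear : BExp :=
  .and (.not (.rlt (.mul (.lit 4) (rv rr)) (.dist pFac (nv vx) pFac (nv vy))))
    (.not (light vRowN vSRowN rh vy))

/-- The net point in `vy` is a member near the one in `vx`. -/
def memberNear : BExp :=
  .and (.not (.rlt (.mul (.lit 6) (rv rr)) (.dist pFac (nv vx) pFac (nv vy))))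
    (.nlt (.lit 0) (.cell aInd (.add (nv vRow) (nv vy))))

/-- Make the net point in `vx` a member if possible. -/
def tryMember : Cmd :=
  nlet vok (.lit 1) ;;
  .ite (light vRow vSRow rr vx) (nlet vok (.lit 0)) .skip ;;
  .ite (.rlt (.lit 0) (.cell rF (.cell aG (.add (nv vSRow) (nv vx))))) .skip (nlet vok (.lit 0)) ;;
  scan vSRowN heavyNear ;; scan vSRow memberNear ;;
  .ite (.nlt (.lit 0) (nv vok)) addMember .skip

/-- Both scans see all relevant points: 4 r_t = 8 r_{t+1} and 6 r_t are below the list radius of 12,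
and members are net points. -/
theorem tryMember_spec {S : Tables V} {ℓ : ℕ} (hV : S.Valid ℓ) {σ : State V} {t j x : ℕ}
    (hU : AtUpdate S t j σ) {K : Finset (ℕ × ℕ)} (hK : IndRep S K σ)
    (hnet : ∀ y, (t, y) ∈ K → S.IsNet t y) (hx : σ.nat vx 0 = x) (hxm : x < S.m) :
    WP tryMember σ fun τ σ' => τ ≤ ℓ * 200 + 300 ∧
      (((S.Eligible (σ.nat aBal) t x ∧
          ∀ y, (t, y) ∈ K → 6 * (S.top / 2 ^ t) < dist (S.F x) (S.F y)) ∧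
        IndRep S (insert (t, x) K) σ') ∨
      (¬ (S.Eligible (σ.nat aBal) t x ∧
          ∀ y, (t, y) ∈ K → 6 * (S.top / 2 ^ t) < dist (S.F x) (S.F y)) ∧
        IndRep S K σ')) := by
  have hr : 0 < S.top / 2 ^ t := by have := hV.top_pos; positivity
  unfold tryMember
  rw [wp_seq, wp_nset, wp_seq]
  set σ₀ : State V := setNat σ vok 0 1 with hσ₀
  have hU₀ : AtUpdate S t j σ₀ := hU.agree (agree_nlet σ (a := vok) (x := 1)) (by decide)
  have hx₀ : σ₀.nat vx 0 = x := by simp [hσ₀, hx]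
  have h₁ : WP (.ite (light vRow vSRow rr vx) (nlet vok (.lit 0)) .skip) σ₀ fun τ σ₁ => τ ≤ 30 ∧
      (σ₁.nat vok 0 ≠ 0 ↔ S.HeavyAt (σ.nat aBal) t x) := by
    have hl := holds_light hU₀.loaded hU₀.level.row hU₀.level.srow hU₀.level.rad hx₀
    have hb : σ₀.nat aBal = σ.nat aBal := by simp [hσ₀]
    rw [hb] at hl
    refine WP.ite (fun hb => ?_) (fun hb => ?_)
    · rw [hl] at hb; simp [light, hb]
    · rw [hl, not_not] at hb; simp [light, hb, hσ₀]
  change WP _ σ₀ _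
  refine h₁.mono fun τ₁ σ₁ hag₁ h₁ => ?_
  obtain ⟨hτ₁, hok₁⟩ := h₁
  have hU₁ := hU₀.agree hag₁ (by decide)
  have hx₁ : σ₁.nat vx 0 = x := by rw [hag₁.nat vx (by decide), hx₀]
  have hB₁ : σ₁.nat aBal = σ.nat aBal := by rw [hag₁.nat aBal (by decide)]; simp [hσ₀]
  have hK₁ : IndRep S K σ₁ := by
    refine hK.of_eq fun a ha => ?_
    rw [hag₁.nat a (by revert a; decide)]
    exact write_other _ (by revert a; decide) _ _
  rw [wp_seq]
  have h₂ : WP (.ite (.rlt (.lit 0) (.cell rF (.cell aG (.add (nv vSRow) (nv vx))))) .skip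
      (nlet vok (.lit 0))) σ₁ fun τ σ₂ => τ ≤ 30 ∧
      (σ₂.nat vok 0 ≠ 0 ↔ S.HeavyAt (σ.nat aBal) t x ∧ 0 < S.f (S.cheap t x)) := by
    have hl : (BExp.rlt (.lit 0) (.cell rF (.cell aG (.add (nv vSRow) (nv vx))))).Holds σ₁ ↔
        0 < S.f (S.cheap t x) := by
      simp [hU₁.level.srow, hx₁, hU₁.loaded.g, hU₁.loaded.f, Tables.cheap, Tables.idx]
    refine WP.ite (fun hb => ?_) (fun hb => ?_)
    · rw [hl] at hb
      rw [wp_skip]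
      exact ⟨by simp, by rw [hok₁]; simp [hb]⟩
    · rw [hl] at hb; simp [hb]
  refine h₂.mono fun τ₂ σ₂ hag₂ h₂ => ?_
  obtain ⟨hτ₂, hok₂⟩ := h₂
  have hU₂ := hU₁.agree hag₂ (by decide)
  have hx₂ : σ₂.nat vx 0 = x := by rw [hag₂.nat vx (by decide), hx₁]
  have hB₂ : σ₂.nat aBal = σ.nat aBal := by rw [hag₂.nat aBal (by decide), hB₁]
  have hK₂ : IndRep S K σ₂ :=
    hK₁.of_eq fun a ha => hag₂.nat a (by revert a; decide)
  rw [wp_seq]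
  have hr' : S.top / 2 ^ (t + 1) = (S.top / 2 ^ t) / 2 := by rw [pow_succ]; field_simp
  refine (scan_spec hV hU₂.loaded (srow := vSRowN) (t := t + 1) (test := heavyNear)
    (by decide) (by decide) hU₂.level.srowN hx₂ hxm
    (fun y => dist (S.F x) (S.F y) ≤ 4 * (S.top / 2 ^ t) ∧ S.HeavyAt (σ.nat aBal) (t + 1) y)
    ?_).mono ?_
  · intro σ' y hag hym _ hy
    have hU' := hU₂.agree hag (by decide)
    have hx' : σ'.nat vx 0 = x := by rw [hag.nat vx (by decide), hx₂]
    have hB' : σ'.nat aBal = σ.nat aBal := by rw [hag.nat aBal (by decide), hB₂]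
    have hl := holds_light hU'.loaded hU'.level.rowN hU'.level.srowN hU'.level.radN hy
    rw [heavyNear, BExp.holds_and, BExp.holds_not, BExp.holds_not, hl, hB']
    simp [hU'.level.rad, hx', hy, hU'.loaded.F x hxm, hU'.loaded.F y hym, ptDist_some]
  rintro τ₃ σ₃ hag₃ ⟨hτ₃, hok₃⟩
  have hU₃ := hU₂.agree hag₃ (by decide)
  have hx₃ : σ₃.nat vx 0 = x := by rw [hag₃.nat vx (by decide), hx₂]
  have hK₃ : IndRep S K σ₃ := hK₂.of_eq fun a ha => hag₃.nat a (by revert a; decide)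
  have hel : σ₃.nat vok 0 ≠ 0 ↔ S.Eligible (σ.nat aBal) t x := by
    rw [hok₃, hok₂, and_assoc]
    refine and_congr_right fun _ => and_congr_right fun _ => ?_
    constructor
    · intro h y hy hny hd hh
      obtain ⟨k, hk1, hk2, rfl⟩ := hV.lst_complete (t + 1) x y hxm hy hny (by rw [hr']; linarith)
      exact h k hk1 hk2 ⟨hd, hh⟩
    · intro h k hk1 hk2 ⟨hd, hh⟩
      exact h _ (hV.lst_lt _ _ _ hxm hk1 hk2) (hV.lst_net _ _ _ hxm hk1 hk2) hd hh
  rw [wp_seq]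
  refine (scan_spec hV hU₃.loaded (srow := vSRow) (t := t) (test := memberNear)
    (by decide) (by decide) hU₃.level.srow hx₃ hxm
    (fun y => dist (S.F x) (S.F y) ≤ 6 * (S.top / 2 ^ t) ∧ (t, y) ∈ K)
    ?_).mono ?_
  · intro σ' y hag hym _ hy
    have hU' := hU₃.agree hag (by decide)
    have hx' : σ'.nat vx 0 = x := by rw [hag.nat vx (by decide), hx₃]
    have hI : σ'.nat aInd (t * S.m + y) = if (t, y) ∈ K then 1 else 0 := by
      rw [hag.nat aInd (by decide), hK₃.ind t y hym]
    rw [memberNear, BExp.holds_and, BExp.holds_not]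
    simp [hU'.level.rad, hU'.level.row, hx', hy, hU'.loaded.F x hxm, hU'.loaded.F y hym,
      ptDist_some, hI]
    intro _
    split_ifs <;> simp [*]
  rintro τ₄ σ₄ hag₄ ⟨hτ₄, hok₄⟩
  have hU₄ := hU₃.agree hag₄ (by decide)
  have hx₄ : σ₄.nat vx 0 = x := by rw [hag₄.nat vx (by decide), hx₃]
  have hK₄ : IndRep S K σ₄ := hK₃.of_eq fun a ha => hag₄.nat a (by revert a; decide)
  have hall : σ₄.nat vok 0 ≠ 0 ↔ S.Eligible (σ.nat aBal) t x ∧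
      ∀ y, (t, y) ∈ K → 6 * (S.top / 2 ^ t) < dist (S.F x) (S.F y) := by
    rw [hok₄, hel]
    refine and_congr_right fun _ => ?_
    constructor
    · intro h y hy
      by_contra! hd
      obtain ⟨k, hk1, hk2, rfl⟩ := hV.lst_complete t x y hxm (hK.lt _ hy) (hnet y hy) (by linarith)
      exact h k hk1 hk2 ⟨hd, hy⟩
    · intro h k hk1 hk2 ⟨hd, hh⟩
      exact absurd hd (not_le.2 (h _ hh))
  refine WP.ite (fun hb => ?_) (fun hb => ?_)
  · have hb' : σ₄.nat vok 0 ≠ 0 := by simpa [Nat.pos_iff_ne_zero] using hb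
    rw [hall] at hb'
    refine (addMember_spec hU₄ hK₄ hx₄ hxm fun hmem => ?_).mono ?_
    · have := hb'.2 x hmem
      rw [dist_self] at this
      linarith
    · rintro τ₅ σ₅ - ⟨hτ₅, h⟩
      refine ⟨?_, .inl ⟨hb', h⟩⟩
      simp only [NExp.cost, BExp.cost]; omega
  · have hb' : ¬ σ₄.nat vok 0 ≠ 0 := by simpa using hb
    rw [hall] at hb'
    rw [wp_skip]
    refine ⟨?_, .inr ⟨hb', hK₄⟩⟩
    simp only [NExp.cost, BExp.cost]; omega

theorem AtUpdate.setVx {S : Tables V} {t j : ℕ} {σ : State V} (h : AtUpdate S t j σ) (x : ℕ) :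
    AtUpdate S t j (setNat σ vx 0 x) :=
  h.agree (agree_nlet σ) (by decide : KeepsUpdate (nlet vx (.lit 0)))

/-- Remove the members near the facility in `vJ`. -/
def removeMembers : Cmd :=
  forLoop vk (listLo vSRow vJ) (listHi vSRow vJ)
    (nlet vx (.cell aLst (nv vk)) ;;
      .ite (.and (.not (.rlt (.mul (.lit 6) (rv rr)) (.dist pFac (nv vx) pFac (nv vJ))))
        (.nlt (.lit 0) (.cell aInd (.add (nv vRow) (nv vx))))) dropMember .skip)

/-- Add members near the facility in `vJ`. -/
def addMembers : Cmd :=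
  forLoop vk (listLo vSRow vJ) (listHi vSRow vJ) (nlet vx (.cell aLst (nv vk)) ;; tryMember)

theorem eval_listLo {S : Tables V} {σ : State V} {t j : ℕ} (hU : AtUpdate S t j σ) :
    (listLo vSRow vJ).eval σ = S.st (S.idx t j) := by
  simp [listLo, hU.loaded.st, hU.level.srow, hU.vJ_eq, Tables.idx]

theorem eval_listHi {S : Tables V} {σ : State V} {t j : ℕ} (hU : AtUpdate S t j σ) :
    (listHi vSRow vJ).eval σ = S.st (S.idx t j + 1) := by
  simp [listHi, hU.loaded.st, hU.level.srow, hU.vJ_eq, Tables.idx]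

open Classical in
theorem removeMembers_spec {S : Tables V} {ℓ : ℕ} (hV : S.Valid ℓ) {σ : State V} {t j : ℕ}
    (hU : AtUpdate S t j σ) (hj : j < S.m) {K : Finset (ℕ × ℕ)} (hK : IndRep S K σ)
    (hnet : ∀ y, (t, y) ∈ K → S.IsNet t y) :
    WP removeMembers σ fun τ σ' => τ ≤ ℓ * 150 + 50 ∧
      IndRep S (K.filter fun p => ¬ (p.1 = t ∧ dist (S.F p.2) (S.F j) ≤ 6 * (S.top / 2 ^ t))) σ' := by
  have hr : 0 < S.top / 2 ^ t := by have := hV.top_pos; positivity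
  set a := S.st (S.idx t j) with ha
  set b := S.st (S.idx t j + 1) with hb
  refine WP.forLoop_bounded a b 120 (hV.st_le t j hj) (by decide) (eval_listLo hU)
    (fun σ' hag => eval_listHi (hU.agree hag (by decide)))
    (fun k σ' => IndRep S (K.filter fun p => ¬ (p.1 = t ∧
      dist (S.F p.2) (S.F j) ≤ 6 * (S.top / 2 ^ t) ∧ ∃ k', a ≤ k' ∧ k' < k ∧ S.lst k' = p.2)) σ')
    ?_ ?_ ?_
  · rw [Finset.filter_true_of_mem]
    · exact hK.of_eq fun i hi => write_other _ (by revert i; decide) _ _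
    · rintro p - ⟨-, -, k', h1, h2, -⟩; omega
  · intro k σ' hak hkb hk hag hI
    have hU' := hU.agree hag (by decide)
    set x := S.lst k with hx
    have hxm : x < S.m := hV.lst_lt t j k hj hak hkb
    rw [wp_seq, wp_nset]
    have hval : (NExp.cell aLst (nv vk)).eval σ' = x := by simp [hk, hU'.loaded.lst, hx]
    rw [hval]
    set σ₁ : State V := setNat σ' vx 0 x with hσ₁
    change WP _ σ₁ _
    have hU₁ : AtUpdate S t j σ₁ := hU'.setVx x
    have hx₁ : σ₁.nat vx 0 = x := by simp [hσ₁]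
    set Kk := K.filter fun p => ¬ (p.1 = t ∧
      dist (S.F p.2) (S.F j) ≤ 6 * (S.top / 2 ^ t) ∧ ∃ k', a ≤ k' ∧ k' < k ∧ S.lst k' = p.2) with hKk
    have hI₁ : IndRep S Kk σ₁ := hI.of_eq fun i hi => write_other _ (by revert i; decide) _ _
    have htest : (BExp.and (.not (.rlt (.mul (.lit 6) (rv rr)) (.dist pFac (nv vx) pFac (nv vJ))))
        (.nlt (.lit 0) (.cell aInd (.add (nv vRow) (nv vx))))).Holds σ₁ ↔
        dist (S.F x) (S.F j) ≤ 6 * (S.top / 2 ^ t) ∧ (t, x) ∈ Kk := by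
      rw [BExp.holds_and, BExp.holds_not]
      simp [hU₁.level.rad, hU₁.level.row, hx₁, hU₁.loaded.F x hxm, hU₁.loaded.F j hj,
        ptDist_some, hI₁.ind t x hxm, hU₁.vJ_eq]
      intro _
      split_ifs with h <;> simp [h]
    have hstep : ∀ p ∈ K, ((p.1 = t ∧ dist (S.F p.2) (S.F j) ≤ 6 * (S.top / 2 ^ t) ∧
        ∃ k', a ≤ k' ∧ k' < k + 1 ∧ S.lst k' = p.2) ↔
        (p.1 = t ∧ dist (S.F p.2) (S.F j) ≤ 6 * (S.top / 2 ^ t) ∧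
          ∃ k', a ≤ k' ∧ k' < k ∧ S.lst k' = p.2) ∨
        (p = (t, x) ∧ dist (S.F x) (S.F j) ≤ 6 * (S.top / 2 ^ t))) := by
      rintro ⟨p1, p2⟩ -
      constructor
      · rintro ⟨h1, h2, k', h3, h4, h5⟩
        rcases Nat.lt_succ_iff_lt_or_eq.1 h4 with h6 | rfl
        · exact .inl ⟨h1, h2, k', h3, h6, h5⟩
        · dsimp only at h1 h2 h5
          refine .inr ⟨by rw [h1, ← h5], by rw [hx, h5]; exact h2⟩
      · rintro (⟨h1, h2, k', h3, h4, h5⟩ | ⟨h1, h2⟩)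
        · exact ⟨h1, h2, k', h3, by omega, h5⟩
        · obtain ⟨rfl, rfl⟩ := Prod.mk.inj h1
          exact ⟨rfl, h2, k, hak, by omega, rfl⟩
    have hset : (K.filter fun p => ¬ (p.1 = t ∧
      dist (S.F p.2) (S.F j) ≤ 6 * (S.top / 2 ^ t) ∧ ∃ k', a ≤ k' ∧ k' < k + 1 ∧ S.lst k' = p.2)) =
      Kk.filter fun p => ¬ (p = (t, x) ∧ dist (S.F x) (S.F j) ≤ 6 * (S.top / 2 ^ t)) := by
      rw [hKk, Finset.filter_filter]
      refine Finset.filter_congr fun p hp => ?_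
      rw [hstep p hp, not_or]
    rw [hset]
    refine WP.ite (fun hb => ?_) (fun hb => ?_)
    · obtain ⟨h1, h2⟩ := htest.1 hb
      refine (dropMember_spec hU₁ hI₁ hx₁ h2).mono ?_
      rintro τ σ₂ - ⟨hτ, h3⟩
      refine ⟨by simp only [NExp.cost, RExp.cost, BExp.cost]; omega, ?_⟩
      have : (Kk.filter fun p => ¬ (p = (t, x) ∧ dist (S.F x) (S.F j) ≤ 6 * (S.top / 2 ^ t))) =
          Kk.erase (t, x) := by
        ext p; simp [h1, and_comm]
      rw [this]
      exact h3.of_eq fun i hi => write_other _ (by revert i; decide) _ _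
    · rw [wp_skip]
      refine ⟨by simp only [NExp.cost, RExp.cost, BExp.cost]; omega, ?_⟩
      rw [Finset.filter_true_of_mem]
      · exact hI₁.of_eq fun i hi => write_other _ (by revert i; decide) _ _
      · rintro p hp ⟨rfl, h⟩
        exact hb (htest.2 ⟨h, hp⟩)
  · intro τ σ' hτ _ _ hI
    refine ⟨?_, ?_⟩
    · have h5 := hV.st_le_add t j hj
      simp only [listLo, listHi, NExp.cost] at hτ
      have : b - a ≤ ℓ := by omega
      have := Nat.mul_le_mul_right 150 this
      omega
    · refine (congrArg (IndRep S · σ') (Finset.filter_congr fun p hp => ?_)).mp hI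
      rw [not_iff_not, Iff.comm]
      constructor
      · rintro ⟨h1, h2⟩
        obtain ⟨p1, p2⟩ := p
        dsimp only at h1 h2
        subst h1
        obtain ⟨k, h3, h4, h5⟩ := hV.lst_complete p1 j p2 hj (hK.lt _ hp) (hnet _ hp)
          (by rw [dist_comm]; linarith)
        exact ⟨rfl, h2, k, h3, h4, h5⟩
      · rintro ⟨h1, h2, -⟩
        exact ⟨h1, h2⟩

/-- Greedy insertion: a listed eligible point either becomes a member or is rejected because a
member lies within six radii. Members are only added, so this remains true until the end. -/
theorem addMembers_spec {S : Tables V} {ℓ : ℕ} (hV : S.Valid ℓ) {σ : State V} {t j : ℕ}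
    (hU : AtUpdate S t j σ) (hj : j < S.m) {K : Finset (ℕ × ℕ)} (hK : IndRep S K σ)
    (hnet : ∀ y, (t, y) ∈ K → S.IsNet t y)
    (hel : ∀ y, (t, y) ∈ K → S.Eligible (σ.nat aBal) t y)
    (hsep : ∀ x y, (t, x) ∈ K → (t, y) ∈ K → x ≠ y →
      6 * (S.top / 2 ^ t) < dist (S.F x) (S.F y)) :
    WP addMembers σ fun τ σ' => τ ≤ ℓ * (ℓ * 200 + 350) + 50 ∧ ∃ K', IndRep S K' σ' ∧ K ⊆ K' ∧
      (∀ p ∈ K', p ∉ K → p.1 = t) ∧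
      (∀ y, (t, y) ∈ K' → S.IsNet t y) ∧
      (∀ y, (t, y) ∈ K' → S.Eligible (σ.nat aBal) t y) ∧
      (∀ x y, (t, x) ∈ K' → (t, y) ∈ K' → x ≠ y →
        6 * (S.top / 2 ^ t) < dist (S.F x) (S.F y)) ∧
      ∀ k, S.st (S.idx t j) ≤ k → k < S.st (S.idx t j + 1) →
        S.Eligible (σ.nat aBal) t (S.lst k) →
        ∃ y, (t, y) ∈ K' ∧ dist (S.F (S.lst k)) (S.F y) ≤ 6 * (S.top / 2 ^ t) := by
  have hr : 0 < S.top / 2 ^ t := by have := hV.top_pos; positivity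
  set a := S.st (S.idx t j) with ha
  set b := S.st (S.idx t j + 1) with hb
  refine WP.forLoop_bounded a b (ℓ * 200 + 320) (hV.st_le t j hj) (by decide) (eval_listLo hU)
    (fun σ' hag => eval_listHi (hU.agree hag (by decide)))
    (fun k σ' => ∃ K', IndRep S K' σ' ∧ K ⊆ K' ∧
      (∀ p ∈ K', p ∉ K → p.1 = t) ∧
      (∀ y, (t, y) ∈ K' → S.IsNet t y) ∧
      (∀ y, (t, y) ∈ K' → S.Eligible (σ.nat aBal) t y) ∧
      (∀ x y, (t, x) ∈ K' → (t, y) ∈ K' → x ≠ y →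
        6 * (S.top / 2 ^ t) < dist (S.F x) (S.F y)) ∧
      ∀ k', a ≤ k' → k' < k → S.Eligible (σ.nat aBal) t (S.lst k') →
        ∃ y, (t, y) ∈ K' ∧ dist (S.F (S.lst k')) (S.F y) ≤ 6 * (S.top / 2 ^ t))
    ?_ ?_ ?_
  · exact ⟨K, hK.of_eq fun i hi => write_other _ (by revert i; decide) _ _, subset_rfl,
      fun p h h' => absurd h h', hnet, hel, hsep, fun k' h1 h2 => by omega⟩
  · rintro k σ' hak hkb hk hag ⟨K', hI, hsub, hnew, hnet', hel', hsep', hcov⟩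
    have hU' := hU.agree hag (by decide)
    set x := S.lst k with hx
    have hxm : x < S.m := hV.lst_lt t j k hj hak hkb
    rw [wp_seq, wp_nset]
    have hval : (NExp.cell aLst (nv vk)).eval σ' = x := by simp [hk, hU'.loaded.lst, hx]
    rw [hval]
    set σ₁ : State V := setNat σ' vx 0 x with hσ₁
    change WP _ σ₁ _
    have hU₁ : AtUpdate S t j σ₁ := hU'.setVx x
    have hx₁ : σ₁.nat vx 0 = x := by simp [hσ₁]
    have hI₁ : IndRep S K' σ₁ := hI.of_eq fun i hi => write_other _ (by revert i; decide) _ _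
    have hB₁ : σ₁.nat aBal = σ.nat aBal := by
      have : σ₁.nat aBal = σ'.nat aBal := by simp [hσ₁]
      rw [this, hag.nat aBal (by decide)]
    refine (tryMember_spec hV hU₁ hI₁ hnet' hx₁ hxm).mono ?_
    rw [hB₁]
    rintro τ σ₂ - ⟨hτ, ⟨⟨he, hd⟩, hI₂⟩ | ⟨hne, hI₂⟩⟩
    · refine ⟨by simp only [NExp.cost]; omega, insert (t, x) K',
        hI₂.of_eq fun i hi => write_other _ (by revert i; decide) _ _, ?_, ?_, ?_, ?_, ?_, ?_⟩
      · exact hsub.trans (Finset.subset_insert _ _)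
      · intro p hp hpK
        rcases Finset.mem_insert.1 hp with rfl | hp
        exacts [rfl, hnew p hp hpK]
      · intro y hy
        rcases Finset.mem_insert.1 hy with h | hy
        · obtain ⟨-, rfl⟩ := Prod.mk.inj h; exact hV.lst_net t j k hj hak hkb
        · exact hnet' y hy
      · intro y hy
        rcases Finset.mem_insert.1 hy with h | hy
        · obtain ⟨-, rfl⟩ := Prod.mk.inj h; exact he
        · exact hel' y hy
      · intro y z hy hz hyz
        rcases Finset.mem_insert.1 hy with h | hy <;> rcases Finset.mem_insert.1 hz with h' | hz
        · obtain ⟨-, rfl⟩ := Prod.mk.inj h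
          obtain ⟨-, rfl⟩ := Prod.mk.inj h'
          exact absurd rfl hyz
        · obtain ⟨-, rfl⟩ := Prod.mk.inj h
          exact hd z hz
        · obtain ⟨-, rfl⟩ := Prod.mk.inj h'
          rw [dist_comm]; exact hd y hy
        · exact hsep' y z hy hz hyz
      · intro k' h1 h2 h3
        rcases Nat.lt_succ_iff_lt_or_eq.1 h2 with h4 | rfl
        · obtain ⟨y, h5, h6⟩ := hcov k' h1 h4 h3
          exact ⟨y, Finset.mem_insert_of_mem h5, h6⟩
        · exact ⟨x, Finset.mem_insert_self _ _, by rw [← hx, dist_self]; positivity⟩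
    · refine ⟨by simp only [NExp.cost]; omega, K',
        hI₂.of_eq fun i hi => write_other _ (by revert i; decide) _ _, hsub, hnew, hnet', hel',
        hsep', ?_⟩
      intro k' h1 h2 h3
      rcases Nat.lt_succ_iff_lt_or_eq.1 h2 with h4 | rfl
      · exact hcov k' h1 h4 h3
      · by_contra! hcon
        exact hne ⟨h3, hcon⟩
  · intro τ σ' hτ _ _ hI
    refine ⟨?_, hI⟩
    have h5 := hV.st_le_add t j hj
    simp only [listLo, listHi, NExp.cost] at hτ
    exact hτ.trans (Nat.add_le_add (Nat.mul_le_mul (by omega) (by omega)) (by omega))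

/-! ### One update of the data structure -/

/-- Restore the maximality of the set of members at one scale. -/
def memberBody : Cmd := removeMembers ;; addMembers

/-- The effect of adding or removing a client at the facility in `vJ`, counted at the scales up to
the one in `vL`. -/
def change : Cmd := countAll ;; levels memberBody

/-- The dynamic data structure is right for the clients `M`. -/
structure Maintained (S : Tables V) (M : Multiset (ℕ × ℕ)) (σ : State V) : Prop where
  counts : Counts S M σ
  members : ∃ K, IndRep S K σ ∧ ∀ t, S.MaxSep (σ.nat aBal) K t

theorem Maintained.of_eq {S : Tables V} {M : Multiset (ℕ × ℕ)} {σ σ' : State V}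
    (h : Maintained S M σ)
    (hn : ∀ a ∈ [aBal, aCnt, aInd, aRef, aOpen, aPos, aLen], σ'.nat a = σ.nat a)
    (hr : σ'.real rPay = σ.real rPay) : Maintained S M σ' := by
  obtain ⟨h1, K, h2, h3⟩ := h
  refine ⟨h1.of_eq (hn _ (by simp)) (hn _ (by simp)) hr, K, h2.of_eq fun a ha => hn a ?_, ?_⟩
  · simp at ha ⊢; tauto
  · rw [hn aBal (by simp)]; exact h3

theorem heavyAt_congr (S : Tables V) {bal bal' : ℕ → ℕ} {t x : ℕ}
    (h : bal' (t * S.m + x) = bal (t * S.m + x)) : S.HeavyAt bal' t x ↔ S.HeavyAt bal t x := by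
  simp [Tables.HeavyAt, Heavy, h]

/-- Eligibility of `x` depends on the heaviness of `x` and of net points of scale `t + 1` within 4
r_t. A point of the latter kind whose count changed is within 3 r_{t+1} = 1.5 r_t of `j`, which
would put `x` within 5.5 r_t of `j`. -/
theorem eligible_congr {S : Tables V} (hr : 0 < S.top) {bal bal' : ℕ → ℕ} {l j : ℕ}
    (hun : ∀ t x, x < S.m → S.IsNet t x →
      ¬ (t ≤ l ∧ dist (S.F x) (S.F j) ≤ 3 * (S.top / 2 ^ t)) →
        bal' (t * S.m + x) = bal (t * S.m + x))
    {t x : ℕ} (hx : x < S.m) (hn : S.IsNet t x)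
    (hd : t ≤ l → 6 * (S.top / 2 ^ t) < dist (S.F x) (S.F j)) :
    S.Eligible bal' t x ↔ S.Eligible bal t x := by
  have hr0 : 0 < S.top / 2 ^ t := by positivity
  have hr' : S.top / 2 ^ (t + 1) = (S.top / 2 ^ t) / 2 := by rw [pow_succ]; field_simp
  have h1 : S.HeavyAt bal' t x ↔ S.HeavyAt bal t x := by
    refine heavyAt_congr S (hun t x hx hn ?_)
    rintro ⟨h1, h2⟩
    have := hd h1
    linarith
  refine and_congr h1 (and_congr_right fun _ => forall_congr' fun y => forall_congr' fun hy =>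
    forall_congr' fun hny => forall_congr' fun hxy => not_congr (heavyAt_congr S (hun _ y hy hny ?_)))
  rintro ⟨h2, h3⟩
  have h4 := hd (by omega)
  have h5 := dist_triangle (S.F x) (S.F y) (S.F j)
  rw [hr'] at h3
  linarith

/-- Members farther than six radii from `j` stay eligible and are kept. An eligible net point within
twelve radii of `j` is handled by the greedy pass. One farther away was eligible before, hence
covered by an old member within six radii; that member is more than 12 - 6 radii from `j` and was
not removed. -/
theorem memberBody_spec {S : Tables V} {ℓ : ℕ} (hV : S.Valid ℓ) {bal bal' : ℕ → ℕ} {l j : ℕ}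
    (hun : ∀ t x, x < S.m → S.IsNet t x →
      ¬ (t ≤ l ∧ dist (S.F x) (S.F j) ≤ 3 * (S.top / 2 ^ t)) →
        bal' (t * S.m + x) = bal (t * S.m + x))
    {σ : State V} {t : ℕ} (hU : AtUpdate S t j σ) (hj : j < S.m) (hb : σ.nat aBal = bal')
    {K : Finset (ℕ × ℕ)} (hK : IndRep S K σ) (hmax : S.MaxSep bal K t) :
    WP memberBody σ fun τ σ' => τ ≤ ℓ * (ℓ * 200 + 500) + 100 ∧ ∃ K', IndRep S K' σ' ∧
      S.MaxSep bal' K' t ∧ ∀ p, p.1 ≠ t → (p ∈ K' ↔ p ∈ K) := by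
  classical
  have hr : 0 < S.top / 2 ^ t := by have := hV.top_pos; positivity
  unfold memberBody
  rw [wp_seq]
  refine (removeMembers_spec hV hU hj hK hmax.isNet).mono ?_
  rintro τ₁ σ₁ hag₁ ⟨hτ₁, hK₁⟩
  have hb₁ : σ₁.nat aBal = bal' := by rw [hag₁.nat aBal (by decide), hb]
  set K₁ := K.filter fun p => ¬ (p.1 = t ∧ dist (S.F p.2) (S.F j) ≤ 6 * (S.top / 2 ^ t)) with hK₁d
  have hmem₁ : ∀ y, (t, y) ∈ K₁ ↔ (t, y) ∈ K ∧ 6 * (S.top / 2 ^ t) < dist (S.F y) (S.F j) := by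
    intro y; simp [hK₁d]
  refine (addMembers_spec hV (hU.agree hag₁ (by decide)) hj hK₁
    (fun y hy => hmax.isNet y ((hmem₁ y).1 hy).1) (fun y hy => ?_)
    (fun x y hx hy => hmax.sep x y ((hmem₁ x).1 hx).1 ((hmem₁ y).1 hy).1)).mono ?_
  · obtain ⟨h1, h2⟩ := (hmem₁ y).1 hy
    rw [hb₁, eligible_congr hV.top_pos hun (hmax.lt y h1) (hmax.isNet y h1) fun _ => h2]
    exact hmax.elig y h1
  rintro τ₂ σ₂ hag₂ ⟨hτ₂, K', hK', hsub, hnew, hnet, hel, hsep, hcov⟩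
  rw [hb₁] at hel hcov
  refine ⟨?_, K', hK', ⟨fun x hx => hK'.lt _ hx, hnet, hel, hsep, ?_⟩, ?_⟩
  · have : ℓ * (ℓ * 200 + 500) = ℓ * (ℓ * 200 + 350) + ℓ * 150 := by ring
    omega
  · intro x hx hn he
    by_cases hd : dist (S.F j) (S.F x) ≤ 12 * (S.top / 2 ^ t)
    · obtain ⟨k, h1, h2, rfl⟩ := hV.lst_complete t j x hj hx hn hd
      exact hcov k h1 h2 he
    · rw [dist_comm] at hd
      have he' : S.Eligible bal t x :=
        (eligible_congr hV.top_pos hun hx hn fun _ => by linarith).1 he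
      obtain ⟨y, h1, h2⟩ := hmax.max x hx hn he'
      refine ⟨y, hsub ((hmem₁ y).2 ⟨h1, ?_⟩), h2⟩
      have := dist_triangle (S.F x) (S.F y) (S.F j)
      linarith
  · intro p hp
    constructor
    · intro h
      by_contra hpK
      refine hp (hnew p h fun h' => hpK (Finset.mem_filter.1 h').1)
    · intro h
      exact hsub (Finset.mem_filter.2 ⟨h, fun h' => hp h'.1⟩)

theorem MaxSep_congr {S : Tables V} {bal bal' : ℕ → ℕ} {K K' : Finset (ℕ × ℕ)} {t : ℕ}
    (h : S.MaxSep bal K t) (hK : ∀ x, (t, x) ∈ K' ↔ (t, x) ∈ K)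
    (he : ∀ x < S.m, S.IsNet t x → (S.Eligible bal' t x ↔ S.Eligible bal t x)) :
    S.MaxSep bal' K' t := by
  obtain ⟨h1, h2, h3, h4, h5⟩ := h
  refine ⟨fun x hx => h1 x ((hK x).1 hx), fun x hx => h2 x ((hK x).1 hx), fun x hx => ?_,
    fun x y hx hy => h4 x y ((hK x).1 hx) ((hK y).1 hy), fun x hx hn hel => ?_⟩
  · have hx' := (hK x).1 hx
    exact (he x (h1 x hx') (h2 x hx')).2 (h3 x hx')
  · obtain ⟨y, h6, h7⟩ := h5 x hx hn ((he x hx hn).1 hel)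
    exact ⟨y, (hK y).2 h6, h7⟩

/-- Eligibility depends on the counts alone, and these are final before this sweep starts. So the
scales are repaired independently of each other, and beyond scale `l` nothing has to be done. -/
theorem memberLevels_spec {S : Tables V} {ℓ : ℕ} (hV : S.Valid ℓ) {bal bal' : ℕ → ℕ} {l j : ℕ}
    (hun : ∀ t x, x < S.m → S.IsNet t x →
      ¬ (t ≤ l ∧ dist (S.F x) (S.F j) ≤ 3 * (S.top / 2 ^ t)) →
        bal' (t * S.m + x) = bal (t * S.m + x))
    {σ : State V} (hS : S.Loaded σ) (hvJ : σ.nat vJ 0 = j) (hj : j < S.m) (hl : σ.nat vL 0 = l)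
    (hb : σ.nat aBal = bal') {K : Finset (ℕ × ℕ)} (hK : IndRep S K σ)
    (hmax : ∀ t, S.MaxSep bal K t) :
    WP (levels memberBody) σ fun τ σ' => τ ≤ (l + 1) * (ℓ * (ℓ * 200 + 500) + 160) + 60 ∧
      ∃ K', IndRep S K' σ' ∧ ∀ t, S.MaxSep bal' K' t := by
  refine levels_spec hS l (ℓ * (ℓ * 200 + 500) + 100) hl (by decide) (by decide) (by decide)
    (fun s σ' => ∃ K', IndRep S K' σ' ∧ (∀ t < s, S.MaxSep bal' K' t) ∧
      ∀ t, s ≤ t → S.MaxSep bal K' t) ?_ ?_ ?_ ?_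
  · rintro t σ₁ σ₂ hag ⟨K', h1, h2⟩
    exact ⟨K', h1.of_eq fun a ha => hag.nat a (by revert a; decide), h2⟩
  · exact ⟨K, hK, fun t ht => by omega, fun t _ => hmax t⟩
  · rintro t σ₁ htl hag hS₁ hat ⟨K', h1, h2, h3⟩
    refine (memberBody_spec hV hun ⟨hS₁, hat, ?_⟩ hj ?_ h1 (h3 t le_rfl)).mono ?_
    · rw [hag.nat vJ (by decide), hvJ]
    · rw [hag.nat aBal (by decide), hb]
    · rintro τ σ₂ - ⟨hτ, K₂, h4, h5, h6⟩
      refine ⟨hτ, K₂, h4, fun t' ht' => ?_, fun t' ht' => ?_⟩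
      · rcases Nat.lt_succ_iff_lt_or_eq.1 ht' with h7 | rfl
        · exact MaxSep_congr (h2 t' h7) (fun x => h6 (t', x) (by simp; omega)) fun _ _ _ => Iff.rfl
        · exact h5
      · exact MaxSep_congr (h3 t' (by omega)) (fun x => h6 (t', x) (by simp; omega))
          fun _ _ _ => Iff.rfl
  · rintro τ σ₁ hτ hag hS₁ - ⟨K', h1, h2, h3⟩
    refine ⟨by linarith, K', h1, fun t => ?_⟩
    by_cases ht : t < l + 1
    · exact h2 t ht
    · exact MaxSep_congr (h3 t (by omega)) (fun _ => Iff.rfl)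
        fun x hx hn => eligible_congr hV.top_pos hun hx hn fun h => by omega

theorem change_spec {S : Tables V} {ℓ : ℕ} (hV : S.Valid ℓ) {σ : State V} (hS : S.Loaded σ)
    {j l inc dec : ℕ} (hj : σ.nat vJ 0 = j) (hjm : j < S.m) (hl : σ.nat vL 0 = l)
    (hinc : σ.nat vInc 0 = inc) (hdec : σ.nat vDec 0 = dec) {M M' : Multiset (ℕ × ℕ)}
    (hM : Change inc dec (j, l) M M') (hC : Maintained S M σ) :
    WP change σ fun τ σ' => τ ≤ (l + 1) * ((ℓ + 1) ^ 2 * 1000) ∧ Maintained S M' σ' := by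
  obtain ⟨hcounts, K, hK, hmax⟩ := hC
  unfold change
  rw [wp_seq]
  refine (countAll_spec hV hS hj hjm hl hinc hdec hM hcounts).mono ?_
  rintro τ₁ σ₁ hag₁ ⟨hτ₁, hcounts₁, hun⟩
  refine (memberLevels_spec hV hun (hS.agree hag₁ (by decide))
    (by rw [hag₁.nat vJ (by decide), hj]) hjm (by rw [hag₁.nat vL (by decide), hl]) rfl
    (hK.of_eq fun a ha => hag₁.nat a (by revert a; decide)) hmax).mono ?_
  rintro τ₂ σ₂ hag₂ ⟨hτ₂, K', hK', hmax'⟩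
  have e1 : σ₂.nat aBal = σ₁.nat aBal := hag₂.nat _ (by decide)
  have e2 : σ₂.nat aCnt = σ₁.nat aCnt := hag₂.nat _ (by decide)
  have e3 : σ₂.real rPay = σ₁.real rPay := hag₂.real _ (by decide)
  refine ⟨?_, hcounts₁.of_eq e1 e2 e3, K', hK', by rw [e1]; exact hmax'⟩
  nlinarith [Nat.zero_le (l * ℓ), Nat.zero_le (l * ℓ ^ 2), Nat.zero_le (ℓ ^ 2), Nat.zero_le l,
    Nat.zero_le ℓ]

/-! ### Packing in doubling metrics -/

theorem HasDoublingDimension.exists_cover {κ : ℝ} (h : HasDoublingDimension V κ) (x : V) (r : ℝ)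
    (k : ℕ) : ∃ s : Finset V, (s.card : ℝ) ≤ 2 ^ (k * κ) ∧
      Metric.closedBall x r ⊆ ⋃ y ∈ s, Metric.closedBall y (r / 2 ^ k) := by
  classical
  induction k with
  | zero => exact ⟨{x}, by simp, by simp⟩
  | succ k ih =>
    obtain ⟨s, hs, hc⟩ := ih
    choose φ hφ hφc using fun y => h y (r / 2 ^ k)
    refine ⟨s.biUnion φ, ?_, fun z hz => ?_⟩
    · have h1 : ((s.biUnion φ).card : ℝ) ≤ ∑ y ∈ s, ((φ y).card : ℝ) := by
        exact_mod_cast Finset.card_biUnion_le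
      refine h1.trans ((Finset.sum_le_card_nsmul s _ _ fun y _ => hφ y).trans ?_)
      rw [nsmul_eq_mul, Nat.cast_succ, add_mul, one_mul, Real.rpow_add two_pos]
      gcongr
    · obtain ⟨y, hy, hz⟩ := Set.mem_iUnion₂.1 (hc hz)
      obtain ⟨w, hw, hz⟩ := Set.mem_iUnion₂.1 (hφc y hz)
      refine Set.mem_iUnion₂.2 ⟨w, Finset.mem_biUnion.2 ⟨y, hy, hw⟩, ?_⟩
      rwa [pow_succ, ← div_div]

/-- A separated set in a ball is small. -/
theorem HasDoublingDimension.card_le {κ : ℝ} (h : HasDoublingDimension V κ) {A : Finset ℕ}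
    {F : ℕ → V} {x : V} {r ρ : ℝ} (k : ℕ) (hA : ∀ a ∈ A, dist (F a) x ≤ r)
    (hsep : ∀ a ∈ A, ∀ b ∈ A, a ≠ b → ρ < dist (F a) (F b)) (hk : 2 * (r / 2 ^ k) ≤ ρ) :
    (A.card : ℝ) ≤ 2 ^ (k * κ) := by
  obtain ⟨s, hs, hc⟩ := h.exists_cover x r k
  refine le_trans ?_ hs
  have : ∀ a ∈ A, ∃ y ∈ s, dist (F a) y ≤ r / 2 ^ k := fun a ha => by
    obtain ⟨y, hy, hz⟩ := Set.mem_iUnion₂.1 (hc (Metric.mem_closedBall.2 (hA a ha)))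
    exact ⟨y, hy, hz⟩
  have hne : Nonempty V := ⟨x⟩
  -- Two points of the set in the same small ball would be at distance at most `2 * (r / 2 ^ k)`,
  -- which is not more than `ρ`. So the assignment to covering balls is injective.
  choose! φ hφ hd using this
  have : A.card ≤ s.card := by
    refine Finset.card_le_card_of_injOn φ hφ fun a ha b hb hab => ?_
    by_contra hne
    have h1 := hsep a ha b hb hne
    have h2 := dist_triangle_right (F a) (F b) (φ a)
    have h3 := hd a ha
    have h4 := hd b hb
    rw [← hab] at h4
    linarith
  exact_mod_cast this

/-- A ball of radius zero contains its centre and so needs at least one covering ball. -/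
theorem HasDoublingDimension.nonneg {κ : ℝ} (h : HasDoublingDimension V κ) (x : V) : 0 ≤ κ := by
  obtain ⟨s, hs, hc⟩ := h x 0
  obtain ⟨y, hy, -⟩ := Set.mem_iUnion₂.1 (hc (Metric.mem_closedBall_self le_rfl))
  have h1 : (1 : ℝ) ≤ s.card := by exact_mod_cast Finset.card_pos.2 ⟨y, hy⟩
  by_contra! hκ
  have := Real.rpow_lt_one_of_one_lt_of_neg (one_lt_two : (1 : ℝ) < 2) hκ
  linarith

open Classical in
/-- In a finite set there is a ball that contains many points and whose double misses many. -/
theorem HasDoublingDimension.exists_ring {κ : ℝ} (h : HasDoublingDimension V κ) {A : Finset ℕ}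
    {F : ℕ → V} (hF : ∀ a ∈ A, ∀ b ∈ A, F a = F b → a = b) (hA : 2 ≤ A.card) :
    ∃ x ∈ A, ∃ y ∈ A,
      (A.card : ℝ) ≤ 2 * 2 ^ (3 * κ) * (min (A.filter fun q => dist (F x) (F q) ≤ dist (F x) (F y)).card
        (A.filter fun q => 2 * dist (F x) (F y) < dist (F x) (F q)).card : ℕ) := by
  obtain ⟨a₀, ha₀⟩ : A.Nonempty := Finset.card_pos.1 (by omega)
  have hκ := h.nonneg (F a₀)
  set M : ℝ := 2 * 2 ^ (3 * κ) with hM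
  have hM2 : 2 ≤ M := by
    have : (1 : ℝ) ≤ 2 ^ (3 * κ) := Real.one_le_rpow one_le_two (by positivity)
    linarith
  have hM0 : 0 < M := by linarith
  set N : V → ℝ → Finset ℕ := fun x r => A.filter fun q => dist x (F q) ≤ r with hN
  -- The pairs whose ball contains at least the fraction `1 / M` of the set. Among them one of least
  -- radius is taken.
  set G := (A ×ˢ A).filter fun p => (A.card : ℝ) ≤ M * (N (F p.1) (dist (F p.1) (F p.2))).card with hG
  have hGne : G.Nonempty := by
    obtain ⟨b, hb, hmax⟩ := A.exists_max_image (fun b => dist (F a₀) (F b)) ⟨a₀, ha₀⟩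
    refine ⟨(a₀, b), Finset.mem_filter.2 ⟨Finset.mk_mem_product ha₀ hb, ?_⟩⟩
    have : N (F a₀) (dist (F a₀) (F b)) = A := Finset.filter_true_of_mem hmax
    rw [this]
    have : (0 : ℝ) ≤ A.card := by positivity
    nlinarith
  obtain ⟨⟨x, y⟩, hxy, hmin⟩ := G.exists_min_image (fun p => dist (F p.1) (F p.2)) hGne
  obtain ⟨hxyA, hbig⟩ := Finset.mem_filter.1 hxy
  obtain ⟨hx, hy⟩ := Finset.mem_product.1 hxyA
  dsimp only at hx hy hbig hmin
  refine ⟨x, hx, y, hy, ?_⟩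
  rw [Nat.cast_min, mul_min_of_nonneg _ _ hM0.le]
  refine le_min hbig ?_
  set r := dist (F x) (F y) with hr
  have hcompl : (N (F x) (2 * r)).card + (A.filter fun q => 2 * r < dist (F x) (F q)).card =
      A.card := by
    rw [← Finset.card_filter_add_card_filter_not (s := A) fun q => dist (F x) (F q) ≤ 2 * r]
    simp [hN]
  have hcompl' : ((N (F x) (2 * r)).card : ℝ) +
      (A.filter fun q => 2 * r < dist (F x) (F q)).card = A.card := by exact_mod_cast hcompl
  have hA2 : (2 : ℝ) ≤ A.card := by exact_mod_cast hA
  rcases (dist_nonneg : 0 ≤ dist (F x) (F y)).eq_or_lt with h0 | hpos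
  -- A ball of radius zero contains one point only. Hence the set has at most `M` points, and at
  -- least one of them lies outside.
  · have hr0 : r = 0 := h0.symm
    have hone : ∀ s, s = 0 → (N (F x) s).card ≤ 1 := by
      rintro s rfl
      refine Finset.card_le_one.2 fun a ha b hb => ?_
      obtain ⟨ha, ha'⟩ := Finset.mem_filter.1 ha
      obtain ⟨hb, hb'⟩ := Finset.mem_filter.1 hb
      exact hF a ha b hb ((dist_le_zero.1 ha').symm.trans (dist_le_zero.1 hb'))
    have h1 : ((N (F x) r).card : ℝ) ≤ 1 := by exact_mod_cast hone r hr0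
    have h2 : ((N (F x) (2 * r)).card : ℝ) ≤ 1 := by exact_mod_cast hone (2 * r) (by rw [hr0]; simp)
    have h3 : (A.card : ℝ) ≤ M := by nlinarith
    nlinarith
  · obtain ⟨s, hs, hc⟩ := h.exists_cover (F x) (2 * r) 3
    -- A covering ball of radius r/4 that contains a point `b` of the set is contained in the ball
    -- of radius r/2 around `b`. By minimality of `r` that ball contains less than the fraction `1 /
    -- M`.
    have hsmall : ∀ z ∈ s, (((N (F x) (2 * r)).filter fun q => dist (F q) z ≤ r / 4).card : ℝ) ≤
        A.card / M := by
      intro z _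
      rcases Finset.eq_empty_or_nonempty ((N (F x) (2 * r)).filter fun q => dist (F q) z ≤ r / 4) with
        he | ⟨b, hb⟩
      · rw [he]; simp; positivity
      · obtain ⟨hbN, hbz⟩ := Finset.mem_filter.1 hb
        have hbA := (Finset.mem_filter.1 hbN).1
        obtain ⟨c, hc, hcmax⟩ := (N (F b) (r / 2)).exists_max_image (fun c => dist (F b) (F c))
          ⟨b, Finset.mem_filter.2 ⟨hbA, by simp; linarith⟩⟩
        obtain ⟨hcA, hcr⟩ := Finset.mem_filter.1 hc
        have hnot : (b, c) ∉ G := fun hmem => by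
          have := hmin _ hmem
          dsimp only at this
          linarith
        have hlt : M * (N (F b) (dist (F b) (F c))).card < A.card := by
          by_contra! hcon
          exact hnot (Finset.mem_filter.2 ⟨Finset.mk_mem_product hbA hcA, hcon⟩)
        have hle : ((N (F x) (2 * r)).filter fun q => dist (F q) z ≤ r / 4).card ≤
            (N (F b) (dist (F b) (F c))).card := by
          refine Finset.card_le_card fun q hq => ?_
          obtain ⟨hqN, hqz⟩ := Finset.mem_filter.1 hq
          have hqA := (Finset.mem_filter.1 hqN).1
          refine Finset.mem_filter.2 ⟨hqA, hcmax q (Finset.mem_filter.2 ⟨hqA, ?_⟩)⟩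
          have := dist_triangle_right (F b) (F q) z
          linarith
        have hle' : (((N (F x) (2 * r)).filter fun q => dist (F q) z ≤ r / 4).card : ℝ) ≤
            (N (F b) (dist (F b) (F c))).card := by exact_mod_cast hle
        rw [le_div_iff₀ hM0]
        nlinarith
    have hsub : N (F x) (2 * r) ⊆ s.biUnion fun z =>
        (N (F x) (2 * r)).filter fun q => dist (F q) z ≤ r / 4 := by
      intro q hq
      have hq' := (Finset.mem_filter.1 hq).2
      obtain ⟨z, hz, hzq⟩ := Set.mem_iUnion₂.1
        (hc (Metric.mem_closedBall.2 (by rw [dist_comm]; exact hq')))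
      refine Finset.mem_biUnion.2 ⟨z, hz, Finset.mem_filter.2 ⟨hq, ?_⟩⟩
      have := Metric.mem_closedBall.1 hzq
      norm_num at this
      linarith
    have hcount : ((N (F x) (2 * r)).card : ℝ) ≤ 2 ^ (3 * κ) * (A.card / M) := by
      have h1 : ((N (F x) (2 * r)).card : ℝ) ≤ ∑ z ∈ s,
          (((N (F x) (2 * r)).filter fun q => dist (F q) z ≤ r / 4).card : ℝ) := by
        exact_mod_cast (Finset.card_le_card hsub).trans Finset.card_biUnion_le
      refine h1.trans ((Finset.sum_le_card_nsmul s _ _ hsmall).trans ?_)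
      rw [nsmul_eq_mul]
      push_cast at hs
      gcongr
    -- `M` is chosen such that the covering balls together contain at most half of the set. The
    -- other half lies outside the doubled ball.
    have hhalf : 2 ^ (3 * κ) * ((A.card : ℝ) / M) = A.card / 2 := by
      rw [hM]; field_simp
    nlinarith

/-! ### Approximate closest facilities -/

/-- The set of facilities that is encoded by the binary digits of `A`. -/
def Tables.bits (S : Tables V) (A : ℕ) : Finset ℕ := (Finset.range S.m).filter fun q => A.testBit q

open Classical in
/-- The tables of the search structure: the node `A` has a centre and a radius such that the numbers
of the points of `A` within the radius and outside twice the radius are large. -/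
structure Tables.Ring (S : Tables V) : Prop where
  full_lt : S.full < 2 ^ S.m
  bits_full : S.bits S.full = Finset.range S.m
  ctr_mem : ∀ A < 2 ^ S.m, (S.bits A).Nonempty → S.ctr A ∈ S.bits A
  inn_lt : ∀ A < 2 ^ S.m, S.inn A < 2 ^ S.m
  out_lt : ∀ A < 2 ^ S.m, S.out A < 2 ^ S.m
  bits_inn : ∀ A < 2 ^ S.m, 0 < S.score A → S.bits (S.inn A) =
    (S.bits A).filter fun q => dist (S.F (S.ctr A)) (S.F q) ≤ 2 * S.rad A
  bits_out : ∀ A < 2 ^ S.m, 0 < S.score A → S.bits (S.out A) =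
    (S.bits A).filter fun q => S.rad A < dist (S.F (S.ctr A)) (S.F q)
  score_le_inn : ∀ A < 2 ^ S.m, 0 < S.score A → S.score A ≤
    ((S.bits A).filter fun q => dist (S.F (S.ctr A)) (S.F q) ≤ S.rad A).card
  score_le_out : ∀ A < 2 ^ S.m, 0 < S.score A → S.score A ≤
    ((S.bits A).filter fun q => 2 * S.rad A < dist (S.F (S.ctr A)) (S.F q)).card
  le_score : ∀ A < 2 ^ S.m, ∀ x ∈ S.bits A, ∀ y ∈ S.bits A,
    min ((S.bits A).filter fun q => dist (S.F x) (S.F q) ≤ dist (S.F x) (S.F y)).card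
      ((S.bits A).filter fun q => 2 * dist (S.F x) (S.F y) < dist (S.F x) (S.F q)).card ≤ S.score A
  rad_nonneg : ∀ A < 2 ^ S.m, 0 < S.score A → 0 ≤ S.rad A

/-- Make the facility in `vx` the candidate in `vJ` if it is closer to the requested point. -/
def improve : Cmd :=
  .ite (.rlt (.dist pReq (.lit 0) pFac (nv vx)) (.dist pReq (.lit 0) pFac (nv vJ)))
    (nlet vJ (nv vx)) .skip

/-- Compute in `vJ` an approximately closest facility to the requested point. -/
def snap : Cmd :=
  nlet vA (nv aFull) ;; nlet vJ (.cell aCtr (nv vA)) ;;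
  .while (.nlt (.lit 0) (.cell aScore (nv vA)))
    (nlet vx (.cell aCtr (nv vA)) ;; improve ;;
      .ite (.rlt (.mul (.lit 3) (.cell rRad (nv vA)))
          (.mul (.lit 2) (.dist pReq (.lit 0) pFac (nv vx))))
        (nlet vA (.cell aOut (nv vA))) (nlet vA (.cell aInn (nv vA)))) ;;
  nlet vx (.cell aCtr (nv vA)) ;; improve

theorem improve_spec {S : Tables V} {σ : State V} (hS : S.Loaded σ) {p : V}
    (hp : σ.pt pReq 0 = some p) (hx : σ.nat vx 0 < S.m) (hj : σ.nat vJ 0 < S.m) :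
    WP improve σ fun τ σ' => τ ≤ 20 ∧ σ'.nat vJ 0 < S.m ∧
      dist p (S.F (σ'.nat vJ 0)) ≤ dist p (S.F (σ.nat vx 0)) ∧
      dist p (S.F (σ'.nat vJ 0)) ≤ dist p (S.F (σ.nat vJ 0)) := by
  have htest : (BExp.rlt (.dist pReq (.lit 0) pFac (nv vx))
      (.dist pReq (.lit 0) pFac (nv vJ))).Holds σ ↔
      dist p (S.F (σ.nat vx 0)) < dist p (S.F (σ.nat vJ 0)) := by
    simp [hp, hS.F _ hx, hS.F _ hj, ptDist_some]
  refine WP.ite (fun hb => ?_) (fun hb => ?_)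
  · rw [htest] at hb
    simp [hx, hb.le]
  · rw [htest, not_lt] at hb
    simp [hj, hb]

/-- With d the distance from the requested point to the centre and ρ the radius, the search goes
outwards if d > 1.5 ρ. A discarded point is then within ρ of the centre, so its distance from the
requested point is at least d - ρ ≥ d/3. Otherwise the search goes inwards, and a discarded point is
farther than 2ρ from the centre, hence at least 2ρ - d ≥ d/3 away. In both cases the centre is good
enough for all discarded points, and the best centre seen is returned. -/
theorem snap_spec {S : Tables V} {ℓ : ℕ} {κ : ℝ} (hκ : HasDoublingDimension V κ) (hV : S.Valid ℓ)
    (hR : S.Ring) (hF : ∀ a < S.m, ∀ b < S.m, S.F a = S.F b → a = b) {σ : State V}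
    (hS : S.Loaded σ) {p : V} (hp : σ.pt pReq 0 = some p) :
    WP snap σ fun τ σ' => (τ : ℝ) ≤ 100 * (2 ^ (3 * κ) * Real.log S.m) + 50 ∧ σ'.nat vJ 0 < S.m ∧
      ∀ q < S.m, dist p (S.F (σ'.nat vJ 0)) ≤ 3 * dist p (S.F q) := by
  classical
  set M : ℝ := 2 * 2 ^ (3 * κ) with hM
  have hMpos : 0 < M := by positivity
  have hsub : ∀ {A q}, q ∈ S.bits A → q < S.m := fun h =>
    Finset.mem_range.1 (Finset.mem_filter.1 h).1
  have hbig : ∀ A < 2 ^ S.m, 2 ≤ (S.bits A).card →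
      0 < S.score A ∧ ((S.bits A).card : ℝ) ≤ M * S.score A := by
    intro A hA h2
    obtain ⟨x, hx, y, hy, hxy⟩ := hκ.exists_ring (F := S.F)
      (fun a ha b hb => hF a (hsub ha) b (hsub hb)) h2
    have h3 : (S.bits A).card ≤ M * S.score A := by
      refine hxy.trans ?_
      have := hR.le_score A hA x hx y hy
      have : ((min _ _ : ℕ) : ℝ) ≤ S.score A := Nat.cast_le.2 this
      exact mul_le_mul_of_nonneg_left this hMpos.le
    refine ⟨Nat.pos_of_ne_zero fun h0 => ?_, h3⟩
    have : (2 : ℝ) ≤ (S.bits A).card := by exact_mod_cast h2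
    rw [h0, Nat.cast_zero, mul_zero] at h3
    linarith
  have hpos2 : ∀ A < 2 ^ S.m, 0 < S.score A → S.score A ≤ (S.bits (S.inn A)).card ∧
      (S.bits (S.inn A)).card + S.score A ≤ (S.bits A).card ∧
      S.score A ≤ (S.bits (S.out A)).card ∧
      (S.bits (S.out A)).card + S.score A ≤ (S.bits A).card := by
    intro A hA hs
    have h1 := hR.score_le_inn A hA hs
    have h2 := hR.score_le_out A hA hs
    have hrad := hR.rad_nonneg A hA hs
    rw [hR.bits_inn A hA hs, hR.bits_out A hA hs]
    have h3 := Finset.card_filter_add_card_filter_not (s := S.bits A)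
      fun q => dist (S.F (S.ctr A)) (S.F q) ≤ 2 * S.rad A
    have h4 := Finset.card_filter_add_card_filter_not (s := S.bits A)
      fun q => S.rad A < dist (S.F (S.ctr A)) (S.F q)
    simp only [not_le, not_lt] at h3 h4
    have h5 : ((S.bits A).filter fun q => dist (S.F (S.ctr A)) (S.F q) ≤ S.rad A).card ≤
        ((S.bits A).filter fun q => dist (S.F (S.ctr A)) (S.F q) ≤ 2 * S.rad A).card :=
      Finset.card_le_card (Finset.monotone_filter_right _ fun q _ h => by
        linarith)
    have h6 : ((S.bits A).filter fun q => 2 * S.rad A < dist (S.F (S.ctr A)) (S.F q)).card ≤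
        ((S.bits A).filter fun q => S.rad A < dist (S.F (S.ctr A)) (S.F q)).card :=
      Finset.card_le_card (Finset.monotone_filter_right _ fun q _ h => by
        linarith)
    omega
  -- The potential `M * log |A|` drops by at least 1 per step, since a fraction of `1 / M` is
  -- discarded and log x ≤ x - 1. One step takes at most 50 operations, which gives the factor 50 in
  -- the loop invariant.
  have hlog : ∀ A < 2 ^ S.m, 0 < S.score A → ∀ A', 1 ≤ (S.bits A').card →
      (S.bits A').card + S.score A ≤ (S.bits A).card →
      M * Real.log (S.bits A').card + 1 ≤ M * Real.log (S.bits A).card := by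
    intro A hA hs A' h1 h2
    have h3 := (hbig A hA (by omega)).2
    have h1' : (1 : ℝ) ≤ (S.bits A').card := by exact_mod_cast h1
    have h2' : ((S.bits A').card : ℝ) + S.score A ≤ (S.bits A).card := by exact_mod_cast h2
    have hs' : (0 : ℝ) ≤ S.score A := by positivity
    have hc : (0 : ℝ) < (S.bits A).card := by linarith
    have h4 := Real.log_le_sub_one_of_pos (x := (S.bits A').card / (S.bits A).card) (by positivity)
    rw [Real.log_div (by positivity) (by positivity)] at h4
    have h5 : ((S.bits A').card : ℝ) / (S.bits A).card ≤ 1 - 1 / M := by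
      rw [div_le_iff₀ hc, sub_mul, one_mul, div_mul_eq_mul_div, one_mul]
      have : ((S.bits A).card : ℝ) / M ≤ S.score A := by rw [div_le_iff₀ hMpos]; linarith
      linarith
    have h6 : M * (Real.log (S.bits A').card - Real.log (S.bits A).card) ≤ M * (-(1 / M)) :=
      mul_le_mul_of_nonneg_left (by linarith) hMpos.le
    rw [mul_neg, mul_one_div_cancel hMpos.ne'] at h6
    linarith
  have hfull : (S.bits S.full).Nonempty := by
    rw [hR.bits_full]; exact ⟨0, Finset.mem_range.2 hV.m_pos⟩
  have hcfull : S.ctr S.full < S.m := hsub (hR.ctr_mem _ hR.full_lt hfull)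
  unfold snap
  simp only [wp_seq, wp_nset]
  refine WP.while _ (fun σ' => (S.bits (σ'.nat vA 0)).card)
    (fun τ σ' => S.Loaded σ' ∧ σ'.pt pReq 0 = some p ∧ ∃ A j, σ'.nat vA 0 = A ∧ σ'.nat vJ 0 = j ∧
      j < S.m ∧ A < 2 ^ S.m ∧ (S.bits A).Nonempty ∧
      (∀ q < S.m, q ∈ S.bits A ∨ dist p (S.F j) ≤ 3 * dist p (S.F q)) ∧
      (τ : ℝ) + 50 * (M * Real.log (S.bits A).card) ≤ 50 * (M * Real.log S.m)) ?_ ?_ ?_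
  · refine ⟨hS.of_eq (fun a ha => ?_) (fun _ _ => rfl) rfl, hp, S.full, S.ctr S.full, ?_, ?_, hcfull,
      hR.full_lt, hfull, fun q hq => .inl ?_, ?_⟩
    · have h1 : a ≠ vA := by rintro rfl; revert ha; decide
      have h2 : a ≠ vJ := by rintro rfl; revert ha; decide
      simp [h1, h2]
    · simp [hS.full]
    · simp [hS.full, hS.ctr]
    · rw [hR.bits_full]; exact Finset.mem_range.2 hq
    · simp [hR.bits_full]
  · rintro τ σ' - ⟨hS', hp', A, j, hA, hj, hjm, hA2, hne, hinv, hτ⟩ hb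
    have hs : 0 < S.score A := by simpa [hS'.score, hA] using hb
    have hcm := hR.ctr_mem A hA2 hne
    obtain ⟨b1, b2, b3, b4⟩ := hpos2 A hA2 hs
    have hrad := hR.rad_nonneg A hA2 hs
    simp only [wp_seq, wp_nset]
    have hval : (NExp.cell aCtr (nv vA)).eval σ' = S.ctr A := by simp [hA, hS'.ctr]
    rw [hval]
    set σ₁ : State V := setNat σ' vx 0 (S.ctr A) with hσ₁
    change WP improve σ₁ _
    have hS₁ : S.Loaded σ₁ := hS'.of_eq (fun a ha => write_other _
      (by rintro rfl; revert ha; decide) _ _) (fun _ _ => rfl) rfl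
    have hx₁ : σ₁.nat vx 0 = S.ctr A := by simp [hσ₁]
    have hj₁ : σ₁.nat vJ 0 = j := by simp [hσ₁, hj]
    refine (improve_spec hS₁ (p := p) hp' (by rw [hx₁]; exact hsub hcm) (by rw [hj₁]; exact hjm)).mono
      ?_
    rintro τ₂ σ₂ hag₂ ⟨hτ₂, hjm₂, hd₂, hd₂'⟩
    rw [hx₁] at hd₂
    rw [hj₁] at hd₂'
    have hS₂ : S.Loaded σ₂ := hS₁.agree hag₂ (by decide)
    have hx₂ : σ₂.nat vx 0 = S.ctr A := by rw [hag₂.nat vx (by decide), hx₁]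
    have hA₂ : σ₂.nat vA 0 = A := by rw [hag₂.nat vA (by decide)]; simp [hσ₁, hA]
    have hp₂ : σ₂.pt pReq 0 = some p := by rw [hag₂.pt pReq (by decide)]; exact hp'
    have hfin : ∀ A' a, A' < 2 ^ S.m → S.score A ≤ (S.bits A').card →
        (S.bits A').card + S.score A ≤ (S.bits A).card → a ≤ 50 →
        (∀ q < S.m, q ∈ S.bits A → q ∉ S.bits A' → dist p (S.F (S.ctr A)) ≤ 3 * dist p (S.F q)) →
        (fun t σ'' => (S.Loaded σ'' ∧ σ''.pt pReq 0 = some p ∧ ∃ A j, σ''.nat vA 0 = A ∧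
          σ''.nat vJ 0 = j ∧ j < S.m ∧ A < 2 ^ S.m ∧ (S.bits A).Nonempty ∧
          (∀ q < S.m, q ∈ S.bits A ∨ dist p (S.F j) ≤ 3 * dist p (S.F q)) ∧
          ((τ + t : ℕ) : ℝ) + 50 * (M * Real.log (S.bits A).card) ≤ 50 * (M * Real.log S.m)) ∧
          (S.bits (σ''.nat vA 0)).card < (S.bits (σ'.nat vA 0)).card) a (setNat σ₂ vA 0 A') := by
      intro A' a hA' h1 h2 ha hfar
      have hl := hlog A hA2 hs A' (by omega) h2
      refine ⟨⟨hS₂.of_eq (fun a ha => write_other _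
        (by rintro rfl; revert ha; decide) _ _) (fun _ _ => rfl) rfl, hp₂, A', σ₂.nat vJ 0, by simp,
        by simp, hjm₂, hA', Finset.card_pos.1 (by omega), fun q hq => ?_, ?_⟩, ?_⟩
      · by_cases hqA' : q ∈ S.bits A'
        · exact .inl hqA'
        · by_cases hqA : q ∈ S.bits A
          · exact .inr (hd₂.trans (hfar q hq hqA hqA'))
          · exact .inr (hd₂'.trans ((hinv q hq).resolve_left hqA))
      · have : (a : ℝ) ≤ 50 := by exact_mod_cast ha
        push_cast
        linarith
      · simp [hA]; omega
    have htest : (BExp.rlt (.mul (.lit 3) (.cell rRad (nv vA)))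
          (.mul (.lit 2) (.dist pReq (.lit 0) pFac (nv vx)))).Holds σ₂ ↔
        3 * S.rad A < 2 * dist p (S.F (S.ctr A)) := by
      simp [hA₂, hS₂.rad, hx₂, hp₂, hS₂.F _ (hsub hcm), ptDist_some]
    have hadd : ∀ a, τ + (BExp.nlt (.lit 0) (.cell aScore (nv vA))).cost + a = τ + (5 + a) := by
      intro a; simp only [BExp.cost, NExp.cost]; omega
    refine WP.ite (fun hb => ?_) (fun hb => ?_)
    · rw [htest] at hb
      rw [wp_nset]
      have hval : (NExp.cell aOut (nv vA)).eval σ₂ = S.out A := by simp [hA₂, hS₂.out]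
      rw [hval, hadd]
      refine hfin (S.out A) _ (hR.out_lt A hA2) b3 b4 ?_ ?_
      · simp only [NExp.cost, BExp.cost, RExp.cost]; omega
      · intro q hq hqA hqA'
        rw [hR.bits_out A hA2 hs, Finset.mem_filter, not_and, not_lt] at hqA'
        have := hqA' hqA
        have := dist_triangle_right p (S.F (S.ctr A)) (S.F q)
        linarith
    · rw [htest, not_lt] at hb
      rw [wp_nset]
      have hval : (NExp.cell aInn (nv vA)).eval σ₂ = S.inn A := by simp [hA₂, hS₂.inn]
      rw [hval, hadd]
      refine hfin (S.inn A) _ (hR.inn_lt A hA2) b1 b2 ?_ ?_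
      · simp only [NExp.cost, BExp.cost, RExp.cost]; omega
      · intro q hq hqA hqA'
        rw [hR.bits_inn A hA2 hs, Finset.mem_filter, not_and, not_le] at hqA'
        have := hqA' hqA
        have := dist_triangle_left (S.F (S.ctr A)) (S.F q) p
        linarith
  · rintro τ σ' - ⟨hS', hp', A, j, hA, hj, hjm, hA2, hne, hinv, hτ⟩ hb
    have hs : S.score A = 0 := by simpa [hS'.score, hA] using hb
    have hcm := hR.ctr_mem A hA2 hne
    have hval : (NExp.cell aCtr (nv vA)).eval σ' = S.ctr A := by simp [hA, hS'.ctr]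
    rw [hval]
    set σ₁ : State V := setNat σ' vx 0 (S.ctr A) with hσ₁
    change WP improve σ₁ _
    have hS₁ : S.Loaded σ₁ := hS'.of_eq (fun a ha => write_other _
      (by rintro rfl; revert ha; decide) _ _) (fun _ _ => rfl) rfl
    have hx₁ : σ₁.nat vx 0 = S.ctr A := by simp [hσ₁]
    have hj₁ : σ₁.nat vJ 0 = j := by simp [hσ₁, hj]
    refine (improve_spec hS₁ (p := p) hp' (by rw [hx₁]; exact hsub hcm) (by rw [hj₁]; exact hjm)).mono
      ?_
    rintro τ₂ σ₂ - ⟨hτ₂, hjm₂, hd₂, hd₂'⟩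
    rw [hx₁] at hd₂
    rw [hj₁] at hd₂'
    -- The search ends at score zero, and any node with two points has positive score. So the centre
    -- is the only point left.
    have hone : (S.bits A).card ≤ 1 := by
      by_contra! h
      have := (hbig A hA2 h).1
      omega
    refine ⟨?_, hjm₂, fun q hq => ?_⟩
    · have h0 : (0 : ℝ) ≤ Real.log (S.bits A).card := Real.log_natCast_nonneg _
      have h1 : 0 ≤ 50 * (M * Real.log (S.bits A).card) := by positivity
      have h2 : (τ₂ : ℝ) ≤ 20 := by exact_mod_cast hτ₂
      simp only [NExp.cost, BExp.cost]
      push_cast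
      rw [hM] at hτ h1
      linarith
    · rcases hinv q hq with h | h
      · rw [Finset.card_le_one.1 hone q h _ hcm]
        have : 0 ≤ dist p (S.F (S.ctr A)) := dist_nonneg
        linarith
      · exact hd₂'.trans h

/-! ### Insertions -/

/-- Compute in `vL` the finest scale at which the client in slot `e` is counted. -/
def depth (e : NExp) : Cmd :=
  nlet vL (nv aBase) ;; nlet vx e ;;
  .while (.nlt (.lit 0) (nv vx)) (nlet vx (.half (nv vx)) ;; nlet vL (.add (nv vL) (.lit 2)))

/-- Add or remove a client at the facility in `vJ` that has slot `e`. -/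
def changeAt (e : NExp) (inc dec : ℕ) : Cmd :=
  depth e ;; nlet vInc (.lit inc) ;; nlet vDec (.lit dec) ;; change

def insertClient : Cmd :=
  snap ;; rlet rSnap (.add (rv rSnap) (.dist pReq (.lit 0) pFac (nv vJ))) ;;
  .nset aCli (nv aN) (nv vJ) ;; .nset aHid (nv aN) (nv aFresh) ;;
  .nset aSlot (nv aFresh) (nv aN) ;; nlet aReq (nv aFresh) ;;
  nlet aFresh (.add (nv aFresh) (.lit 1)) ;;
  changeAt (nv aN) 1 0 ;; nlet aN (.add (nv aN) (.lit 1))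

/-- Move the client in the last slot to the slot in `vs`. -/
def moveLast : Cmd :=
  nlet vJ (.cell aCli (nv aN)) ;; changeAt (nv aN) 0 1 ;; changeAt (nv vs) 1 0 ;;
  .nset aCli (nv vs) (nv vJ) ;; .nset aHid (nv vs) (.cell aHid (nv aN)) ;;
  .nset aSlot (.cell aHid (nv vs)) (nv vs)

def deleteClient : Cmd :=
  nlet vs (.cell aSlot (nv aReq)) ;; nlet vJ (.cell aCli (nv vs)) ;;
  rlet rSnap (.sub (rv rSnap) (.dist pReq (.lit 0) pFac (nv vJ))) ;;
  changeAt (nv vs) 0 1 ;; nlet aN (.sub (nv aN) (.lit 1)) ;;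
  .ite (.nlt (nv vs) (nv aN)) moveLast .skip

def answerCost : Cmd := rlet rAns (.add (rv rSnap) (.mul (.lit 24) (rv rPay)))

def answerSolution : Cmd := forLoop vk (.lit 0) (nv aLen) (.emit (.cell aOpen (nv vk)))

/-- Halving until zero counts the binary digits of the slot, and each adds two scales. The
expression `e` must not depend on `vL`, which is overwritten first. -/
theorem depth_spec {σ : State V} {e : NExp} {s : ℕ} (he : ∀ x, e.eval (setNat σ vL 0 x) = s) :
    WP (depth e) σ fun τ σ' => τ ≤ 20 * Nat.size s + 20 + e.cost ∧
      σ'.nat vL 0 = σ.nat aBase 0 + 2 * Nat.size s := by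
  unfold depth
  simp only [wp_seq, wp_nset]
  have h0 : e.eval { σ with nat := write σ.nat vL ((NExp.lit 0).eval σ) ((nv aBase).eval σ) } = s :=
    he _
  rw [h0]
  refine WP.while _ (fun σ' => σ'.nat vx 0)
    (fun τ σ' => τ + 20 * Nat.size (σ'.nat vx 0) ≤ 20 * Nat.size s ∧
      σ'.nat vL 0 + 2 * Nat.size (σ'.nat vx 0) = σ.nat aBase 0 + 2 * Nat.size s) ?_ ?_ ?_
  · simp
  · rintro τ σ' - ⟨h1, h2⟩ hb
    have hx : 0 < σ'.nat vx 0 := by simpa using hb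
    set x := σ'.nat vx 0 with hxd
    have hsize : Nat.size x = Nat.size (x / 2) + 1 := by
      conv_lhs => rw [← Nat.bit_testBit_zero_shiftRight_one x]
      rw [Nat.size_bit (by rw [Nat.bit_testBit_zero_shiftRight_one]; omega), Nat.shiftRight_one]
    simp only [wp_seq, wp_nset]
    simp [← hxd]
    omega
  · rintro τ σ' - ⟨h1, h2⟩ hb
    have hx : σ'.nat vx 0 = 0 := by simpa using hb
    rw [hx] at h1 h2
    simp at h1 h2 ⊢
    omega

/-- The clients with the facilities to which they are snapped and the scales up to which they are
counted. -/
def Tables.records (S : Tables V) (cli : ℕ → ℕ) (n : ℕ) : Multiset (ℕ × ℕ) :=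
  (Multiset.range n).map fun k => (cli k, S.base + 2 * Nat.size k)

/-- The memory is right for the client set `C` with handles `h`; the slot `k` holds the client
`q k`. -/
structure Represents (S : Tables V) (C : Finset V) (h : V → ℕ) (q : ℕ → V) (σ : State V) :
    Prop where
  loaded : S.Loaded σ
  card : σ.nat aN 0 = C.card
  mem : ∀ k < C.card, q k ∈ C
  surj : ∀ x ∈ C, ∃ k < C.card, q k = x
  inj : ∀ k < C.card, ∀ k' < C.card, q k = q k' → k = k'
  cli_lt : ∀ k < C.card, σ.nat aCli k < S.m
  snap : ∀ k < C.card, ∀ x < S.m, dist (q k) (S.F (σ.nat aCli k)) ≤ 3 * dist (q k) (S.F x)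
  slot : ∀ k < C.card, σ.nat aSlot (σ.nat aHid k) = k
  hid : ∀ k < C.card, σ.nat aHid k = h (q k)
  fresh : ∀ k < C.card, σ.nat aHid k < σ.nat aFresh 0
  snapDist : σ.real rSnap 0 = ∑ k ∈ Finset.range C.card, dist (q k) (S.F (σ.nat aCli k))
  maintained : Maintained S (S.records (σ.nat aCli) C.card) σ

/-- The arrays of the dynamic data structure. -/
def dynamicNat : List ℕ :=
  [aBal, aCnt, aInd, aRef, aOpen, aPos, aLen, aN, aCli, aHid, aSlot, aFresh]

theorem Represents.of_eq {S : Tables V} {C : Finset V} {h : V → ℕ} {q : ℕ → V} {σ σ' : State V}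
    (hσ : Represents S C h q σ) (hn : ∀ a ∈ tableNat, σ'.nat a = σ.nat a)
    (hd : ∀ a ∈ dynamicNat, σ'.nat a = σ.nat a) (hr : ∀ a ∈ tableReal, σ'.real a = σ.real a)
    (hpay : σ'.real rPay = σ.real rPay) (hsnap : σ'.real rSnap = σ.real rSnap)
    (hp : σ'.pt pFac = σ.pt pFac) : Represents S C h q σ' := by
  have hm : Maintained S (S.records (σ'.nat aCli) C.card) σ' := by
    rw [hd aCli (by decide)]
    exact hσ.maintained.of_eq (fun a ha => hd a (by revert a; decide)) hpay
  simp only [dynamicNat, List.forall_mem_cons, List.not_mem_nil] at hd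
  obtain ⟨-, -, -, -, -, -, -, e1, e2, e3, e4, e5, -⟩ := hd
  obtain ⟨h1, h2, h3, h4, h5, h6, h7, h8, h9, h10, h11, -⟩ := hσ
  exact ⟨h1.of_eq hn hr hp, by rw [e1, h2], h3, h4, h5, by rw [e2]; exact h6, by rw [e2]; exact h7,
    by rw [e3, e4]; exact h8, by rw [e3]; exact h9, by rw [e3, e5]; exact h10,
    by rw [hsnap, e2]; exact h11, hm⟩

/-- A bound for the time of `change` for a client in slot `s`. -/
def Tables.changeTime (S : Tables V) (ℓ s : ℕ) : ℕ :=
  (S.base + 2 * Nat.size s + 1) * ((ℓ + 1) ^ 2 * 1000)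

theorem records_congr (S : Tables V) {cli cli' : ℕ → ℕ} {n : ℕ} (h : ∀ k < n, cli' k = cli k) :
    S.records cli' n = S.records cli n :=
  Multiset.map_congr rfl fun k hk => by rw [h k (Multiset.mem_range.1 hk)]

theorem records_succ (S : Tables V) (cli : ℕ → ℕ) (n : ℕ) :
    S.records cli (n + 1) = (cli n, S.base + 2 * Nat.size n) ::ₘ S.records cli n := by
  rw [Tables.records, Multiset.range_succ, Multiset.map_cons]; rfl

/-- The records without the slot `k`. -/
def Tables.recordsErase (S : Tables V) (cli : ℕ → ℕ) (n k : ℕ) : Multiset (ℕ × ℕ) :=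
  ((Multiset.range n).erase k).map fun k => (cli k, S.base + 2 * Nat.size k)

theorem records_eq_cons (S : Tables V) (cli : ℕ → ℕ) {n k : ℕ} (hk : k < n) :
    S.records cli n = (cli k, S.base + 2 * Nat.size k) ::ₘ S.recordsErase cli n k := by
  rw [Tables.records, Tables.recordsErase,
    ← Multiset.map_cons (fun k => (cli k, S.base + 2 * Nat.size k)),
    Multiset.cons_erase (Multiset.mem_range.2 hk)]

theorem recordsErase_self (S : Tables V) (cli : ℕ → ℕ) (n : ℕ) :
    S.recordsErase cli (n + 1) n = S.records cli n := by
  rw [Tables.recordsErase, Multiset.range_succ, Multiset.erase_cons_head]; rfl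

theorem recordsErase_succ (S : Tables V) (cli : ℕ → ℕ) {n k : ℕ} (hk : k < n) :
    S.recordsErase cli (n + 1) k =
      (cli n, S.base + 2 * Nat.size n) ::ₘ S.recordsErase cli n k := by
  rw [Tables.recordsErase, Multiset.range_succ, Multiset.erase_cons_tail _ (by omega),
    Multiset.map_cons]; rfl

theorem recordsErase_congr (S : Tables V) {cli cli' : ℕ → ℕ} {n k : ℕ}
    (h : ∀ i, i ≠ k → cli' i = cli i) : S.recordsErase cli' n k = S.recordsErase cli n k :=
  Multiset.map_congr rfl fun i hi => by
    rw [h i ((Multiset.nodup_range n).mem_erase_iff.1 hi).1]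

theorem changeAt_spec {S : Tables V} {ℓ : ℕ} (hV : S.Valid ℓ) {σ : State V} (hS : S.Loaded σ)
    {e : NExp} {j s inc dec : ℕ} (hj : σ.nat vJ 0 = j) (hjm : j < S.m)
    (he : ∀ x, e.eval (setNat σ vL 0 x) = s) {M M' : Multiset (ℕ × ℕ)}
    (hM : Change inc dec (j, S.base + 2 * Nat.size s) M M') (hC : Maintained S M σ) :
    WP (changeAt e inc dec) σ fun τ σ' =>
      τ ≤ 20 * Nat.size s + 35 + e.cost + S.changeTime ℓ s ∧ Maintained S M' σ' := by
  unfold changeAt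
  simp only [wp_seq, wp_nset]
  refine (depth_spec he).mono ?_
  rintro t σ₁ hag₁ ⟨ht, hL⟩
  have hnw : ∀ a ∈ (depth e).nw, a = vL ∨ a = vx := by
    intro a ha; simp [depth, Cmd.nw] at ha; tauto
  have hrw : ∀ a, a ∉ (depth e).rw := by intro a ha; simp [depth, Cmd.rw] at ha
  have hpw : ∀ a, a ∉ (depth e).pw := by intro a ha; simp [depth, Cmd.pw] at ha
  have hnat : ∀ a, a ≠ vL → a ≠ vx → σ₁.nat a = σ.nat a := fun a h1 h2 =>
    hag₁.nat a fun h => (hnw a h).elim h1 h2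
  set σ₂ : State V := { σ₁ with nat := write (write σ₁.nat vInc 0 inc) vDec 0 dec } with hσ₂
  have hnat₂ : ∀ a, a ≠ vL → a ≠ vx → a ≠ vInc → a ≠ vDec → σ₂.nat a = σ.nat a := by
    intro a h1 h2 h3 h4
    simp [hσ₂, h3, h4, hnat a h1 h2]
  have hS₂ : S.Loaded σ₂ := hS.of_eq (fun a ha => by
    apply hnat₂ <;> (rintro rfl; revert ha; decide)) (fun a _ => hag₁.real a (hrw a))
    (hag₁.pt _ (hpw _))
  refine (change_spec hV hS₂ (j := j) (l := S.base + 2 * Nat.size s) (inc := inc) (dec := dec)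
    ?_ hjm ?_ ?_ ?_ hM (hC.of_eq (fun a ha => ?_) (hag₁.real _ (hrw _)))).mono ?_
  · rw [hnat₂ _ (by decide) (by decide) (by decide) (by decide), hj]
  · simp [hσ₂, hL, hS.base]
  · simp [hσ₂]
  · simp [hσ₂]
  · apply hnat₂ <;> (rintro rfl; revert ha; decide)
  · rintro t' σ₃ - ⟨ht', hM'⟩
    refine ⟨?_, hM'⟩
    simp only [NExp.cost, Tables.changeTime]
    omega

-- The handle is the value of a counter that never decreases. It therefore differs from the handles
-- of all present clients, and recording its slot leaves their entries intact.
open Classical in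
theorem insertClient_spec {S : Tables V} {ℓ : ℕ} {κ : ℝ} (hκ : HasDoublingDimension V κ)
    (hV : S.Valid ℓ) (hR : S.Ring) (hF : ∀ a < S.m, ∀ b < S.m, S.F a = S.F b → a = b)
    {C : Finset V} {h : V → ℕ} {q : ℕ → V} {σ : State V} (hσ : Represents S C h q σ) {p : V}
    (hpC : p ∉ C) (hp : σ.pt pReq 0 = some p) :
    WP insertClient σ fun τ σ' =>
      (τ : ℝ) ≤ 100 * (2 ^ (3 * κ) * Real.log S.m) + 200 + 20 * Nat.size C.card +
        S.changeTime ℓ C.card ∧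
      ∃ q', Represents S (insert p C) (Function.update h p (σ'.nat aReq 0)) q' σ' := by
  unfold insertClient
  rw [wp_seq]
  refine (snap_spec hκ hV hR hF hσ.loaded hp).mono ?_
  rintro τ₁ σ₁ hag₁ ⟨hτ₁, hjm, hsnap⟩
  have hσ₁ : Represents S C h q σ₁ := hσ.of_eq (fun a ha => hag₁.nat a (by revert a; decide))
    (fun a ha => hag₁.nat a (by revert a; decide)) (fun a ha => hag₁.real a (by revert a; decide))
    (hag₁.real _ (by decide)) (hag₁.real _ (by decide)) (hag₁.pt _ (by decide))
  have hp₁ : σ₁.pt pReq 0 = some p := by rw [hag₁.pt pReq (by decide), hp]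
  set j := σ₁.nat vJ 0 with hj
  set n := C.card with hn
  set H := σ₁.nat aFresh 0 with hH
  simp only [wp_seq, wp_nset, wp_rset]
  set σ₂ : State V := { σ₁ with
    nat := write (write (write (write (write σ₁.nat aCli n j) aHid n H) aSlot H n) aReq 0 H) aFresh 0
      (H + 1)
    real := write σ₁.real rSnap 0 (σ₁.real rSnap 0 + dist p (S.F j)) } with hσ₂
  have hS₂ : S.Loaded σ₂ := by
    refine hσ₁.loaded.of_eq (fun a ha => ?_) (fun a ha => ?_) rfl
    · have : a ≠ aCli ∧ a ≠ aHid ∧ a ≠ aSlot ∧ a ≠ aReq ∧ a ≠ aFresh := by revert a; decide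
      simp [hσ₂, this]
    · exact write_other _ (by revert a; decide) _ _
  have hM₂ : Maintained S (S.records (σ₁.nat aCli) n) σ₂ := by
    refine hσ₁.maintained.of_eq (fun a ha => ?_) (by simp [hσ₂])
    have h1 : a ≠ aCli ∧ a ≠ aHid ∧ a ≠ aSlot ∧ a ≠ aReq ∧ a ≠ aFresh := by revert a; decide
    simp [hσ₂, h1]
  have hchange : Change 1 0 (j, S.base + 2 * Nat.size n) (S.records (σ₁.nat aCli) n)
      (S.records (σ₂.nat aCli) (n + 1)) := by
    refine .inl ⟨rfl, rfl, ?_⟩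
    rw [records_succ, records_congr S (cli := σ₁.nat aCli)]
    · simp [hσ₂]
    · intro k hk
      simp [hσ₂, hk.ne]
  have hrun : WP (changeAt (nv aN) 1 0) σ₂ fun t σ' =>
      t ≤ 20 * Nat.size n + 40 + S.changeTime ℓ n ∧
      ∃ q', Represents S (insert p C) (Function.update h p (σ'.nat aReq 0)) q'
        (setNat σ' aN 0 (n + 1)) := by
    refine (changeAt_spec hV hS₂ (s := n) (by simp [hσ₂, hj]) hjm (fun x => ?_) hchange hM₂).mono ?_
    · simp [hσ₂, hσ₁.card, ← hn]
    rintro t σ₃ hag₃ ⟨ht, hM₃⟩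
    refine ⟨by simp only [NExp.cost] at ht; omega, Function.update q n p, ?_⟩
    set σ₅ : State V := setNat σ₃ aN 0 (n + 1) with hσ₅
    have hcard : (insert p C).card = n + 1 := Finset.card_insert_of_notMem hpC
    have e1 : σ₅.nat aCli = Function.update (σ₁.nat aCli) n j := by
      simp [hσ₅, hag₃.nat aCli (by decide), hσ₂]
    have e2 : σ₅.nat aHid = Function.update (σ₁.nat aHid) n H := by
      simp [hσ₅, hag₃.nat aHid (by decide), hσ₂]
    have e3 : σ₅.nat aSlot = Function.update (σ₁.nat aSlot) H n := by
      simp [hσ₅, hag₃.nat aSlot (by decide), hσ₂]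
    have e4 : σ₃.nat aReq 0 = H := by simp [hag₃.nat aReq (by decide), hσ₂]
    have e5 : σ₅.nat aFresh 0 = H + 1 := by simp [hσ₅, hag₃.nat aFresh (by decide), hσ₂]
    have e6 : σ₅.nat aN 0 = n + 1 := by simp [hσ₅]
    have e7 : σ₅.real rSnap 0 = σ₁.real rSnap 0 + dist p (S.F j) := by
      simp [hσ₅, hag₃.real rSnap (by decide), hσ₂]
    have hS₅ : S.Loaded σ₅ := (hS₂.agree hag₃ (by decide)).of_eq
      (fun a ha => write_other _ (by rintro rfl; revert ha; decide) _ _) (fun _ _ => rfl) rfl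
    have hlt : ∀ k < n + 1, k ≠ n → k < n := fun k h1 h2 => by omega
    have hqp : ∀ k < n, q k ≠ p := fun k hk he => hpC (he ▸ hσ₁.mem k hk)
    refine ⟨hS₅, by rw [e6, hcard], ?_, ?_, ?_, ?_, ?_, ?_, ?_, ?_, ?_, ?_⟩
    · intro k hk
      rw [hcard] at hk
      by_cases hkn : k = n
      · simp [hkn]
      · rw [Function.update_of_ne hkn]
        exact Finset.mem_insert_of_mem (hσ₁.mem k (hlt k hk hkn))
    · intro x hx
      rw [hcard]
      rcases Finset.mem_insert.1 hx with rfl | hx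
      · exact ⟨n, by omega, by simp⟩
      · obtain ⟨k, hk, rfl⟩ := hσ₁.surj x hx
        exact ⟨k, by omega, Function.update_of_ne (by omega) _ _⟩
    · intro k hk k' hk'
      rw [hcard] at hk hk'
      by_cases h1 : k = n <;> by_cases h2 : k' = n
      · intro _; omega
      · rw [h1, Function.update_self, Function.update_of_ne h2]
        exact fun h3 => absurd h3.symm (hqp k' (hlt k' hk' h2))
      · rw [h2, Function.update_self, Function.update_of_ne h1]
        exact fun h3 => absurd h3 (hqp k (hlt k hk h1))
      · rw [Function.update_of_ne h1, Function.update_of_ne h2]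
        exact hσ₁.inj k (hlt k hk h1) k' (hlt k' hk' h2)
    · intro k hk
      rw [hcard] at hk
      rw [e1]
      by_cases hkn : k = n
      · rw [hkn, Function.update_self]; exact hjm
      · rw [Function.update_of_ne hkn]; exact hσ₁.cli_lt k (hlt k hk hkn)
    · intro k hk
      rw [hcard] at hk
      rw [e1]
      by_cases hkn : k = n
      · rw [hkn, Function.update_self, Function.update_self]; exact hsnap
      · rw [Function.update_of_ne hkn, Function.update_of_ne hkn]
        exact hσ₁.snap k (hlt k hk hkn)
    · intro k hk
      rw [hcard] at hk
      rw [e2, e3]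
      by_cases hkn : k = n
      · rw [hkn, Function.update_self, Function.update_self]
      · rw [Function.update_of_ne hkn,
          Function.update_of_ne (hσ₁.fresh k (hlt k hk hkn)).ne]
        exact hσ₁.slot k (hlt k hk hkn)
    · intro k hk
      rw [hcard] at hk
      rw [e2, e4]
      by_cases hkn : k = n
      · rw [hkn, Function.update_self, Function.update_self, Function.update_self]
      · rw [Function.update_of_ne hkn, Function.update_of_ne hkn,
          Function.update_of_ne (hqp k (hlt k hk hkn))]
        exact hσ₁.hid k (hlt k hk hkn)
    · intro k hk
      rw [hcard] at hk
      rw [e2, e5]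
      by_cases hkn : k = n
      · rw [hkn, Function.update_self]; omega
      · rw [Function.update_of_ne hkn]
        have := hσ₁.fresh k (hlt k hk hkn)
        omega
    · rw [e7, hcard, Finset.sum_range_succ, e1, Function.update_self, Function.update_self,
        hσ₁.snapDist]
      congr 1
      refine Finset.sum_congr rfl fun k hk => ?_
      have := (Finset.mem_range.1 hk).ne
      rw [Function.update_of_ne this, Function.update_of_ne this]
    · rw [hcard]
      have : σ₅.nat aCli = σ₂.nat aCli := by rw [e1]; simp [hσ₂]
      rw [this]
      exact hM₃.of_eq (fun a ha => write_other _ (by rintro rfl; revert ha; decide) _ _) rfl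
  have hst : (σ₁.real rSnap 0 + ptDist (σ₁.pt pReq 0) (σ₁.pt pFac j)) =
      σ₁.real rSnap 0 + dist p (S.F j) := by
    rw [hp₁, hσ₁.loaded.F j hjm, ptDist_some]
  simp only [NExp.eval, RExp.eval, hst, hσ₁.card, ← hj, ← hH, write_other, ne_eq,
    Nat.reduceEqDiff, not_false_eq_true]
  change WP (changeAt (nv aN) 1 0) σ₂ _
  refine hrun.mono fun t σ₃ hag₃ h3 => ?_
  have e6 : σ₃.nat aN 0 = n := by
    rw [hag₃.nat aN (by decide)]; simp [hσ₂, hσ₁.card, ← hn]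
  rw [e6]
  refine ⟨?_, by simpa using h3.2⟩
  have h4' : (t : ℝ) ≤ 20 * Nat.size n + 40 + S.changeTime ℓ n := by exact_mod_cast h3.1
  simp only [NExp.cost, RExp.cost]
  push_cast
  linarith

/-! ### Deletions and queries -/

-- The occupied slots must stay an initial segment, because the bound on the finest radii is a sum
-- over slot numbers. So the last client moves to the vacated slot: it is removed at its old depth
-- and inserted at the new one, which explains three changes in the time bound. Handles are not
-- affected, since they refer to slots indirectly.
open Classical in
theorem deleteClient_spec {S : Tables V} {ℓ : ℕ} (hV : S.Valid ℓ)
    {C : Finset V} {h : V → ℕ} {q : ℕ → V} {σ : State V} (hσ : Represents S C h q σ) {p : V}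
    (hpC : p ∈ C) (hp : σ.pt pReq 0 = some p) (hreq : σ.nat aReq 0 = h p) :
    WP deleteClient σ fun τ σ' => τ ≤ 500 + 60 * Nat.size C.card + 3 * S.changeTime ℓ C.card ∧
      ∃ q', Represents S (C.erase p) h q' σ' := by
  obtain ⟨k, hk, hqk⟩ := hσ.surj p hpC
  obtain ⟨N, hN⟩ : ∃ N, C.card = N + 1 := ⟨C.card - 1, by omega⟩
  have hcard : (C.erase p).card = N := by rw [Finset.card_erase_of_mem hpC, hN]; rfl
  have hkN : k < N + 1 := hN ▸ hk
  set cli := σ.nat aCli with hcli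
  set j := cli k with hj
  have hjm : j < S.m := hσ.cli_lt k hk
  have hslot : σ.nat aSlot (σ.nat aReq 0) = k := by rw [hreq, ← hqk, ← hσ.hid k hk, hσ.slot k hk]
  have hmono : ∀ s ≤ N + 1, Nat.size s ≤ Nat.size C.card ∧
      S.changeTime ℓ s ≤ S.changeTime ℓ C.card := by
    intro s hs
    have : Nat.size s ≤ Nat.size C.card := Nat.size_le_size (by omega)
    exact ⟨this, Nat.mul_le_mul_right _ (by omega)⟩
  -- After the deletion slot `i` holds the client that was in slot `if i = k then N else i`. If `k =
  -- N`, this renaming is the identity on the remaining slots.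
  have hsum : ∑ i ∈ Finset.range N, dist (q (if i = k then N else i))
      (S.F (cli (if i = k then N else i))) = σ.real rSnap 0 - dist p (S.F j) := by
    rw [hσ.snapDist, hN, Finset.sum_range_succ, ← hcli]
    by_cases hkN' : k = N
    · have : ∀ i ∈ Finset.range N, dist (q (if i = k then N else i))
        (S.F (cli (if i = k then N else i))) = dist (q i) (S.F (cli i)) := by
        intro i hi
        have := Finset.mem_range.1 hi
        rw [if_neg (by omega)]
      rw [Finset.sum_congr rfl this, hj, ← hqk, hkN']
      ring
    · have hkr : k ∈ Finset.range N := Finset.mem_range.2 (by omega)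
      rw [← Finset.add_sum_erase _ _ hkr, ← Finset.add_sum_erase (Finset.range N)
        (fun i => dist (q i) (S.F (cli i))) hkr]
      have : ∀ i ∈ (Finset.range N).erase k, dist (q (if i = k then N else i))
        (S.F (cli (if i = k then N else i))) = dist (q i) (S.F (cli i)) := by
        intro i hi
        rw [if_neg (Finset.mem_erase.1 hi).1]
      rw [Finset.sum_congr rfl this, if_pos rfl, hqk]
      ring
  unfold deleteClient
  simp only [wp_seq, wp_nset, wp_rset]
  set σ₁ : State V := { σ with
    nat := write (write σ.nat vs 0 k) vJ 0 j
    real := write σ.real rSnap 0 (σ.real rSnap 0 - dist p (S.F j)) } with hσ₁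
  have hS₁ : S.Loaded σ₁ := by
    refine hσ.loaded.of_eq (fun a ha => ?_) (fun a ha => ?_) rfl
    · have : a ≠ vs ∧ a ≠ vJ := by revert a; decide
      simp [hσ₁, this]
    · exact write_other _ (by revert a; decide) _ _
  have hM₁ : Maintained S (S.records cli (N + 1)) σ₁ := by
    refine (hN ▸ hσ.maintained : Maintained S (S.records cli (N + 1)) σ).of_eq (fun a ha => ?_)
      (by simp [hσ₁])
    have h1 : a ≠ vs ∧ a ≠ vJ := by revert a; decide
    simp [hσ₁, h1]
  have hrun : WP (changeAt (nv vs) 0 1) σ₁ fun t σ₂ =>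
      WP (.ite (.nlt (nv vs) (nv aN)) moveLast .skip) (setNat σ₂ aN 0 N) fun t' σ' =>
        t + t' ≤ 300 + 60 * Nat.size C.card + 3 * S.changeTime ℓ C.card ∧
        ∃ q', Represents S (C.erase p) h q' σ' := by
    refine (changeAt_spec hV hS₁ (j := j) (s := k) (by simp [hσ₁]) hjm (fun x => by simp [hσ₁])
      (.inr ⟨rfl, rfl, records_eq_cons S cli hkN⟩) hM₁).mono ?_
    rintro t σ₂ hag₂ ⟨ht, hM₂⟩
    set σ₃ : State V := setNat σ₂ aN 0 N with hσ₃
    have hS₃ : S.Loaded σ₃ := (hS₁.agree hag₂ (by decide)).of_eq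
      (fun a ha => write_other _ (by rintro rfl; revert ha; decide) _ _) (fun _ _ => rfl) rfl
    have hM₃ : Maintained S (S.recordsErase cli (N + 1) k) σ₃ :=
      hM₂.of_eq (fun a ha => write_other _ (by rintro rfl; revert ha; decide) _ _) rfl
    have e1 : σ₃.nat aCli = cli := by simp [hσ₃, hag₂.nat aCli (by decide), hσ₁, hcli]
    have e2 : σ₃.nat aHid = σ.nat aHid := by simp [hσ₃, hag₂.nat aHid (by decide), hσ₁]
    have e3 : σ₃.nat aSlot = σ.nat aSlot := by simp [hσ₃, hag₂.nat aSlot (by decide), hσ₁]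
    have e4 : σ₃.nat aFresh = σ.nat aFresh := by simp [hσ₃, hag₂.nat aFresh (by decide), hσ₁]
    have e5 : σ₃.nat aN 0 = N := by simp [hσ₃]
    have e6 : σ₃.real rSnap 0 = σ.real rSnap 0 - dist p (S.F j) := by
      simp [hσ₃, hag₂.real rSnap (by decide), hσ₁]
    have e7 : σ₃.nat vs 0 = k := by simp [hσ₃, hag₂.nat vs (by decide), hσ₁]
    have hk1 := hmono k (by omega)
    have hN1 := hmono N (by omega)
    simp only [NExp.cost] at ht
    have htest : (BExp.nlt (nv vs) (nv aN)).Holds σ₃ ↔ k < N := by simp [e5, e7]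
    -- The conclusion follows from the renaming alone, with or without a client having been moved.
    have hconcl : ∀ σ' : State V, S.Loaded σ' → σ'.nat aN 0 = N →
        (∀ i < N, σ'.nat aCli i = cli (if i = k then N else i)) →
        (∀ i < N, σ'.nat aHid i = σ.nat aHid (if i = k then N else i)) →
        (∀ i < N, σ'.nat aSlot (σ'.nat aHid i) = i) →
        σ'.nat aFresh = σ.nat aFresh → σ'.real rSnap 0 = σ.real rSnap 0 - dist p (S.F j) →
        Maintained S (S.records (σ'.nat aCli) N) σ' →
        ∃ q', Represents S (C.erase p) h q' σ' := by
      intro σ' g1 g2 g3 g4 g5 g6 g7 g8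
      have hlt : ∀ i < N, (if i = k then N else i) < C.card := by
        intro i hi; split_ifs <;> omega
      have hnek : ∀ i < N, (if i = k then N else i) ≠ k := by
        intro i hi; split_ifs with h1 <;> omega
      refine ⟨fun i => q (if i = k then N else i), g1, by rw [g2, hcard], ?_, ?_, ?_, ?_, ?_, ?_,
        ?_, ?_, ?_, ?_⟩ <;> rw [hcard]
      · intro i hi
        refine Finset.mem_erase.2 ⟨fun he => ?_, hσ.mem _ (hlt i hi)⟩
        exact hnek i hi (hσ.inj _ (hlt i hi) k hk (he.trans hqk.symm))
      · intro x hx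
        obtain ⟨hxp, hxC⟩ := Finset.mem_erase.1 hx
        obtain ⟨i, hi, rfl⟩ := hσ.surj x hxC
        have hik : i ≠ k := by rintro rfl; exact hxp hqk
        by_cases hiN : i = N
        · exact ⟨k, by omega, by simp [hiN]⟩
        · exact ⟨i, by omega, by simp [hik]⟩
      · intro i hi i' hi' he
        have := hσ.inj _ (hlt i hi) _ (hlt i' hi') he
        split_ifs at this <;> omega
      · intro i hi; rw [g3 i hi]; exact hσ.cli_lt _ (hlt i hi)
      · intro i hi; rw [g3 i hi]; exact hσ.snap _ (hlt i hi)
      · exact g5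
      · intro i hi; rw [g4 i hi]; exact hσ.hid _ (hlt i hi)
      · intro i hi; rw [g4 i hi, g6]; exact hσ.fresh _ (hlt i hi)
      · rw [g7, ← hsum]
        refine Finset.sum_congr rfl fun i hi => ?_
        rw [g3 i (Finset.mem_range.1 hi)]
      · exact g8
    refine WP.ite (fun hb => ?_) (fun hb => ?_)
    · rw [htest] at hb
      unfold moveLast
      simp only [wp_seq, wp_nset]
      have hval : (NExp.cell aCli (nv aN)).eval σ₃ = cli N := by simp [e5, e1]
      rw [hval]
      set σ₄ : State V := setNat σ₃ vJ 0 (cli N) with hσ₄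
      change WP _ σ₄ _
      have hcN : cli N < S.m := hσ.cli_lt N (by omega)
      have hS₄ : S.Loaded σ₄ := hS₃.of_eq
        (fun a ha => write_other _ (by rintro rfl; revert ha; decide) _ _) (fun _ _ => rfl) rfl
      have hM₄ : Maintained S (S.recordsErase cli (N + 1) k) σ₄ :=
        hM₃.of_eq (fun a ha => write_other _ (by rintro rfl; revert ha; decide) _ _) rfl
      refine (changeAt_spec hV hS₄ (j := cli N) (s := N) (by simp [hσ₄]) hcN
        (fun x => by simp [hσ₄, e5]) (.inr ⟨rfl, rfl, recordsErase_succ S cli hb⟩) hM₄).mono ?_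
      rintro t₅ σ₅ hag₅ ⟨ht₅, hM₅⟩
      have hS₅ := hS₄.agree hag₅ (by decide)
      have f1 : σ₅.nat vJ 0 = cli N := by rw [hag₅.nat vJ (by decide)]; simp [hσ₄]
      have f2 : σ₅.nat vs 0 = k := by rw [hag₅.nat vs (by decide)]; simp [hσ₄, e7]
      refine (changeAt_spec hV hS₅ (j := cli N) (s := k) f1 hcN (fun x => by simp [f2])
        (M' := (cli N, S.base + 2 * Nat.size k) ::ₘ S.recordsErase cli N k)
        (.inl ⟨rfl, rfl, rfl⟩) hM₅).mono ?_
      rintro t₆ σ₆ hag₆ ⟨ht₆, hM₆⟩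
      have hS₆ := hS₅.agree hag₆ (by decide)
      have back : ∀ a ∈ [aCli, aHid, aSlot, aFresh, aN, vs], σ₆.nat a = σ₃.nat a := by
        intro a ha
        rw [hag₆.nat a (by revert a; decide), hag₅.nat a (by revert a; decide)]
        exact write_other _ (by revert a; decide) _ _
      have f3 : σ₆.nat vJ 0 = cli N := by rw [hag₆.nat vJ (by decide), f1]
      have g1 : σ₆.nat aCli = cli := by rw [back _ (by decide), e1]
      have g2 : σ₆.nat aHid = σ.nat aHid := by rw [back _ (by decide), e2]
      have g3 : σ₆.nat aSlot = σ.nat aSlot := by rw [back _ (by decide), e3]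
      have g4 : σ₆.nat aFresh = σ.nat aFresh := by rw [back _ (by decide), e4]
      have g5 : σ₆.nat aN 0 = N := by rw [back _ (by decide), e5]
      have g6 : σ₆.nat vs 0 = k := by rw [back _ (by decide), e7]
      have g7 : σ₆.real rSnap 0 = σ.real rSnap 0 - dist p (S.F j) := by
        rw [hag₆.real rSnap (by decide), hag₅.real rSnap (by decide), ← e6]
      set H := σ.nat aHid N with hH
      set σ₇ : State V := { σ₆ with
        nat := write (write (write σ₆.nat aCli k (cli N)) aHid k H) aSlot H k } with hσ₇
      have hS₇ : S.Loaded σ₇ := hS₆.of_eq (fun a ha => by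
        have : a ≠ aCli ∧ a ≠ aHid ∧ a ≠ aSlot := by revert a; decide
        simp [hσ₇, this]) (fun _ _ => rfl) rfl
      have k1 : σ₇.nat aCli = Function.update cli k (cli N) := by simp [hσ₇, g1]
      have k2 : σ₇.nat aHid = Function.update (σ.nat aHid) k H := by simp [hσ₇, g2]
      have k3 : σ₇.nat aSlot = Function.update (σ.nat aSlot) H k := by simp [hσ₇, g3]
      have hfin : ∃ q', Represents S (C.erase p) h q' σ₇ := by
        refine hconcl σ₇ hS₇ (by simp [hσ₇, g5]) ?_ ?_ ?_ (by simp [hσ₇, g4]) g7 ?_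
        · intro i _; rw [k1, Function.update_apply]; split_ifs <;> rfl
        · intro i _; rw [k2, Function.update_apply]; split_ifs <;> rfl
        · intro i hi
          rw [k2, k3, Function.update_apply (σ.nat aHid)]
          split_ifs with hik
          · rw [Function.update_self, hik]
          -- The slot table inverts the handle table, so the handle of a client that stays differs
          -- from that of the moved one and its entry is not overwritten.
          · have h1 := hσ.slot i (by omega)
            rw [Function.update_of_ne, h1]
            intro he
            have h2 := hσ.slot N (by omega)
            rw [← hH, ← he, h1] at h2
            omega
        · rw [records_eq_cons S _ hb, k1, Function.update_self,
            recordsErase_congr S (cli := cli) fun i hi => Function.update_of_ne hi _ _]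
          refine hM₆.of_eq (fun a ha => ?_) rfl
          have : a ≠ aCli ∧ a ≠ aHid ∧ a ≠ aSlot := by revert a; decide
          simp [hσ₇, this]
      simp only [NExp.eval, write_other, ne_eq, Nat.reduceEqDiff, not_false_eq_true, write_same,
        g6, f3, g5, g2, ← hH, Function.update_self]
      refine ⟨?_, hfin⟩
      simp only [NExp.cost, BExp.cost] at ht₅ ht₆ ⊢
      omega
    · rw [htest] at hb
      have hkN' : k = N := by omega
      rw [wp_skip]
      refine ⟨?_, hconcl σ₃ hS₃ e5 ?_ ?_ ?_ e4 e6 ?_⟩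
      · simp only [NExp.cost, BExp.cost]; omega
      · intro i hi; rw [if_neg (by omega), e1]
      · intro i hi; rw [if_neg (by omega), e2]
      · intro i hi; rw [e2, e3]; exact hσ.slot i (by omega)
      · rw [e1, ← recordsErase_self]
        rw [hkN'] at hM₃
        exact hM₃
  have hst : (σ.real rSnap 0 - ptDist (σ.pt pReq 0) (σ.pt pFac j)) =
      σ.real rSnap 0 - dist p (S.F j) := by
    rw [hp, hσ.loaded.F j hjm, ptDist_some]
  simp only [NExp.eval, RExp.eval, hst, hslot, ← hj, ← hcli, write_other, ne_eq,
    Nat.reduceEqDiff, not_false_eq_true, write_same, Function.update_self]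
  change WP (changeAt (nv vs) 0 1) σ₁ _
  refine hrun.mono fun t σ₂ hag₂ h3 => ?_
  have e5 : σ₂.nat aN 0 = N + 1 := by
    rw [hag₂.nat aN (by decide)]; simp [hσ₁, hσ.card, hN]
  rw [e5]
  refine WP.mono h3 fun t' σ' _ ⟨h4, h5⟩ => ⟨?_, h5⟩
  simp only [NExp.cost, RExp.cost]
  omega

theorem answerCost_spec (σ : State V) :
    WP answerCost σ fun τ σ' => τ ≤ 20 ∧
      σ'.real rAns 0 = σ.real rSnap 0 + 24 * σ.real rPay 0 := by
  simp [answerCost]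

theorem answerSolution_spec {σ : State V} (hout : σ.out = []) :
    WP answerSolution σ fun τ σ' => τ ≤ 30 * (σ.nat aLen 0 + 1) ∧
      σ'.out = (List.range (σ.nat aLen 0)).map (σ.nat aOpen) := by
  unfold answerSolution
  refine WP.forLoop_bounded 0 (σ.nat aLen 0) 10 (Nat.zero_le _) (by decide) rfl ?_
    (fun k σ' => σ'.out = (List.range k).map (σ.nat aOpen)) ?_ ?_ ?_
  · intro σ' hag; simp [hag.nat aLen (by decide)]
  · simpa [State.nlet] using hout
  · intro k σ' _ hk hv hag hI
    simp [State.nlet, hI, hv, hag.nat aOpen (by decide), List.range_succ]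
  · intro τ σ' hτ _ _ hI
    refine ⟨?_, hI⟩
    simp at hτ
    omega

/-! ### Approximation guarantee -/

/-- The stored counts are meaningful for net points only, so heaviness in memory and true heaviness
are compared only there. -/
theorem IsMaxSep.congr {m : ℕ} {F : ℕ → V} {f : ℕ → ℝ} {R₀ : ℝ} {net : ℕ → ℕ → Prop}
    {g : ℕ → ℕ → ℕ} {heavy heavy' : ℕ → ℕ → Prop} {K : ℕ → Prop} {t : ℕ}
    (h : IsMaxSep m F f R₀ net g heavy K t)
    (hh : ∀ t x, x < m → net t x → (heavy' t x ↔ heavy t x)) :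
    IsMaxSep m F f R₀ net g heavy' K t := by
  have he : ∀ x < m, net t x →
      (Elig m F f R₀ net g heavy' t x ↔ Elig m F f R₀ net g heavy t x) := fun x hx hn =>
    and_congr (hh t x hx hn) (and_congr_right fun _ => forall_congr' fun y => forall_congr' fun hy =>
      forall_congr' fun hny => forall_congr' fun _ => not_congr (hh _ y hy hny))
  exact ⟨h.lt, h.isNet, fun x hx => (he x (h.lt x hx) (h.isNet x hx)).2 (h.elig x hx), h.sep,
    fun x hx hn hel => h.max x hx hn ((he x hx hn).1 hel)⟩

theorem sum_inv_sq_le (n : ℕ) : ∑ k ∈ Finset.range n, 1 / ((k : ℝ) + 1) ^ 2 ≤ 2 := by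
  suffices H : ∀ n : ℕ, ∑ k ∈ Finset.range (n + 1), 1 / ((k : ℝ) + 1) ^ 2 ≤ 2 - 1 / ((n : ℝ) + 1) by
    cases n with
    | zero => simp
    | succ n => exact (H n).trans (by have : (0 : ℝ) ≤ 1 / (n + 1) := by positivity
                                      linarith)
  intro n
  induction n with
  | zero => norm_num
  | succ n ih =>
    rw [Finset.sum_range_succ]
    -- Telescoping: each square is bounded by a difference of consecutive reciprocals.
    have : 1 / (((n + 1 : ℕ) : ℝ) + 1) ^ 2 ≤ 1 / ((n : ℝ) + 1) - 1 / (((n + 1 : ℕ) : ℝ) + 1) := by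
      push_cast
      rw [div_sub_div _ _ (by positivity) (by positivity), div_le_div_iff₀ (by positivity)
        (by positivity)]
      ring_nf
      nlinarith [(Nat.cast_nonneg n : (0 : ℝ) ≤ n), sq_nonneg (n : ℝ)]
    linarith

/-- Two scales per binary digit of `k` divide the radius by 4 ^ size(k), which is at least (k + 1)²,
and the inverse squares sum to at most 2. -/
theorem sum_scale_le {a fm : ℝ} (ha : 0 ≤ a) {b : ℕ} (hb : a / 2 ^ b ≤ fm) (n : ℕ) :
    ∑ k ∈ Finset.range n, a / 2 ^ (b + 2 * Nat.size k) ≤ 2 * fm := by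
  have h : ∀ k ∈ Finset.range n, a / 2 ^ (b + 2 * Nat.size k) ≤ fm * (1 / ((k : ℝ) + 1) ^ 2) := by
    intro k _
    have h1 : (k : ℝ) + 1 ≤ 2 ^ Nat.size k := by exact_mod_cast Nat.lt_size_self k
    rw [pow_add, ← div_div, mul_comm 2, pow_mul, div_eq_mul_one_div (a / 2 ^ b)]
    have h0 : 0 ≤ a / 2 ^ b := by positivity
    gcongr
    linarith
  have hfm : 0 ≤ fm := le_trans (by positivity) hb
  calc _ ≤ ∑ k ∈ Finset.range n, fm * (1 / ((k : ℝ) + 1) ^ 2) := Finset.sum_le_sum h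
    _ = fm * ∑ k ∈ Finset.range n, 1 / ((k : ℝ) + 1) ^ 2 := by rw [Finset.mul_sum]
    _ ≤ fm * 2 := by gcongr; exact sum_inv_sq_le n
    _ = _ := mul_comm _ _

/-- The tables belong to the instance `I`. -/
structure Tables.Fits (S : Tables V) (I : Input V) : Prop where
  m_eq : S.m = I.m
  F_eq : ∀ k (hk : k < I.m), S.F k = I.fac ⟨k, hk⟩
  f_eq : ∀ k (hk : k < I.m), S.f k = I.f ⟨k, hk⟩
  top_eq : S.top = max I.W I.fmax
  base_ge : S.top / 2 ^ S.base ≤ I.fmin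
  base_le : 2 ^ S.base * I.fmin ≤ 2 * S.top

/-- The facility and the finest scale of the client in slot `k`. -/
def Tables.lev (S : Tables V) (k : ℕ) : ℕ := S.base + 2 * Nat.size k

theorem countP_records (S : Tables V) (cli : ℕ → ℕ) (n : ℕ) (P : ℕ × ℕ → Prop) [DecidablePred P] :
    (S.records cli n).countP P = ((Finset.range n).filter fun k => P (cli k, S.lev k)).card := by
  rw [Tables.records, Multiset.countP_map]
  rfl

theorem sum_records (S : Tables V) (cli : ℕ → ℕ) (n : ℕ) (φ : ℕ × ℕ → ℝ) :
    ((S.records cli n).map φ).sum = ∑ k ∈ Finset.range n, φ (cli k, S.lev k) := by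
  rw [Tables.records, Multiset.map_map]
  rfl

theorem Represents.heavyAt_iff {S : Tables V} {C : Finset V} {h : V → ℕ} {q : ℕ → V} {σ : State V}
    (hσ : Represents S C h q σ) {t x : ℕ} (hx : x < S.m) (hn : S.IsNet t x) :
    Heavy S.f S.top S.cheap (ballCount S.F S.top C.card (σ.nat aCli) S.lev) t x ↔
      S.HeavyAt (σ.nat aBal) t x := by
  classical
  have h1 : ballCount S.F S.top C.card (σ.nat aCli) S.lev t x = σ.nat aBal (t * S.m + x) := by
    rw [hσ.maintained.counts.bal t x hx hn, countP_records]
    unfold ballCount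
    congr
  rw [Tables.HeavyAt, Heavy, Heavy, h1]

/-- The stored estimate is the sum of the estimates for the clients. -/
theorem Represents.pay_eq {S : Tables V} {ℓ : ℕ} (hV : S.Valid ℓ) {C : Finset V} {h : V → ℕ}
    {q : ℕ → V} {σ : State V} (hσ : Represents S C h q σ) :
    σ.real rPay 0 = ∑ k ∈ Finset.range C.card, payment S.top S.Z S.parent
      (Heavy S.f S.top S.cheap (ballCount S.F S.top C.card (σ.nat aCli) S.lev))
      (σ.nat aCli k) (S.lev k) := by
  classical
  obtain ⟨B₀, hB₀⟩ := hσ.maintained.counts.pay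
  set n := C.card with hn
  set cli := σ.nat aCli with hcli
  set heavy := Heavy S.f S.top S.cheap (ballCount S.F S.top n cli S.lev) with hheavy
  set B := max B₀ ((Finset.range n).sup S.lev + 1) with hB
  have hlev : ∀ k ∈ Finset.range n, S.lev k < B := fun k hk =>
    lt_of_lt_of_le (Nat.lt_succ_of_le (Finset.le_sup (f := S.lev) hk)) (le_max_right _ _)
  rw [hB₀ B (le_max_left _ _), sum_records]
  unfold payment
  rw [Finset.sum_add_distrib]
  congr 1
  -- A row groups the clients by their parents; here the sum is regrouped by clients.
  have hrow : ∀ t, S.rowPay (σ.nat aBal) (σ.nat aCnt) t = ∑ k ∈ Finset.range n,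
      if t ≤ S.lev k then (if heavy t (S.parent t (cli k)) then 0 else S.top / 2 ^ t) else 0 := by
    intro t
    have hc : ∀ x ∈ Finset.range S.m, S.cellPay (σ.nat aBal) (σ.nat aCnt) t x =
        ∑ k ∈ Finset.range n, if t ≤ S.lev k ∧ S.parent t (cli k) = x then
          (if heavy t (S.parent t (cli k)) then 0 else S.top / 2 ^ t) else 0 := by
      intro x hx
      have hxm := Finset.mem_range.1 hx
      rw [← Finset.sum_filter]
      have hcnt := hσ.maintained.counts.cnt t x hxm
      rw [countP_records] at hcnt
      have hcnt' : σ.nat aCnt (t * S.m + x) = ((Finset.range n).filter fun k =>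
          t ≤ S.lev k ∧ S.parent t (cli k) = x).card := hcnt.trans (by congr)
      rw [Tables.cellPay, hcnt']
      -- A cell counting some client belongs to a net point, as parents are net points, and there
      -- stored and true heaviness agree. A cell counting nobody contributes nothing, whatever its
      -- heaviness.
      by_cases hne : ((Finset.range n).filter fun k =>
          t ≤ S.lev k ∧ S.parent t (cli k) = x).Nonempty
      · obtain ⟨k₀, hk₀⟩ := hne
        obtain ⟨hk₀n, -, hk₀x⟩ := Finset.mem_filter.1 hk₀
        have hnet : S.IsNet t x := by
          rw [← hk₀x]
          exact hV.sys.par_net t _ (hσ.cli_lt k₀ (Finset.mem_range.1 hk₀n))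
        have hiff := hσ.heavyAt_iff hxm hnet
        rw [Finset.sum_congr rfl (g := fun _ => if heavy t x then 0 else S.top / 2 ^ t)]
        · rw [Finset.sum_const, nsmul_eq_mul]
          simp only [← hiff, ← hn, ← hcli, ← hheavy]
          split_ifs <;> simp
        · intro k hk
          rw [(Finset.mem_filter.1 hk).2.2]
      · rw [Finset.not_nonempty_iff_eq_empty.1 hne]
        simp
    rw [Tables.rowPay, Finset.sum_congr rfl hc, Finset.sum_comm]
    refine Finset.sum_congr rfl fun k hk => ?_
    by_cases ht : t ≤ S.lev k
    · rw [if_pos ht]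
      simp only [ht, true_and]
      rw [Finset.sum_ite_eq, if_pos]
      exact Finset.mem_range.2 (hV.sys.par_lt t _ (hσ.cli_lt k (Finset.mem_range.1 hk)))
    · simp [ht]
  rw [Finset.sum_congr rfl fun t _ => hrow t, Finset.sum_comm]
  refine Finset.sum_congr rfl fun k hk => ?_
  rw [← Finset.sum_filter]
  refine Finset.sum_congr ?_ fun _ _ => rfl
  ext t
  have := hlev k hk
  simp only [Finset.mem_filter, Finset.mem_range]
  omega

theorem sum_clients {S : Tables V} {C : Finset V} {h : V → ℕ} {q : ℕ → V} {σ : State V}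
    (hσ : Represents S C h q σ) (φ : V → ℝ) :
    ∑ i ∈ C, φ i = ∑ k ∈ Finset.range C.card, φ (q k) := by
  classical
  have : C = (Finset.range C.card).image q := by
    ext x
    simp only [Finset.mem_image, Finset.mem_range]
    constructor
    · exact fun hx => hσ.surj x hx
    · rintro ⟨k, hk, rfl⟩; exact hσ.mem k hk
  conv_lhs => rw [this]
  exact Finset.sum_image fun k hk k' hk' he =>
    hσ.inj k (Finset.mem_range.1 hk) k' (Finset.mem_range.1 hk') he

/-- The infimum is taken over a finite nonempty set, hence attained. -/
theorem Input.fmin_mem (I : Input V) : 0 < I.fmin ∧ (∃ j, I.f j = I.fmin) ∧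
    ∀ j, 0 < I.f j → I.fmin ≤ I.f j := by
  have hfin : {x | 0 < x ∧ ∃ j, I.f j = x}.Finite :=
    (Set.finite_range I.f).subset fun x hx => hx.2
  have hne : {x | 0 < x ∧ ∃ j, I.f j = x}.Nonempty := by
    obtain ⟨j, hj⟩ := I.exists_f_pos
    exact ⟨_, hj, j, rfl⟩
  have h := hne.csInf_mem hfin
  exact ⟨h.1, h.2, fun j hj => csInf_le hfin.bddBelow ⟨hj, j, rfl⟩⟩

theorem Input.opt_le (I : Input V) {C : Finset V} {S : Finset (Fin I.m)} (hS : I.Feasible C S) :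
    I.opt C ≤ I.cost C S := by
  refine csInf_le ⟨0, ?_⟩ ⟨S, hS, rfl⟩
  rintro _ ⟨S, -, rfl⟩
  exact add_nonneg (Finset.sum_nonneg fun j _ => I.f_nonneg j)
    (Finset.sum_nonneg fun _ _ => Metric.infDist_nonneg)

theorem Input.le_opt (I : Input V) {C : Finset V} {v : ℝ}
    (h : ∀ S, I.Feasible C S → v ≤ I.cost C S) : v ≤ I.opt C := by
  obtain ⟨j, -⟩ := I.exists_f_pos
  refine le_csInf ⟨_, {j}, fun _ => Finset.singleton_nonempty _, rfl⟩ ?_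
  rintro _ ⟨S, hS, rfl⟩
  exact h S hS

open Classical in
/-- The open facilities, as facilities of the instance. -/
noncomputable def Input.opened (I : Input V) (S : Tables V) (K : Finset (ℕ × ℕ)) :
    Finset (Fin I.m) :=
  Finset.univ.filter fun j => 0 < S.refs K j

/-- The approximate value of the optimum that is kept in the memory. -/
def estimate (σ : State V) : ℝ := σ.real rSnap 0 + 24 * σ.real rPay 0

/-- Twice the payments for opening, 22 times the payments for connecting the snapped clients, and
the snapping distances themselves by the triangle inequality. This explains the factor 24 of
`estimate`. -/
theorem Represents.cost_opened_le {S : Tables V} {ℓ : ℕ} (hV : S.Valid ℓ) {I : Input V}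
    (hI : S.Fits I) {C : Finset V} {h : V → ℕ} {q : ℕ → V} {σ : State V}
    (hσ : Represents S C h q σ) {K : Finset (ℕ × ℕ)}
    (hmax : ∀ t, S.MaxSep (σ.nat aBal) K t) :
    I.Feasible C (I.opened S K) ∧ I.cost C (I.opened S K) ≤ estimate σ := by
  classical
  set heavy := Heavy S.f S.top S.cheap (ballCount S.F S.top C.card (σ.nat aCli) S.lev) with hheavy
  have hmax' : ∀ t, IsMaxSep S.m S.F S.f S.top S.IsNet S.cheap heavy (fun x => (t, x) ∈ K) t :=
    fun t => (hmax t).congr fun t x hx hn => hσ.heavyAt_iff hx hn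
  have hpay := hσ.pay_eq hV
  have hopen : ∀ k < C.card, ∃ j ∈ I.opened S K, dist (S.F (σ.nat aCli k)) (I.fac j) ≤
      22 * payment S.top S.Z S.parent heavy (σ.nat aCli k) (S.lev k) := by
    intro k hk
    obtain ⟨s, hs, h1, h2⟩ := exists_open_le_payment hV.top_pos hV.sys hV.f_nonneg hV.f_le hV.dist_le
      hV.free (fun k hk => hσ.cli_lt k hk) hmax' hk
    have hs' : s < I.m := hI.m_eq ▸ hs
    refine ⟨⟨s, hs'⟩, Finset.mem_filter.2 ⟨Finset.mem_univ _, ?_⟩, by rwa [← hI.F_eq s hs']⟩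
    rcases h1 with h1 | ⟨p, hp, rfl⟩
    · simp [Tables.refs, hs, h1]
    · refine lt_of_lt_of_le ?_ (Nat.le_add_left _ _)
      exact Finset.card_pos.2 ⟨p, Finset.mem_filter.2 ⟨hp, rfl⟩⟩
  refine ⟨?_, ?_⟩
  · rintro ⟨x, hx⟩
    obtain ⟨k, hk, -⟩ := hσ.surj x hx
    obtain ⟨j, hj, -⟩ := hopen k hk
    exact ⟨j, hj⟩
  · have h1 : ∑ j ∈ I.opened S K, I.f j ≤ 2 * σ.real rPay 0 := by
      rw [hpay]
      refine le_trans ?_ (sum_open_le hV.top_pos hV.sys hV.free (fun k hk => hσ.cli_lt k hk) hmax')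
      have h2 : ∀ j ∈ I.opened S K, I.f j ≤
          ∑ p ∈ K.filter (fun p => S.cheap p.1 p.2 = j), S.f (S.cheap p.1 p.2) := by
        intro j hj
        have hj' := (Finset.mem_filter.1 hj).2
        by_cases h0 : I.f j = 0
        · rw [h0]; exact Finset.sum_nonneg fun _ _ => hV.f_nonneg _
        · have h3 : S.f j = I.f j := hI.f_eq j j.2
          rw [Tables.refs, if_neg (by rw [h3]; tauto), zero_add] at hj'
          obtain ⟨p, hp⟩ := Finset.card_pos.1 hj'
          have h4 : I.f j = S.f (S.cheap p.1 p.2) := by rw [(Finset.mem_filter.1 hp).2, h3]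
          rw [h4]
          exact Finset.single_le_sum (f := fun p => S.f (S.cheap p.1 p.2))
            (fun _ _ => hV.f_nonneg _) hp
      refine (Finset.sum_le_sum h2).trans ?_
      rw [← Finset.sum_biUnion]
      · exact Finset.sum_le_sum_of_subset_of_nonneg
          (Finset.biUnion_subset.2 fun j _ => Finset.filter_subset _ _)
          fun _ _ _ => hV.f_nonneg _
      · intro j _ j' _ hne
        refine Finset.disjoint_left.2 fun p hp hp' => hne (Fin.ext ?_)
        rw [← (Finset.mem_filter.1 hp).2, (Finset.mem_filter.1 hp').2]
    have h2 : ∑ i ∈ C, Metric.infDist i (I.fac '' (I.opened S K : Set (Fin I.m))) ≤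
        σ.real rSnap 0 + 22 * σ.real rPay 0 := by
      rw [sum_clients hσ, hpay, hσ.snapDist, Finset.mul_sum, ← Finset.sum_add_distrib]
      refine Finset.sum_le_sum fun k hk => ?_
      obtain ⟨j, hj, hd⟩ := hopen k (Finset.mem_range.1 hk)
      refine (Metric.infDist_le_dist_of_mem (Set.mem_image_of_mem _ hj)).trans ?_
      exact (dist_triangle _ (S.F (σ.nat aCli k)) _).trans (by linarith)
    rw [Input.cost, estimate]
    linarith

/-- Let E be the connection cost of the given solution. The snapping distances sum to at most 3E, so
snapped clients are connected at cost at most 4E. The estimate is then at most 3E + 24 · 4 (opening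
+ 4E), which is below 400 times the cost. -/
theorem Represents.estimate_le_cost {S : Tables V} {ℓ : ℕ} (hV : S.Valid ℓ) {I : Input V}
    (hI : S.Fits I) {C : Finset V} {h : V → ℕ} {q : ℕ → V} {σ : State V}
    (hσ : Represents S C h q σ) {T : Finset (Fin I.m)} (hT : I.Feasible C T) :
    estimate σ ≤ 400 * I.cost C T := by
  classical
  have hcost0 : 0 ≤ I.cost C T := add_nonneg (Finset.sum_nonneg fun j _ => I.f_nonneg j)
    (Finset.sum_nonneg fun _ _ => Metric.infDist_nonneg)
  have hpay := hσ.pay_eq hV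
  rcases C.eq_empty_or_nonempty with hC | hC
  · subst hC
    have h1 := hσ.snapDist
    simp at h1 hpay
    rw [estimate, h1, hpay]
    linarith
  have hTne := hT hC
  have hnear : ∀ x : V, ∃ j ∈ T, dist x (I.fac j) ≤ Metric.infDist x (I.fac '' (T : Set (Fin I.m))) := by
    intro x
    have hcomp : IsCompact (I.fac '' (T : Set (Fin I.m))) := (T.finite_toSet.image _).isCompact
    obtain ⟨y, ⟨j, hj, rfl⟩, hd⟩ := hcomp.exists_infDist_eq_dist
      (Set.Nonempty.image _ (Finset.coe_nonempty.2 hTne)) x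
    exact ⟨j, hj, hd.ge⟩
  choose φ hφT hφd using hnear
  have hsum : ∑ j ∈ T.map Fin.valEmbedding, S.f j = ∑ j ∈ T, I.f j := by
    rw [Finset.sum_map]
    exact Finset.sum_congr rfl fun j _ => hI.f_eq j j.2
  have hP := sum_payment_le (n := C.card) (j := σ.nat aCli) (L := S.lev) (fm := I.fmin)
    hV.top_pos hV.sys hV.f_nonneg hV.free (fun k hk => hσ.cli_lt k hk)
    (fun x hx hfx => by
      have hx' : x < I.m := hI.m_eq ▸ hx
      rw [hI.f_eq x hx'] at hfx ⊢
      exact I.fmin_mem.2.2 _ hfx)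
    (sum_scale_le hV.top_pos.le hI.base_ge _)
    (T.map Fin.valEmbedding)
    (fun s hs => by
      obtain ⟨j, -, rfl⟩ := Finset.mem_map.1 hs
      rw [hI.m_eq]; exact j.2)
    (fun k => (φ (q k) : ℕ))
    (fun k hk => Finset.mem_map.2 ⟨_, hφT (q k), rfl⟩)
  rw [← hpay, hsum] at hP
  have hFφ : ∀ x : V, S.F (φ x) = I.fac (φ x) := fun x => hI.F_eq _ (φ x).2
  set E := ∑ i ∈ C, Metric.infDist i (I.fac '' (T : Set (Fin I.m))) with hE
  have hsnap : ∀ k < C.card, dist (q k) (S.F (σ.nat aCli k)) ≤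
      3 * Metric.infDist (q k) (I.fac '' (T : Set (Fin I.m))) := by
    intro k hk
    have := hσ.snap k hk (φ (q k)) (by rw [hI.m_eq]; exact (φ (q k)).2)
    rw [hFφ] at this
    have := hφd (q k)
    linarith
  have h1 : σ.real rSnap 0 ≤ 3 * E := by
    rw [hσ.snapDist, hE, sum_clients hσ, Finset.mul_sum]
    exact Finset.sum_le_sum fun k hk => hsnap k (Finset.mem_range.1 hk)
  have h2 : ∑ k ∈ Finset.range C.card, dist (S.F (σ.nat aCli k)) (S.F (φ (q k))) ≤ 4 * E := by
    rw [hE, sum_clients hσ, Finset.mul_sum]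
    refine Finset.sum_le_sum fun k hk => ?_
    have h3 := hsnap k (Finset.mem_range.1 hk)
    have h4 := hφd (q k)
    have h5 := dist_triangle_left (S.F (σ.nat aCli k)) (S.F (φ (q k))) (q k)
    rw [hFφ] at h5 ⊢
    linarith
  have h3 : 0 ≤ ∑ j ∈ T, I.f j := Finset.sum_nonneg fun j _ => I.f_nonneg j
  have h4 : 0 ≤ E := Finset.sum_nonneg fun _ _ => Metric.infDist_nonneg
  rw [Input.cost, estimate]
  linarith

/-- The list has no repetitions because `aPos` inverts it. Facilities with positive count have valid
indices, as free facilities and cheapest facilities of members do. -/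
theorem IndRep.opened_eq {S : Tables V} {ℓ : ℕ} (hV : S.Valid ℓ) {I : Input V}
    (hI : S.Fits I) {K : Finset (ℕ × ℕ)} {σ : State V} (hK : IndRep S K σ) :
    (I.opened S K).card = σ.nat aLen 0 ∧
      (((List.range (σ.nat aLen 0)).map (σ.nat aOpen) : List ℕ) : Multiset ℕ) =
        (I.opened S K).val.map Fin.val := by
  classical
  obtain ⟨h1, h2, h3⟩ := hK.rep
  have hnodup : ((List.range (σ.nat aLen 0)).map (σ.nat aOpen)).Nodup := by
    refine List.Nodup.map_on ?_ List.nodup_range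
    intro i hi i' hi' he
    rw [← (h2 i (List.mem_range.1 hi)).2, he, (h2 i' (List.mem_range.1 hi')).2]
  have hlt : ∀ x, 0 < S.refs K x → x < I.m := by
    intro x hx
    rw [← hI.m_eq]
    by_contra! hxm
    have : S.refs K x = 0 := by
      rw [Tables.refs, if_neg (by omega), zero_add, Finset.card_eq_zero]
      refine Finset.filter_eq_empty_iff.2 fun p hp he => ?_
      have := hV.sys.g_lt p.1 p.2 (hK.lt p hp)
      omega
    omega
  have hmem : ∀ j : Fin I.m, j ∈ (I.opened S K).val ↔ 0 < S.refs K j := fun j => by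
    rw [Finset.mem_val, Input.opened, Finset.mem_filter]; simp
  have hms : (((List.range (σ.nat aLen 0)).map (σ.nat aOpen) : List ℕ) : Multiset ℕ) =
      (I.opened S K).val.map Fin.val := by
    refine (Multiset.Nodup.ext (Multiset.coe_nodup.2 hnodup)
      ((I.opened S K).nodup.map Fin.val_injective)).2 fun x => ?_
    rw [Multiset.mem_coe, List.mem_map, Multiset.mem_map]
    constructor
    · rintro ⟨i, hi, rfl⟩
      have := (h2 i (List.mem_range.1 hi)).1
      exact ⟨⟨_, hlt _ this⟩, (hmem _).2 this, rfl⟩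
    · rintro ⟨j, hj, rfl⟩
      have := h3 j ((hmem j).1 hj)
      exact ⟨_, List.mem_range.2 this.1, this.2⟩
  refine ⟨?_, hms⟩
  have := congrArg Multiset.card hms
  simpa using this.symm

/-! ### Running time -/

theorem Tables.Fits.fmin_le {S : Tables V} {I : Input V} (hI : S.Fits I) : I.fmin ≤ S.top := by
  obtain ⟨j, hj⟩ := I.fmin_mem.2.1
  rw [hI.top_eq, ← hj]
  exact (le_ciSup (Set.finite_range I.f).bddAbove j).trans (le_max_right _ _)

/-- The quantities that enter the running times are at most `Δ`. -/
theorem Tables.Fits.le_Δ {S : Tables V} {I : Input V} (hI : S.Fits I) (C : Finset V) :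
    2 ≤ I.Δ C ∧ (S.base : ℝ) ≤ I.Δ C - 1 ∧ (Nat.size C.card : ℝ) ≤ I.Δ C - 1 ∧
      Real.log S.m ≤ I.Δ C := by
  have hfm := I.fmin_mem.1
  have hle := hI.fmin_le
  have htop : 0 < S.top := hfm.trans_le hle
  set N : ℝ := max (I.m : ℝ) (C.card : ℝ) with hN
  have hm1 : (1 : ℝ) ≤ I.m := by
    obtain ⟨j, -⟩ := I.exists_f_pos
    exact_mod_cast j.pos
  have hN1 : 1 ≤ N := hm1.trans (le_max_left _ _)
  set X : ℝ := S.top * N / I.fmin with hX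
  have hratio : 1 ≤ S.top / I.fmin := by rwa [le_div_iff₀ hfm, one_mul]
  have hXN : N ≤ X := by
    rw [hX, mul_div_right_comm]; nlinarith
  have hXr : S.top / I.fmin ≤ X := by
    rw [hX, mul_div_right_comm]; nlinarith
  have hX1 : 1 ≤ X := hN1.trans hXN
  have hΔ : I.Δ C = 2 + Real.logb 2 X := by rw [Input.Δ, hX, hN, hI.top_eq]
  have hlog0 : 0 ≤ Real.logb 2 X := Real.logb_nonneg one_lt_two hX1
  -- Both `base` and the number of digits of the client count are exponents of a power of two that
  -- is at most `2 * X`.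
  have hpow : ∀ k : ℕ, (2 : ℝ) ^ k ≤ 2 * X → (k : ℝ) ≤ 1 + Real.logb 2 X := by
    intro k hk
    have h1 : Real.logb 2 ((2 : ℝ) ^ k) ≤ Real.logb 2 (2 * X) :=
      Real.logb_le_logb_of_le one_lt_two (by positivity) hk
    rwa [Real.logb_pow, Real.logb_self_eq_one one_lt_two, mul_one,
      Real.logb_mul (by norm_num) (by positivity), Real.logb_self_eq_one one_lt_two] at h1
  rw [hΔ]
  refine ⟨by linarith, ?_, ?_, ?_⟩
  · have := hpow S.base (by
      refine le_trans ?_ (mul_le_mul_of_nonneg_left hXr two_pos.le)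
      rw [mul_div_assoc', le_div_iff₀ hfm]
      exact hI.base_le)
    linarith
  · have := hpow (Nat.size C.card) (by
      rcases Nat.eq_zero_or_pos C.card with h0 | h0
      · rw [h0]; simp; linarith
      · obtain ⟨s, hs⟩ : ∃ s, Nat.size C.card = s + 1 :=
          ⟨Nat.size C.card - 1, by have := Nat.size_pos.2 h0; omega⟩
        have h1 : 2 ^ s ≤ C.card := Nat.lt_size.1 (by omega)
        have h2 : (2 : ℝ) ^ s ≤ C.card := by exact_mod_cast h1
        have h3 : (C.card : ℝ) ≤ N := le_max_right _ _
        rw [hs, pow_succ]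
        linarith)
    linarith
  · have h1 : Real.log S.m ≤ Real.log X := by
      rw [hI.m_eq]
      exact Real.log_le_log (by linarith) ((le_max_left _ _).trans hXN)
    have h2 : Real.log X = Real.logb 2 X * Real.log 2 := by
      rw [Real.logb, div_mul_cancel₀]
      exact (Real.log_pos one_lt_two).ne'
    have h3 : Real.log 2 ≤ 1 := by have := Real.log_two_lt_d9; linarith
    nlinarith

/-- The running time of the updates is within the required bound. -/
theorem time_le_updateBound {S : Tables V} {I : Input V} (hI : S.Fits I) {κ : ℝ} (hκ : 0 ≤ κ)
    {ℓ : ℕ} (hℓ : (ℓ : ℝ) ≤ 2 ^ (5 * κ)) (C : Finset V) :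
    100 * (2 ^ (3 * κ) * Real.log S.m) + 500 + 60 * Nat.size C.card +
      3 * S.changeTime ℓ C.card ≤ updateBound 100000000 κ (I.Δ C) := by
  obtain ⟨h1, h2, h3, h4⟩ := hI.le_Δ C
  set Δ := I.Δ C with hΔ
  set E : ℝ := 2 ^ (10 * κ) with hE
  have hE1 : 1 ≤ E := Real.one_le_rpow one_le_two (by positivity)
  have h35 : (2 : ℝ) ^ (3 * κ) ≤ E := Real.rpow_le_rpow_of_exponent_le one_le_two (by linarith)
  have h5 : (1 : ℝ) ≤ 2 ^ (5 * κ) := Real.one_le_rpow one_le_two (by positivity)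
  have hEsq : E = (2 ^ (5 * κ)) ^ 2 := by
    rw [hE, ← Real.rpow_natCast, ← Real.rpow_mul two_pos.le]; congr 1; push_cast; ring
  have hℓ2 : ((ℓ : ℝ) + 1) ^ 2 ≤ 4 * E := by
    have : (ℓ : ℝ) + 1 ≤ 2 * 2 ^ (5 * κ) := by linarith
    calc ((ℓ : ℝ) + 1) ^ 2 ≤ (2 * 2 ^ (5 * κ)) ^ 2 := by gcongr
      _ = 4 * E := by rw [hEsq]; ring
  have hchange : (S.changeTime ℓ C.card : ℝ) ≤ 12000 * (Δ * E) := by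
    rw [Tables.changeTime]
    push_cast
    calc ((S.base : ℝ) + 2 * Nat.size C.card + 1) * ((ℓ + 1) ^ 2 * 1000)
        ≤ (3 * Δ) * (4 * E * 1000) := by gcongr; linarith
      _ = 12000 * (Δ * E) := by ring
  have hsnap : 2 ^ (3 * κ) * Real.log S.m ≤ Δ * E := by
    have h0 : 0 ≤ Real.log S.m := Real.log_natCast_nonneg _
    calc 2 ^ (3 * κ) * Real.log S.m ≤ E * Δ := by gcongr
      _ = Δ * E := mul_comm _ _
  have hΔE : Δ ≤ Δ * E := by nlinarith
  have htotal : 100 * (2 ^ (3 * κ) * Real.log S.m) + 500 + 60 * Nat.size C.card +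
      3 * S.changeTime ℓ C.card ≤ 40000 * (Δ * E) := by nlinarith
  -- From 10κ ≤ 10 + cκ²; the summand 10 becomes the factor 1024.
  have hEκ : E ≤ 1024 * 2 ^ (100000000 * κ ^ 2) := by
    have : (1024 : ℝ) = 2 ^ (10 : ℝ) := by norm_num
    rw [hE, this, ← Real.rpow_add two_pos]
    refine Real.rpow_le_rpow_of_exponent_le one_le_two ?_
    nlinarith [sq_nonneg (κ - 1)]
  -- As Δ ≥ 2, the last factor of the bound is at least log 2 > 1/2, even if κ = 0.
  have hlog : (1 : ℝ) / 2 ≤ κ ^ 2 + Real.log Δ := by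
    have h6 : Real.log 2 ≤ Real.log Δ := Real.log_le_log two_pos h1
    have := Real.log_two_gt_d9
    nlinarith [sq_nonneg κ]
  have hΔ3 : 4 * Δ ≤ Δ ^ 3 := by
    have : (4 : ℝ) ≤ Δ ^ 2 := by nlinarith
    nlinarith
  refine htotal.trans ?_
  rw [updateBound]
  set G : ℝ := 2 ^ (100000000 * κ ^ 2) with hG
  have hG0 : 0 < G := by positivity
  calc 40000 * (Δ * E) ≤ 40000 * (Δ * (1024 * G)) := by gcongr
    _ ≤ 100000000 * G * (4 * Δ) * (1 / 2) := by nlinarith [mul_pos hG0 (by linarith : 0 < Δ)]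
    _ ≤ 100000000 * G * Δ ^ 3 * (κ ^ 2 + Real.log Δ) := by gcongr

/-! ### Preprocessing: scales -/

theorem Input.m_pos (I : Input V) : 0 < I.m := by
  obtain ⟨j, -⟩ := I.exists_f_pos
  exact j.pos

/-- The location and the cost of the facility `k`; arbitrary for `k ≥ m`. -/
noncomputable def Input.point (I : Input V) (k : ℕ) : V :=
  if h : k < I.m then I.fac ⟨k, h⟩ else I.fac ⟨0, I.m_pos⟩

noncomputable def Input.price (I : Input V) (k : ℕ) : ℝ :=
  if h : k < I.m then I.f ⟨k, h⟩ else 0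

theorem Input.price_nonneg (I : Input V) (k : ℕ) : 0 ≤ I.price k := by
  unfold Input.price
  split_ifs
  exacts [I.f_nonneg _, le_rfl]

theorem Input.point_injOn (I : Input V) : ∀ a < I.m, ∀ b < I.m, I.point a = I.point b → a = b := by
  intro a ha b hb h
  rw [Input.point, Input.point, dif_pos ha, dif_pos hb] at h
  simpa using I.fac_injective h

/-- The input is in the memory. -/
structure Given (I : Input V) (σ : State V) : Prop where
  m : σ.nat aM 0 = I.m
  F : ∀ x < I.m, σ.pt pFac x = some (I.point x)
  f : σ.real rF = I.price

/-- `c` does not write the input. -/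
def KeepsInput (c : Cmd) : Prop := aM ∉ c.nw ∧ rF ∉ c.rw ∧ pFac ∉ c.pw

instance (c : Cmd) : Decidable (KeepsInput c) := by unfold KeepsInput; infer_instance

theorem Given.agree {I : Input V} {σ σ' : State V} {c : Cmd} (h : Given I σ) (ha : Agree c σ σ')
    (hc : KeepsInput c) : Given I σ' :=
  ⟨by rw [ha.nat _ hc.1, h.m], fun x hx => by rw [ha.pt _ hc.2.2, h.F x hx],
    by rw [ha.real _ hc.2.1, h.f]⟩

/-- The loop over all facilities. -/
abbrev forAll (v : ℕ) (body : Cmd) : Cmd := forLoop v (.lit 0) (nv aM) body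

theorem WP.forAll {I : Input V} {v : ℕ} {body : Cmd} {Q : ℕ → State V → Prop} {σ : State V}
    (hσ : Given I σ) (hv : v ∉ body.nw) (hk : KeepsInput (forAll v body))
    (Inv : ℕ → State V → Prop) (h0 : Inv 0 (σ.nlet v 0))
    (step : ∀ k σ', k < I.m → σ'.nat v 0 = k → Agree (forAll v body) σ σ' → Given I σ' →
      Inv k σ' → WP body σ' fun _ σ'' => Inv (k + 1) (σ''.nlet v (k + 1)))
    (post : ∀ t σ', Agree (forAll v body) σ σ' → Given I σ' → Inv I.m σ' → Q t σ') :
    WP (forAll v body) σ Q := by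
  refine WP.forLoop_halts 0 I.m (Nat.zero_le _) hv rfl ?_ Inv h0
    (fun k σ' _ h1 h2 h3 h4 => step k σ' h1 h2 h3 (hσ.agree h3 hk) h4)
    (fun t σ' h1 _ h3 => post t σ' h1 (hσ.agree h1 hk) h3)
  intro σ' hag
  exact (hσ.agree hag hk).m

def setTop : Cmd :=
  rlet rTop (rv rAns) ;;
  forAll vx (.ite (.rlt (rv rTop) (.cell rF (nv vx))) (rlet rTop (.cell rF (nv vx))) .skip)

theorem setTop_spec {I : Input V} {σ : State V} (hσ : Given I σ) (hW : σ.real rAns 0 = I.W) :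
    WP setTop σ fun _ σ' => σ'.real rTop 0 = max I.W I.fmax := by
  unfold setTop
  rw [wp_seq, wp_rset]
  set σ₀ : State V := setReal σ rTop 0 I.W with hσ₀
  have hg : Given I σ₀ := ⟨hσ.m, hσ.F, by simp [hσ₀, hσ.f]⟩
  have hrun : WP (forAll vx (.ite (.rlt (rv rTop) (.cell rF (nv vx)))
      (rlet rTop (.cell rF (nv vx))) .skip)) σ₀ fun _ σ' => σ'.real rTop 0 = max I.W I.fmax := by
    refine WP.forAll hg (by decide) (by decide)
      (fun k σ' => I.W ≤ σ'.real rTop 0 ∧ (∀ x < k, I.price x ≤ σ'.real rTop 0) ∧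
        (σ'.real rTop 0 = I.W ∨ ∃ x < I.m, σ'.real rTop 0 = I.price x)) ?_ ?_ ?_
    · simp [hσ₀, State.nlet]
    · rintro k σ' hk hv - hg' ⟨h1, h2, h3⟩
      refine WP.ite (fun hb => ?_) (fun hb => ?_)
      · have hb' : σ'.real rTop 0 < I.price k := by simpa [hv, hg'.f] using hb
        simp only [wp_rset, State.nlet, NExp.eval, RExp.eval, hv, hg'.f, write_same,
          Function.update_self]
        refine ⟨by linarith, fun x hx => ?_, .inr ⟨k, hk, rfl⟩⟩
        rcases Nat.lt_succ_iff_lt_or_eq.1 hx with hx | rfl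
        · linarith [h2 x hx]
        · exact le_rfl
      · have hb' : I.price k ≤ σ'.real rTop 0 := by simpa [hv, hg'.f] using hb
        simp only [wp_skip, State.nlet]
        refine ⟨h1, fun x hx => ?_, h3⟩
        rcases Nat.lt_succ_iff_lt_or_eq.1 hx with hx | rfl
        exacts [h2 x hx, hb']
    · rintro t σ' - hg' ⟨h1, h2, h3⟩
      have hne : Nonempty (Fin I.m) := ⟨⟨0, I.m_pos⟩⟩
      refine le_antisymm ?_ (max_le h1 (ciSup_le fun j => ?_))
      · rcases h3 with h3 | ⟨x, hx, h3⟩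
        · rw [h3]; exact le_max_left _ _
        · rw [h3, Input.price, dif_pos hx]
          exact (le_ciSup (Set.finite_range I.f).bddAbove _).trans (le_max_right _ _)
      · have := h2 j j.2
        rwa [Input.price, dif_pos j.2] at this
  simpa [hW] using hrun

def setMin : Cmd :=
  rlet rMin (rv rTop) ;;
  forAll vx (.ite (.and (.rlt (.lit 0) (.cell rF (nv vx))) (.rlt (.cell rF (nv vx)) (rv rMin)))
    (rlet rMin (.cell rF (nv vx))) .skip)

theorem setMin_spec {I : Input V} {σ : State V} (hσ : Given I σ)
    (htop : σ.real rTop 0 = max I.W I.fmax) :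
    WP setMin σ fun _ σ' => σ'.real rMin 0 = I.fmin := by
  unfold setMin
  rw [wp_seq, wp_rset]
  set σ₀ : State V := setReal σ rMin 0 (max I.W I.fmax) with hσ₀
  have hg : Given I σ₀ := ⟨hσ.m, hσ.F, by simp [hσ₀, hσ.f]⟩
  obtain ⟨hpos, ⟨j₀, hj₀⟩, hmin⟩ := I.fmin_mem
  have hrun : WP (forAll vx (.ite (.and (.rlt (.lit 0) (.cell rF (nv vx)))
      (.rlt (.cell rF (nv vx)) (rv rMin))) (rlet rMin (.cell rF (nv vx))) .skip)) σ₀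
      fun _ σ' => σ'.real rMin 0 = I.fmin := by
    refine WP.forAll hg (by decide) (by decide)
      (fun k σ' => I.fmin ≤ σ'.real rMin 0 ∧
        (∀ x < k, 0 < I.price x → σ'.real rMin 0 ≤ I.price x)) ?_ ?_ ?_
    · refine ⟨?_, by simp⟩
      simp only [hσ₀, State.nlet, write_same, Function.update_self, ← hj₀]
      exact (le_ciSup (Set.finite_range I.f).bddAbove j₀).trans (le_max_right _ _)
    · rintro k σ' hk hv - hg' ⟨h1, h2⟩
      have htest : (BExp.and (.rlt (.lit 0) (.cell rF (nv vx)))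
          (.rlt (.cell rF (nv vx)) (rv rMin))).Holds σ' ↔
          0 < I.price k ∧ I.price k < σ'.real rMin 0 := by simp [hv, hg'.f]
      refine WP.ite (fun hb => ?_) (fun hb => ?_)
      · rw [htest] at hb
        simp only [wp_rset, State.nlet, NExp.eval, RExp.eval, hv, hg'.f, write_same,
          Function.update_self]
        refine ⟨?_, fun x hx hx0 => ?_⟩
        · have h4 := hb.1
          rw [Input.price, dif_pos hk] at h4 ⊢
          exact hmin _ h4
        · rcases Nat.lt_succ_iff_lt_or_eq.1 hx with hx | rfl
          · linarith [h2 x hx hx0, hb.2]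
          · exact le_rfl
      · rw [htest, not_and, not_lt] at hb
        simp only [wp_skip, State.nlet]
        refine ⟨h1, fun x hx hx0 => ?_⟩
        rcases Nat.lt_succ_iff_lt_or_eq.1 hx with hx | rfl
        exacts [h2 x hx hx0, hb hx0]
    · rintro t σ' - hg' ⟨h1, h2⟩
      refine le_antisymm ?_ h1
      have := h2 j₀ j₀.2
      rw [Input.price, dif_pos j₀.2, hj₀] at this
      exact this hpos
  simpa [htop] using hrun

def setBase : Cmd :=
  rlet rr (rv rTop) ;;
  .while (.rlt (rv rMin) (rv rr)) (rlet rr (.div (rv rr) (.lit 2)) ;;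
    nlet aBase (.add (nv aBase) (.lit 1)))

theorem exists_div_two_pow_le (a : ℝ) {b : ℝ} (hb : 0 < b) :
    ∃ N : ℕ, ∀ n ≥ N, a / 2 ^ n ≤ b := by
  obtain ⟨N, hN⟩ := pow_unbounded_of_one_lt (a / b) (one_lt_two : (1 : ℝ) < 2)
  refine ⟨N, fun n hn => ?_⟩
  have h1 : (2 : ℝ) ^ N ≤ 2 ^ n := pow_le_pow_right₀ one_le_two hn
  rw [div_lt_iff₀ hb] at hN
  rw [div_le_iff₀ (by positivity)]
  nlinarith

/-- The first scale whose radius is at most the least positive cost. The radius of the preceding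
scale exceeded it, and this gives the second bound, which keeps `base` below Δ. -/
theorem setBase_spec {σ : State V} {top fm : ℝ} (htop : σ.real rTop 0 = top)
    (hfm : σ.real rMin 0 = fm) (hpos : 0 < fm) (hle : fm ≤ top) (hb : σ.nat aBase 0 = 0) :
    WP setBase σ fun _ σ' => top / 2 ^ (σ'.nat aBase 0) ≤ fm ∧
      2 ^ (σ'.nat aBase 0) * fm ≤ 2 * top := by
  obtain ⟨N, hN⟩ := exists_div_two_pow_le top hpos
  unfold setBase
  rw [wp_seq, wp_rset]
  refine WP.while _ (fun σ' => N - σ'.nat aBase 0)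
    (fun _ σ' => σ'.real rMin 0 = fm ∧ σ'.real rr 0 = top / 2 ^ σ'.nat aBase 0 ∧
      2 ^ (σ'.nat aBase 0) * fm ≤ 2 * top) ?_ ?_ ?_
  · simp [hfm, htop, hb]; linarith
  · rintro τ σ' - ⟨h1, h2, h3⟩ hb
    have hb' : fm < top / 2 ^ σ'.nat aBase 0 := by simpa [h1, h2] using hb
    have hlt : σ'.nat aBase 0 < N := by
      by_contra! h
      exact absurd (hN _ h) (not_le.2 hb')
    simp only [wp_seq, wp_rset, wp_nset]
    simp only [NExp.eval, RExp.eval, write_same, Function.update_self, ne_eq, Nat.reduceEqDiff,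
      not_false_eq_true, write_other]
    refine ⟨⟨h1, ?_, ?_⟩, by omega⟩
    · rw [h2, pow_succ]; push_cast; field_simp
    · rw [lt_div_iff₀ (by positivity)] at hb'
      rw [pow_succ]; nlinarith
  · rintro τ σ' - ⟨h1, h2, h3⟩ hb
    have hb' : top / 2 ^ σ'.nat aBase 0 ≤ fm := by simpa [h1, h2] using hb
    exact ⟨hb', h3⟩

/-- The facilities in `vx` and `vy` are different. -/
def distinct : BExp := .not (.and (.not (.nlt (nv vx) (nv vy))) (.not (.nlt (nv vy) (nv vx))))

theorem holds_distinct (σ : State V) : distinct.Holds σ ↔ σ.nat vx 0 ≠ σ.nat vy 0 := by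
  simp [distinct]; omega

/-- Find a scale at which the facilities are far from each other. -/
def setLast : Cmd :=
  rlet rr (rv rTop) ;;
  forAll vx (forAll vy
    (.while (.and distinct (.not (.rlt (.mul (.lit 12) (rv rr)) (.dist pFac (nv vx) pFac (nv vy)))))
      (rlet rr (.div (rv rr) (.lit 2)) ;; nlet aT (.add (nv aT) (.lit 1)))))

/-- At this scale all facilities are net points and no list contains anything but the facility
itself. The same is true at finer scales, so they can share the last row of the tables. -/
theorem setLast_spec {I : Input V} {σ : State V} (hσ : Given I σ) {top : ℝ}
    (htop : σ.real rTop 0 = top) (hpos : 0 ≤ top) (hb : σ.nat aT 0 = 0) :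
    WP setLast σ fun _ σ' => ∀ x < I.m, ∀ y < I.m, x ≠ y →
      12 * (top / 2 ^ (σ'.nat aT 0)) < dist (I.point x) (I.point y) := by
  unfold setLast
  rw [wp_seq, wp_rset]
  set σ₀ : State V := setReal σ rr 0 top with hσ₀
  have hg : Given I σ₀ := ⟨hσ.m, hσ.F, by simp [hσ₀, hσ.f]⟩
  have hmono : ∀ {d : ℝ} {a b : ℕ}, a ≤ b → 12 * (top / 2 ^ a) < d → 12 * (top / 2 ^ b) < d := by
    intro d a b hab h
    have : top / 2 ^ b ≤ top / 2 ^ a := by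
      gcongr
      exact one_le_two
    linarith
  have hrun : WP (forAll vx (forAll vy (.while (.and distinct
      (.not (.rlt (.mul (.lit 12) (rv rr)) (.dist pFac (nv vx) pFac (nv vy)))))
      (rlet rr (.div (rv rr) (.lit 2)) ;; nlet aT (.add (nv aT) (.lit 1)))))) σ₀
      fun _ σ' => ∀ x < I.m, ∀ y < I.m, x ≠ y →
        12 * (top / 2 ^ (σ'.nat aT 0)) < dist (I.point x) (I.point y) := by
    refine WP.forAll hg (by decide) (by decide)
      (fun k σ' => σ'.real rr 0 = top / 2 ^ (σ'.nat aT 0) ∧ ∀ x < k, ∀ y < I.m, x ≠ y →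
        12 * (top / 2 ^ (σ'.nat aT 0)) < dist (I.point x) (I.point y)) ?_ ?_ ?_
    · simp [State.nlet, hσ₀, hb]
    · rintro x σ₁ hx hvx - hg₁ ⟨h1, h2⟩
      refine WP.forAll hg₁ (by decide) (by decide)
        (fun k σ' => σ'.real rr 0 = top / 2 ^ (σ'.nat aT 0) ∧
          (∀ x' < x, ∀ y < I.m, x' ≠ y →
            12 * (top / 2 ^ (σ'.nat aT 0)) < dist (I.point x') (I.point y)) ∧
          ∀ y < k, x ≠ y → 12 * (top / 2 ^ (σ'.nat aT 0)) < dist (I.point x) (I.point y)) ?_ ?_ ?_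
      · exact ⟨by simpa [State.nlet] using h1, by simpa [State.nlet] using h2, by simp⟩
      · rintro y σ₂ hy hvy hag₂ hg₂ ⟨h3, h4, h5⟩
        have hvx₂ : σ₂.nat vx 0 = x := by rw [hag₂.nat vx (by decide), hvx]
        obtain ⟨N, hN⟩ : ∃ N : ℕ, ∀ n ≥ N, x ≠ y →
            12 * (top / 2 ^ n) < dist (I.point x) (I.point y) := by
          by_cases hxy : x = y
          · exact ⟨0, fun _ _ h => absurd hxy h⟩
          · have hd : 0 < dist (I.point x) (I.point y) :=
              dist_pos.2 fun h => hxy (I.point_injOn x hx y hy h)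
            -- Dividing by 13 rather than 12 makes the final inequality strict.
            obtain ⟨N, hN⟩ := exists_div_two_pow_le top (b := dist (I.point x) (I.point y) / 13)
              (by positivity)
            exact ⟨N, fun n hn _ => by linarith [hN n hn]⟩
        refine WP.while _ (fun σ' => N - σ'.nat aT 0)
          (fun _ σ' => σ₂.nat aT 0 ≤ σ'.nat aT 0 ∧ σ'.real rr 0 = top / 2 ^ (σ'.nat aT 0))
          ⟨le_rfl, h3⟩ ?_ ?_
        · rintro τ σ₃ hag₃ ⟨h6, h7⟩ hb
          rw [BExp.holds_and, holds_distinct] at hb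
          have e1 : σ₃.nat vx 0 = x := by rw [hag₃.nat vx (by decide), hvx₂]
          have e2 : σ₃.nat vy 0 = y := by rw [hag₃.nat vy (by decide), hvy]
          have hg₃ := hg₂.agree hag₃ (by decide)
          rw [e1, e2] at hb
          have hb' : dist (I.point x) (I.point y) ≤ 12 * (top / 2 ^ (σ₃.nat aT 0)) := by
            simpa [e1, e2, h7, hg₃.F x hx, hg₃.F y hy, ptDist_some] using hb.2
          have hlt : σ₃.nat aT 0 < N := by
            by_contra! h
            exact absurd (hN _ h hb.1) (not_lt.2 hb')
          simp only [wp_seq, wp_rset, wp_nset]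
          simp only [NExp.eval, RExp.eval, write_same, Function.update_self]
          refine ⟨⟨by omega, ?_⟩, by omega⟩
          rw [h7, pow_succ]; push_cast; field_simp
        · rintro τ σ₃ hag₃ ⟨h6, h7⟩ hb
          rw [BExp.holds_and, holds_distinct, not_and] at hb
          have e1 : σ₃.nat vx 0 = x := by rw [hag₃.nat vx (by decide), hvx₂]
          have e2 : σ₃.nat vy 0 = y := by rw [hag₃.nat vy (by decide), hvy]
          have hg₃ := hg₂.agree hag₃ (by decide)
          rw [e1, e2] at hb
          have hb' : x ≠ y → 12 * (top / 2 ^ (σ₃.nat aT 0)) < dist (I.point x) (I.point y) := by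
            intro hxy
            have := hb hxy
            simpa [e1, e2, h7, hg₃.F x hx, hg₃.F y hy, ptDist_some] using this
          have e3 : (σ₃.nlet vy (y + 1)).nat aT 0 = σ₃.nat aT 0 := by simp [State.nlet]
          rw [e3]
          refine ⟨h7, fun x' hx' y' hy' hne => hmono h6 (h4 x' hx' y' hy' hne), ?_⟩
          intro y' hy' hne
          rcases Nat.lt_succ_iff_lt_or_eq.1 hy' with hy' | rfl
          exacts [hmono h6 (h5 y' hy' hne), hb' hne]
      · rintro t σ₂ - - ⟨h3, h4, h5⟩
        have e3 : (σ₂.nlet vx (x + 1)).nat aT 0 = σ₂.nat aT 0 := by simp [State.nlet]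
        rw [e3]
        refine ⟨h3, fun x' hx' => ?_⟩
        rcases Nat.lt_succ_iff_lt_or_eq.1 hx' with hx' | rfl
        exacts [h4 x' hx', h5]
    · rintro t σ₁ - - ⟨-, h2⟩
      exact h2
  simpa [htop] using hrun

/-! ### Preprocessing: nets -/

/-- Run `body` for all rows of the tables of nets. -/
def rows (body : Cmd) : Cmd :=
  nlet vRow (.lit 0) ;; rlet rr (rv rTop) ;;
  forLoop vt (.lit 0) (.add (nv aT) (.lit 1))
    (body ;; nlet vRow (.add (nv vRow) (nv aM)) ;; rlet rr (.div (rv rr) (.lit 2)))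

theorem rows_spec {I : Input V} {σ : State V} {body : Cmd} {Q : ℕ → State V → Prop}
    (hσ : Given I σ) {T : ℕ} {top : ℝ} (hT : σ.nat aT 0 = T) (htop : σ.real rTop 0 = top)
    (hk : KeepsInput body) (hn : ∀ a ∈ [aT, vt, vRow], a ∉ body.nw) (hr : rr ∉ body.rw)
    (Inv : ℕ → State V → Prop)
    (hInv : ∀ s σ σ', Agree (rows .skip) σ σ' → Inv s σ → Inv s σ') (h0 : Inv 0 σ)
    (step : ∀ s σ', s ≤ T → Agree (rows body) σ σ' → Given I σ' → σ'.nat vRow 0 = s * I.m →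
      σ'.real rr 0 = top / 2 ^ s → Inv s σ' → WP body σ' fun _ σ'' => Inv (s + 1) σ'')
    (post : ∀ t σ', Agree (rows body) σ σ' → Inv (T + 1) σ' → Q t σ') :
    WP (rows body) σ Q := by
  simp only [List.forall_mem_cons, List.not_mem_nil] at hn
  obtain ⟨n1, n2, n3, -⟩ := hn
  have hkr : KeepsInput (rows body) := by
    obtain ⟨h1, h2, h3⟩ := hk
    refine ⟨?_, ?_, ?_⟩
    · simpa [rows, forLoop, Cmd.nw] using h1
    · simpa [rows, forLoop, Cmd.rw] using h2
    · simpa [rows, forLoop, Cmd.pw] using h3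
  have hTr : aT ∉ (rows body).nw := by simpa [rows, forLoop, Cmd.nw] using n1
  unfold rows
  simp only [wp_seq, wp_nset, wp_rset]
  set σ₀ : State V := { σ with
    nat := write σ.nat vRow 0 0
    real := write σ.real rr 0 top } with hσ₀
  have hA0s : ∀ b, Agree (rows b) σ σ₀ := by
    intro b
    refine ⟨fun a ha => ?_, fun a ha => ?_, fun a _ => rfl⟩
    · simp only [rows, Cmd.nw, List.mem_append, List.mem_singleton, not_or] at ha
      simp [hσ₀, write_other, ha]
    · simp only [rows, Cmd.rw, List.mem_append, List.mem_singleton, not_or] at ha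
      simp [hσ₀, write_other, ha]
  have hsub : ∀ σ', Agree (forLoop vt (.lit 0) (.add (nv aT) (.lit 1))
      (body ;; nlet vRow (.add (nv vRow) (nv aM)) ;; rlet rr (.div (rv rr) (.lit 2)))) σ₀ σ' →
      Agree (rows body) σ σ' := by
    intro σ' h
    refine (hA0s body).trans (h.mono ?_ ?_ ?_)
    · simp only [rows, Cmd.nw]; intro a; simp only [List.mem_append]; tauto
    · simp only [rows, Cmd.rw]; intro a; simp only [List.mem_append]; tauto
    · simp only [rows, Cmd.pw]; intro a; simp only [List.mem_append]; tauto
  have hst : ({ σ with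
      nat := write σ.nat vRow ((NExp.lit 0).eval σ) ((NExp.lit 0).eval σ)
      real := write σ.real rr ((NExp.lit 0).eval { σ with
        nat := write σ.nat vRow ((NExp.lit 0).eval σ) ((NExp.lit 0).eval σ) })
        ((rv rTop).eval { σ with
        nat := write σ.nat vRow ((NExp.lit 0).eval σ) ((NExp.lit 0).eval σ) }) } : State V) = σ₀ := by
    simp [hσ₀, htop]
  rw [hst]
  refine WP.forLoop_halts 0 (T + 1) (Nat.zero_le _) ?_ rfl ?_
    (fun s σ' => σ'.nat vRow 0 = s * I.m ∧ σ'.real rr 0 = top / 2 ^ s ∧ Inv s σ') ?_ ?_ ?_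
  · simp [Cmd.nw, n2]
  · intro σ' hag
    simp [(hsub σ' hag).nat aT hTr, hT]
  · refine ⟨by simp [State.nlet, hσ₀], by simp [State.nlet, hσ₀], ?_⟩
    refine hInv _ _ _ ((hA0s .skip).nlet vt 0 ?_) h0
    simp [rows, forLoop, Cmd.nw]
  · rintro s σ' - hsT hvt hag ⟨h1, h2, h3⟩
    have hg := hσ.agree (hsub σ' hag) hkr
    rw [wp_seq]
    refine (step s σ' (by omega) (hsub σ' hag) hg h1 h2 h3).mono ?_
    rintro t σ₁ hag₁ hI₁
    have e1 : σ₁.nat vRow 0 = s * I.m := by rw [hag₁.nat vRow n3, h1]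
    have e2 : σ₁.real rr 0 = top / 2 ^ s := by rw [hag₁.real rr hr, h2]
    have e3 : σ₁.nat aM 0 = I.m := (hg.agree hag₁ hk).m
    simp only [wp_seq, wp_nset, wp_rset]
    refine ⟨?_, ?_, hInv _ _ _ ?_ hI₁⟩
    · simp [State.nlet, e1, e3]; ring
    · simp [State.nlet, e2, pow_succ]; field_simp
    · refine ⟨fun a ha => ?_, fun a ha => ?_, fun a _ => rfl⟩
      · simp only [rows, forLoop, Cmd.nw, List.mem_append, List.mem_singleton, not_or] at ha
        simp [State.nlet, write_other, ha]
      · simp only [rows, forLoop, Cmd.rw, List.mem_append, List.mem_singleton, not_or] at ha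
        simp [State.nlet, write_other, ha]
  · rintro t σ' hag - ⟨-, -, h3⟩
    exact post _ σ' (hsub σ' hag) h3

/-- The test that the facilities in `vx` and `vy` are at distance at most `c` radii. -/
def within (c : ℕ) : BExp := .not (.rlt (.mul (.lit c) (rv rr)) (.dist pFac (nv vx) pFac (nv vy)))

theorem holds_within {I : Input V} {σ : State V} (hσ : Given I σ) {c x y : ℕ} {r : ℝ}
    (hr : σ.real rr 0 = r) (hx : σ.nat vx 0 = x) (hy : σ.nat vy 0 = y) (hxm : x < I.m)
    (hym : y < I.m) : (within c).Holds σ ↔ dist (I.point x) (I.point y) ≤ c * r := by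
  simp [within, hr, hx, hy, hσ.F x hxm, hσ.F y hym, ptDist_some]

/-- Compute one row of the nets greedily. -/
def netBody : Cmd :=
  forAll vx (.nset aNet (.add (nv vRow) (nv vx)) (.lit 1) ;;
    .nset aPar (.add (nv vRow) (nv vx)) (nv vx) ;;
    forLoop vy (.lit 0) (nv vx)
      (.ite (.and (.nlt (.lit 0) (.cell aNet (.add (nv vRow) (nv vy)))) (within 1))
        (.nset aNet (.add (nv vRow) (nv vx)) (.lit 0) ;;
          .nset aPar (.add (nv vRow) (nv vx)) (nv vy)) .skip))

/-- The point `x` is a net point that is separated from those below `k`, or has a parent. -/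
def NetEntry (F : ℕ → V) (r : ℝ) (o : ℕ) (net par : ℕ → ℕ) (k x : ℕ) : Prop :=
  (net (o + x) = 1 ∧ par (o + x) = x ∧ ∀ y < k, net (o + y) = 1 → r < dist (F x) (F y)) ∨
  (net (o + x) = 0 ∧ par (o + x) < x ∧ net (o + par (o + x)) = 1 ∧
    dist (F x) (F (par (o + x))) ≤ r)

theorem NetEntry.congr {F : ℕ → V} {r : ℝ} {o k x : ℕ} {net par net' par' : ℕ → ℕ}
    (h : NetEntry F r o net par k x) (hk : k ≤ x) (hn : ∀ y ≤ x, net' (o + y) = net (o + y))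
    (hp : par' (o + x) = par (o + x)) : NetEntry F r o net' par' k x := by
  rcases h with ⟨h1, h2, h3⟩ | ⟨h1, h2, h3, h4⟩
  · exact .inl ⟨by rw [hn x le_rfl, h1], by rw [hp, h2],
      fun y hy h => h3 y hy (by rwa [hn y (by omega)] at h)⟩
  · exact .inr ⟨by rw [hn x le_rfl, h1], by rw [hp]; exact h2,
      by rw [hp, hn _ h2.le]; exact h3, by rw [hp]; exact h4⟩

/-- Greedy net: a facility joins unless an earlier net point is within the radius, and then such a
point becomes its parent. -/
theorem netBody_spec {I : Input V} {σ : State V} (hσ : Given I σ) {s : ℕ} {r : ℝ}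
    (hrow : σ.nat vRow 0 = s * I.m) (hr : σ.real rr 0 = r) :
    WP netBody σ fun _ σ' =>
      (∀ x < I.m, NetEntry I.point r (s * I.m) (σ'.nat aNet) (σ'.nat aPar) x x) ∧
      ∀ i < s * I.m, σ'.nat aNet i = σ.nat aNet i ∧ σ'.nat aPar i = σ.nat aPar i := by
  unfold netBody
  refine WP.forAll hσ (by decide) (by decide)
    (fun k σ' => (∀ x < k, NetEntry I.point r (s * I.m) (σ'.nat aNet) (σ'.nat aPar) x x) ∧
      ∀ i < s * I.m, σ'.nat aNet i = σ.nat aNet i ∧ σ'.nat aPar i = σ.nat aPar i) ?_ ?_ ?_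
  · simp [State.nlet]
  · rintro x σ₁ hx hvx hag₁ hg₁ ⟨h1, h2⟩
    have hrow₁ : σ₁.nat vRow 0 = s * I.m := by rw [hag₁.nat vRow (by decide), hrow]
    have hr₁ : σ₁.real rr 0 = r := by rw [hag₁.real rr (by decide), hr]
    simp only [wp_seq, wp_nset]
    simp only [NExp.eval, hvx, hrow₁, ne_eq, Nat.reduceEqDiff, not_false_eq_true, write_other]
    set σ₂ : State V := { σ₁ with
      nat := write (write σ₁.nat aNet (s * I.m + x) 1) aPar (s * I.m + x) x } with hσ₂
    have hg₂ : Given I σ₂ := ⟨by simp [hσ₂, hg₁.m], hg₁.F, hg₁.f⟩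
    have hvx₂ : σ₂.nat vx 0 = x := by simp [hσ₂, hvx]
    have hrow₂ : σ₂.nat vRow 0 = s * I.m := by simp [hσ₂, hrow₁]
    refine WP.forLoop_halts 0 x (Nat.zero_le _) (by decide) rfl ?_
      (fun k σ' => NetEntry I.point r (s * I.m) (σ'.nat aNet) (σ'.nat aPar) k x ∧
        ∀ i, i ≠ s * I.m + x → σ'.nat aNet i = σ₁.nat aNet i ∧ σ'.nat aPar i = σ₁.nat aPar i)
      ?_ ?_ ?_
    · intro σ' hag
      simp [hag.nat vx (by decide), hvx₂]
    · refine ⟨.inl ⟨by simp [State.nlet, hσ₂], by simp [State.nlet, hσ₂], by simp⟩, ?_⟩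
      intro i hi
      simp [State.nlet, hσ₂, hi]
    · rintro y σ₃ - hy hvy hag₃ ⟨h3, h4⟩
      have hg₃ := hg₂.agree hag₃ (by decide)
      have hvx₃ : σ₃.nat vx 0 = x := by rw [hag₃.nat vx (by decide), hvx₂]
      have hrow₃ : σ₃.nat vRow 0 = s * I.m := by rw [hag₃.nat vRow (by decide), hrow₂]
      have hr₃ : σ₃.real rr 0 = r := by rw [hag₃.real rr (by decide)]; exact hr₁
      have hnety : σ₃.nat aNet (s * I.m + y) = σ₁.nat aNet (s * I.m + y) := (h4 _ (by omega)).1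
      -- Entries that have been decided are 0 or 1, so positivity is a test for membership.
      have h01 : 0 < σ₃.nat aNet (s * I.m + y) ↔ σ₃.nat aNet (s * I.m + y) = 1 := by
        rw [hnety]
        rcases h1 y hy with ⟨h, -⟩ | ⟨h, -⟩ <;> simp [h]
      have htest : (BExp.and (.nlt (.lit 0) (.cell aNet (.add (nv vRow) (nv vy))))
          (within 1)).Holds σ₃ ↔ σ₃.nat aNet (s * I.m + y) = 1 ∧
            dist (I.point x) (I.point y) ≤ r := by
        rw [BExp.holds_and, holds_within hg₃ hr₃ hvx₃ hvy hx (by omega), ← h01]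
        simp [hrow₃, hvy]
      refine WP.ite (fun hb => ?_) (fun hb => ?_)
      · rw [htest] at hb
        simp only [wp_seq, wp_nset]
        simp only [NExp.eval, hvx₃, hvy, hrow₃, ne_eq, Nat.reduceEqDiff, not_false_eq_true,
          write_other, State.nlet, write_same]
        refine ⟨.inr ⟨by simp, by simpa using hy, ?_, by simpa using hb.2⟩, fun i hi => ?_⟩
        · rw [Function.update_self, Function.update_of_ne (by omega)]; exact hb.1
        · simp [hi, h4 i hi]
      · rw [htest] at hb
        rw [wp_skip]
        refine ⟨?_, by simpa [State.nlet] using h4⟩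
        simp only [State.nlet, ne_eq, Nat.reduceEqDiff, not_false_eq_true, write_other]
        rcases h3 with ⟨h5, h6, h7⟩ | h3
        · refine .inl ⟨h5, h6, fun y' hy' hn' => ?_⟩
          rcases Nat.lt_succ_iff_lt_or_eq.1 hy' with hy' | rfl
          · exact h7 y' hy' hn'
          · by_contra! hd
            exact hb ⟨hn', hd⟩
        · exact .inr h3
    · rintro t σ₃ - - ⟨h3, h4⟩
      simp only [State.nlet, ne_eq, Nat.reduceEqDiff, not_false_eq_true, write_other]
      refine ⟨fun x' hx' => ?_, fun i hi => ?_⟩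
      · rcases Nat.lt_succ_iff_lt_or_eq.1 hx' with hx' | rfl
        · exact (h1 x' hx').congr le_rfl (fun y hy => (h4 _ (by omega)).1) (h4 _ (by omega)).2
        · exact h3
      · have := h4 i (by omega)
        rw [this.1, this.2]
        exact h2 i hi
  · rintro t σ' - - h
    exact h

theorem nets_spec {I : Input V} {σ : State V} (hσ : Given I σ) {T : ℕ} {top : ℝ}
    (hT : σ.nat aT 0 = T) (htop : σ.real rTop 0 = top) :
    WP (rows netBody) σ fun _ σ' => ∀ s ≤ T, ∀ x < I.m,
      NetEntry I.point (top / 2 ^ s) (s * I.m) (σ'.nat aNet) (σ'.nat aPar) x x := by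
  refine rows_spec hσ hT htop (by decide) (by decide) (by decide)
    (fun k σ' => ∀ s < k, ∀ x < I.m,
      NetEntry I.point (top / 2 ^ s) (s * I.m) (σ'.nat aNet) (σ'.nat aPar) x x) ?_ (by simp) ?_ ?_
  · intro s σ₁ σ₂ hag h
    rw [hag.nat aNet (by decide), hag.nat aPar (by decide)]
    exact h
  · rintro s σ₁ hs hag hg hrow hr h
    refine (netBody_spec hg hrow hr).mono ?_
    rintro t σ₂ - ⟨h1, h2⟩ s' hs' x hx
    rcases Nat.lt_succ_iff_lt_or_eq.1 hs' with hs' | rfl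
    · have hlt : ∀ y ≤ x, s' * I.m + y < s * I.m := by
        intro y hy
        have : (s' + 1) * I.m ≤ s * I.m := Nat.mul_le_mul_right _ hs'
        rw [add_mul] at this
        omega
      exact (h s' hs' x hx).congr le_rfl (fun y hy => (h2 _ (hlt y hy)).1) (h2 _ (hlt x le_rfl)).2
    · exact h1 x hx
  · rintro t σ' - h s hs
    exact h s (by omega)

/-- Compute one row of the table of cheapest facilities nearby. -/
def cheapBody : Cmd :=
  forAll vx (.nset aG (.add (nv vRow) (nv vx)) (nv vx) ;;
    forAll vy (.ite (.and (within 4)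
        (.rlt (.cell rF (nv vy)) (.cell rF (.cell aG (.add (nv vRow) (nv vx))))))
      (.nset aG (.add (nv vRow) (nv vx)) (nv vy)) .skip))

/-- `g` is a cheapest one of the facilities below `k` within four radii. -/
def CheapEntry (I : Input V) (r : ℝ) (k x g : ℕ) : Prop :=
  g < I.m ∧ dist (I.point x) (I.point g) ≤ 4 * r ∧
    ∀ y < k, dist (I.point x) (I.point y) ≤ 4 * r → I.price g ≤ I.price y

theorem cheapBody_spec {I : Input V} {σ : State V} (hσ : Given I σ) {s : ℕ} {r : ℝ}
    (hrow : σ.nat vRow 0 = s * I.m) (hr : σ.real rr 0 = r) (hr0 : 0 ≤ r) :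
    WP cheapBody σ fun _ σ' =>
      (∀ x < I.m, CheapEntry I r I.m x (σ'.nat aG (s * I.m + x))) ∧
      ∀ i < s * I.m, σ'.nat aG i = σ.nat aG i := by
  unfold cheapBody
  refine WP.forAll hσ (by decide) (by decide)
    (fun k σ' => (∀ x < k, CheapEntry I r I.m x (σ'.nat aG (s * I.m + x))) ∧
      ∀ i < s * I.m, σ'.nat aG i = σ.nat aG i) ?_ ?_ ?_
  · simp [State.nlet]
  · rintro x σ₁ hx hvx hag₁ hg₁ ⟨h1, h2⟩
    have hrow₁ : σ₁.nat vRow 0 = s * I.m := by rw [hag₁.nat vRow (by decide), hrow]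
    have hr₁ : σ₁.real rr 0 = r := by rw [hag₁.real rr (by decide), hr]
    simp only [wp_seq, wp_nset]
    simp only [NExp.eval, hvx, hrow₁]
    set σ₂ : State V := setNat σ₁ aG (s * I.m + x) x with hσ₂
    change WP _ σ₂ _
    have hg₂ : Given I σ₂ := ⟨by simp [hσ₂, hg₁.m], hg₁.F, hg₁.f⟩
    have hvx₂ : σ₂.nat vx 0 = x := by simp [hσ₂, hvx]
    have hrow₂ : σ₂.nat vRow 0 = s * I.m := by simp [hσ₂, hrow₁]
    refine WP.forAll hg₂ (by decide) (by decide)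
      (fun k σ' => CheapEntry I r k x (σ'.nat aG (s * I.m + x)) ∧
        ∀ i, i ≠ s * I.m + x → σ'.nat aG i = σ₁.nat aG i) ?_ ?_ ?_
    · refine ⟨⟨by simpa [State.nlet, hσ₂] using hx, ?_, by simp⟩, fun i hi => ?_⟩
      · simp [State.nlet, hσ₂, hr0]
      · simp [State.nlet, hσ₂, hi]
    · rintro y σ₃ hy hvy hag₃ hg₃ ⟨⟨h3, h4, h5⟩, h6⟩
      have hvx₃ : σ₃.nat vx 0 = x := by rw [hag₃.nat vx (by decide), hvx₂]
      have hrow₃ : σ₃.nat vRow 0 = s * I.m := by rw [hag₃.nat vRow (by decide), hrow₂]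
      have hr₃ : σ₃.real rr 0 = r := by rw [hag₃.real rr (by decide)]; exact hr₁
      have htest : (BExp.and (within 4) (.rlt (.cell rF (nv vy))
          (.cell rF (.cell aG (.add (nv vRow) (nv vx)))))).Holds σ₃ ↔
          dist (I.point x) (I.point y) ≤ 4 * r ∧
            I.price y < I.price (σ₃.nat aG (s * I.m + x)) := by
        rw [BExp.holds_and, holds_within hg₃ hr₃ hvx₃ hvy hx hy]
        simp [hrow₃, hvy, hvx₃, hg₃.f]
      refine WP.ite (fun hb => ?_) (fun hb => ?_)
      · rw [htest] at hb
        simp only [wp_nset, NExp.eval, hvx₃, hvy, hrow₃, State.nlet, ne_eq, Nat.reduceEqDiff,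
          not_false_eq_true, write_other, write_same, Function.update_self]
        refine ⟨⟨hy, hb.1, fun y' hy' hd => ?_⟩, fun i hi => ?_⟩
        · rcases Nat.lt_succ_iff_lt_or_eq.1 hy' with hy' | rfl
          · exact hb.2.le.trans (h5 y' hy' hd)
          · exact le_rfl
        · rw [Function.update_of_ne hi, h6 i hi]
      · rw [htest, not_and, not_lt] at hb
        simp only [wp_skip, State.nlet, ne_eq, Nat.reduceEqDiff, not_false_eq_true, write_other]
        refine ⟨⟨h3, h4, fun y' hy' hd => ?_⟩, h6⟩
        rcases Nat.lt_succ_iff_lt_or_eq.1 hy' with hy' | rfl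
        exacts [h5 y' hy' hd, hb hd]
    · rintro t σ₃ - - ⟨h3, h4⟩
      simp only [State.nlet, ne_eq, Nat.reduceEqDiff, not_false_eq_true, write_other]
      refine ⟨fun x' hx' => ?_, fun i hi => ?_⟩
      · rcases Nat.lt_succ_iff_lt_or_eq.1 hx' with hx' | rfl
        · rw [h4 _ (by omega)]; exact h1 x' hx'
        · exact h3
      · rw [h4 i (by omega)]; exact h2 i hi
  · rintro t σ' - - h
    exact h

theorem cheaps_spec {I : Input V} {σ : State V} (hσ : Given I σ) {T : ℕ} {top : ℝ}
    (hT : σ.nat aT 0 = T) (htop : σ.real rTop 0 = top) (h0 : 0 ≤ top) :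
    WP (rows cheapBody) σ fun _ σ' => ∀ s ≤ T, ∀ x < I.m,
      CheapEntry I (top / 2 ^ s) I.m x (σ'.nat aG (s * I.m + x)) := by
  refine rows_spec hσ hT htop (by decide) (by decide) (by decide)
    (fun k σ' => ∀ s < k, ∀ x < I.m,
      CheapEntry I (top / 2 ^ s) I.m x (σ'.nat aG (s * I.m + x))) ?_ (by simp) ?_ ?_
  · intro s σ₁ σ₂ hag h
    rw [hag.nat aG (by decide)]
    exact h
  · rintro s σ₁ hs hag hg hrow hr h
    refine (cheapBody_spec hg hrow hr (by positivity)).mono ?_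
    rintro t σ₂ - ⟨h1, h2⟩ s' hs' x hx
    rcases Nat.lt_succ_iff_lt_or_eq.1 hs' with hs' | rfl
    · have : (s' + 1) * I.m ≤ s * I.m := Nat.mul_le_mul_right _ hs'
      rw [add_mul] at this
      rw [h2 _ (by omega)]
      exact h s' hs' x hx
    · exact h1 x hx
  · rintro t σ' - h s hs
    exact h s (by omega)

/-! ### Preprocessing: lists and free facilities -/

/-- The positions from `a` to `b - 1` enumerate the numbers with the property `P`. -/
structure Enumerates (lst : ℕ → ℕ) (a b : ℕ) (P : ℕ → Prop) : Prop where
  prop : ∀ k, a ≤ k → k < b → P (lst k)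
  inj : ∀ k k', a ≤ k → k < b → a ≤ k' → k' < b → lst k = lst k' → k = k'
  complete : ∀ y, P y → ∃ k, a ≤ k ∧ k < b ∧ lst k = y

theorem Enumerates.congr {lst lst' : ℕ → ℕ} {a b : ℕ} {P P' : ℕ → Prop} (h : Enumerates lst a b P)
    (hl : ∀ k, a ≤ k → k < b → lst' k = lst k) (hP : ∀ y, P' y ↔ P y) :
    Enumerates lst' a b P' := by
  refine ⟨fun k h1 h2 => ?_, fun k k' h1 h2 h3 h4 h5 => ?_, fun y hy => ?_⟩
  · rw [hl k h1 h2, hP]; exact h.prop k h1 h2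
  · rw [hl k h1 h2, hl k' h3 h4] at h5; exact h.inj k k' h1 h2 h3 h4 h5
  · obtain ⟨k, h1, h2, h3⟩ := h.complete y ((hP y).1 hy)
    exact ⟨k, h1, h2, by rw [hl k h1 h2, h3]⟩

theorem Enumerates.push {lst : ℕ → ℕ} {a b y : ℕ} {P P' : ℕ → Prop} (h : Enumerates lst a b P)
    (hab : a ≤ b) (hy : ¬ P y) (hP : ∀ z, P' z ↔ P z ∨ z = y) :
    Enumerates (Function.update lst b y) a (b + 1) P' := by
  refine ⟨fun k h1 h2 => ?_, fun k k' h1 h2 h3 h4 h5 => ?_, fun z hz => ?_⟩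
  · rw [hP]
    rcases Nat.lt_succ_iff_lt_or_eq.1 h2 with h2 | rfl
    · rw [Function.update_of_ne h2.ne]; exact .inl (h.prop k h1 h2)
    · simp
  · rcases Nat.lt_succ_iff_lt_or_eq.1 h2 with h2 | rfl <;>
      rcases Nat.lt_succ_iff_lt_or_eq.1 h4 with h4 | rfl
    · rw [Function.update_of_ne h2.ne, Function.update_of_ne h4.ne] at h5
      exact h.inj k k' h1 h2 h3 h4 h5
    · rw [Function.update_of_ne h2.ne, Function.update_self] at h5
      exact absurd (h5 ▸ h.prop k h1 h2) hy
    · rw [Function.update_of_ne h4.ne, Function.update_self] at h5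
      exact absurd (h5 ▸ h.prop k' h3 h4) hy
    · rfl
  · rcases (hP z).1 hz with hz | rfl
    · obtain ⟨k, h1, h2, h3⟩ := h.complete z hz
      exact ⟨k, h1, by omega, by rw [Function.update_of_ne h2.ne, h3]⟩
    · exact ⟨b, hab, by omega, by simp⟩

/-- Compute one row of the table of lists of net points nearby. -/
def listBody : Cmd :=
  forAll vx (forAll vy
    (.ite (.and (.nlt (.lit 0) (.cell aNet (.add (nv vRow) (nv vy)))) (within 12))
      (.nset aLst (nv vPtr) (nv vy) ;; nlet vPtr (.add (nv vPtr) (.lit 1))) .skip) ;;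
    .nset aSt (.add (.add (nv vRow) (nv vx)) (.lit 1)) (nv vPtr))

/-- The first `N` lists are stored below `e`. -/
structure ListsUpTo (P : ℕ → ℕ → Prop) (N e : ℕ) (st lst : ℕ → ℕ) : Prop where
  last : st N = e
  le : ∀ i < N, st i ≤ st (i + 1)
  lt : ∀ i < N, st (i + 1) ≤ e
  enum : ∀ i < N, Enumerates lst (st i) (st (i + 1)) (P i)

/-- The lists are stored consecutively, and a new one is written above all the former ones, which
are thus preserved. The end of one list is the start of the next. -/
theorem ListsUpTo.succ {P : ℕ → ℕ → Prop} {N e e' : ℕ} {st lst lst' : ℕ → ℕ}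
    (h : ListsUpTo P N e st lst) (hl : ∀ k < e, lst' k = lst k) (he : e ≤ e')
    (hn : Enumerates lst' e e' (P N)) : ListsUpTo P (N + 1) e' (Function.update st (N + 1) e') lst' := by
  have hst : ∀ i < N + 1, Function.update st (N + 1) e' i = st i := fun i hi =>
    Function.update_of_ne hi.ne _ _
  refine ⟨by simp, fun i hi => ?_, fun i hi => ?_, fun i hi => ?_⟩ <;>
    rcases Nat.lt_succ_iff_lt_or_eq.1 hi with hi' | rfl
  · rw [hst i hi, hst (i + 1) (by omega)]; exact h.le i hi'
  · rw [hst i hi, Function.update_self, h.last]; exact he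
  · rw [hst (i + 1) (by omega)]; exact (h.lt i hi').trans he
  · rw [Function.update_self]
  · rw [hst i hi, hst (i + 1) (by omega)]
    refine (h.enum i hi').congr (fun k _ hk => hl k (hk.trans_le (h.lt i hi'))) fun _ => Iff.rfl
  · rw [hst i hi, Function.update_self, h.last]; exact hn

theorem listBody_spec {I : Input V} {σ : State V} (hσ : Given I σ) {s : ℕ} {r : ℝ}
    (hrow : σ.nat vRow 0 = s * I.m) (hr : σ.real rr 0 = r) {P : ℕ → ℕ → Prop}
    (hP : ∀ x < I.m, ∀ y, P (s * I.m + x) y ↔ y < I.m ∧ 0 < σ.nat aNet (s * I.m + y) ∧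
      dist (I.point x) (I.point y) ≤ 12 * r)
    (hL : ListsUpTo P (s * I.m) (σ.nat vPtr 0) (σ.nat aSt) (σ.nat aLst)) :
    WP listBody σ fun _ σ' =>
      ListsUpTo P (s * I.m + I.m) (σ'.nat vPtr 0) (σ'.nat aSt) (σ'.nat aLst) := by
  unfold listBody
  refine WP.forAll hσ (by decide) (by decide)
    (fun k σ' => ListsUpTo P (s * I.m + k) (σ'.nat vPtr 0) (σ'.nat aSt) (σ'.nat aLst)) ?_ ?_ ?_
  · simpa [State.nlet] using hL
  · rintro x σ₁ hx hvx hag₁ hg₁ hL₁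
    have hrow₁ : σ₁.nat vRow 0 = s * I.m := by rw [hag₁.nat vRow (by decide), hrow]
    have hr₁ : σ₁.real rr 0 = r := by rw [hag₁.real rr (by decide), hr]
    have hnet₁ : σ₁.nat aNet = σ.nat aNet := hag₁.nat aNet (by decide)
    set e := σ₁.nat vPtr 0 with he
    rw [wp_seq]
    refine WP.forAll hg₁ (by decide) (by decide)
      (fun k σ' => e ≤ σ'.nat vPtr 0 ∧ (∀ i < e, σ'.nat aLst i = σ₁.nat aLst i) ∧
        Enumerates (σ'.nat aLst) e (σ'.nat vPtr 0) fun y => y < k ∧ P (s * I.m + x) y) ?_ ?_ ?_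
    · refine ⟨by simp [State.nlet, he], by simp [State.nlet], ?_⟩
      simp only [State.nlet, ne_eq, Nat.reduceEqDiff, not_false_eq_true, write_other, ← he]
      exact ⟨fun k h1 h2 => by omega, fun k k' h1 h2 => by omega, fun y hy => by omega⟩
    · rintro y σ₂ hy hvy hag₂ hg₂ ⟨h1, h2, h3⟩
      have hvx₂ : σ₂.nat vx 0 = x := by rw [hag₂.nat vx (by decide), hvx]
      have hrow₂ : σ₂.nat vRow 0 = s * I.m := by rw [hag₂.nat vRow (by decide), hrow₁]
      have hr₂ : σ₂.real rr 0 = r := by rw [hag₂.real rr (by decide), hr₁]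
      have hnet₂ : σ₂.nat aNet = σ.nat aNet := by rw [hag₂.nat aNet (by decide), hnet₁]
      have htest : (BExp.and (.nlt (.lit 0) (.cell aNet (.add (nv vRow) (nv vy))))
          (within 12)).Holds σ₂ ↔ P (s * I.m + x) y := by
        rw [BExp.holds_and, holds_within hg₂ hr₂ hvx₂ hvy hx hy, hP x hx]
        simp [hrow₂, hvy, hnet₂, hy]
      refine WP.ite (fun hb => ?_) (fun hb => ?_)
      · rw [htest] at hb
        simp only [wp_seq, wp_nset]
        simp only [NExp.eval, hvy, State.nlet, ne_eq, Nat.reduceEqDiff, not_false_eq_true,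
          write_other, write_same, Function.update_self]
        refine ⟨by omega, fun i hi => ?_, ?_⟩
        · rw [Function.update_of_ne (by omega), h2 i hi]
        · refine h3.push h1 (fun h => by omega) fun z => ?_
          constructor
          · rintro ⟨h4, h5⟩
            rcases Nat.lt_succ_iff_lt_or_eq.1 h4 with h4 | h4
            exacts [.inl ⟨h4, h5⟩, .inr h4]
          · rintro (⟨h4, h5⟩ | rfl)
            exacts [⟨by omega, h5⟩, ⟨by omega, hb⟩]
      · rw [htest] at hb
        simp only [wp_skip, State.nlet, ne_eq, Nat.reduceEqDiff, not_false_eq_true, write_other]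
        refine ⟨h1, h2, h3.congr (fun _ _ _ => rfl) fun z => ?_⟩
        constructor
        · rintro ⟨h4, h5⟩
          rcases Nat.lt_succ_iff_lt_or_eq.1 h4 with h4 | rfl
          exacts [⟨h4, h5⟩, absurd h5 hb]
        · rintro ⟨h4, h5⟩
          exact ⟨by omega, h5⟩
    · rintro t σ₂ hag₂ hg₂ ⟨h1, h2, h3⟩
      have hvx₂ : σ₂.nat vx 0 = x := by rw [hag₂.nat vx (by decide), hvx]
      have hrow₂ : σ₂.nat vRow 0 = s * I.m := by rw [hag₂.nat vRow (by decide), hrow₁]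
      have hst₂ : σ₂.nat aSt = σ₁.nat aSt := hag₂.nat aSt (by decide)
      rw [wp_nset]
      simp only [NExp.eval, hvx₂, hrow₂, State.nlet, ne_eq, Nat.reduceEqDiff, not_false_eq_true,
        write_other, write_same, hst₂]
      refine hL₁.succ h2 h1 (h3.congr (fun _ _ _ => rfl) fun y => ?_)
      rw [hP x hx]
      tauto
  · rintro t σ' - - h
    exact h

theorem lists_spec {I : Input V} {σ : State V} (hσ : Given I σ) {T : ℕ} {top : ℝ}
    (hT : σ.nat aT 0 = T) (htop : σ.real rTop 0 = top) (hptr : σ.nat vPtr 0 = 0)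
    (hst : σ.nat aSt 0 = 0) {P : ℕ → ℕ → Prop}
    (hP : ∀ s, ∀ x < I.m, ∀ y, P (s * I.m + x) y ↔ y < I.m ∧ 0 < σ.nat aNet (s * I.m + y) ∧
      dist (I.point x) (I.point y) ≤ 12 * (top / 2 ^ s)) :
    WP (rows listBody) σ fun _ σ' => ∃ e,
      ListsUpTo P ((T + 1) * I.m) e (σ'.nat aSt) (σ'.nat aLst) := by
  refine rows_spec hσ hT htop (by decide) (by decide) (by decide)
    (fun k σ' => ListsUpTo P (k * I.m) (σ'.nat vPtr 0) (σ'.nat aSt) (σ'.nat aLst)) ?_ ?_ ?_ ?_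
  · intro s σ₁ σ₂ hag h
    rw [hag.nat vPtr (by decide), hag.nat aSt (by decide), hag.nat aLst (by decide)]
    exact h
  · rw [zero_mul]
    exact ⟨by rw [hst, hptr], fun i hi => by omega, fun i hi => by omega, fun i hi => by omega⟩
  · rintro s σ₁ hs hag hg hrow hr h
    have hnet : σ₁.nat aNet = σ.nat aNet := hag.nat aNet (by decide)
    refine (listBody_spec hg hrow hr (by rw [hnet]; exact hP s) h).mono ?_
    rintro t σ₂ - h2
    rwa [add_mul, one_mul]
  · rintro t σ' - h
    exact ⟨_, h⟩

/-- Compute the distances to the closest free facility. -/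
def setFree : Cmd :=
  forAll vx (.rset rZ (nv vx) (rv rTop) ;;
    forAll vy (.ite (.and (.not (.rlt (.lit 0) (.cell rF (nv vy))))
        (.rlt (.dist pFac (nv vx) pFac (nv vy)) (.cell rZ (nv vx))))
      (.rset rZ (nv vx) (.dist pFac (nv vx) pFac (nv vy))) .skip))

/-- `z` is the distance of `x` to the closest free facility below `k`, cut off at `top`. -/
def FreeEntry (I : Input V) (top : ℝ) (k x : ℕ) (z : ℝ) : Prop :=
  0 ≤ z ∧ (∀ y < k, I.price y = 0 → z ≤ dist (I.point x) (I.point y)) ∧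
    (z = top ∨ ∃ y < I.m, I.price y = 0 ∧ dist (I.point x) (I.point y) = z)

theorem setFree_spec {I : Input V} {σ : State V} (hσ : Given I σ) {top : ℝ}
    (htop : σ.real rTop 0 = top) (h0 : 0 ≤ top) :
    WP setFree σ fun _ σ' => ∀ x < I.m, FreeEntry I top I.m x (σ'.real rZ x) := by
  unfold setFree
  refine WP.forAll hσ (by decide) (by decide)
    (fun k σ' => ∀ x < k, FreeEntry I top I.m x (σ'.real rZ x)) ?_ ?_ ?_
  · simp [State.nlet]
  · rintro x σ₁ hx hvx hag₁ hg₁ h1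
    have htop₁ : σ₁.real rTop 0 = top := by rw [hag₁.real rTop (by decide), htop]
    rw [wp_seq, wp_rset]
    simp only [NExp.eval, RExp.eval, hvx, htop₁]
    set σ₂ : State V := setReal σ₁ rZ x top with hσ₂
    change WP _ σ₂ _
    have hg₂ : Given I σ₂ := ⟨hg₁.m, hg₁.F, by simp [hσ₂, hg₁.f]⟩
    refine WP.forAll hg₂ (by decide) (by decide)
      (fun k σ' => FreeEntry I top k x (σ'.real rZ x) ∧
        ∀ i, i ≠ x → σ'.real rZ i = σ₁.real rZ i) ?_ ?_ ?_
    · refine ⟨⟨by simp [State.nlet, hσ₂, h0], by simp, .inl (by simp [State.nlet, hσ₂])⟩, ?_⟩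
      intro i hi
      simp [State.nlet, hσ₂, hi]
    · rintro y σ₃ hy hvy hag₃ hg₃ ⟨⟨h2, h3, h4⟩, h5⟩
      have hvx₃ : σ₃.nat vx 0 = x := by rw [hag₃.nat vx (by decide)]; exact hvx
      have hd : ptDist (σ₃.pt pFac x) (σ₃.pt pFac y) = dist (I.point x) (I.point y) := by
        rw [hg₃.F x hx, hg₃.F y hy, ptDist_some]
      have htest : (BExp.and (.not (.rlt (.lit 0) (.cell rF (nv vy))))
          (.rlt (.dist pFac (nv vx) pFac (nv vy)) (.cell rZ (nv vx)))).Holds σ₃ ↔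
          I.price y = 0 ∧ dist (I.point x) (I.point y) < σ₃.real rZ x := by
        have := I.price_nonneg y
        rw [BExp.holds_and, BExp.holds_not, BExp.holds_rlt, BExp.holds_rlt]
        simp only [RExp.eval, NExp.eval, hvx₃, hvy, hd, hg₃.f, Nat.cast_zero, not_lt]
        exact and_congr_left fun _ => ⟨fun h => le_antisymm h this, fun h => h.le⟩
      refine WP.ite (fun hb => ?_) (fun hb => ?_)
      · rw [htest] at hb
        simp only [wp_rset, NExp.eval, RExp.eval, hvx₃, hvy, State.nlet, hd, write_same,
          Function.update_self]
        refine ⟨⟨dist_nonneg, fun y' hy' hf => ?_, .inr ⟨y, hy, hb.1, rfl⟩⟩, fun i hi => ?_⟩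
        · rcases Nat.lt_succ_iff_lt_or_eq.1 hy' with hy' | rfl
          exacts [hb.2.le.trans (h3 y' hy' hf), le_rfl]
        · rw [Function.update_of_ne hi, h5 i hi]
      · rw [htest, not_and, not_lt] at hb
        simp only [wp_skip, State.nlet]
        refine ⟨⟨h2, fun y' hy' hf => ?_, h4⟩, h5⟩
        rcases Nat.lt_succ_iff_lt_or_eq.1 hy' with hy' | rfl
        exacts [h3 y' hy' hf, hb hf]
    · rintro t σ₃ - - ⟨h2, h3⟩ x' hx'
      simp only [State.nlet]
      rcases Nat.lt_succ_iff_lt_or_eq.1 hx' with hx' | rfl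
      · rw [h3 x' hx'.ne]; exact h1 x' hx'
      · exact h2
  · rintro t σ' - - h
    exact h

/-- Open the free facilities. -/
def openFree : Cmd :=
  forAll vx (.ite (.rlt (.lit 0) (.cell rF (nv vx))) .skip (nlet vg (nv vx) ;; openFac))

open Classical in
theorem openFree_spec {I : Input V} {σ : State V} (hσ : Given I σ)
    (hrep : OpenRep (fun _ => 0) σ) :
    WP openFree σ fun _ σ' =>
      OpenRep (fun x => if x < I.m ∧ I.price x = 0 then 1 else 0) σ' := by
  unfold openFree
  refine WP.forAll hσ (by decide) (by decide)
    (fun k σ' => OpenRep (fun x => if x < k ∧ I.price x = 0 then 1 else 0) σ') ?_ ?_ ?_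
  · simpa using hrep.of_eq fun a ha => write_other _ (by revert a; decide) _ _
  · rintro x σ₁ hx hvx - hg₁ h1
    have htest : (BExp.rlt (.lit 0) (.cell rF (nv vx))).Holds σ₁ ↔ I.price x ≠ 0 := by
      have := I.price_nonneg x
      rw [BExp.holds_rlt]
      simp only [RExp.eval, NExp.eval, hvx, hg₁.f, Nat.cast_zero]
      exact ⟨fun h => h.ne', fun h => lt_of_le_of_ne this h.symm⟩
    refine WP.ite (fun hb => ?_) (fun hb => ?_)
    · rw [htest] at hb
      rw [wp_skip]
      have : (fun z => if z < x + 1 ∧ I.price z = 0 then 1 else 0) =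
          fun z => if z < x ∧ I.price z = 0 then 1 else 0 := by
        funext z
        refine if_congr ⟨fun h => ⟨?_, h.2⟩, fun h => ⟨by omega, h.2⟩⟩ rfl rfl
        rcases Nat.lt_succ_iff_lt_or_eq.1 h.1 with h4 | rfl
        exacts [h4, absurd h.2 hb]
      rw [this]
      exact h1.of_eq fun a ha => write_other _ (by revert a; decide) _ _
    · rw [htest, not_not] at hb
      rw [wp_seq, wp_nset]
      simp only [NExp.eval, hvx]
      set σ₂ : State V := setNat σ₁ vg 0 x with hσ₂
      change WP _ σ₂ _
      have h2 : OpenRep (fun z => if z < x ∧ I.price z = 0 then 1 else 0) σ₂ :=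
        h1.of_eq fun a ha => write_other _ (by revert a; decide) _ _
      refine (openFac_spec h2).mono ?_
      rintro t σ₃ - ⟨-, h3⟩
      have hv : σ₂.nat vg 0 = x := by simp [hσ₂]
      rw [hv] at h3
      have : (fun z => if z < x + 1 ∧ I.price z = 0 then 1 else 0) =
          Function.update (fun z => if z < x ∧ I.price z = 0 then 1 else 0) x
            ((if x < x ∧ I.price x = 0 then 1 else 0) + 1) := by
        funext z
        rcases eq_or_ne z x with rfl | hz
        · simp [hb]
        · rw [Function.update_of_ne hz]
          exact if_congr (and_congr_left fun _ => by omega) rfl rfl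
      rw [this]
      exact h3.of_eq fun a ha => write_other _ (by revert a; decide) _ _
  · rintro t σ' - - h
    exact h

/-! ### Preprocessing: the search structure -/

/-- The set of facilities that is encoded by the binary digits of `A`. -/
def Input.part (I : Input V) (A : ℕ) : Finset ℕ := (Finset.range I.m).filter fun q => A.testBit q

theorem Input.mem_part {I : Input V} {A q : ℕ} : q ∈ I.part A ↔ q < I.m ∧ A.testBit q = true := by
  simp [Input.part]

open Classical in
/-- The number of facilities of `A` at distance at most `r` from `x`. -/
noncomputable def Input.near (I : Input V) (A x : ℕ) (r : ℝ) : ℕ :=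
  ((I.part A).filter fun q => dist (I.point x) (I.point q) ≤ r).card

open Classical in
/-- The number of facilities of `A` at distance more than `2 * r` from `x`. -/
noncomputable def Input.far (I : Input V) (A x : ℕ) (r : ℝ) : ℕ :=
  ((I.part A).filter fun q => 2 * r < dist (I.point x) (I.point q)).card

/-- Compute the number whose binary digits are all one. -/
def setFull : Cmd :=
  nlet vPow (.lit 1) ;; forAll vq (nlet vPow (.add (nv vPow) (nv vPow))) ;;
  nlet aFull (.sub (nv vPow) (.lit 1))

theorem setFull_spec {I : Input V} {σ : State V} (hσ : Given I σ) :
    WP setFull σ fun _ σ' => σ'.nat aFull 0 = 2 ^ I.m - 1 := by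
  unfold setFull
  rw [wp_seq, wp_nset, wp_seq]
  set σ₁ : State V := setNat σ vPow 0 1 with hσ₁
  change WP _ σ₁ _
  have hg₁ : Given I σ₁ := ⟨by simp [hσ₁, hσ.m], hσ.F, hσ.f⟩
  refine WP.forAll hg₁ (by decide) (by decide) (fun k σ' => σ'.nat vPow 0 = 2 ^ k) ?_ ?_ ?_
  · simp [State.nlet, hσ₁]
  · rintro k σ₂ - - - - h
    simp [State.nlet, h, pow_succ, mul_two]
  · rintro t σ₂ - - h
    simp [h]

/-- The array `aMem` indicates the facilities of `A`. -/
def Marks (I : Input V) (A : ℕ) (σ : State V) : Prop :=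
  ∀ q < I.m, 0 < σ.nat aMem q ↔ A.testBit q = true

/-- Compute the binary digits of `A`, and a member if there is one. -/
def mark : Cmd :=
  nlet vg (nv vA) ;; nlet vJ (.lit 0) ;;
  forAll vq (.nset aMem (nv vq) (.sub (nv vg) (.add (.half (nv vg)) (.half (nv vg)))) ;;
    nlet vg (.half (nv vg)) ;;
    .ite (.nlt (.lit 0) (.cell aMem (nv vq))) (nlet vJ (nv vq)) .skip)

theorem mark_spec {I : Input V} {σ : State V} (hσ : Given I σ) {A : ℕ} (hA : σ.nat vA 0 = A) :
    WP mark σ fun _ σ' => Marks I A σ' ∧ σ'.nat vJ 0 < I.m ∧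
      ((I.part A).Nonempty → σ'.nat vJ 0 ∈ I.part A) := by
  unfold mark
  simp only [wp_seq, wp_nset]
  simp only [NExp.eval, hA]
  set σ₁ : State V := setNat (setNat σ vg 0 A) vJ 0 0 with hσ₁
  change WP _ σ₁ _
  have hg₁ : Given I σ₁ := ⟨by simp [hσ₁, hσ.m], hσ.F, hσ.f⟩
  refine WP.forAll hg₁ (by decide) (by decide) (fun k σ' => σ'.nat vg 0 = A / 2 ^ k ∧
    (∀ q < k, 0 < σ'.nat aMem q ↔ A.testBit q = true) ∧ σ'.nat vJ 0 < I.m ∧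
    ((∃ q < k, A.testBit q = true) → σ'.nat vJ 0 < k ∧ A.testBit (σ'.nat vJ 0) = true)) ?_ ?_ ?_
  · simp [State.nlet, hσ₁, I.m_pos]
  · rintro k σ₂ hk hvq - - ⟨h1, h2, hJ, h3⟩
    simp only [wp_seq, wp_nset]
    simp only [NExp.eval, hvq, h1, ne_eq, Nat.reduceEqDiff, not_false_eq_true, write_other]
    -- The machine has no remainder operation; the lowest digit is what two halves leave over.
    set d := A / 2 ^ k - (A / 2 ^ k / 2 + A / 2 ^ k / 2) with hd
    have hdk : 0 < d ↔ A.testBit k = true := by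
      rw [Nat.testBit_eq_decide_div_mod_eq, decide_eq_true_eq]
      omega
    set σ₃ : State V := setNat (setNat σ₂ aMem k d) vg 0 (A / 2 ^ k / 2) with hσ₃
    change WP _ σ₃ _
    have hmem : ∀ q < k + 1, 0 < σ₃.nat aMem q ↔ A.testBit q = true := by
      intro q hq
      rcases Nat.lt_succ_iff_lt_or_eq.1 hq with hq | rfl
      · simpa [hσ₃, hq.ne] using h2 q hq
      · simpa [hσ₃] using hdk
    have hvq₃ : σ₃.nat vq 0 = k := by simp [hσ₃, hvq]
    have htest : (BExp.nlt (.lit 0) (.cell aMem (nv vq))).Holds σ₃ ↔ A.testBit k = true := by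
      rw [← hmem k (Nat.lt_succ_self k)]
      simp [hvq₃]
    have hvg₃ : σ₃.nat vg 0 = A / 2 ^ (k + 1) := by
      simp [hσ₃, Nat.div_div_eq_div_mul, pow_succ]
    refine WP.ite (fun hb => ?_) (fun hb => ?_)
    · rw [htest] at hb
      simp only [wp_nset, NExp.eval, State.nlet, ne_eq, Nat.reduceEqDiff,
        not_false_eq_true, write_other, write_same, Function.update_self, hvq₃]
      exact ⟨hvg₃, hmem, hk, fun _ => ⟨Nat.lt_succ_self k, hb⟩⟩
    · rw [htest] at hb
      simp only [wp_skip, State.nlet, ne_eq, Nat.reduceEqDiff, not_false_eq_true, write_other]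
      have hJ₃ : σ₃.nat vJ 0 = σ₂.nat vJ 0 := by simp [hσ₃]
      rw [hJ₃]
      refine ⟨hvg₃, hmem, hJ, ?_⟩
      rintro ⟨q, hq, hq'⟩
      have hqk : q ≠ k := by rintro rfl; exact hb hq'
      obtain ⟨h4, h5⟩ := h3 ⟨q, by omega, hq'⟩
      exact ⟨by omega, h5⟩
  · rintro t σ₂ - - ⟨-, h2, hJ, h3⟩
    refine ⟨h2, hJ, ?_⟩
    rintro ⟨q, hq⟩
    rw [Input.mem_part] at hq ⊢
    exact h3 ⟨q, hq⟩

/-- Count the marked facilities close to and far from `vx`, relative to the distance of `vy`. -/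
def count : Cmd :=
  nlet vNear (.lit 0) ;; nlet vFar (.lit 0) ;;
  forAll vq (.ite (.nlt (.lit 0) (.cell aMem (nv vq)))
    (.ite (.rlt (.dist pFac (nv vx) pFac (nv vy)) (.dist pFac (nv vx) pFac (nv vq)))
        (.ite (.rlt (.mul (.lit 2) (.dist pFac (nv vx) pFac (nv vy)))
          (.dist pFac (nv vx) pFac (nv vq))) (nlet vFar (.add (nv vFar) (.lit 1))) .skip)
        (nlet vNear (.add (nv vNear) (.lit 1)))) .skip)

open Classical in
theorem count_spec {I : Input V} {σ : State V} (hσ : Given I σ) {A x y : ℕ} (hmk : Marks I A σ)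
    (hx : σ.nat vx 0 = x) (hy : σ.nat vy 0 = y) (hxm : x < I.m) (hym : y < I.m) :
    WP count σ fun _ σ' => σ'.nat vNear 0 = I.near A x (dist (I.point x) (I.point y)) ∧
      σ'.nat vFar 0 = I.far A x (dist (I.point x) (I.point y)) := by
  set r := dist (I.point x) (I.point y) with hr
  unfold count
  simp only [wp_seq, wp_nset]
  set σ₁ : State V := setNat (setNat σ vNear 0 0) vFar 0 0 with hσ₁
  change WP _ σ₁ _
  have hg₁ : Given I σ₁ := ⟨by simp [hσ₁, hσ.m], hσ.F, hσ.f⟩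
  refine WP.forAll hg₁ (by decide) (by decide) (fun k σ' =>
    σ'.nat vNear 0 = (((Finset.range k).filter fun q => A.testBit q = true).filter fun q =>
      dist (I.point x) (I.point q) ≤ r).card ∧
    σ'.nat vFar 0 = (((Finset.range k).filter fun q => A.testBit q = true).filter fun q =>
      2 * r < dist (I.point x) (I.point q)).card) ?_ ?_ ?_
  · simp [State.nlet, hσ₁]
  · rintro q σ₂ hq hvq hag hg₂ ⟨h1, h2⟩
    have hx₂ : σ₂.nat vx 0 = x := by rw [hag.nat vx (by decide)]; simp [hσ₁, hx]
    have hy₂ : σ₂.nat vy 0 = y := by rw [hag.nat vy (by decide)]; simp [hσ₁, hy]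
    have hm₂ : 0 < σ₂.nat aMem q ↔ A.testBit q = true := by
      rw [hag.nat aMem (by decide), ← hmk q hq]; simp [hσ₁]
    have hr0 : 0 ≤ r := dist_nonneg
    have hins : ∀ P : ℕ → Prop, (((Finset.range (q + 1)).filter fun q => A.testBit q = true).filter
        P).card = (((Finset.range q).filter fun q => A.testBit q = true).filter P).card +
          if A.testBit q = true ∧ P q then 1 else 0 := by
      intro P
      rw [Finset.filter_filter, Finset.filter_filter, Finset.range_add_one, Finset.filter_insert]
      split_ifs with h
      · rw [Finset.card_insert_of_notMem (by simp)]
      · rfl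
    simp only [hins]
    refine WP.ite (fun hb => ?_) (fun hb => ?_)
    · have hb' : A.testBit q = true := by rw [← hm₂]; simpa [hvq] using hb
      refine WP.ite (fun hc => ?_) (fun hc => ?_)
      · have hc' : r < dist (I.point x) (I.point q) := by
          simpa [hx₂, hy₂, hvq, hg₂.F x hxm, hg₂.F y hym, hg₂.F q hq, ptDist_some] using hc
        refine WP.ite (fun hd => ?_) (fun hd => ?_)
        · have hd' : 2 * r < dist (I.point x) (I.point q) := by
            simpa [hx₂, hy₂, hvq, hg₂.F x hxm, hg₂.F y hym, hg₂.F q hq, ptDist_some] using hd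
          simp [State.nlet, hb', hd', h1, h2, not_le.2 hc']
        · have hd' : ¬ 2 * r < dist (I.point x) (I.point q) := by
            simpa [hx₂, hy₂, hvq, hg₂.F x hxm, hg₂.F y hym, hg₂.F q hq, ptDist_some] using hd
          simp [State.nlet, hb', hd', h1, h2, not_le.2 hc']
      · have hc' : dist (I.point x) (I.point q) ≤ r := by
          simpa [hx₂, hy₂, hvq, hg₂.F x hxm, hg₂.F y hym, hg₂.F q hq, ptDist_some] using hc
        have hd' : ¬ 2 * r < dist (I.point x) (I.point q) := by linarith
        simp [State.nlet, hb', hc', h1, h2, hd']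
    · have hb' : ¬ A.testBit q = true := by rw [← hm₂]; simpa [hvq] using hb
      simp [State.nlet, hb', h1, h2]
  · rintro t σ₂ - - h
    exact h

/-- The node `A` with the centre `c`, the radius `r` and the score `s` has large parts. -/
structure GoodRing (I : Input V) (A c s : ℕ) (r : ℝ) : Prop where
  lt : c < I.m
  mem : (I.part A).Nonempty → c ∈ I.part A
  nonneg : 0 ≤ r
  le_near : 0 < s → s ≤ I.near A c r
  le_far : 0 < s → s ≤ I.far A c r

/-- Try all pairs of a centre and a radius. -/
def search : Cmd :=
  nlet vs (.lit 0) ;; rlet rr (.lit 0) ;;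
  forAll vx (.ite (.nlt (.lit 0) (.cell aMem (nv vx)))
    (forAll vy (count ;;
      .ite (.nlt (nv vFar) (nv vNear)) (nlet vNear (nv vFar)) .skip ;;
      .ite (.nlt (nv vs) (nv vNear))
        (nlet vs (nv vNear) ;; nlet vJ (nv vx) ;;
          rlet rr (.dist pFac (nv vx) pFac (nv vy))) .skip)) .skip)

/-- Exhaustive search for the largest minimum of the two counts. The radius is given by any facility
`y`, in the set or not; this only enlarges the choice, and `exists_ring` supplies a good pair within
the set. If nothing is found, the score stays zero and the marked facility serves as the centre. -/
theorem search_spec {I : Input V} {σ : State V} (hσ : Given I σ) {A : ℕ} (hmk : Marks I A σ)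
    (hJm : σ.nat vJ 0 < I.m) (hJ : (I.part A).Nonempty → σ.nat vJ 0 ∈ I.part A) :
    WP search σ fun _ σ' => GoodRing I A (σ'.nat vJ 0) (σ'.nat vs 0) (σ'.real rr 0) ∧
      ∀ x ∈ I.part A, ∀ y < I.m, min (I.near A x (dist (I.point x) (I.point y)))
        (I.far A x (dist (I.point x) (I.point y))) ≤ σ'.nat vs 0 := by
  unfold search
  simp only [wp_seq, wp_nset, wp_rset]
  set σ₁ : State V := setReal (setNat σ vs 0 0) rr 0 0 with hσ₁
  have hst : ({ σ with
      nat := write σ.nat vs ((NExp.lit 0).eval σ) ((NExp.lit 0).eval σ)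
      real := write σ.real rr ((NExp.lit 0).eval { σ with
        nat := write σ.nat vs ((NExp.lit 0).eval σ) ((NExp.lit 0).eval σ) })
        ((RExp.lit 0).eval { σ with
        nat := write σ.nat vs ((NExp.lit 0).eval σ) ((NExp.lit 0).eval σ) }) } : State V) = σ₁ := by
    simp [hσ₁]
  rw [hst]
  have hg₁ : Given I σ₁ := ⟨by simp [hσ₁, hσ.m], hσ.F, by simp [hσ₁, hσ.f]⟩
  have hm₁ : Marks I A σ₁ := by simpa [Marks, hσ₁] using hmk
  refine WP.forAll hg₁ (by decide) (by decide) (fun k σ' =>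
    GoodRing I A (σ'.nat vJ 0) (σ'.nat vs 0) (σ'.real rr 0) ∧
    ∀ x ∈ I.part A, x < k → ∀ y < I.m, min (I.near A x (dist (I.point x) (I.point y)))
        (I.far A x (dist (I.point x) (I.point y))) ≤ σ'.nat vs 0) ?_ ?_ ?_
  · refine ⟨⟨?_, ?_, ?_, ?_, ?_⟩, by simp⟩ <;> simp [State.nlet, hσ₁]
    exacts [hJm, hJ]
  · rintro x σ₂ hxm hx₂ hag₂ hg₂ ⟨h1, h2⟩
    have hm₂ : Marks I A σ₂ := by rw [Marks, hag₂.nat aMem (by decide)]; exact hm₁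
    have htest : (BExp.nlt (.lit 0) (.cell aMem (nv vx))).Holds σ₂ ↔ A.testBit x = true := by
      rw [← hm₂ x hxm]
      simp [hx₂]
    refine WP.ite (fun hb => ?_) (fun hb => ?_)
    · rw [htest] at hb
      have hxA : x ∈ I.part A := Input.mem_part.2 ⟨hxm, hb⟩
      refine WP.forAll hg₂ (by decide) (by decide) (fun k σ' =>
        GoodRing I A (σ'.nat vJ 0) (σ'.nat vs 0) (σ'.real rr 0) ∧ σ₂.nat vs 0 ≤ σ'.nat vs 0 ∧
        ∀ y < k, min (I.near A x (dist (I.point x) (I.point y)))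
          (I.far A x (dist (I.point x) (I.point y))) ≤ σ'.nat vs 0) ?_ ?_ ?_
      · simpa [State.nlet] using h1
      · rintro y σ₃ hym hy₃ hag₃ hg₃ ⟨h3, h4, h5⟩
        have hm₃ : Marks I A σ₃ := by rw [Marks, hag₃.nat aMem (by decide)]; exact hm₂
        have hx₃ : σ₃.nat vx 0 = x := by rw [hag₃.nat vx (by decide), hx₂]
        set r := dist (I.point x) (I.point y) with hr
        rw [wp_seq]
        refine (count_spec hg₃ hm₃ hx₃ hy₃ hxm hym).mono ?_
        rintro t₄ σ₄ hag₄ ⟨hn₄, hf₄⟩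
        rw [← hr] at hn₄ hf₄
        have hg₄ := hg₃.agree hag₄ (by decide)
        have hx₄ : σ₄.nat vx 0 = x := by rw [hag₄.nat vx (by decide), hx₃]
        have hy₄ : σ₄.nat vy 0 = y := by rw [hag₄.nat vy (by decide), hy₃]
        have hs₄ : σ₄.nat vs 0 = σ₃.nat vs 0 := by rw [hag₄.nat vs (by decide)]
        have hJ₄ : σ₄.nat vJ 0 = σ₃.nat vJ 0 := by rw [hag₄.nat vJ (by decide)]
        have hr₄ : σ₄.real rr 0 = σ₃.real rr 0 := by rw [hag₄.real rr (by decide)]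
        have hmin : WP (.ite (.nlt (nv vFar) (nv vNear)) (nlet vNear (nv vFar)) .skip) σ₄
            fun _ σ' => σ'.nat vNear 0 = min (I.near A x r) (I.far A x r) := by
          refine WP.ite (fun hc => ?_) (fun hc => ?_)
          · have : I.far A x r < I.near A x r := by simpa [hn₄, hf₄] using hc
            simp [hf₄, this.le]
          · have : I.near A x r ≤ I.far A x r := by simpa [hn₄, hf₄] using hc
            simp [hn₄, this]
        rw [wp_seq]
        refine hmin.mono ?_
        rintro t₅ σ₅ hag₅ hn₅
        have hg₅ := hg₄.agree hag₅ (by decide)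
        have hx₅ : σ₅.nat vx 0 = x := by rw [hag₅.nat vx (by decide), hx₄]
        have hy₅ : σ₅.nat vy 0 = y := by rw [hag₅.nat vy (by decide), hy₄]
        have hs₅ : σ₅.nat vs 0 = σ₃.nat vs 0 := by rw [hag₅.nat vs (by decide), hs₄]
        have hJ₅ : σ₅.nat vJ 0 = σ₃.nat vJ 0 := by rw [hag₅.nat vJ (by decide), hJ₄]
        have hr₅ : σ₅.real rr 0 = σ₃.real rr 0 := by rw [hag₅.real rr (by decide), hr₄]
        refine WP.ite (fun hc => ?_) (fun hc => ?_)
        · have hlt : σ₃.nat vs 0 < min (I.near A x r) (I.far A x r) := by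
            simpa [hn₅, hs₅] using hc
          have e : (RExp.dist pFac (nv vx) pFac (nv vy)).eval σ₅ = r := by
            simp [hx₅, hy₅, hg₅.F x hxm, hg₅.F y hym, ptDist_some, hr]
          simp only [RExp.eval, NExp.eval] at e
          simp only [wp_seq, wp_nset, wp_rset]
          simp only [NExp.eval, RExp.eval, State.nlet, ne_eq, Nat.reduceEqDiff, not_false_eq_true,
            write_other, write_same, Function.update_self, hn₅, hx₅]
          rw [hx₅] at e
          rw [e]
          refine ⟨⟨hxm, fun _ => hxA, dist_nonneg, fun _ => min_le_left _ _, fun _ => min_le_right _ _⟩,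
            by omega, fun y' hy' => ?_⟩
          rcases Nat.lt_succ_iff_lt_or_eq.1 hy' with hy' | rfl
          exacts [(h5 y' hy').trans hlt.le, le_rfl]
        · have hle : min (I.near A x r) (I.far A x r) ≤ σ₃.nat vs 0 := by
            simpa only [BExp.holds_nlt, NExp.eval, hn₅, hs₅, not_lt] using hc
          simp only [wp_skip, State.nlet, ne_eq, Nat.reduceEqDiff, not_false_eq_true, write_other,
            hJ₅, hs₅, hr₅]
          refine ⟨h3, h4, fun y' hy' => ?_⟩
          rcases Nat.lt_succ_iff_lt_or_eq.1 hy' with hy' | rfl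
          exacts [h5 y' hy', hle]
      · rintro t σ₃ - - ⟨h3, h4, h5⟩
        simp only [State.nlet, ne_eq, Nat.reduceEqDiff, not_false_eq_true, write_other]
        refine ⟨h3, fun x' hx'A hx' y hy => ?_⟩
        rcases Nat.lt_succ_iff_lt_or_eq.1 hx' with hx' | rfl
        exacts [(h2 x' hx'A hx' y hy).trans h4, h5 y hy]
    · rw [htest] at hb
      simp only [wp_skip, State.nlet, ne_eq, Nat.reduceEqDiff, not_false_eq_true, write_other]
      refine ⟨h1, fun x' hx'A hx' y hy => ?_⟩
      rcases Nat.lt_succ_iff_lt_or_eq.1 hx' with hx' | rfl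
      exacts [h2 x' hx'A hx' y hy, absurd (Input.mem_part.1 hx'A).2 hb]
  · rintro t σ₂ - - ⟨h1, h2⟩
    exact ⟨h1, fun x hx y hy => h2 x hx (Input.mem_part.1 hx).1 y hy⟩

/-! ### Preprocessing: nodes of the search structure -/

theorem two_pow_add_testBit {x k : ℕ} (hx : x < 2 ^ k) (q : ℕ) :
    (2 ^ k + x).testBit q = true ↔ q = k ∨ x.testBit q = true := by
  rcases lt_trichotomy q k with h | rfl | h
  · rw [Nat.testBit_two_pow_add_gt h]
    simp [h.ne]
  · rw [Nat.testBit_two_pow_add_eq, Nat.testBit_lt_two_pow hx]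
    simp
  · have h2 : 2 ^ (k + 1) ≤ 2 ^ q := Nat.pow_le_pow_right two_pos h
    have h3 : 2 ^ (k + 1) = 2 ^ k + 2 ^ k := by rw [pow_succ, mul_two]
    rw [Nat.testBit_lt_two_pow (by omega), Nat.testBit_lt_two_pow (by omega)]
    simp [h.ne']

/-- The binary digits of `x` mark the numbers below `k` with the property `P`. -/
def Encodes (P : ℕ → Prop) (k x : ℕ) : Prop :=
  x < 2 ^ k ∧ ∀ q, x.testBit q = true ↔ q < k ∧ P q

theorem Encodes.succ_pos {P : ℕ → Prop} {k x : ℕ} (h : Encodes P k x) (hk : P k) :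
    Encodes P (k + 1) (x + 2 ^ k) := by
  refine ⟨by rw [pow_succ]; have := h.1; omega, fun q => ?_⟩
  rw [add_comm, two_pow_add_testBit h.1, h.2]
  constructor
  · rintro (rfl | ⟨h1, h2⟩)
    exacts [⟨Nat.lt_succ_self _, hk⟩, ⟨by omega, h2⟩]
  · rintro ⟨h1, h2⟩
    rcases Nat.lt_succ_iff_lt_or_eq.1 h1 with h1 | rfl
    exacts [.inr ⟨h1, h2⟩, .inl rfl]

theorem Encodes.succ_neg {P : ℕ → Prop} {k x : ℕ} (h : Encodes P k x) (hk : ¬ P k) :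
    Encodes P (k + 1) x := by
  refine ⟨by rw [pow_succ]; have := h.1; omega, fun q => ?_⟩
  rw [h.2]
  constructor
  · rintro ⟨h1, h2⟩
    exact ⟨by omega, h2⟩
  · rintro ⟨h1, h2⟩
    rcases Nat.lt_succ_iff_lt_or_eq.1 h1 with h1 | rfl
    exacts [⟨h1, h2⟩, absurd h2 hk]

/-- Add the power in `vPow` to `v` if the marked facility `vq` satisfies `b`. -/
def addPower (v : ℕ) (b : BExp) : Cmd :=
  .ite (.and (.nlt (.lit 0) (.cell aMem (nv vq))) b) (nlet v (.add (nv v) (nv vPow))) .skip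

theorem addPower_spec {I : Input V} {σ : State V} {A q v x : ℕ} {b : BExp} {P : ℕ → Prop}
    (hmk : Marks I A σ) (hq : σ.nat vq 0 = q) (hqm : q < I.m) (hpow : σ.nat vPow 0 = 2 ^ q)
    (hv : σ.nat v 0 = x) (hx : Encodes (fun q => A.testBit q = true ∧ P q) q x)
    (hb : b.Holds σ ↔ P q) :
    WP (addPower v b) σ fun _ σ' =>
      Encodes (fun q => A.testBit q = true ∧ P q) (q + 1) (σ'.nat v 0) := by
  have htest : (BExp.and (.nlt (.lit 0) (.cell aMem (nv vq))) b).Holds σ ↔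
      A.testBit q = true ∧ P q := by
    rw [BExp.holds_and, hb, ← hmk q hqm]
    simp [hq]
  refine WP.ite (fun h => ?_) (fun h => ?_)
  · rw [htest] at h
    simpa [hv, hpow] using hx.succ_pos (P := fun q => A.testBit q = true ∧ P q) h
  · rw [htest] at h
    simpa [hv] using hx.succ_neg (P := fun q => A.testBit q = true ∧ P q) h

/-- Compute the children of a node with the centre `vJ` and the radius `rr`. -/
def split : Cmd :=
  nlet vPow (.lit 1) ;; nlet vInc (.lit 0) ;; nlet vDec (.lit 0) ;;
  forAll vq (
    addPower vInc (.not (.rlt (.mul (.lit 2) (rv rr)) (.dist pFac (nv vJ) pFac (nv vq)))) ;;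
    addPower vDec (.rlt (rv rr) (.dist pFac (nv vJ) pFac (nv vq))) ;;
    nlet vPow (.add (nv vPow) (nv vPow)))

theorem split_spec {I : Input V} {σ : State V} (hσ : Given I σ) {A c : ℕ} {r : ℝ}
    (hmk : Marks I A σ) (hc : σ.nat vJ 0 = c) (hcm : c < I.m) (hr : σ.real rr 0 = r) :
    WP split σ fun _ σ' =>
      Encodes (fun q => A.testBit q = true ∧ dist (I.point c) (I.point q) ≤ 2 * r) I.m
        (σ'.nat vInc 0) ∧
      Encodes (fun q => A.testBit q = true ∧ r < dist (I.point c) (I.point q)) I.m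
        (σ'.nat vDec 0) := by
  unfold split
  simp only [wp_seq, wp_nset]
  set σ₁ : State V := setNat (setNat (setNat σ vPow 0 1) vInc 0 0) vDec 0 0 with hσ₁
  change WP _ σ₁ _
  have hg₁ : Given I σ₁ := ⟨by simp [hσ₁, hσ.m], hσ.F, hσ.f⟩
  refine WP.forAll hg₁ (by decide) (by decide) (fun k σ' => σ'.nat vPow 0 = 2 ^ k ∧
      Encodes (fun q => A.testBit q = true ∧ dist (I.point c) (I.point q) ≤ 2 * r) k
        (σ'.nat vInc 0) ∧
      Encodes (fun q => A.testBit q = true ∧ r < dist (I.point c) (I.point q)) k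
        (σ'.nat vDec 0)) ?_ ?_ ?_
  · simp [State.nlet, hσ₁, Encodes]
  · rintro q σ₂ hqm hq₂ hag₂ hg₂ ⟨h1, h2, h3⟩
    have hm₂ : Marks I A σ₂ := by
      rw [Marks, hag₂.nat aMem (by decide)]; simpa [Marks, hσ₁] using hmk
    have hc₂ : σ₂.nat vJ 0 = c := by rw [hag₂.nat vJ (by decide)]; simp [hσ₁, hc]
    have hr₂ : σ₂.real rr 0 = r := by rw [hag₂.real rr (by decide)]; simp [hσ₁, hr]
    rw [wp_seq]
    refine (addPower_spec hm₂ hq₂ hqm h1 rfl h2 ?_).mono ?_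
    · simp [hc₂, hr₂, hq₂, hg₂.F c hcm, hg₂.F q hqm, ptDist_some]
    rintro t₃ σ₃ hag₃ h2
    have hg₃ := hg₂.agree hag₃ (by decide)
    have hm₃ : Marks I A σ₃ := by rw [Marks, hag₃.nat aMem (by decide)]; exact hm₂
    have hc₃ : σ₃.nat vJ 0 = c := by rw [hag₃.nat vJ (by decide), hc₂]
    have hq₃ : σ₃.nat vq 0 = q := by rw [hag₃.nat vq (by decide), hq₂]
    have hr₃ : σ₃.real rr 0 = r := by rw [hag₃.real rr (by decide), hr₂]
    rw [← hag₃.nat vPow (by decide)] at h1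
    rw [← hag₃.nat vDec (by decide)] at h3
    rw [wp_seq]
    refine (addPower_spec hm₃ hq₃ hqm h1 rfl h3 ?_).mono ?_
    · simp [hc₃, hr₃, hq₃, hg₃.F c hcm, hg₃.F q hqm, ptDist_some]
    rintro t₄ σ₄ hag₄ h3
    rw [← hag₄.nat vPow (by decide)] at h1
    rw [← hag₄.nat vInc (by decide)] at h2
    simp only [wp_nset, NExp.eval, State.nlet, ne_eq, Nat.reduceEqDiff, not_false_eq_true,
      write_other, write_same, Function.update_self, h1]
    exact ⟨by rw [pow_succ, mul_two], h2, h3⟩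
  · rintro t σ₂ - - h
    exact h.2

/-- The node `A` of the search structure. -/
structure RingEntry (I : Input V) (A c s i o : ℕ) (r : ℝ) : Prop extends GoodRing I A c s r where
  inn : Encodes (fun q => A.testBit q = true ∧ dist (I.point c) (I.point q) ≤ 2 * r) I.m i
  out : Encodes (fun q => A.testBit q = true ∧ r < dist (I.point c) (I.point q)) I.m o
  le_score : ∀ x ∈ I.part A, ∀ y < I.m, min (I.near A x (dist (I.point x) (I.point y)))
        (I.far A x (dist (I.point x) (I.point y))) ≤ s

/-- Compute one node of the search structure. -/
def ringBody : Cmd :=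
  mark ;; search ;; split ;;
  .nset aCtr (nv vA) (nv vJ) ;; .nset aScore (nv vA) (nv vs) ;;
  .nset aInn (nv vA) (nv vInc) ;; .nset aOut (nv vA) (nv vDec) ;; .rset rRad (nv vA) (rv rr)

/-- Compute the tables of the search structure. -/
def rings : Cmd := setFull ;; forLoop vA (.lit 0) (.add (nv aFull) (.lit 1)) ringBody

theorem ringBody_spec {I : Input V} {σ : State V} (hσ : Given I σ) {A : ℕ} (hA : σ.nat vA 0 = A) :
    WP ringBody σ fun _ σ' => ∃ c s i o r, RingEntry I A c s i o r ∧
      σ'.nat aCtr = Function.update (σ.nat aCtr) A c ∧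
      σ'.nat aScore = Function.update (σ.nat aScore) A s ∧
      σ'.nat aInn = Function.update (σ.nat aInn) A i ∧
      σ'.nat aOut = Function.update (σ.nat aOut) A o ∧
      σ'.real rRad = Function.update (σ.real rRad) A r := by
  unfold ringBody
  rw [wp_seq]
  refine (mark_spec hσ hA).mono ?_
  rintro t₁ σ₁ hag₁ ⟨hm₁, hJm, hJ⟩
  have hg₁ := hσ.agree hag₁ (by decide)
  rw [wp_seq]
  refine (search_spec hg₁ hm₁ hJm hJ).mono ?_
  rintro t₂ σ₂ hag₂ ⟨h1, h2⟩
  have hg₂ := hg₁.agree hag₂ (by decide)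
  have hm₂ : Marks I A σ₂ := by rw [Marks, hag₂.nat aMem (by decide)]; exact hm₁
  rw [wp_seq]
  refine (split_spec hg₂ hm₂ rfl h1.lt rfl).mono ?_
  rintro t₃ σ₃ hag₃ ⟨h3, h4⟩
  have hN : ∀ a ∈ [vA, aCtr, aScore, aInn, aOut], σ₃.nat a = σ.nat a := by
    intro a ha
    rw [hag₃.nat a (by revert a; decide), hag₂.nat a (by revert a; decide),
      hag₁.nat a (by revert a; decide)]
  have hR : σ₃.real rRad = σ.real rRad := by
    rw [hag₃.real _ (by decide), hag₂.real _ (by decide), hag₁.real _ (by decide)]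
  have hJ₃ : σ₃.nat vJ 0 = σ₂.nat vJ 0 := by rw [hag₃.nat vJ (by decide)]
  have hs₃ : σ₃.nat vs 0 = σ₂.nat vs 0 := by rw [hag₃.nat vs (by decide)]
  have hr₃ : σ₃.real rr 0 = σ₂.real rr 0 := by rw [hag₃.real rr (by decide)]
  have hA₃ : σ₃.nat vA 0 = A := by rw [hN vA (by decide), hA]
  simp only [wp_seq, wp_nset, wp_rset]
  refine ⟨_, _, _, _, _, ⟨h1, h3, h4, h2⟩, ?_, ?_, ?_, ?_, ?_⟩
  · simp [hA₃, hJ₃, hN aCtr (by decide)]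
  · simp [hA₃, hs₃, hN aScore (by decide)]
  · simp [hA₃, hN aInn (by decide)]
  · simp [hA₃, hN aOut (by decide)]
  · simp [hA₃, hr₃, hR]

/-- All subsets of the facilities are treated as nodes, so no recursion has to be programmed. The
exponential time does not matter for the preprocessing. -/
theorem rings_spec {I : Input V} {σ : State V} (hσ : Given I σ) :
    WP rings σ fun _ σ' => σ'.nat aFull 0 = 2 ^ I.m - 1 ∧
      ∀ A < 2 ^ I.m, RingEntry I A (σ'.nat aCtr A) (σ'.nat aScore A) (σ'.nat aInn A)
        (σ'.nat aOut A) (σ'.real rRad A) := by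
  have hpos : 0 < 2 ^ I.m := by positivity
  unfold rings
  rw [wp_seq]
  refine (setFull_spec hσ).mono ?_
  rintro t₁ σ₁ hag₁ hfull
  have hg₁ := hσ.agree hag₁ (by decide)
  refine WP.forLoop_halts 0 (2 ^ I.m) (Nat.zero_le _) (by decide) rfl ?_ (fun k σ' =>
    ∀ A < k, RingEntry I A (σ'.nat aCtr A) (σ'.nat aScore A) (σ'.nat aInn A)
        (σ'.nat aOut A) (σ'.real rRad A)) (by simp) ?_ ?_
  · intro σ' hag
    simp only [NExp.eval, hag.nat aFull (by decide), hfull]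
    omega
  · rintro A σ₂ - hA hA₂ hag₂ h
    have hg₂ := hg₁.agree hag₂ (by decide)
    refine (ringBody_spec hg₂ hA₂).mono ?_
    rintro t₃ σ₃ - ⟨c, s, i, o, r, he, h1, h2, h3, h4, h5⟩ A' hA'
    simp only [State.nlet, ne_eq, Nat.reduceEqDiff, not_false_eq_true, write_other, h1, h2, h3, h4,
      h5]
    rcases eq_or_ne A' A with rfl | hne
    · simpa using he
    · simpa [hne] using h A' (by omega)
  · rintro t₂ σ₂ hag₂ - h
    exact ⟨by rw [hag₂.nat aFull (by decide), hfull], h⟩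

/-! ### Properties of the tables -/

/-- The number `y` belongs to the list in position `i`. -/
def Input.Listed (I : Input V) (top : ℝ) (net : ℕ → ℕ) (i y : ℕ) : Prop :=
  y < I.m ∧ 0 < net (i / I.m * I.m + y) ∧
    dist (I.point (i % I.m)) (I.point y) ≤ 12 * (top / 2 ^ (i / I.m))

theorem Input.listed_iff {I : Input V} {top : ℝ} {net : ℕ → ℕ} {s x y : ℕ} (hx : x < I.m) :
    I.Listed top net (s * I.m + x) y ↔ y < I.m ∧ 0 < net (s * I.m + y) ∧
      dist (I.point x) (I.point y) ≤ 12 * (top / 2 ^ s) := by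
  have h1 : (s * I.m + x) / I.m = s := by
    rw [mul_comm, Nat.mul_add_div I.m_pos, Nat.div_eq_of_lt hx, add_zero]
  have h2 : (s * I.m + x) % I.m = x := by
    rw [mul_comm, Nat.mul_add_mod, Nat.mod_eq_of_lt hx]
  rw [Input.Listed, h1, h2]

open Classical in
/-- The preprocessing has computed the tables. -/
structure Prepared (I : Input V) (σ : State V) : Prop where
  given : Given I σ
  top : σ.real rTop 0 = max I.W I.fmax
  base_ge : max I.W I.fmax / 2 ^ (σ.nat aBase 0) ≤ I.fmin
  base_le : 2 ^ (σ.nat aBase 0) * I.fmin ≤ 2 * max I.W I.fmax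
  last : ∀ x < I.m, ∀ y < I.m, x ≠ y →
    12 * (max I.W I.fmax / 2 ^ (σ.nat aT 0)) < dist (I.point x) (I.point y)
  nets : ∀ s ≤ σ.nat aT 0, ∀ x < I.m, NetEntry I.point (max I.W I.fmax / 2 ^ s) (s * I.m)
    (σ.nat aNet) (σ.nat aPar) x x
  lists : ∃ e, ListsUpTo (I.Listed (max I.W I.fmax) (σ.nat aNet)) ((σ.nat aT 0 + 1) * I.m) e
    (σ.nat aSt) (σ.nat aLst)
  cheaps : ∀ s ≤ σ.nat aT 0, ∀ x < I.m,
    CheapEntry I (max I.W I.fmax / 2 ^ s) I.m x (σ.nat aG (s * I.m + x))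
  free : ∀ x < I.m, FreeEntry I (max I.W I.fmax) I.m x (σ.real rZ x)
  opened : OpenRep (fun x => if x < I.m ∧ I.price x = 0 then 1 else 0) σ
  full : σ.nat aFull 0 = 2 ^ I.m - 1
  rings : ∀ A < 2 ^ I.m, RingEntry I A (σ.nat aCtr A) (σ.nat aScore A) (σ.nat aInn A)
    (σ.nat aOut A) (σ.real rRad A)
  clear : ∀ a ∈ [aBal, aCnt, aInd, aN], σ.nat a = fun _ => 0
  pay : σ.real rPay 0 = 0
  snap : σ.real rSnap 0 = 0

/-- The tables in the memory. -/
noncomputable def Input.tables (I : Input V) (σ : State V) : Tables V where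
  m := I.m
  F := I.point
  f := I.price
  top := max I.W I.fmax
  T := σ.nat aT 0
  base := σ.nat aBase 0
  net := σ.nat aNet
  par := σ.nat aPar
  st := σ.nat aSt
  lst := σ.nat aLst
  g := σ.nat aG
  Z := σ.real rZ
  ctr := σ.nat aCtr
  inn := σ.nat aInn
  out := σ.nat aOut
  score := σ.nat aScore
  rad := σ.real rRad
  full := σ.nat aFull 0

theorem Prepared.loaded {I : Input V} {σ : State V} (h : Prepared I σ) : (I.tables σ).Loaded σ :=
  ⟨h.given.m, h.given.F, h.given.f, h.top, rfl, rfl, rfl, rfl, rfl, rfl, rfl, rfl, rfl, rfl, rfl,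
    rfl, rfl, rfl⟩

theorem Prepared.fits {I : Input V} {σ : State V} (h : Prepared I σ) : (I.tables σ).Fits I :=
  ⟨rfl, fun _ hk => dif_pos hk, fun _ hk => dif_pos hk, rfl, h.base_ge, h.base_le⟩

theorem Prepared.ring {I : Input V} {σ : State V} (h : Prepared I σ) : (I.tables σ).Ring := by
  classical
  have hm : ∀ {A q}, q ∈ (I.tables σ).bits A ↔ q < I.m ∧ A.testBit q = true := Input.mem_part
  have hfull : (I.tables σ).full = 2 ^ I.m - 1 := h.full
  refine ⟨?_, ?_, fun A hA hne => (h.rings A hA).mem hne, fun A hA => (h.rings A hA).inn.1,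
    fun A hA => (h.rings A hA).out.1, fun A hA _ => ?_, fun A hA _ => ?_,
    fun A hA hs => (h.rings A hA).le_near hs, fun A hA hs => (h.rings A hA).le_far hs,
    fun A hA x hx y hy => (h.rings A hA).le_score x hx y (hm.1 hy).1,
    fun A hA _ => (h.rings A hA).nonneg⟩
  · rw [hfull]
    exact Nat.sub_lt (by positivity) one_pos
  · ext q
    rw [hm, hfull, Nat.testBit_two_pow_sub_one, Finset.mem_range]
    simp [Input.tables]
  · ext q
    rw [hm, Finset.mem_filter, hm]
    exact (and_congr_right fun _ => (h.rings A hA).inn.2 q).trans (by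
      change _ ↔ _ ∧ dist (I.point (σ.nat aCtr A)) (I.point q) ≤ 2 * σ.real rRad A
      tauto)
  · ext q
    rw [hm, Finset.mem_filter, hm]
    exact (and_congr_right fun _ => (h.rings A hA).out.2 q).trans (by
      change _ ↔ _ ∧ σ.real rRad A < dist (I.point (σ.nat aCtr A)) (I.point q)
      tauto)

theorem Input.fmin_le_top (I : Input V) : I.fmin ≤ max I.W I.fmax := by
  obtain ⟨-, ⟨j, hj⟩, -⟩ := I.fmin_mem
  rw [← hj]
  exact (le_ciSup (Set.finite_range I.f).bddAbove j).trans (le_max_right _ _)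

theorem Input.price_le_top (I : Input V) (x : ℕ) : I.price x ≤ max I.W I.fmax := by
  unfold Input.price
  split_ifs with hx
  · exact (le_ciSup (Set.finite_range I.f).bddAbove _).trans (le_max_right _ _)
  · exact I.fmin_mem.1.le.trans I.fmin_le_top

theorem Prepared.isNet_iff {I : Input V} {σ : State V} (h : Prepared I σ) {s x : ℕ}
    (hs : s ≤ σ.nat aT 0) (hx : x < I.m) :
    σ.nat aNet (s * I.m + x) = 1 ↔ 0 < σ.nat aNet (s * I.m + x) := by
  rcases h.nets s hs x hx with ⟨h1, -⟩ | ⟨h1, -⟩ <;> simp [h1]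

theorem Prepared.net_sep {I : Input V} {σ : State V} (h : Prepared I σ) {s x y : ℕ}
    (hs : s ≤ σ.nat aT 0) (hx : x < I.m) (hy : y < I.m) (hxy : x ≠ y)
    (hnx : σ.nat aNet (s * I.m + x) = 1) (hny : σ.nat aNet (s * I.m + y) = 1) :
    max I.W I.fmax / 2 ^ s < dist (I.point x) (I.point y) := by
  wlog hlt : y < x generalizing x y
  · rw [dist_comm]
    exact this hy hx hxy.symm hny hnx (by omega)
  rcases h.nets s hs x hx with ⟨-, -, h1⟩ | ⟨h1, -⟩
  · exact h1 y hlt hny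
  · omega

/-- The net points of a list lie in a ball of radius 12 r and are more than r apart. Since 2 · 12 /
2 ^ 5 ≤ 1, five halvings of that ball separate them, so there are at most 2 ^ (5κ). Rows beyond the
last one are justified by `hlast`. -/
theorem Prepared.valid {I : Input V} {σ : State V} (h : Prepared I σ) {κ : ℝ}
    (hκ : HasDoublingDimension V κ) : (I.tables σ).Valid ⌊(2 : ℝ) ^ (5 * κ)⌋₊ := by
  classical
  set top := max I.W I.fmax with htop
  set T := σ.nat aT 0 with hT
  have htop0 : 0 < top := I.fmin_mem.1.trans_le I.fmin_le_top
  have hidx : ∀ t x, (I.tables σ).idx t x = min t T * I.m + x := fun _ _ => rfl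
  have hmin : ∀ t, min t T ≤ T := fun t => min_le_right _ _
  have hrad : ∀ t, top / 2 ^ t ≤ top / 2 ^ min t T := by
    intro t
    gcongr
    · exact one_le_two
    · exact min_le_left _ _
  -- Beyond scale `T` the tables give distances bounded by multiples of the radius at `T`. Distinct
  -- facilities are farther apart than that, so the distances are in fact zero.
  have hlast : ∀ {t c x y}, x < I.m → y < I.m → c ≤ 12 →
      dist (I.point x) (I.point y) ≤ c * (top / 2 ^ min t T) →
      dist (I.point x) (I.point y) ≤ c * (top / 2 ^ t) := by
    intro t c x y hx hy hc hd
    rcases le_total t T with ht | ht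
    · rwa [min_eq_left ht] at hd
    · rw [min_eq_right ht] at hd
      have hxy : x = y := by
        by_contra hxy
        have h1 := h.last x hx y hy hxy
        have h2 : c * (top / 2 ^ T) ≤ 12 * (top / 2 ^ T) := by gcongr
        linarith
      have hc0 : 0 ≤ c := by
        rw [hxy, dist_self] at hd
        exact nonneg_of_mul_nonneg_left hd (by positivity)
      rw [hxy, dist_self]
      positivity
  obtain ⟨e, hL⟩ := h.lists
  have hpos : ∀ t x, x < I.m → min t T * I.m + x < (T + 1) * I.m := by
    intro t x hx
    have := Nat.mul_le_mul_right I.m (hmin t)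
    rw [add_mul, one_mul]
    omega
  have hprop : ∀ t x k, x < I.m → σ.nat aSt (min t T * I.m + x) ≤ k →
      k < σ.nat aSt (min t T * I.m + x + 1) → σ.nat aLst k < I.m ∧
      σ.nat aNet (min t T * I.m + σ.nat aLst k) = 1 ∧
      dist (I.point x) (I.point (σ.nat aLst k)) ≤ 12 * (top / 2 ^ min t T) := by
    intro t x k hx h1 h2
    have h3 := (hL.enum _ (hpos t x hx)).prop k h1 h2
    rw [Input.listed_iff hx] at h3
    exact ⟨h3.1, (h.isNet_iff (hmin t) h3.1).2 h3.2.1, h3.2.2⟩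
  refine ⟨I.m_pos, htop0, I.price_nonneg, I.price_le_top,
    fun x y => (I.dist_le_W _ _).trans (le_max_left _ _), ⟨?_, ?_, ?_, ?_, ?_, ?_⟩,
    ⟨fun x hx => (h.free x hx).1, fun x hx => (h.free x hx).2.1, fun x hx => (h.free x hx).2.2⟩,
    fun t x hx => hL.le _ (hpos t x hx), ?_, fun t x k hx h1 h2 => (hprop t x k hx h1 h2).1,
    fun t x k hx h1 h2 => (hprop t x k hx h1 h2).2.1,
    fun t x k k' hx => (hL.enum _ (hpos t x hx)).inj k k', ?_⟩
  · intro t x hx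
    rcases h.nets _ (hmin t) x hx with ⟨-, h2, -⟩ | ⟨-, h2, -⟩
    · exact h2.trans_lt hx
    · exact h2.trans hx
  · intro t x hx
    rcases h.nets _ (hmin t) x hx with ⟨h1, h2, -⟩ | ⟨-, -, h3, -⟩
    · rwa [Tables.IsNet, Tables.parent, hidx, hidx,
        show (I.tables σ).par (min t T * I.m + x) = x from h2]
    · exact h3
  · intro t x hx
    have hlt : (I.tables σ).parent t x < I.m := by
      rcases h.nets _ (hmin t) x hx with ⟨-, h2, -⟩ | ⟨-, h2, -⟩
      · exact h2.trans_lt hx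
      · exact h2.trans hx
    have := hlast (t := t) (c := 1) hx hlt (by norm_num) ?_
    · rwa [one_mul] at this
    · rw [one_mul]
      rcases h.nets _ (hmin t) x hx with ⟨-, h2, -⟩ | ⟨-, -, -, h4⟩
      · rw [show (I.tables σ).parent t x = x from h2, dist_self]
        positivity
      · exact h4
  · exact fun t x hx => (h.cheaps _ (hmin t) x hx).1
  · intro t x hx
    obtain ⟨h1, h2, -⟩ := h.cheaps _ (hmin t) x hx
    exact hlast hx h1 (by norm_num) h2
  -- The row at scale `min t T` minimises over a ball at least as large as the required one.
  · intro t x y hx hy hd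
    have h4 : 4 * (top / 2 ^ t) ≤ 4 * (top / 2 ^ min t T) := by linarith [hrad t]
    exact (h.cheaps _ (hmin t) x hx).2.2 y hy (hd.trans h4)
  · intro t x hx
    set a := σ.nat aSt (min t T * I.m + x) with ha
    set b := σ.nat aSt (min t T * I.m + x + 1) with hb
    have hcard : ((Finset.Ico a b).image (σ.nat aLst)).card = b - a := by
      rw [Finset.card_image_of_injOn, Nat.card_Ico]
      intro k hk k' hk' he
      rw [Finset.coe_Ico, Set.mem_Ico] at hk hk'
      exact (hL.enum _ (hpos t x hx)).inj k k' hk.1 hk.2 hk'.1 hk'.2 he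
    have hle := hκ.card_le (A := (Finset.Ico a b).image (σ.nat aLst)) (F := I.point)
      (x := I.point x) (r := 12 * (top / 2 ^ min t T)) (ρ := top / 2 ^ min t T) 5 ?_ ?_ ?_
    · rw [hcard] at hle
      have : b - a ≤ ⌊(2 : ℝ) ^ (5 * κ)⌋₊ := Nat.le_floor (by exact_mod_cast hle)
      change b ≤ a + _
      omega
    · intro y hy
      obtain ⟨k, hk, rfl⟩ := Finset.mem_image.1 hy
      rw [Finset.mem_Ico] at hk
      rw [dist_comm]
      exact (hprop t x k hx hk.1 hk.2).2.2
    · intro y hy z hz hyz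
      obtain ⟨k, hk, rfl⟩ := Finset.mem_image.1 hy
      obtain ⟨k', hk', rfl⟩ := Finset.mem_image.1 hz
      rw [Finset.mem_Ico] at hk hk'
      obtain ⟨h1, h2, -⟩ := hprop t x k hx hk.1 hk.2
      obtain ⟨h3, h4, -⟩ := hprop t x k' hx hk'.1 hk'.2
      exact h.net_sep (hmin t) h1 h3 hyz h2 h4
    · have : 0 ≤ top / 2 ^ min t T := by positivity
      linarith
  · intro t x y hx hy hn hd
    have h4 : 12 * (top / 2 ^ t) ≤ 12 * (top / 2 ^ min t T) := by linarith [hrad t]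
    refine (hL.enum _ (hpos t x hx)).complete y ?_
    rw [Input.listed_iff hx]
    exact ⟨hy, (h.isNet_iff (hmin t) hy).1 hn, hd.trans h4⟩

theorem Prepared.represents {I : Input V} {σ : State V} (h : Prepared I σ) :
    Represents (I.tables σ) ∅ (fun _ => 0) I.point σ := by
  classical
  have hbal := h.clear aBal (by simp)
  have hcnt := h.clear aCnt (by simp)
  have hind := h.clear aInd (by simp)
  have hn := h.clear aN (by simp)
  have htop0 : 0 < (I.tables σ).top := I.fmin_mem.1.trans_le I.fmin_le_top
  refine ⟨h.loaded, by simp [hn], by simp, by simp, by simp, by simp, by simp, by simp, by simp,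
    by simp, by simp [h.snap], ⟨?_, ?_, ?_, 0, fun B _ => ?_⟩, ∅, ⟨by simp, ?_, ?_⟩, fun t => ?_⟩
  · simp [Tables.records]
  · simp [Tables.records, hbal]
  · simp [Tables.records, hcnt]
  · simp [Tables.records, h.pay, Tables.rowPay, Tables.cellPay, hcnt]
  · simp [hind]
  · have : (I.tables σ).refs ∅ = fun x => if x < I.m ∧ I.price x = 0 then 1 else 0 := by
      funext x
      rw [Tables.refs, Finset.filter_empty, Finset.card_empty, add_zero]
      rfl
    rw [this]
    exact h.opened
  -- Without clients a heavy point has a free cheapest facility, so nothing is eligible and the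
  -- empty set is maximal.
  · refine ⟨by simp, by simp, by simp, by simp, fun x _ _ he => absurd he.2.1 (not_lt.2 ?_)⟩
    have h1 := he.1
    simpa [Tables.HeavyAt, Heavy, hbal] using h1

/-! ### The preprocessing -/

def setScales : Cmd := setTop ;; setMin ;; setBase ;; setLast

theorem setScales_spec {I : Input V} {σ : State V} (hσ : Given I σ) (hW : σ.real rAns 0 = I.W)
    (hbase : σ.nat aBase 0 = 0) (hT : σ.nat aT 0 = 0) :
    WP setScales σ fun _ σ' => σ'.real rTop 0 = max I.W I.fmax ∧
      max I.W I.fmax / 2 ^ (σ'.nat aBase 0) ≤ I.fmin ∧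
      2 ^ (σ'.nat aBase 0) * I.fmin ≤ 2 * max I.W I.fmax ∧
      ∀ x < I.m, ∀ y < I.m, x ≠ y →
        12 * (max I.W I.fmax / 2 ^ (σ'.nat aT 0)) < dist (I.point x) (I.point y) := by
  have hpos := I.fmin_mem.1
  have hle := I.fmin_le_top
  unfold setScales
  rw [wp_seq]
  refine (setTop_spec hσ hW).mono ?_
  rintro t₁ σ₁ hag₁ htop₁
  have hg₁ := hσ.agree hag₁ (by decide)
  rw [wp_seq]
  refine (setMin_spec hg₁ htop₁).mono ?_
  rintro t₂ σ₂ hag₂ hmin₂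
  have hg₂ := hg₁.agree hag₂ (by decide)
  have htop₂ := (congrFun (hag₂.real rTop (by decide)) 0).trans htop₁
  rw [wp_seq]
  refine (setBase_spec htop₂ hmin₂ hpos hle ?_).mono ?_
  · rw [hag₂.nat aBase (by decide), hag₁.nat aBase (by decide), hbase]
  rintro t₃ σ₃ hag₃ ⟨h1, h2⟩
  have hg₃ := hg₂.agree hag₃ (by decide)
  have htop₃ := (congrFun (hag₃.real rTop (by decide)) 0).trans htop₂
  refine (setLast_spec hg₃ htop₃ (hpos.le.trans hle) ?_).mono ?_
  · rw [hag₃.nat aT (by decide), hag₂.nat aT (by decide), hag₁.nat aT (by decide), hT]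
  rintro t₄ σ₄ hag₄ h3
  rw [hag₄.real rTop (by decide), hag₄.nat aBase (by decide)]
  exact ⟨htop₃, h1, h2, h3⟩

def setLocal : Cmd := rows netBody ;; rows listBody ;; rows cheapBody ;; setFree

theorem setLocal_spec {I : Input V} {σ : State V} (hσ : Given I σ) {T : ℕ} {top : ℝ}
    (htop : σ.real rTop 0 = top) (h0 : 0 ≤ top) (hT : σ.nat aT 0 = T)
    (hptr : σ.nat vPtr 0 = 0) (hst : σ.nat aSt 0 = 0) :
    WP setLocal σ fun _ σ' =>
      (∀ s ≤ T, ∀ x < I.m,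
        NetEntry I.point (top / 2 ^ s) (s * I.m) (σ'.nat aNet) (σ'.nat aPar) x x) ∧
      (∃ e, ListsUpTo (I.Listed top (σ'.nat aNet)) ((T + 1) * I.m) e (σ'.nat aSt) (σ'.nat aLst)) ∧
      (∀ s ≤ T, ∀ x < I.m, CheapEntry I (top / 2 ^ s) I.m x (σ'.nat aG (s * I.m + x))) ∧
      ∀ x < I.m, FreeEntry I top I.m x (σ'.real rZ x) := by
  unfold setLocal
  rw [wp_seq]
  refine (nets_spec hσ hT htop).mono ?_
  rintro t₁ σ₁ hag₁ h1
  have hg₁ := hσ.agree hag₁ (by decide)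
  rw [← hag₁.real rTop (by decide)] at htop
  rw [← hag₁.nat aT (by decide)] at hT
  rw [← hag₁.nat vPtr (by decide)] at hptr
  rw [← hag₁.nat aSt (by decide)] at hst
  rw [wp_seq]
  refine (lists_spec hg₁ hT htop hptr hst fun s x hx y => Input.listed_iff hx).mono ?_
  rintro t₂ σ₂ hag₂ h2
  have hg₂ := hg₁.agree hag₂ (by decide)
  rw [← hag₂.nat aNet (by decide)] at h1 h2
  rw [← hag₂.nat aPar (by decide)] at h1
  rw [← hag₂.real rTop (by decide)] at htop
  rw [← hag₂.nat aT (by decide)] at hT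
  rw [wp_seq]
  refine (cheaps_spec hg₂ hT htop h0).mono ?_
  rintro t₃ σ₃ hag₃ h3
  have hg₃ := hg₂.agree hag₃ (by decide)
  rw [← hag₃.nat aNet (by decide)] at h1 h2
  rw [← hag₃.nat aPar (by decide)] at h1
  rw [← hag₃.nat aSt (by decide), ← hag₃.nat aLst (by decide)] at h2
  rw [← hag₃.real rTop (by decide)] at htop
  refine (setFree_spec hg₃ htop h0).mono ?_
  rintro t₄ σ₄ hag₄ h4
  rw [← hag₄.nat aNet (by decide)] at h1 h2
  rw [← hag₄.nat aPar (by decide)] at h1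
  rw [← hag₄.nat aSt (by decide), ← hag₄.nat aLst (by decide)] at h2
  rw [← hag₄.nat aG (by decide)] at h3
  exact ⟨h1, h2, h3, h4⟩

/-- Compute the tables, and open the free facilities. -/
def preprocess : Cmd := setScales ;; setLocal ;; openFree ;; rings

theorem given_initState (I : Input V) : Given I I.initState := by
  refine ⟨by simp [Input.initState], fun x hx => ?_, ?_⟩
  · simp [Input.initState, hx, Input.point]
  · funext k
    simp [Input.initState, Input.price]

theorem preprocess_spec (I : Input V) : WP preprocess I.initState fun _ σ => Prepared I σ := by
  classical
  have hg := given_initState I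
  have hzero : ∀ a, a ≠ 0 → I.initState.nat a = fun _ => 0 := by
    intro a ha
    simp [Input.initState, write_other _ ha]
  have hzr : ∀ a, a ≠ 0 → a ≠ 1 → I.initState.real a = fun _ => 0 := by
    intro a ha ha'
    simp [Input.initState, write_other _ ha', ha]
  -- The dynamic arrays are not written by the preprocessing at all. This is checked once for the
  -- whole program, and they keep their initial value zero.
  suffices H : WP preprocess I.initState fun _ σ =>
      (∀ a ∈ [aBal, aCnt, aInd, aN], σ.nat a = I.initState.nat a) →
      (∀ a ∈ [rPay, rSnap], σ.real a = I.initState.real a) → Prepared I σ by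
    refine H.mono ?_
    rintro t σ hag h
    refine h (fun a ha => hag.nat a ?_) (fun a ha => hag.real a ?_)
    · revert a; decide
    · revert a; decide
  unfold preprocess
  rw [wp_seq]
  refine (setScales_spec hg (by simp [Input.initState]) ?_ ?_).mono ?_
  · rw [hzero aBase (by decide)]
  · rw [hzero aT (by decide)]
  rintro t₁ σ₁ hag₁ ⟨htop, hb, hb', hl⟩
  have hg₁ := hg.agree hag₁ (by decide)
  have htop0 : 0 ≤ max I.W I.fmax := I.fmin_mem.1.le.trans I.fmin_le_top
  rw [wp_seq]
  refine (setLocal_spec hg₁ htop htop0 rfl ?_ ?_).mono ?_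
  · rw [hag₁.nat vPtr (by decide), hzero vPtr (by decide)]
  · rw [hag₁.nat aSt (by decide), hzero aSt (by decide)]
  rintro t₂ σ₂ hag₂ ⟨h1, h2, h3, h4⟩
  have hg₂ := hg₁.agree hag₂ (by decide)
  have hrep : OpenRep (fun _ => 0) σ₂ := by
    have hz : ∀ a ∈ [aRef, aLen], σ₂.nat a = fun _ => 0 := by
      intro a ha
      rw [hag₂.nat a (by revert a; decide), hag₁.nat a (by revert a; decide),
        hzero a (by revert a; decide)]
    exact ⟨hz aRef (by simp), by simp [hz aLen], by simp⟩
  rw [wp_seq]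
  refine (openFree_spec hg₂ hrep).mono ?_
  rintro t₃ σ₃ hag₃ h5
  have hg₃ := hg₂.agree hag₃ (by decide)
  refine (rings_spec hg₃).mono ?_
  rintro t₄ σ₄ hag₄ ⟨h6, h7⟩ hclear hreal
  have hN : ∀ a ∈ [aNet, aPar, aSt, aLst, aG], σ₄.nat a = σ₂.nat a := by
    intro a ha
    rw [hag₄.nat a (by revert a; decide), hag₃.nat a (by revert a; decide)]
  have hN' : ∀ a ∈ [aBase, aT], σ₄.nat a = σ₁.nat a := by
    intro a ha
    rw [hag₄.nat a (by revert a; decide), hag₃.nat a (by revert a; decide),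
      hag₂.nat a (by revert a; decide)]
  have hR : σ₄.real rTop = σ₁.real rTop := by
    rw [hag₄.real _ (by decide), hag₃.real _ (by decide), hag₂.real _ (by decide)]
  have hZ : σ₄.real rZ = σ₂.real rZ := by
    rw [hag₄.real _ (by decide), hag₃.real _ (by decide)]
  refine ⟨hg₃.agree hag₄ (by decide), ?_, ?_, ?_, ?_, ?_, ?_, ?_, ?_, ?_, h6, h7, ?_, ?_, ?_⟩
  · rw [hR, htop]
  · rw [hN' aBase (by simp)]; exact hb
  · rw [hN' aBase (by simp)]; exact hb'
  · rw [hN' aT (by simp)]; exact hl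
  · rw [hN' aT (by simp), hN aNet (by simp), hN aPar (by simp)]; exact h1
  · rw [hN' aT (by simp), hN aNet (by simp), hN aSt (by simp), hN aLst (by simp)]; exact h2
  · rw [hN' aT (by simp), hN aG (by simp)]; exact h3
  · rw [hZ]; exact h4
  · exact h5.of_eq fun a ha => hag₄.nat a (by revert a; decide)
  · exact fun a ha => (hclear a ha).trans (hzero a (by revert a; decide))
  · rw [hreal rPay (by simp), hzr rPay (by decide) (by decide)]
  · rw [hreal rSnap (by simp), hzr rSnap (by decide) (by decide)]

/-! ### The algorithm -/

/-- The dynamic algorithm. -/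
def algorithm : Algorithm := ⟨preprocess, insertClient, deleteClient, answerCost, answerSolution⟩

theorem Represents.agree {S : Tables V} {C : Finset V} {h : V → ℕ} {q : ℕ → V} {σ σ' : State V}
    {c : Cmd} (hσ : Represents S C h q σ) (hag : Agree c σ σ')
    (hc : (∀ a ∈ tableNat ++ dynamicNat, a ∉ c.nw) ∧ (∀ a ∈ tableReal ++ [rPay, rSnap], a ∉ c.rw) ∧
      pFac ∉ c.pw) : Represents S C h q σ' := by
  obtain ⟨h1, h2, h3⟩ := hc
  exact hσ.of_eq (fun a ha => hag.nat a (h1 a (List.mem_append_left _ ha)))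
    (fun a ha => hag.nat a (h1 a (List.mem_append_right _ ha)))
    (fun a ha => hag.real a (h2 a (List.mem_append_left _ ha)))
    (hag.real _ (h2 _ (by simp))) (hag.real _ (h2 _ (by simp))) (hag.pt _ h3)

theorem Represents.insertRequest {S : Tables V} {C : Finset V} {h : V → ℕ} {q : ℕ → V} {σ : State V}
    (hσ : Represents S C h q σ) (p : V) : Represents S C h q (insertRequest σ p) :=
  hσ.of_eq (fun _ _ => rfl) (fun _ _ => rfl) (fun _ _ => rfl) rfl rfl
    (write_other σ.pt (a := pReq) (b := pFac) (by decide) 0 (some p))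

theorem Represents.deleteRequest {S : Tables V} {C : Finset V} {h : V → ℕ} {q : ℕ → V} {σ : State V}
    (hσ : Represents S C h q σ) (p : V) (k : ℕ) : Represents S C h q (deleteRequest σ p k) :=
  hσ.of_eq (fun a ha => write_other _ (by revert a; decide) _ _)
    (fun a ha => write_other _ (by revert a; decide) _ _) (fun _ _ => rfl) rfl rfl
    (write_other σ.pt (a := pReq) (b := pFac) (by decide) 0 (some p))

theorem Represents.queryRequest {S : Tables V} {C : Finset V} {h : V → ℕ} {q : ℕ → V} {σ : State V}
    (hσ : Represents S C h q σ) : Represents S C h q (queryRequest σ) :=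
  hσ.of_eq (fun _ _ => rfl) (fun _ _ => rfl) (fun _ _ => rfl) rfl rfl rfl

/-- By determinism, what is proved for some run holds for the run at hand. This carries the
specifications over to the histories in `Reachable`. -/
theorem _root_.RAM.WP.of_exec {c : Cmd} {σ σ' : State V} {t : ℕ} {Q : ℕ → State V → Prop} (h : WP c σ Q)
    (he : Exec c σ t σ') : Q t σ' := by
  obtain ⟨t', σ'', he', hQ⟩ := h
  obtain ⟨rfl, rfl⟩ := he'.det he
  exact hQ

/-- The content of the tables is determined by the instance. -/
theorem exists_tables {κ : ℝ} (hκ : HasDoublingDimension V κ) (I : Input V) :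
    ∃ S : Tables V, S.Valid ⌊(2 : ℝ) ^ (5 * κ)⌋₊ ∧ S.Ring ∧ S.Fits I ∧
      ∀ C h σ, Reachable algorithm I C h σ → ∃ q, Represents S C h q σ := by
  classical
  obtain ⟨t, σ₀, he, hσ₀⟩ := preprocess_spec I
  have hV := hσ₀.valid hκ
  have hR := hσ₀.ring
  have hfac : ∀ a < (I.tables σ₀).m, ∀ b < (I.tables σ₀).m,
    (I.tables σ₀).F a = (I.tables σ₀).F b → a = b := I.point_injOn
  refine ⟨I.tables σ₀, hV, hR, hσ₀.fits, fun C h σ hreach => ?_⟩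
  induction hreach with
  | init he' =>
    -- The preprocessing is deterministic, so the tables read off one run are those of every
    -- history.
    obtain ⟨-, rfl⟩ := he.det he'
    exact ⟨_, hσ₀.represents⟩
  | @insert C h σ σ' t p _ hp he' ih =>
    obtain ⟨q, hq⟩ := ih
    exact ((insertClient_spec hκ hV hR hfac (hq.insertRequest p) hp
      (by simp [FacilityLocation.insertRequest])).of_exec he').2
  | @delete C h σ σ' t p _ hp he' ih =>
    obtain ⟨q, hq⟩ := ih
    have := ((deleteClient_spec hV (hq.deleteRequest p (h p)) hp
      (by simp [FacilityLocation.deleteRequest])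
      (by simp [FacilityLocation.deleteRequest])).of_exec he').2
    convert this
  | costQuery _ he' ih =>
    obtain ⟨q, hq⟩ := ih
    exact ⟨q, hq.queryRequest.agree he'.agree (by decide)⟩
  | solutionQuery _ he' ih =>
    obtain ⟨q, hq⟩ := ih
    exact ⟨q, hq.queryRequest.agree he'.agree (by decide)⟩

theorem Represents.bounds {S : Tables V} {ℓ : ℕ} (hV : S.Valid ℓ) {I : Input V} (hI : S.Fits I)
    {C : Finset V} {h : V → ℕ} {q : ℕ → V} {σ : State V} (hσ : Represents S C h q σ) :
    I.opt C ≤ estimate σ ∧ estimate σ ≤ 400 * I.opt C := by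
  obtain ⟨K, -, hK⟩ := hσ.maintained.members
  obtain ⟨h1, h2⟩ := hσ.cost_opened_le hV hI hK
  refine ⟨(I.opt_le h1).trans h2, ?_⟩
  have : estimate σ / 400 ≤ I.opt C := I.le_opt fun T hT => by
    have := hσ.estimate_le_cost hV hI hT
    linarith
  linarith

end FacilityLocation

/-! ### The main theorem. -/

open FacilityLocation in
theorem theorem1 :
    ∃ (A : Algorithm) (c : ℝ), 0 < c ∧
      ∀ (V : Type*) [MetricSpace V] (κ : ℝ) (_ : HasDoublingDimension V κ) (I : Input V),
        -- the preprocessing halts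
        (∃ t σ, RAM.Exec A.preprocess I.initState t σ) ∧
        ∀ (C : Finset V) (h : V → ℕ) (σ : RAM.State V), Reachable A I C h σ →
          -- insertions
          (∀ p ∉ C, ∃ t σ', RAM.Exec A.insert (insertRequest σ p) t σ' ∧
            (t : ℝ) ≤ updateBound c κ (I.Δ C)) ∧
          -- deletions
          (∀ p ∈ C, ∃ t σ', RAM.Exec A.delete (deleteRequest σ p (h p)) t σ' ∧
            (t : ℝ) ≤ updateBound c κ (I.Δ C)) ∧
          -- cost queries, answered in cell 0 of real array 1
          (∃ t σ', RAM.Exec A.costQuery (queryRequest σ) t σ' ∧ (t : ℝ) ≤ c ∧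
            I.opt C ≤ σ'.real 1 0 ∧ σ'.real 1 0 ≤ c * I.opt C) ∧
          -- solution queries, answered by a list without repetition of the open facilities
          (∃ t σ' S, RAM.Exec A.solutionQuery (queryRequest σ) t σ' ∧
            (σ'.out : Multiset ℕ) = (S : Finset (Fin I.m)).val.map Fin.val ∧
            (t : ℝ) ≤ c * (S.card + 1) ∧
            I.Feasible C S ∧ I.cost C S ≤ c * I.opt C) := by
  classical
  -- The constant is that of `time_le_updateBound`; it far exceeds the approximation factor 400 and
  -- the query times.
  refine ⟨algorithm, 100000000, by norm_num, fun V _ κ hκ I => ⟨?_, fun C h σ hreach => ?_⟩⟩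
  · obtain ⟨t, σ, he, -⟩ := preprocess_spec I
    exact ⟨t, σ, he⟩
  obtain ⟨S, hV, hR, hI, hrep⟩ := exists_tables hκ I
  obtain ⟨q, hq⟩ := hrep C h σ hreach
  have hκ0 : 0 ≤ κ := hκ.nonneg (I.point 0)
  have hfac : ∀ a < S.m, ∀ b < S.m, S.F a = S.F b → a = b := by
    intro a ha b hb hab
    rw [hI.m_eq] at ha hb
    rw [hI.F_eq a ha, hI.F_eq b hb] at hab
    simpa using I.fac_injective hab
  have htime := time_le_updateBound hI hκ0 (Nat.floor_le (by positivity)) C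
  have hlog : 0 ≤ 100 * (2 ^ (3 * κ) * Real.log S.m) := by
    have := Real.log_natCast_nonneg S.m
    positivity
  have hopt : 0 ≤ I.opt C := I.le_opt fun T _ =>
    add_nonneg (Finset.sum_nonneg fun j _ => I.f_nonneg j)
      (Finset.sum_nonneg fun _ _ => Metric.infDist_nonneg)
  refine ⟨fun p hp => ?_, fun p hp => ?_, ?_, ?_⟩
  · obtain ⟨t, σ', he, ht, -⟩ := insertClient_spec hκ hV hR hfac (hq.insertRequest p) hp
      (by simp [insertRequest])
    refine ⟨t, σ', he, ht.trans (le_trans ?_ htime)⟩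
    have h1 : (0 : ℝ) ≤ Nat.size C.card := Nat.cast_nonneg _
    have h2 : (0 : ℝ) ≤ S.changeTime ⌊(2 : ℝ) ^ (5 * κ)⌋₊ C.card := Nat.cast_nonneg _
    linarith
  · obtain ⟨t, σ', he, ht, -⟩ := deleteClient_spec hV (hq.deleteRequest p (h p)) hp
      (by simp [deleteRequest]) (by simp [deleteRequest])
    refine ⟨t, σ', he, le_trans ?_ htime⟩
    have : (t : ℝ) ≤ 500 + 60 * Nat.size C.card +
      3 * S.changeTime ⌊(2 : ℝ) ^ (5 * κ)⌋₊ C.card := by exact_mod_cast ht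
    linarith
  · obtain ⟨t, σ', he, ht, hans⟩ := answerCost_spec (queryRequest σ)
    obtain ⟨h1, h2⟩ := hq.queryRequest.bounds hV hI
    refine ⟨t, σ', he, ?_, ?_, ?_⟩
    · have : (t : ℝ) ≤ 20 := by exact_mod_cast ht
      linarith
    · rw [hans]; exact h1
    · rw [hans]
      refine h2.trans ?_
      nlinarith
  · obtain ⟨t, σ', he, ht, hout⟩ := answerSolution_spec (σ := queryRequest σ) rfl
    obtain ⟨-, h2⟩ := hq.queryRequest.bounds hV hI
    obtain ⟨K, hK, hmax⟩ := hq.queryRequest.maintained.members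
    obtain ⟨h3, h4⟩ := hq.queryRequest.cost_opened_le hV hI hmax
    obtain ⟨h5, h6⟩ := hK.opened_eq hV hI
    refine ⟨t, σ', I.opened S K, he, ?_, ?_, h3, ?_⟩
    · rw [hout, h6]
    · rw [h5]
      have h7 : (t : ℝ) ≤ 30 * ((queryRequest σ).nat aLen 0 + 1) := by exact_mod_cast ht
      have h8 : (0 : ℝ) ≤ (queryRequest σ).nat aLen 0 := Nat.cast_nonneg _
      linarith
    · refine h4.trans (h2.trans ?_)
      nlinarith
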